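/- Let $\mathcal C$ be an $\infty$-category (quasi-category) with finite limits. Simplicial objects of $\mathcal C$ are functors $\Delta^{\mathrm{op}}\to\mathcal C$; their morphisms, composites and pullbacks are those of the $\infty$-category $\mathrm{Fun}(\Delta^{\mathrm{op}},\mathcal C)$. We use the following terms. A simplicial object $X_\bullet$ is *1-Segal* if for all $n\ge 2$ the map $X_n\to X_{\{0,1\}}\times_{X_{\{1\}}}\cdots\times_{X_{\{n-1\}}}X_{\{n-1,n\}}$ is an equivalence, and *2-Segal* if for all $0\le i<j\le n$ the map $X_n\to X_{\{0,\dots,i,j,\dots,n\}}\times_{X_{\{i,j\}}}X_{\{i,\dots,j\}}$ is an equivalence. A morphism $f\colon X_\bullet\to Y_\bullet$ is *active equifibered* if for every active map $\alpha\colon[m]\to[n]$ in $\Delta$ (that is, $\alpha(0)=0$ and $\alpha(m)=n$) the naturality square with vertices $X_n, X_m, Y_n, Y_m$ is a pullback. A morphism $f\colon X_\bullet\to Y_\bullet$ is *relative Segal* if for all $n\ge 2$ the square with vertices $X_n$, $X_1\times_{X_0}\cdots\times_{X_0}X_1$, $Y_n$, $Y_1\times_{Y_0}\cdots\times_{Y_0}Y_1$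 is a pullback. A morphism $p\colon Y_\bullet\to X_\bullet$ is a *relative 2-Segal object* (over $X_\bullet$) if $Y_\bullet$ is 1-Segal and $p$ is active equifibered. **Proposition.** Let $p\colon Y_\bullet\to X_\bullet$ be a relative 2-Segal object, let $f\colon X_\bullet\to Z_\bullet$ be an active equifibered morphism and let $g\colon W_\bullet\to X_\bullet$ be a relative Segal morphism. Then 1. the composite $f\circ p\colon Y_\bullet\to Z_\bullet$ is a relative 2-Segal object; 2. the pullback $\pi\colon Y_\bullet\times_{X_\bullet}W_\bullet\to W_\bullet$ is a relative 2-Segal object; 3. if $X_\bullet$ is 2-Segal, then so is $W_\bullet$. By (3), the proposition also holds if one requires the base of a relative 2-Segal object to be 2-Segal, where in (1) $Z_\bullet$ is then taken to be 2-Segal. -/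

import Mathlib

open CategoryTheory MonoidalCategory CartesianMonoidalCategory Simplicial Opposite

universe u

namespace InftyCat

/-! ### Diagrams in a quasi-category indexed by nerves of small categories -/

section Nerves

variable {J K L : Type} [SmallCategory J] [SmallCategory K] [SmallCategory L]

/-- The nerve of a small category, as a simplicial set in the universe `u`. A map `N J ⟶ C` into a
quasi-category `C` is a (homotopy coherent) diagram of shape `J` in `C`. -/
def N (J : Type) [SmallCategory J] : SSet.{u} :=
  SSet.uliftFunctor.{u, 0}.obj (nerve J)

/-- The map of nerves induced by a functor. -/
def nMap (F : J ⥤ K) : N.{u} J ⟶ N.{u} K :=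
  SSet.uliftFunctor.{u, 0}.map (nerveMap F)

/-- The canonical comparison (an isomorphism) from the product of two nerves to the nerve of the
product. -/
def nProd (J K : Type) [SmallCategory J] [SmallCategory K] :
    N.{u} J ⊗ N.{u} K ⟶ N.{u} (J × K) where
  app _ := ↾fun x => ULift.up (Functor.prod' x.1.down x.2.down)
  naturality _ _ _ := rfl

/-- The vertex of `N J` given by an object of `J`. -/
def nVertex (j : J) : (N.{u} J) _⦋0⦌ := ULift.up (ComposableArrows.mk₀ j)

/-- The canonical map (an isomorphism) from the standard `1`-simplex to the nerve of `{0 < 1}`. -/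
def intervalMap : (Δ[1] : SSet.{u}) ⟶ N.{u} (Fin 2) where
  app _ := ↾fun s => ULift.up (SSet.stdSimplex.asOrderHom s).monotone.functor
  naturality _ _ _ := rfl

end Nerves

/-! ### Limits in a quasi-category -/

section Limits

/-- An `S`-indexed family of cones over `d : K ⟶ E`: a family `pt : S ⟶ E` of apexes and a homotopy
`K × S × Δ[1] ⟶ E` from the family of constant diagrams at the apexes to the constant family at
`d`. For `S = Δ[m]` these are the `m`-simplices of the quasi-category
`E ×_{Fun(K, E)} Fun(Δ[1], Fun(K, E)) ×_{Fun(K, E)} {d}` of cones over `d`; a cone is a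
`Δ[0]`-indexed family. -/
@[ext]
structure ConeFamily {K E : SSet.{u}} (d : K ⟶ E) (S : SSet.{u}) where
  pt : S ⟶ E
  htpy : (K ⊗ S) ⊗ Δ[1] ⟶ E
  htpy_zero : SSet.ι₀ ≫ htpy = snd K S ≫ pt
  htpy_one : SSet.ι₁ ≫ htpy = fst K S ≫ d

variable {K E : SSet.{u}} {d : K ⟶ E}

/-- Reindexing a family of cones. -/
noncomputable def ConeFamily.restrict {S T : SSet.{u}} (c : ConeFamily d T) (φ : S ⟶ T) :
    ConeFamily d S where
  pt := φ ≫ c.pt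
  htpy := ((K ◁ φ) ▷ Δ[1]) ≫ c.htpy
  htpy_zero := by
    rw [SSet.ι₀_comp_assoc, c.htpy_zero]
    rfl
  htpy_one := by
    rw [SSet.ι₁_comp_assoc, c.htpy_one]
    rfl

/-- The last vertex of the boundary of `Δ[m + 1]`. -/
def lastVertex (m : ℕ) : (Δ[0] : SSet.{u}) ⟶ (∂Δ[m + 1] : SSet.{u}) :=
  SSet.yonedaEquiv.symm ⟨SSet.stdSimplex.obj₀Equiv.symm (Fin.last (m + 1)), by
    rw [SSet.boundary_obj_eq_univ 0 (m + 1)]; trivial⟩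

/-- A cone is a limit cone if it is a terminal vertex of the quasi-category of cones: every
boundary of a simplex of positive dimension in the quasi-category of cones, whose last vertex is
the given cone, can be filled. -/
def ConeFamily.IsLimit (c : ConeFamily d Δ[0]) : Prop :=
  ∀ (m : ℕ) (b : ConeFamily d (∂Δ[m + 1] : SSet.{u})), b.restrict (lastVertex m) = c →
    ∃ b' : ConeFamily d Δ[m + 1], b'.restrict (∂Δ[m + 1] : (Δ[m + 1] : SSet.{u}).Subcomplex).ι = b

/-- `E` has finite limits: every diagram indexed by a simplicial set with finitely many
nondegenerate simplices has a limit cone. -/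
def HasFiniteLimits (E : SSet.{u}) : Prop :=
  ∀ (K : SSet.{u}) [K.Finite] (d : K ⟶ E), ∃ c : ConeFamily d Δ[0], c.IsLimit

variable {P : Type} [PartialOrder P] [OrderBot P]

variable (P) in
/-- A poset with bottom element is a cone (with apex `⊥`) on the poset of its other elements. -/
abbrev NonBot : Type := {x : P // x ≠ ⊥}

variable (P) in
/-- The inclusion of the elements different from `⊥`. -/
def nonBotInclusion : NonBot P ⥤ P := Monotone.functor (f := Subtype.val) fun _ _ h => h

open Classical in
variable (P) in
/-- The functor `(x, 0) ↦ ⊥`, `(x, 1) ↦ x`. -/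
noncomputable def coneFunctor : NonBot P × Fin 2 ⥤ P where
  obj x := if x.2 = 0 then ⊥ else x.1
  map {x y} f := homOfLE (by
    have h₁ : x.1.1 ≤ y.1.1 := leOfHom f.1
    have h₂ : x.2 ≤ y.2 := leOfHom f.2
    split_ifs with hx hy hy
    · exact le_rfl
    · exact bot_le
    · exact absurd (le_antisymm (hy ▸ h₂) (Fin.zero_le _)) hx
    · exact h₁)

/-- The cone with apex `D ⊥` on the restriction of `D` to the elements different from `⊥`. -/
noncomputable def coneOfDiagram (D : N.{u} P ⟶ E) :
    ConeFamily (nMap (nonBotInclusion P) ≫ D) Δ[0] where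
  pt := SSet.const (nVertex ⊥) ≫ D
  htpy := (fst (N (NonBot P)) Δ[0] ⊗ₘ intervalMap) ≫ nProd _ _ ≫ nMap (coneFunctor P) ≫ D
  htpy_zero := by
    have h : SSet.ι₀ ≫ (fst (N (NonBot P)) Δ[0] ⊗ₘ intervalMap) ≫ nProd _ _ ≫
        nMap (coneFunctor P) = snd (N.{u} (NonBot P)) Δ[0] ≫ SSet.const (nVertex ⊥) := by
      ext n x
      apply ULift.ext
      exact CategoryTheory.Functor.ext (fun i => by
        change (coneFunctor P).obj (x.1.down.obj i, (0 : Fin 2)) = ⊥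
        simp [coneFunctor]) fun i j f => Subsingleton.elim _ _
    simpa only [Category.assoc] using h =≫ D
  htpy_one := by
    have h : SSet.ι₁ ≫ (fst (N (NonBot P)) Δ[0] ⊗ₘ intervalMap) ≫ nProd _ _ ≫
        nMap (coneFunctor P) = fst (N.{u} (NonBot P)) Δ[0] ≫ nMap (nonBotInclusion P) := by
      ext n x
      apply ULift.ext
      exact CategoryTheory.Functor.ext (fun i => by
        change (coneFunctor P).obj (x.1.down.obj i, (1 : Fin 2)) = (x.1.down.obj i).1
        simp [coneFunctor])
        fun i j f => Subsingleton.elim _ _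
    simpa only [Category.assoc] using h =≫ D

/-- A diagram on a poset with bottom element is a limit diagram if its value at `⊥`, with the
given maps, is the limit of its restriction to the other elements. -/
def IsLimitDiagram (D : N.{u} P ⟶ E) : Prop := (coneOfDiagram D).IsLimit

/-- The poset `{0 < 1} × {0 < 1}`. -/
def Square : Type := Fin 2 × Fin 2

instance : PartialOrder Square := inferInstanceAs (PartialOrder (Fin 2 × Fin 2))

instance : OrderBot Square where
  bot := ((0, 0) : Fin 2 × Fin 2)
  bot_le s := ⟨Fin.zero_le s.1, Fin.zero_le s.2⟩

namespace Square

/-- The first coordinate. -/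
def fstFunctor : Square ⥤ Fin 2 := Monotone.functor (f := fun s : Square => s.1) fun _ _ h => h.1

/-- The second coordinate. -/
def sndFunctor : Square ⥤ Fin 2 := Monotone.functor (f := fun s : Square => s.2) fun _ _ h => h.2

/-- The edge `t ↦ (t, k)` of the square. -/
def left (k : Fin 2) : Fin 2 ⥤ Square :=
  Monotone.functor (f := fun t => ((t, k) : Fin 2 × Fin 2)) fun _ _ h => ⟨h, le_rfl⟩

/-- The edge `t ↦ (k, t)` of the square. -/
def right (k : Fin 2) : Fin 2 ⥤ Square :=
  Monotone.functor (f := fun t => ((k, t) : Fin 2 × Fin 2)) fun _ _ h => ⟨le_rfl, h⟩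

end Square

/-- A square in `E` is a pullback square if it exhibits its value at `(0, 0)` as the limit of the
cospan of its other values. -/
abbrev IsPullbackSquare (Q : N.{u} Square ⟶ E) : Prop := IsLimitDiagram Q

end Limits

/-! ### Simplicial objects in a quasi-category -/

section SimplicialObjects

variable {C : SSet.{u}}

/-- Simplicial objects of `C`: vertices of `Fun(N(Δᵒᵖ), C)`. -/
abbrev SimplicialObj (C : SSet.{u}) : Type u := N.{u} SimplexCategoryᵒᵖ ⟶ C

/-- Morphisms of simplicial objects: edges of `Fun(N(Δᵒᵖ), C)`. -/
structure SimplicialObj.Hom (X Y : SimplicialObj C) where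
  toMap : N.{u} (SimplexCategoryᵒᵖ × Fin 2) ⟶ C
  source : nMap (Prod.sectL SimplexCategoryᵒᵖ (0 : Fin 2)) ≫ toMap = X
  target : nMap (Prod.sectL SimplexCategoryᵒᵖ (1 : Fin 2)) ≫ toMap = Y

/-- `h` is a composite of `p` and `f`: there is a `2`-simplex of `Fun(N(Δᵒᵖ), C)` with edges
`p`, `f` and `h`. -/
def IsComposite {X Y Z : SimplicialObj C} (p : Y.Hom X) (f : X.Hom Z) (h : Y.Hom Z) : Prop :=
  ∃ σ : N.{u} (SimplexCategoryᵒᵖ × Fin 3) ⟶ C,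
    nMap ((𝟭 SimplexCategoryᵒᵖ).prod (Fin.succAboveOrderEmb (2 : Fin 3)).monotone.functor) ≫ σ
      = p.toMap ∧
    nMap ((𝟭 SimplexCategoryᵒᵖ).prod (Fin.succAboveOrderEmb (0 : Fin 3)).monotone.functor) ≫ σ
      = f.toMap ∧
    nMap ((𝟭 SimplexCategoryᵒᵖ).prod (Fin.succAboveOrderEmb (1 : Fin 3)).monotone.functor) ≫ σ
      = h.toMap

/-- The square `T ⟶ Y`, `T ⟶ W`, `Y ⟶ X`, `W ⟶ X` formed by `q`, `π`, `p`, `g` can be completed to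
a pullback square in the quasi-category `Fun(N(Δᵒᵖ), C)`, so that `T` is a fibre product
`Y ×_X W` with projections `q` and `π`. -/
def IsFibreProduct {X Y W T : SimplicialObj C} (q : T.Hom Y) (π : T.Hom W) (p : Y.Hom X)
    (g : W.Hom X) : Prop :=
  ∃ Q : N.{u} (SimplexCategoryᵒᵖ × Square) ⟶ C,
    nMap ((𝟭 SimplexCategoryᵒᵖ).prod (Square.left 0)) ≫ Q = q.toMap ∧
    nMap ((𝟭 SimplexCategoryᵒᵖ).prod (Square.right 0)) ≫ Q = π.toMap ∧
    nMap ((𝟭 SimplexCategoryᵒᵖ).prod (Square.right 1)) ≫ Q = p.toMap ∧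
    nMap ((𝟭 SimplexCategoryᵒᵖ).prod (Square.left 1)) ≫ Q = g.toMap ∧
    IsPullbackSquare (E := (ihom (N.{u} SimplexCategoryᵒᵖ)).obj C)
      (MonoidalClosed.curry (nProd SimplexCategoryᵒᵖ Square ≫ Q))

/-! ### Faces of the standard simplex -/

/-- Nonempty subsets of `[n]`. -/
abbrev Face (n : ℕ) : Type := {S : Finset (Fin (n + 1)) // S.Nonempty}

/-- The increasing bijection of `[#S - 1]` with the subset `S` of `[n]`. -/
def Face.orderIso {n : ℕ} (S : Face n) : Fin (S.1.card - 1 + 1) ≃o S.1 :=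
  S.1.orderIsoOfFin (Nat.sub_add_cancel S.2.card_pos).symm

/-- The functor that sends a nonempty subset `S` of `[n]` to the ordinal `[#S - 1]`, identified with
`S`, and inclusions to the corresponding injections; the source is ordered by reverse inclusion.
The composite with a simplicial object `X` is `S ↦ X_S`. -/
def faceFunctor (n : ℕ) : (Face n)ᵒᵈ ⥤ SimplexCategoryᵒᵖ where
  obj S := op ⦋(OrderDual.ofDual S).1.card - 1⦌
  map {S T} f := Quiver.Hom.op (SimplexCategory.Hom.mk
    { toFun := fun k => (OrderDual.ofDual S).orderIso.symm
        ⟨((OrderDual.ofDual T).orderIso k).1, leOfHom f ((OrderDual.ofDual T).orderIso k).2⟩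
      monotone' := fun a b h => (OrderDual.ofDual S).orderIso.symm.monotone
        ((OrderDual.ofDual T).orderIso.monotone h) })
  map_id S := by
    apply Quiver.Hom.unop_inj
    ext k : 3
    exact (OrderDual.ofDual S).orderIso.symm_apply_apply k
  map_comp {S T U} f g := by
    apply Quiver.Hom.unop_inj
    ext k : 3
    refine congrArg (OrderDual.ofDual S).orderIso.symm (Subtype.ext ?_)
    exact (congrArg Subtype.val ((OrderDual.ofDual T).orderIso.apply_symm_apply
      ⟨((OrderDual.ofDual U).orderIso k).1, leOfHom g ((OrderDual.ofDual U).orderIso k).2⟩)).symm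

/-! ### Segal conditions -/

/-- The faces `{i}` and `{i, i + 1}` of `[n]`, ordered by reverse inclusion. -/
abbrev SpineFace (n : ℕ) : Type :=
  {S : (Face n)ᵒᵈ // (∃ i : Fin (n + 1), (OrderDual.ofDual S).1 = {i}) ∨
    ∃ i : Fin n, (OrderDual.ofDual S).1 = {i.castSucc, i.succ}}

/-- The functor on the cone over the poset of spine faces, with the apex sent to `[n]`. -/
def spineFunctor (n : ℕ) : WithBot (SpineFace n) ⥤ (Face n)ᵒᵈ :=
  Monotone.functor
    (f := fun s => s.recBotCoe (OrderDual.toDual ⟨Finset.univ, Finset.univ_nonempty⟩)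
      (fun S => S.1))
    (by
      intro s t h
      induction s with
      | bot => exact fun k _ => Finset.mem_univ k
      | coe S =>
        induction t with
        | bot => exact absurd h (WithBot.not_coe_le_bot S)
        | coe T => exact (WithBot.coe_le_coe (a := S) (b := T)).1 h)

/-- `X` is `1`-Segal: for `n ≥ 2`, the object `X_n` is, through the face maps, the limit
`X_{0,1} ×_{X_1} X_{1,2} ×_{X_2} ⋯ ×_{X_{n-1}} X_{n-1,n}` of the diagram of the
`X_{i,i+1} ⟶ X_i` and `X_{i,i+1} ⟶ X_{i+1}`. -/
def IsSegal (X : SimplicialObj C) : Prop :=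
  ∀ n : ℕ, 2 ≤ n → IsLimitDiagram (nMap (spineFunctor n ⋙ faceFunctor n) ≫ X)

/-- The square of faces `(0, 0) ↦ [n]`, `(1, 0) ↦ {0, …, i, j, …, n}`, `(0, 1) ↦ {i, …, j}`,
`(1, 1) ↦ {i, j}` of `[n]`, for `i < j`. -/
def cutSquare {n : ℕ} (i j : Fin (n + 1)) (h : i < j) : Square ⥤ (Face n)ᵒᵈ :=
  Monotone.functor
    (f := fun s : Square => OrderDual.toDual
      ⟨Finset.univ.filter fun k => (s.1 = 1 → k ≤ i ∨ j ≤ k) ∧ (s.2 = 1 → i ≤ k ∧ k ≤ j),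
        i, by simp [h.le]⟩)
    (by
      intro s t hst k hk
      have e (a b : Fin 2) (hab : a ≤ b) (ha : a = 1) : b = 1 := by omega
      have hk' := (Finset.mem_filter.1 hk).2
      exact Finset.mem_filter.2 ⟨Finset.mem_univ k,
        fun h₁ => hk'.1 (e _ _ hst.1 h₁), fun h₂ => hk'.2 (e _ _ hst.2 h₂)⟩)

/-- `X` is `2`-Segal: for `0 ≤ i < j ≤ n`, the object `X_n` is the pullback
`X_{0,…,i,j,…,n} ×_{X_{i,j}} X_{i,…,j}`. -/
def IsTwoSegal (X : SimplicialObj C) : Prop :=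
  ∀ (n : ℕ) (i j : Fin (n + 1)) (h : i < j),
    IsPullbackSquare (nMap (cutSquare i j h ⋙ faceFunctor n) ≫ X)

/-- A map of ordinals is active if it preserves the first and the last element. -/
def IsActive {m n : ℕ} (α : ⦋m⦌ ⟶ ⦋n⦌) : Prop :=
  α.toOrderHom 0 = 0 ∧ α.toOrderHom (Fin.last m) = Fin.last n

/-- `f : X ⟶ Y` is active equifibered: for every active `α : [m] ⟶ [n]`, the naturality square
`X_n ⟶ X_m`, `X_n ⟶ Y_n`, `X_m ⟶ Y_m`, `Y_n ⟶ Y_m` is a pullback. -/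
def IsActiveEquifibered {X Y : SimplicialObj C} (f : X.Hom Y) : Prop :=
  ∀ (m n : ℕ) (α : ⦋m⦌ ⟶ ⦋n⦌), IsActive α →
    IsPullbackSquare
      (nMap ((Square.fstFunctor ⋙ ComposableArrows.mk₁ α.op).prod' Square.sndFunctor) ≫ f.toMap)

/-- The functor on the cone over the poset of spine faces, into the same cone with a further object
(the element `↑⊥`, to be mapped to the limit over the spine) between the apex and the spine. -/
def skipMiddle (J : Type) [PartialOrder J] : WithBot J ⥤ WithBot (WithBot J) :=
  Monotone.functor (f := WithBot.map (WithBot.some : J → WithBot J))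
    (WithBot.monotone_map_iff.2 fun _ _ h => WithBot.coe_le_coe.2 h)

/-- The arrow from the apex to the middle object. -/
def apexArrow (J : Type) [PartialOrder J] : Fin 2 ⥤ WithBot (WithBot J) :=
  ComposableArrows.mk₁ (homOfLE (bot_le : (⊥ : WithBot (WithBot J)) ≤ ((⊥ : WithBot J) :)))

/-- The inclusion of the middle object and the spine. -/
def dropApex (J : Type) [PartialOrder J] : WithBot J ⥤ WithBot (WithBot J) :=
  Monotone.functor (f := WithBot.some) fun _ _ h => WithBot.coe_le_coe.2 h

/-- `f : X ⟶ Y` is relative Segal: for `n ≥ 2`, the square with vertices `X_n`,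
`X_1 ×_{X_0} ⋯ ×_{X_0} X_1`, `Y_n`, `Y_1 ×_{Y_0} ⋯ ×_{Y_0} Y_1` is a pullback. Here `G` is the diagram
`X_n ⟶ L ⟶ (X_{i,i+1}, X_i)_i` over `Y_n ⟶ M ⟶ (Y_{i,i+1}, Y_i)_i` that extends the one given by `f`
by limits `L` and `M` over the spines. When `C` has finite limits, `G` exists and is essentially
unique. -/
def IsRelativeSegal {X Y : SimplicialObj C} (f : X.Hom Y) : Prop :=
  ∀ n : ℕ, 2 ≤ n → ∃ G : N.{u} (WithBot (WithBot (SpineFace n)) × Fin 2) ⟶ C,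
    nMap ((skipMiddle (SpineFace n)).prod (𝟭 (Fin 2))) ≫ G =
      nMap ((spineFunctor n ⋙ faceFunctor n).prod (𝟭 (Fin 2))) ≫ f.toMap ∧
    (∀ k : Fin 2, IsLimitDiagram
      (nMap (dropApex (SpineFace n) ⋙ Prod.sectL (WithBot (WithBot (SpineFace n))) k) ≫ G)) ∧
    IsPullbackSquare
      (nMap ((Square.fstFunctor ⋙ apexArrow (SpineFace n)).prod' Square.sndFunctor) ≫ G)

/-- `p : Y ⟶ X` is a relative `2`-Segal object over `X`: `Y` is `1`-Segal and `p` is active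
equifibered. If the base of a relative `2`-Segal object is required to be `2`-Segal, this is to be
combined with `IsTwoSegal X`. -/
structure IsRelativeTwoSegal {X Y : SimplicialObj C} (p : Y.Hom X) : Prop where
  isSegal : IsSegal Y
  isActiveEquifibered : IsActiveEquifibered p

end SimplicialObjects

end InftyCat

namespace InftyCat

/-! ### Partial diagrams on posets -/

section PartialMaps

variable {Q Q' T : Type} [PartialOrder Q] [PartialOrder Q'] [PartialOrder T] {E : SSet.{u}}

/-! Every universal property in the statement is brought into one form. For a diagram `D` on a poset
`P` and a subset `U` of `P`, `D.IsExact U` says that each diagram on Δⁿ ⋆ U ∪ ∂Δⁿ ⋆ P that restricts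
to `D` on P extends to Δⁿ ⋆ P. In other words, the restriction from the slice over `D` to the slice
over `D|U` is a trivial fibration: cones over `D` and cones over `D|U` are the same thing. If `P`
has a least element and `U = {⊥}ᶜ`, this says that `D` is a limit cone (`isLimitDiagram_iff`).

For subsets of one fixed finite poset, exactness obeys a small calculus. Trivial fibrations give
transitivity and the two cancellation laws (`Exact.trans`, `Exact.of_trans`, `Exact.of_trans_left`).
A coreflective inclusion is exact (`Exact.of_isGreatest`). A point may be added if its value is the
limit over the points of `U` above it (`Exact.of_insert`, `Exact.of_forall_exact`). The three
assertions then become manipulations of finite posets.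

(1) Naturality squares of a composite are pasted from those of its factors (`exact_paste`).

(2) Pullbacks of simplicial objects are pointwise. For an active map, two parallel faces of a cube
are pullbacks, and so is the face of `p`; hence so is the opposite face, that of the projection
(`exact_cube`). For the Segal condition, T_n = Y_n ×_{X_n} W_n, where Y_n is the limit over its
spine and W_n is the limit of its spine together with X_n and the spine of X. Everything is thus a
limit over the spines of Y, W and X, which is also the limit over the spine of T
(`exact_fibre_product`). No Segal condition on X enters, because X_n lies above Y_n.

(3) The relative Segal condition for [n] and for the faces {0,…,i,j,…,n} and {i,…,j} expresses the
values of W through spines and values of X; the `2`-Segal square of X removes X_n, and the square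
for W remains (`exact_cut`).

The foundation is the filling of horns. `PMap` describes diagrams on those simplices of the nerve of
a poset whose vertex sets belong to a given family. Missing chains are paired by the insertion and
removal of a pivot, as in discrete Morse theory, and attached one horn at a time
(`exists_extension_of_fill`). Inner horns are filled by hypothesis. Outer horns occur only with a
degenerate end edge, and are filled by means of a homotopy inverse (`exists_fill_outer`).

Two comparisons with the definitions remain. Cones are defined by homotopies K × S × Δ¹, whereas
exactness uses joins; both extend to a common cylinder (`exists_extension_fat`,
`exists_extension_thin`). Limits in Fun(L, C) are pointwise (`famOf_at_isExact`): a limit cone maps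
to a cone of pointwise limits over the same diagram, its universal property makes it a retract of
that cone, and a retract of a limit cone is a limit cone (`IsExact.of_retract`). -/

/-- The family of sets of vertices with a property that passes to subsets. -/
def mkCx {Q : Type} (p : Set Q → Prop) (h : ∀ ⦃s t : Set Q⦄, t ⊆ s → p s → p t) :
    LowerSet (Set Q) :=
  ⟨{s | p s}, fun _ _ hst hs => h hst hs⟩

/-- A diagram in `E` defined on those simplices of the nerve of a poset `Q` whose set of vertices
belongs to `A`. -/
structure PMap (A : LowerSet (Set Q)) (E : SSet.{u}) where
  app : ∀ {k : ℕ} (x : Fin (k + 1) →o Q), Set.range x ∈ A → E _⦋k⦌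
  nat : ∀ {k l : ℕ} (α : Fin (l + 1) →o Fin (k + 1)) (x : Fin (k + 1) →o Q)
    (h : Set.range x ∈ A) (h' : Set.range (x.comp α) ∈ A),
    app (x.comp α) h' = E.map (SimplexCategory.mkHom α).op (app x h)

namespace PMap

variable {A B : LowerSet (Set Q)}

lemma isChain_range {k : ℕ} (x : Fin (k + 1) →o Q) : IsChain (· ≤ ·) (Set.range x) := by
  rintro _ ⟨i, rfl⟩ _ ⟨j, rfl⟩ _
  exact (le_total i j).imp (fun h => x.monotone h) fun h => x.monotone h

lemma range_comp_mem {k l : ℕ} {x : Fin (k + 1) →o Q} (h : Set.range x ∈ A)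
    (α : Fin (l + 1) →o Fin (k + 1)) : Set.range (x.comp α) ∈ A :=
  A.lower (Set.range_comp_subset_range α x) h

lemma range_comp_mem' {k : ℕ} {A : LowerSet (Set Q')} (φ : Q →o Q') (x : Fin (k + 1) →o Q)
    (h : φ '' Set.range x ∈ A) : Set.range (φ.comp x) ∈ A := by
  rwa [show ⇑(φ.comp x) = φ ∘ x from rfl, Set.range_comp]

/-- Two partial diagrams agree where both are defined. -/
def Agree (f : PMap A E) (g : PMap B E) : Prop :=
  ∀ ⦃k : ℕ⦄ (x : Fin (k + 1) →o Q) (hf : Set.range x ∈ A) (hg : Set.range x ∈ B),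
    f.app x hf = g.app x hg

lemma Agree.trans {C : LowerSet (Set Q)} {f : PMap A E} {g : PMap B E} {e : PMap C E}
    (h : f.Agree g) (h' : g.Agree e) (hB : A ⊓ C ≤ B) : f.Agree e :=
  fun _ x hf he => (h x hf (hB ⟨hf, he⟩)).trans (h' x (hB ⟨hf, he⟩) he)

lemma app_congr (f : PMap A E) {k : ℕ} {x y : Fin (k + 1) →o Q} (e : x = y)
    (hx : Set.range x ∈ A) (hy : Set.range y ∈ A) : f.app x hx = f.app y hy := by
  subst e; rfl

/-- The restriction of a partial diagram along a monotone map. -/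
def pull (f : PMap A E) (φ : Q' →o Q) (B : LowerSet (Set Q'))
    (h : ∀ s ∈ B, IsChain (· ≤ ·) s → φ '' s ∈ A) : PMap B E where
  app x hx := f.app (φ.comp x) (range_comp_mem' φ x (h _ hx (isChain_range x)))
  nat α x _ _ := f.nat α (φ.comp x) _ _

/-- The restriction of a partial diagram to fewer simplices. -/
def res (f : PMap A E) (B : LowerSet (Set Q))
    (h : ∀ s ∈ B, IsChain (· ≤ ·) s → s ∈ A) : PMap B E where
  app x hx := f.app x (h _ hx (isChain_range x))
  nat α x _ _ := f.nat α x _ _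

open Classical in
/-- The union of two partial diagrams that agree where both are defined. -/
noncomputable def glue (f : PMap A E) (g : PMap B E) (h : f.Agree g) : PMap (A ⊔ B) E where
  app x hx := if h₁ : Set.range x ∈ A then f.app x h₁ else g.app x (hx.resolve_left h₁)
  nat α x hx hx' := by
    by_cases h₁ : Set.range x ∈ A
    · rw [dif_pos h₁, dif_pos (range_comp_mem h₁ α)]
      exact f.nat ..
    · rw [dif_neg h₁]
      split_ifs with h₂
      · rw [h _ h₂ (range_comp_mem (hx.resolve_left h₁) α)]
        exact g.nat ..
      · exact g.nat ..

lemma glue_agree_left (f : PMap A E) (g : PMap B E) (h : f.Agree g) : (glue f g h).Agree f :=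
  fun _ _ _ hf => dif_pos hf

lemma glue_agree_right (f : PMap A E) (g : PMap B E) (h : f.Agree g) : (glue f g h).Agree g := by
  intro k x hx hg
  by_cases h₁ : Set.range x ∈ A
  · exact (dif_pos h₁).trans (h x h₁ hg)
  · exact dif_neg h₁

lemma glue_agree {C : LowerSet (Set Q)} (f : PMap A E) (g : PMap B E) (h : f.Agree g)
    (e : PMap C E) (hf : f.Agree e) (hg : g.Agree e) : (glue f g h).Agree e := by
  intro k x hx he
  rcases hx with hx | hx
  · exact (glue_agree_left f g h x _ hx).trans (hf x hx he)
  · exact (glue_agree_right f g h x _ hx).trans (hg x hx he)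

/-- The factorization of a simplex through an order embedding. -/
noncomputable def lift (ι : T ↪o Q) {k : ℕ} (x : Fin (k + 1) →o Q) (h : Set.range x ⊆ Set.range ι) :
    Fin (k + 1) →o T where
  toFun i := (h ⟨i, rfl⟩).choose
  monotone' i j hij := by
    rw [← ι.le_iff_le, (h ⟨i, rfl⟩).choose_spec, (h ⟨j, rfl⟩).choose_spec]
    exact x.monotone hij

lemma comp_lift (ι : T ↪o Q) {k : ℕ} (x : Fin (k + 1) →o Q) (h : Set.range x ⊆ Set.range ι) :
    (ι : T →o Q).comp (lift ι x h) = x := by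
  ext i
  exact (h ⟨i, rfl⟩).choose_spec

lemma lift_comp (ι : T ↪o Q) {k : ℕ} (x : Fin (k + 1) →o T)
    (h : Set.range ((ι : T →o Q).comp x) ⊆ Set.range ι) :
    lift ι ((ι : T →o Q).comp x) h = x := by
  ext i
  exact ι.injective (h ⟨i, rfl⟩).choose_spec

/-- The transport of a diagram along an order embedding. -/
noncomputable def push (ι : T ↪o Q) {A : LowerSet (Set T)} (f : PMap A E) (B : LowerSet (Set Q))
    (hB : ∀ s ∈ B, s ⊆ Set.range ι ∧ ι ⁻¹' s ∈ A) : PMap B E where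
  app x hx := f.app (lift ι x (hB _ hx).1) (A.lower (by
    rintro _ ⟨i, rfl⟩
    refine ⟨i, ?_⟩
    exact (DFunLike.congr_fun (comp_lift ι x (hB _ hx).1) i).symm) (hB _ hx).2)
  nat α x h h' := by
    have e : lift ι (x.comp α) (hB _ h').1 = (lift ι x (hB _ h).1).comp α := by
      ext i
      exact ι.injective ((DFunLike.congr_fun (comp_lift ι (x.comp α) (hB _ h').1) i).trans
        (DFunLike.congr_fun (comp_lift ι x (hB _ h).1) (α i)).symm)
    rw [← f.nat α]
    · exact f.app_congr e _ _
    · rw [← e]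
      refine A.lower ?_ (hB _ h').2
      rintro _ ⟨i, rfl⟩
      exact ⟨i, (DFunLike.congr_fun (comp_lift ι _ (hB _ h').1) i).symm⟩

lemma push_app (ι : T ↪o Q) {A : LowerSet (Set T)} (f : PMap A E) (B : LowerSet (Set Q))
    (hB : ∀ s ∈ B, s ⊆ Set.range ι ∧ ι ⁻¹' s ∈ A) {k : ℕ} (x : Fin (k + 1) →o T)
    (h : Set.range ((ι : T →o Q).comp x) ∈ B) (h' : Set.range x ∈ A) :
    (f.push ι B hB).app ((ι : T →o Q).comp x) h = f.app x h' :=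
  f.app_congr (lift_comp ι x _) _ _

/-- Attaching a diagram along an order embedding. -/
theorem exists_attach (ι : T ↪o Q) (f : PMap A E) (g : PMap (⊤ : LowerSet (Set T)) E)
    (hfg : ∀ ⦃k : ℕ⦄ (x : Fin (k + 1) →o T) (h : Set.range ((ι : T →o Q).comp x) ∈ A),
      f.app ((ι : T →o Q).comp x) h = g.app x trivial) :
    ∃ f' : PMap (A ⊔ LowerSet.Iic (Set.range ι)) E, f'.Agree f ∧
      ∀ ⦃k : ℕ⦄ (x : Fin (k + 1) →o T) (h : Set.range ((ι : T →o Q).comp x) ∈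
        A ⊔ LowerSet.Iic (Set.range ι)), f'.app ((ι : T →o Q).comp x) h = g.app x trivial := by
  let p := g.push ι (LowerSet.Iic (Set.range ι)) fun s hs => ⟨hs, trivial⟩
  have hp : f.Agree p := by
    intro k x hf hg
    have e := comp_lift ι x hg
    exact (f.app_congr e.symm _ _).trans (hfg (lift ι x hg) (e.symm ▸ hf))
  refine ⟨glue f p hp, glue_agree_left f p hp, fun k x h => ?_⟩
  exact (glue_agree_right f p hp _ _ (by rintro _ ⟨i, rfl⟩; exact ⟨x i, rfl⟩)).trans
    (push_app ι g _ _ x _ trivial)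

/-- The chains that do not contain all elements different from `i`. -/
def hornCx (i : T) : LowerSet (Set T) :=
  mkCx (fun s => ¬ {i}ᶜ ⊆ s) fun _ _ h hs h' => hs (h'.trans h)

/-- Inner horns can be filled. -/
theorem exists_fill_inner [SSet.Quasicategory E] [Finite T] (hT : ∀ x y : T, x ≤ y ∨ y ≤ x)
    {i a b : T} (ha : a < i) (hb : i < b) (f : PMap (hornCx i) E) :
    ∃ g : PMap (⊤ : LowerSet (Set T)) E, g.Agree f := by
  have := Fintype.ofFinite T
  let : LinearOrder T :=
    { ‹PartialOrder T› with le_total := hT, toDecidableLE := Classical.decRel _ }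
  obtain ⟨d, hd⟩ : ∃ d, Fintype.card T = d + 1 :=
    Nat.exists_eq_succ_of_ne_zero (Fintype.card_pos_iff.2 ⟨i⟩).ne'
  let e : Fin (d + 1) ≃o T := monoEquivOfFin T hd
  have hmem {n : SimplexCategoryᵒᵖ} (x : (Λ[d, e.symm i] : SSet.{u}).obj n) :
      Set.range ((e : Fin (d + 1) →o T).comp (SSet.stdSimplex.asOrderHom x.1)) ∈ hornCx i := by
    intro h
    apply x.2
    rw [Set.eq_univ_iff_forall]
    intro j
    by_cases hj : j = e.symm i
    · exact Or.inr hj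
    · obtain ⟨k, hk⟩ := h (show e j ∈ ({i}ᶜ : Set T) from fun h => hj (by
        rw [← (h : e j = i), e.symm_apply_apply]))
      exact Or.inl ⟨k, e.injective hk⟩
  let φ : (Λ[d, e.symm i] : SSet.{u}) ⟶ E :=
    { app n := ↾fun x => f.app ((e : Fin (d + 1) →o T).comp (SSet.stdSimplex.asOrderHom x.1)) (hmem x)
      naturality n m α := by
        ext x
        exact f.nat α.unop.toOrderHom
          ((e : Fin (d + 1) →o T).comp (SSet.stdSimplex.asOrderHom x.1)) (hmem x) _ }
  obtain ⟨ψ, hψ⟩ := SSet.Quasicategory.hornFilling (S := E) (n := d) (i := e.symm i)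
    (lt_of_le_of_lt (Fin.zero_le _) (e.symm.lt_iff_lt.2 ha))
    (lt_of_lt_of_le (e.symm.lt_iff_lt.2 hb) (Fin.le_last _)) φ
  refine ⟨{ app := fun {k} x _ => ψ.app (op ⦋k⦌)
              (SSet.stdSimplex.objMk (n := ⦋d⦌) (m := op ⦋k⦌) ((e.symm : T →o Fin (d + 1)).comp x))
            nat := fun {k l} α x _ _ => ?_ }, fun {k} x _ hx => ?_⟩
  · exact ConcreteCategory.congr_hom (ψ.naturality (SimplexCategory.mkHom α).op)
      (SSet.stdSimplex.objMk (n := ⦋d⦌) (m := op ⦋k⦌) ((e.symm : T →o Fin (d + 1)).comp x))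
  · have hx' : SSet.stdSimplex.objMk (n := ⦋d⦌) (m := op ⦋k⦌) ((e.symm : T →o Fin (d + 1)).comp x) ∈
        (Λ[d, e.symm i] : (Δ[d] : SSet.{u}).Subcomplex).obj (op ⦋k⦌) := by
      intro h
      apply hx
      intro t ht
      rcases (Set.eq_univ_iff_forall.1 h) (e.symm t) with ⟨j, hj⟩ | h'
      · exact ⟨j, e.symm.injective hj⟩
      · exact absurd (e.symm.injective h') ht
    have := ConcreteCategory.congr_hom (NatTrans.congr_app hψ (op ⦋k⦌)) ⟨_, hx'⟩
    refine Eq.trans this.symm (f.app_congr ?_ _ _)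
    ext j
    exact e.apply_symm_apply _

/-- Extension of partial diagrams by filling horns one at a time. Every missing chain `s` has a
pivot `v`, which does not change when the pivot is inserted or removed; the chain `insert v s` is
attached along the horn that misses the face `s \ {v}`. -/
theorem exists_extension_of_fill [Finite Q] (f : PMap A E) (Z : Set Q → Q → Prop)
    {α : Type*} [LinearOrder α] (rank : Set Q → α)
    (ex : ∀ s ∈ B, s ∉ A → IsChain (· ≤ ·) s →
      ∃ v, Z s v ∧ insert v s ∈ B ∧ IsChain (· ≤ ·) (insert v s) ∧ s \ {v} ∉ A)
    (uniq : ∀ s v w, Z s v → Z s w → v = w)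
    (ins : ∀ s v, Z s v → Z (insert v s) v) (del : ∀ s v, Z s v → Z (s \ {v}) v)
    (rk : ∀ s v z w, s ∈ B → s ∉ A → IsChain (· ≤ ·) (insert v s) → Z s v → v ∉ s → z ∈ s →
      insert v (s \ {z}) ∉ A → Z (insert v (s \ {z})) w → w ∉ insert v (s \ {z}) →
      rank (insert v (s \ {z})) < rank s)
    (fill : ∀ (A' : LowerSet (Set Q)) (f' : PMap A' E), A ≤ A' → f'.Agree f → ∀ s v, s ∈ B → s ∉ A →
      IsChain (· ≤ ·) (insert v s) → Z s v → v ∉ s → (∀ t ⊆ insert v s, t ∈ A' ↔ ¬ s ⊆ t) →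
      ∃ g : PMap (A' ⊔ LowerSet.Iic (insert v s)) E, g.Agree f') :
    ∃ g : PMap B E, g.Agree f := by
  -- Induction on the number of missing chains. The invariant says that a missing chain stays
  -- missing after removal of its pivot; as `A'` is closed under subsets, a chain and the chain
  -- without its pivot are always missing together.
  suffices H : ∀ (N : ℕ) (A' : LowerSet (Set Q)) (f' : PMap A' E), A ≤ A' → f'.Agree f →
      (∀ s ∈ B, IsChain (· ≤ ·) s → s ∉ A' → ∀ v, Z s v → s \ {v} ∉ A') →
      {s | s ∈ B ∧ IsChain (· ≤ ·) s ∧ s ∉ A'}.ncard ≤ N → ∃ g : PMap B E, g.Agree f from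
    H _ A f le_rfl (fun _ _ _ _ => rfl) (fun s hs hc hsA v hv => by
      obtain ⟨w, hw, -, -, h⟩ := ex s hs hsA hc
      rwa [uniq s v w hv hw]) le_rfl
  intro N
  induction N with
  | zero =>
    intro A' f' hA hf inv hN
    rw [Nat.le_zero, Set.ncard_eq_zero, Set.eq_empty_iff_forall_notMem] at hN
    refine ⟨f'.res B fun s hs hc => by_contra fun h => hN s ⟨hs, hc, h⟩, ?_⟩
    exact fun _ x _ hx => hf x _ hx
  | succ N ih =>
    intro A' f' hA hf inv hN
    by_cases hD : {s | s ∈ B ∧ IsChain (· ≤ ·) s ∧ s ∉ A' ∧ ∃ v, Z s v ∧ v ∉ s}.Nonempty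
    -- The next horn belongs to a missing chain without its pivot, of least cardinality and then of
    -- least rank. Minimality ensures that all other faces of `insert v s` are already present.
    · obtain ⟨s, ⟨hs, hc, hsA, v, hv, hvs⟩, hmin⟩ :=
        Set.exists_min_image _ (fun s => toLex (s.ncard, rank s)) (Set.toFinite _) hD
      obtain ⟨v', hv', hvB, hvc, -⟩ := ex s hs (fun h => hsA (hA h)) hc
      obtain rfl := uniq s v v' hv hv'
      -- A missing face `t` that omits some `z ∈ s` leads to the competitor `t \ {w}`, with `w` the
      -- pivot of `t`. Comparison of cardinalities forces `t = insert v (s \ {z})` and `w ∉ t`; then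
      -- `rk` contradicts the minimality of the rank.
      have key : ∀ t ⊆ insert v s, t ∈ A' ↔ ¬ s ⊆ t := by
        intro t ht
        refine ⟨fun h h' => hsA (A'.lower h' h), fun h => by_contra fun htA => ?_⟩
        obtain ⟨z, hz, hzt⟩ := Set.not_subset.1 h
        have htB : t ∈ B := B.lower ht hvB
        have htc : IsChain (· ≤ ·) t := hvc.mono ht
        obtain ⟨w, hw, -, -, -⟩ := ex t htB (fun h => htA (hA h)) htc
        have hm := hmin (t \ {w}) ⟨B.lower Set.sdiff_subset htB, htc.mono Set.sdiff_subset,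
          inv t htB htc htA w hw, w, del _ _ hw, fun h => h.2 rfl⟩
        have ht' : t ⊆ insert v (s \ {z}) := by
          intro q hq
          rcases ht hq with rfl | h
          · exact Or.inl rfl
          · exact Or.inr ⟨h, fun h' => hzt ((h' : q = z) ▸ hq)⟩
        have hcard : (insert v (s \ {z})).ncard = s.ncard := by
          rw [Set.ncard_insert_of_notMem (fun h => hvs h.1), Set.ncard_sdiff_singleton_add_one hz]
        have h₁ : (t \ {w}).ncard ≤ t.ncard := Set.ncard_le_ncard Set.sdiff_subset
        have h₂ : t.ncard ≤ s.ncard := hcard ▸ Set.ncard_le_ncard ht'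
        have h₃ : s.ncard ≤ (t \ {w}).ncard := by
          rcases (Prod.Lex.toLex_le_toLex).1 hm with h | h
          · exact h.le
          · exact h.1.le
        have e₁ : t \ {w} = t := Set.eq_of_subset_of_ncard_le Set.sdiff_subset (h₂.trans h₃)
        have e₂ : t = insert v (s \ {z}) :=
          Set.eq_of_subset_of_ncard_le ht' (by rw [hcard]; exact h₃.trans h₁)
        have hwt : w ∉ t := fun h => (e₁.symm.subset h).2 rfl
        rw [e₁] at hm
        have hr : rank s ≤ rank t := by
          rcases (Prod.Lex.toLex_le_toLex).1 hm with h | h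
          · exact absurd h (not_lt.2 h₂)
          · exact h.2
        rw [e₂] at hr hwt hw htA
        exact absurd (rk s v z w hs (fun h => hsA (hA h)) hvc hv hvs hz (fun h => htA (hA h)) hw hwt)
          (not_lt.2 hr)
      obtain ⟨g, hg⟩ := fill A' f' hA hf s v hs (fun h => hsA (hA h)) hvc hv hvs key
      refine ih _ g (hA.trans le_sup_left) (hg.trans hf fun _ h => hA h.2) ?_ ?_
      · rintro t htB htc htA w hw (h | h)
        · exact inv t htB htc (fun h => htA (Or.inl h)) w hw h
        · have h' := (key _ h).not.1 (inv t htB htc (fun h => htA (Or.inl h)) w hw)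
          rw [not_not] at h'
          -- The chain `t \ {w}` lies between `s` and `insert v s`, so it is one of the two, and
          -- both have pivot `v`. Consequently `t` itself is contained in `insert v s` and is no
          -- longer missing.
          have hwv : w = v := by
            by_cases hvt : v ∈ t \ {w}
            · refine uniq _ w v (del _ _ hw) ?_
              rw [Set.Subset.antisymm h (Set.insert_subset hvt h')]
              exact ins _ _ hv
            · refine uniq _ w v (del _ _ hw) ?_
              rw [Set.Subset.antisymm (fun q hq => (h hq).resolve_left fun e => hvt (e ▸ hq)) h']
              exact hv
          subst hwv
          exact htA (Or.inr fun q hq => (em (q = w)).imp id fun hqw => by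
            rcases h ⟨hq, hqw⟩ with h | h
            · exact absurd h hqw
            · exact h)
      · refine Nat.lt_succ_iff.1 (lt_of_lt_of_le (Set.ncard_lt_ncard ?_) hN)
        refine ⟨fun t ht => ⟨ht.1, ht.2.1, fun h => ht.2.2 (Or.inl h)⟩, fun h => ?_⟩
        exact (h ⟨hs, hc, hsA⟩).2.2 (Or.inr (Set.subset_insert v s))
    -- If anything were missing, removal of its pivot would give a missing chain without its pivot.
    · refine ⟨f'.res B fun s hs hc => by_contra fun h => hD ?_, fun _ x _ hx => hf x _ hx⟩
      obtain ⟨v, hv, -, -, -⟩ := ex s hs (fun h' => h (hA h')) hc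
      exact ⟨s \ {v}, B.lower Set.sdiff_subset hs, hc.mono Set.sdiff_subset, inv s hs hc h v hv, v,
        del _ _ hv, fun h => h.2 rfl⟩

/-- A set in the horn opposite to `v` omits an element other than `v`, that is, an element of `s`;
by `key` such a set is present. -/
lemma hornCx_image {s : Set Q} {v : Q}
    (key : ∀ t ⊆ insert v s, t ∈ A ↔ ¬ s ⊆ t) (t : Set ↥(insert v s))
    (ht : t ∈ hornCx ⟨v, Set.mem_insert v s⟩) : Subtype.val '' t ∈ A := by
  rw [key _ (by rintro _ ⟨q, -, rfl⟩; exact q.2)]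
  intro h
  apply ht
  rintro ⟨q, hq⟩ hqv
  have hqv' : q ≠ v := fun h => hqv (Subtype.ext h)
  obtain ⟨q', hq', e⟩ := h (hq.resolve_left hqv')
  rwa [show (⟨q, hq⟩ : ↥(insert v s)) = q' from Subtype.ext e.symm]

/-- The chain `insert v s` meets the domain exactly in the horn opposite to `v`, because by `key`
its missing faces are `s` and the whole chain. A filler of that horn can therefore be glued in. -/
lemma exists_attach_of_fill (f : PMap A E) {s : Set Q} {v : Q} (hvs : v ∉ s)
    (key : ∀ t ⊆ insert v s, t ∈ A ↔ ¬ s ⊆ t)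
    (h : ∃ g : PMap (⊤ : LowerSet (Set ↥(insert v s))) E,
      g.Agree (f.pull (OrderHom.Subtype.val _) (hornCx ⟨v, Set.mem_insert v s⟩)
        fun t ht _ => hornCx_image key t ht)) :
    ∃ g : PMap (A ⊔ LowerSet.Iic (insert v s)) E, g.Agree f := by
  obtain ⟨g, hg⟩ := h
  obtain ⟨g', hg', -⟩ := exists_attach (OrderEmbedding.subtype (· ∈ insert v s)) f g
    fun k x hx => ((hg x trivial fun h => by
      refine ((key _ ?_).1 hx) fun q hq => ?_
      · rintro _ ⟨i, rfl⟩
        exact (x i).2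
      · obtain ⟨i, hi⟩ := @h ⟨q, Or.inr hq⟩ fun e => hvs (by
          have e' : q = v := congrArg Subtype.val e
          rwa [← e'])
        exact ⟨i, congrArg Subtype.val hi⟩)).symm
  have e : (LowerSet.Iic (Set.range (OrderEmbedding.subtype (· ∈ insert v s)))) =
      LowerSet.Iic (insert v s) := congrArg _ Subtype.range_coe
  rw [← e]
  exact ⟨g', hg'⟩

lemma exists_attach_inner [SSet.Quasicategory E] [Finite Q] (f : PMap A E) {s : Set Q} {v a b : Q}
    (hc : IsChain (· ≤ ·) (insert v s)) (hvs : v ∉ s)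
    (key : ∀ t ⊆ insert v s, t ∈ A ↔ ¬ s ⊆ t) (ha : a ∈ s) (hb : b ∈ s) (hav : a < v)
    (hvb : v < b) : ∃ g : PMap (A ⊔ LowerSet.Iic (insert v s)) E, g.Agree f :=
  exists_attach_of_fill f hvs key (exists_fill_inner (T := ↥(insert v s)) (fun x y => hc.total x.2 y.2)
    (a := ⟨a, Or.inr ha⟩) (b := ⟨b, Or.inr hb⟩) hav hvb _)

/-- Extension along a fixed inner pivot. -/
theorem exists_extension_inner_fixed [SSet.Quasicategory E] [Finite Q] (f : PMap A E) (v : Q)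
    (h : ∀ s ∈ B, s ∉ A → IsChain (· ≤ ·) s → insert v s ∈ B ∧ (∀ q ∈ s, q ≤ v ∨ v ≤ q) ∧
      s \ {v} ∉ A ∧ (∃ a ∈ s, a < v) ∧ ∃ b ∈ s, v < b) :
    ∃ g : PMap B E, g.Agree f := by
  have hins : ∀ s ∈ B, s ∉ A → IsChain (· ≤ ·) s → IsChain (· ≤ ·) (insert v s) :=
    fun s hs hsA hc => hc.insert fun q hq _ => ((h s hs hsA hc).2.1 q hq).symm
  -- The rank may be constant: the pivot of every chain is `v`, and it belongs to each chain
  -- obtained by an exchange.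
  refine exists_extension_of_fill f (fun _ w => w = v) (fun _ => 0)
    (fun s hs hsA hc => ⟨v, rfl, (h s hs hsA hc).1, hins s hs hsA hc, (h s hs hsA hc).2.2.1⟩)
    (fun _ _ _ hv hw => hv.trans hw.symm) (fun _ _ h => h) (fun _ _ h => h) ?_ ?_
  · rintro s v' z w - - - rfl - - - rfl hw
    exact absurd (Or.inl rfl) hw
  · rintro A' f' - - s v' hs hsA hc rfl hvs key
    obtain ⟨-, -, -, ⟨a, ha, hav⟩, b, hb, hvb⟩ := h s hs hsA (hc.mono (Set.subset_insert _ _))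
    exact exists_attach_inner f' hc hvs key ha hb hav hvb

end PMap

end PartialMaps

/-! ### Special outer horns -/

section Joins

variable {R P : Type}

instance [Finite R] [Finite P] : Finite (R ⊕ₗ P) := inferInstanceAs (Finite (R ⊕ P))

lemma lex_cases (q : R ⊕ₗ P) : (∃ r, q = Sum.inlₗ r) ∨ ∃ p, q = Sum.inrₗ p := by
  rcases q with q | q
  exacts [Or.inl ⟨q, rfl⟩, Or.inr ⟨q, rfl⟩]

/-- All elements of `R` belong to `s`. -/
def HasAll (s : Set (R ⊕ₗ P)) : Prop := ∀ r : R, Sum.inlₗ r ∈ s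

/-- No element of `R` belongs to `s`. -/
def HasNone (s : Set (R ⊕ₗ P)) : Prop := ∀ r : R, Sum.inlₗ r ∉ s

lemma HasAll.mono {s t : Set (R ⊕ₗ P)} (h : HasAll s) (hst : s ⊆ t) : HasAll t :=
  fun r => hst (h r)

lemma HasNone.mono {s t : Set (R ⊕ₗ P)} (h : HasNone t) (hst : s ⊆ t) : HasNone s :=
  fun r hr => h r (hst hr)

/-- The chains that do not contain all elements of `R`. -/
def properCx (R P : Type) : LowerSet (Set (R ⊕ₗ P)) :=
  mkCx (fun s => ¬ HasAll s) fun _ _ h hs h' => hs (h'.mono h)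

end Joins

section Special

variable {R R' P P' Q : Type} [PartialOrder R] [PartialOrder R'] [PartialOrder P] [PartialOrder P']
  [PartialOrder Q] {E : SSet.{u}}

/-- The join of two monotone maps. -/
def joinMap (φ : R →o R') (ψ : P →o P') : R ⊕ₗ P →o R' ⊕ₗ P' where
  toFun x := toLex (Sum.map φ ψ (ofLex x))
  monotone' x y h := by
    rcases x with x | x <;> rcases y with y | y
    · exact Sum.Lex.inl_le_inl_iff.2 (φ.monotone (Sum.Lex.inl_le_inl_iff.1 h))
    · exact Sum.Lex.inl_le_inr _ _
    · exact absurd h Sum.Lex.not_inr_le_inl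
    · exact Sum.Lex.inr_le_inr_iff.2 (ψ.monotone (Sum.Lex.inr_le_inr_iff.1 h))

@[simp] lemma joinMap_inl (φ : R →o R') (ψ : P →o P') (r : R) :
    joinMap φ ψ (Sum.inlₗ r) = Sum.inlₗ (φ r) := rfl

@[simp] lemma joinMap_inr (φ : R →o R') (ψ : P →o P') (p : P) :
    joinMap φ ψ (Sum.inrₗ p) = Sum.inrₗ (ψ p) := rfl

lemma joinMap_comp_congr {k : ℕ} (x : Fin (k + 1) →o R ⊕ₗ P) {φ φ' : R →o R'} {ψ ψ' : P →o P'}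
    (h : ∀ r, Sum.inlₗ r ∈ Set.range x → φ r = φ' r)
    (h' : ∀ p, Sum.inrₗ p ∈ Set.range x → ψ p = ψ' p) :
    (joinMap φ ψ).comp x = (joinMap φ' ψ').comp x := by
  ext i
  change joinMap φ ψ (x i) = joinMap φ' ψ' (x i)
  rcases lex_cases (x i) with ⟨r, e⟩ | ⟨p, e⟩
  · rw [e, joinMap_inl, joinMap_inl, h r ⟨i, e⟩]
  · rw [e, joinMap_inr, joinMap_inr, h' p ⟨i, e⟩]

lemma joinMap_comp_comp {R'' P'' : Type} [PartialOrder R''] [PartialOrder P''] {k : ℕ}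
    (x : Fin (k + 1) →o R ⊕ₗ P) {φ : R →o R'} {ψ : P →o P'} {φ' : R' →o R''} {ψ' : P' →o P''}
    {φ'' : R →o R''} {ψ'' : P →o P''}
    (h : ∀ r, Sum.inlₗ r ∈ Set.range x → φ' (φ r) = φ'' r)
    (h' : ∀ p, Sum.inrₗ p ∈ Set.range x → ψ' (ψ p) = ψ'' p) :
    (joinMap φ' ψ').comp ((joinMap φ ψ).comp x) = (joinMap φ'' ψ'').comp x :=
  joinMap_comp_congr (φ := φ'.comp φ) (ψ := ψ'.comp ψ) x h h' ▸ by
    ext i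
    change joinMap φ' ψ' (joinMap φ ψ (x i)) = joinMap (φ'.comp φ) (ψ'.comp ψ) (x i)
    rcases lex_cases (x i) with ⟨r, e⟩ | ⟨p, e⟩ <;> rw [e] <;> rfl

lemma range_joinMap_comp {k : ℕ} (x : Fin (k + 1) →o R ⊕ₗ P) (φ : R →o R') (ψ : P →o P') :
    Set.range ((joinMap φ ψ).comp x) = joinMap φ ψ '' Set.range x :=
  Set.range_comp (joinMap φ ψ) x

lemma inl_mem_joinMap_image {s : Set (R ⊕ₗ P)} {ψ : P →o P'} {r : R} :
    Sum.inlₗ r ∈ joinMap OrderHom.id ψ '' s ↔ Sum.inlₗ r ∈ s := by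
  refine ⟨?_, fun h => ⟨_, h, rfl⟩⟩
  rintro ⟨q, hq, e⟩
  rcases lex_cases q with ⟨r', rfl⟩ | ⟨p, rfl⟩
  · rwa [← Sum.inl_injective (toLex.injective e)]
  · exact absurd (toLex.injective e) Sum.inr_ne_inl

lemma inr_mem_joinMap_image {s : Set (R ⊕ₗ P)} {φ : R →o R'} {ψ : P →o P'} {p : P'} :
    Sum.inrₗ p ∈ joinMap φ ψ '' s ↔ ∃ p', Sum.inrₗ p' ∈ s ∧ ψ p' = p := by
  refine ⟨?_, fun ⟨p', h, e⟩ => ⟨_, h, by rw [joinMap_inr, e]⟩⟩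
  rintro ⟨q, hq, e⟩
  rcases lex_cases q with ⟨r', rfl⟩ | ⟨p, rfl⟩
  · exact absurd (toLex.injective e) Sum.inl_ne_inr
  · exact ⟨p, hq, Sum.inr_injective (toLex.injective e)⟩

lemma hasAll_joinMap_image {s : Set (R ⊕ₗ P)} {ψ : P →o P'} :
    HasAll (joinMap OrderHom.id ψ '' s) ↔ HasAll s :=
  forall_congr' fun _ => inl_mem_joinMap_image

lemma hasNone_joinMap_image {s : Set (R ⊕ₗ P)} {ψ : P →o P'} :
    HasNone (joinMap OrderHom.id ψ '' s) ↔ HasNone s :=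
  forall_congr' fun _ => inl_mem_joinMap_image.not

namespace PMap

/-- The edge from `a` to `b` is degenerate. -/
def Degen {A : LowerSet (Set Q)} (f : PMap A E) (a b : Q) : Prop :=
  ∀ ⦃k : ℕ⦄ (x y : Fin (k + 1) →o Q) (hx : Set.range x ∈ A) (hy : Set.range y ∈ A),
    (∀ i, x i = a ∨ x i = b) → (∀ i, y i = a ∨ y i = b) → f.app x hx = f.app y hy

/-- The outer horn `S ⋆ {1} ∪ ∂S ⋆ {0, 1}` in `S ⋆ {0, 1}`. -/
def outerCx (S : Type) [PartialOrder S] : LowerSet (Set (S ⊕ₗ Fin 2)) :=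
  mkCx (fun s => HasAll s → Sum.inrₗ 0 ∉ s) fun _ _ h hs h' h₀ => hs (h'.mono h) (h h₀)

/-- These maps tell which faces of auxiliary simplices are the given edge `e`, a homotopy inverse
`e'`, or degenerate. On vertices 0, 1, 2 the edge 0 → 1 is `e` (`mono3`). On vertices 0, 1, 2, 3 the
face 012 is the triangle built first (`mono43`), the face 013 is `e` followed by an identity
(`mono4`), and the face 023 is an identity followed by `e` (`mono4'`). The face 123 (`mono34`) then
shows `e'` followed by `e` with composite an identity, and `mono23` selects the edge `e` in it. -/
def mono3 : Fin 3 →o Fin 2 := ⟨![0, 1, 1], by decide⟩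
def mono43 : Fin 4 →o Fin 3 := ⟨![0, 1, 2, 2], by decide⟩
def mono4 : Fin 4 →o Fin 2 := ⟨![0, 1, 1, 1], by decide⟩
def mono4' : Fin 4 →o Fin 2 := ⟨![0, 0, 0, 1], by decide⟩
def mono34 : Fin 3 →o Fin 4 := ⟨![1, 2, 3], by decide⟩
def mono23 : Fin 2 →o Fin 3 := ⟨![1, 2], by decide⟩

variable {S : Type} [PartialOrder S]

/-- A homotopy inverse `h` of an edge `e` below `∂S` that lies over a degenerate edge. -/
lemma exists_homotopy_inverse [SSet.Quasicategory E] [Finite S] [Nonempty S]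
    (f : PMap (outerCx S) E) (hf : f.Degen (Sum.inrₗ 0) (Sum.inrₗ 1)) :
    ∃ h : PMap (properCx S (Fin 3)) E,
      (∀ ⦃k : ℕ⦄ (x : Fin (k + 1) →o S ⊕ₗ Fin 3) hx hx',
        (Sum.inrₗ 2 ∉ Set.range x ∨ HasNone (Set.range x)) →
          h.app x hx = f.app ((joinMap OrderHom.id mono3).comp x) hx') ∧
      ∀ ⦃k : ℕ⦄ (x : Fin (k + 1) →o S ⊕ₗ Fin 3) hx hx', Sum.inrₗ 1 ∉ Set.range x →
          h.app x hx = f.app ((joinMap OrderHom.id (OrderHom.const _ 0)).comp x) hx' := by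
  -- Two sides of a triangle 0 → 1 → 2 below ∂S are prescribed: `e` on 0 → 1 by `p₁`, and an
  -- identity on 0 → 2 by `p₂`. The third side will be the inverse. Chains without elements of S
  -- form the triangle underneath, which is degenerate and belongs to `p₁`.
  let p₁ : PMap (mkCx (fun s : Set (S ⊕ₗ Fin 3) => ¬ HasAll s ∧ (Sum.inrₗ 2 ∉ s ∨ HasNone s))
      fun s t h hs => ⟨fun h' => hs.1 (h'.mono h),
        hs.2.imp (fun h₁ h₂ => h₁ (h h₂)) fun h₁ => h₁.mono h⟩) E :=
    f.pull (joinMap OrderHom.id mono3) _ fun s hs _ h => absurd (hasAll_joinMap_image.1 h) hs.1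
  let p₂ : PMap (mkCx (fun s : Set (S ⊕ₗ Fin 3) => ¬ HasAll s ∧ Sum.inrₗ 1 ∉ s)
      fun s t h hs => ⟨fun h' => hs.1 (h'.mono h), fun h' => hs.2 (h h')⟩) E :=
    f.pull (joinMap OrderHom.id (OrderHom.const _ 0)) _
      fun s hs _ h => absurd (hasAll_joinMap_image.1 h) hs.1
  have h₁₂ : p₁.Agree p₂ := by
    intro k x h₁ h₂
    rcases h₁.2 with h | h
    · refine f.app_congr (joinMap_comp_congr x (fun _ _ => rfl) fun j hj => ?_) _ _
      fin_cases j
      · rfl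
      · exact absurd hj h₂.2
      · exact absurd hj h
    -- Without elements of S the two prescriptions differ only by the choice of vertices of the
    -- given edge, and that edge is degenerate.
    · refine hf _ _ _ _ (fun i => ?_) fun i => ?_
      all_goals
        rcases lex_cases (x i) with ⟨r, e⟩ | ⟨j, e⟩
        · exact absurd ⟨i, e⟩ (h r)
        · change joinMap _ _ (x i) = _ ∨ joinMap _ _ (x i) = _
          rw [e, joinMap_inr]
          fin_cases j <;> simp [mono3]
  -- A missing chain contains an element of S as well as 1 and 2, so the vertex 0 is an inner pivot
  -- for it.
  obtain ⟨h, hh⟩ := exists_extension_inner_fixed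
    (B := properCx S (Fin 3)) (glue p₁ p₂ h₁₂) (Sum.inrₗ 0) (by
      intro s hs hsA hc
      have hsA' : ¬ HasNone s ∧ Sum.inrₗ 2 ∈ s ∧ Sum.inrₗ 1 ∈ s := by
        refine ⟨fun h => hsA (Or.inl ⟨hs, Or.inr h⟩), by_contra fun h => hsA (Or.inl ⟨hs, Or.inl h⟩),
          by_contra fun h => hsA (Or.inr ⟨hs, h⟩)⟩
      obtain ⟨hn, h2, h1⟩ := hsA'
      obtain ⟨r, hr⟩ := not_forall_not.1 hn
      refine ⟨?_, ?_, ?_, ⟨_, hr, Sum.Lex.inl_lt_inr _ _⟩, _, h1, ?_⟩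
      · intro h
        refine hs fun r => (h r).resolve_left fun e => ?_
        exact absurd (toLex.injective e) Sum.inl_ne_inr
      · intro q _
        rcases lex_cases q with ⟨r, rfl⟩ | ⟨j, rfl⟩
        · exact Or.inl (Sum.Lex.inl_le_inr _ _)
        · exact Or.inr (Sum.Lex.inr_le_inr_iff.2 (Fin.zero_le _))
      · rintro (⟨-, h | h⟩ | ⟨-, h⟩)
        · exact h ⟨h2, fun e => absurd (Sum.inr_injective (toLex.injective e)) (by decide)⟩
        · exact h r ⟨hr, fun e => absurd (toLex.injective e) Sum.inl_ne_inr⟩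
        · exact h ⟨h1, fun e => absurd (Sum.inr_injective (toLex.injective e)) (by decide)⟩
      · exact Sum.Lex.inr_lt_inr_iff.2 (by decide))
  refine ⟨h, fun k x hx _ hx₁ => ?_, fun k x hx _ hx₂ => ?_⟩
  · exact (hh x hx (Or.inl ⟨hx, hx₁⟩)).trans (glue_agree_left p₁ p₂ h₁₂ x _ ⟨hx, hx₁⟩)
  · exact (hh x hx (Or.inr ⟨hx, hx₂⟩)).trans (glue_agree_right p₁ p₂ h₁₂ x _ ⟨hx, hx₂⟩)

/-- A homotopy inverse of an edge `e` below `∂S` that lies over a degenerate edge, which has `e` as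
a homotopy inverse itself. -/
lemma exists_homotopy_inverse' [SSet.Quasicategory E] [Finite S] [Nonempty S]
    (f : PMap (outerCx S) E) (hf : f.Degen (Sum.inrₗ 0) (Sum.inrₗ 1)) :
    ∃ h : PMap (properCx S (Fin 4)) E,
      (∀ ⦃k : ℕ⦄ (x : Fin (k + 1) →o S ⊕ₗ Fin 4) hx hx', Sum.inrₗ 2 ∉ Set.range x →
          h.app x hx = f.app ((joinMap OrderHom.id mono4).comp x) hx') ∧
      ∀ ⦃k : ℕ⦄ (x : Fin (k + 1) →o S ⊕ₗ Fin 4) hx hx', Sum.inrₗ 1 ∉ Set.range x →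
          h.app x hx = f.app ((joinMap OrderHom.id mono4').comp x) hx' := by
  obtain ⟨h, hh₁, hh₂⟩ := exists_homotopy_inverse f hf
  -- Three faces of a tetrahedron 0, 1, 2, 3 below ∂S are prescribed: the triangle just constructed
  -- on 012, `e` and an identity on 013, an identity and `e` on 023. The inner vertex 0 again serves
  -- as pivot, and the new face 123 shows that `e` inverts `e'` on the other side.
  let p₀ : PMap (mkCx (fun s : Set (S ⊕ₗ Fin 4) => ¬ HasAll s ∧ Sum.inrₗ 3 ∉ s)
      fun s t h hs => ⟨fun h' => hs.1 (h'.mono h), fun h' => hs.2 (h h')⟩) E :=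
    h.pull (joinMap OrderHom.id mono43) _ fun s hs _ h => hs.1 (hasAll_joinMap_image.1 h)
  let p₁ : PMap (mkCx (fun s : Set (S ⊕ₗ Fin 4) => ¬ HasAll s ∧ (Sum.inrₗ 2 ∉ s ∨ HasNone s))
      fun s t h hs => ⟨fun h' => hs.1 (h'.mono h),
        hs.2.imp (fun h₁ h₂ => h₁ (h h₂)) fun h₁ => h₁.mono h⟩) E :=
    f.pull (joinMap OrderHom.id mono4) _ fun s hs _ h => absurd (hasAll_joinMap_image.1 h) hs.1
  let p₂ : PMap (mkCx (fun s : Set (S ⊕ₗ Fin 4) => ¬ HasAll s ∧ Sum.inrₗ 1 ∉ s)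
      fun s t h hs => ⟨fun h' => hs.1 (h'.mono h), fun h' => hs.2 (h h')⟩) E :=
    f.pull (joinMap OrderHom.id mono4') _ fun s hs _ h => absurd (hasAll_joinMap_image.1 h) hs.1
  have h₀₁ : p₀.Agree p₁ := by
    intro k x h₀ h₁
    have e : (joinMap OrderHom.id mono3).comp ((joinMap OrderHom.id mono43).comp x) =
        (joinMap OrderHom.id mono4).comp x :=
      joinMap_comp_comp x (fun _ _ => rfl) fun j _ => by fin_cases j <;> rfl
    refine (hh₁ _ _ (fun h' => ?_) ?_).trans (f.app_congr e _ _)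
    · rw [e, range_joinMap_comp] at h'
      exact absurd (hasAll_joinMap_image.1 h') h₁.1
    · rw [range_joinMap_comp, hasNone_joinMap_image]
      refine h₁.2.imp_left fun h hx => ?_
      obtain ⟨j, hj, e⟩ := inr_mem_joinMap_image.1 hx
      fin_cases j
      exacts [absurd e (by decide), absurd e (by decide), h hj, h₀.2 hj]
  have h₀₂ : p₀.Agree p₂ := by
    intro k x h₀ h₂
    have e : (joinMap OrderHom.id (OrderHom.const _ 0)).comp ((joinMap OrderHom.id mono43).comp x) =
        (joinMap OrderHom.id mono4').comp x :=
      joinMap_comp_comp x (fun _ _ => rfl) fun j hj => by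
        fin_cases j
        exacts [rfl, rfl, rfl, absurd hj h₀.2]
    refine (hh₂ _ _ (fun h' => ?_) ?_).trans (f.app_congr e _ _)
    · rw [e, range_joinMap_comp] at h'
      exact absurd (hasAll_joinMap_image.1 h') h₂.1
    · rw [range_joinMap_comp]
      intro hx
      obtain ⟨j, hj, e⟩ := inr_mem_joinMap_image.1 hx
      fin_cases j
      exacts [absurd e (by decide), h₂.2 hj, absurd e (by decide), absurd e (by decide)]
  have h₁₂ : p₁.Agree p₂ := by
    intro k x h₁ h₂
    rcases h₁.2 with h | h
    · refine f.app_congr (joinMap_comp_congr x (fun _ _ => rfl) fun j hj => ?_) _ _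
      fin_cases j
      exacts [rfl, absurd hj h₂.2, absurd hj h, rfl]
    · refine hf _ _ _ _ (fun i => ?_) fun i => ?_
      all_goals
        rcases lex_cases (x i) with ⟨r, e⟩ | ⟨j, e⟩
        · exact absurd ⟨i, e⟩ (h r)
        · change joinMap _ _ (x i) = _ ∨ joinMap _ _ (x i) = _
          rw [e, joinMap_inr]
          fin_cases j <;> simp [mono4, mono4']
  have hg : (glue p₀ p₁ h₀₁).Agree p₂ := glue_agree p₀ p₁ h₀₁ p₂ h₀₂ h₁₂
  obtain ⟨h', hh'⟩ := exists_extension_inner_fixed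
    (B := properCx S (Fin 4)) (glue _ p₂ hg) (Sum.inrₗ 0) (by
      intro s hs hsA hc
      have hn : ¬ HasNone s := fun h => hsA (Or.inl (Or.inr ⟨hs, Or.inr h⟩))
      have h3 : Sum.inrₗ 3 ∈ s := by_contra fun h => hsA (Or.inl (Or.inl ⟨hs, h⟩))
      have h2 : Sum.inrₗ 2 ∈ s := by_contra fun h => hsA (Or.inl (Or.inr ⟨hs, Or.inl h⟩))
      have h1 : Sum.inrₗ 1 ∈ s := by_contra fun h => hsA (Or.inr ⟨hs, h⟩)
      obtain ⟨r, hr⟩ := not_forall_not.1 hn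
      refine ⟨?_, ?_, ?_, ⟨_, hr, Sum.Lex.inl_lt_inr _ _⟩, _, h1, ?_⟩
      · intro h
        refine hs fun r => (h r).resolve_left fun e => ?_
        exact absurd (toLex.injective e) Sum.inl_ne_inr
      · intro q _
        rcases lex_cases q with ⟨r, rfl⟩ | ⟨j, rfl⟩
        · exact Or.inl (Sum.Lex.inl_le_inr _ _)
        · exact Or.inr (Sum.Lex.inr_le_inr_iff.2 (Fin.zero_le _))
      · rintro ((⟨-, h⟩ | ⟨-, h | h⟩) | ⟨-, h⟩)
        · exact h ⟨h3, fun e => absurd (Sum.inr_injective (toLex.injective e)) (by decide)⟩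
        · exact h ⟨h2, fun e => absurd (Sum.inr_injective (toLex.injective e)) (by decide)⟩
        · exact h r ⟨hr, fun e => absurd (toLex.injective e) Sum.inl_ne_inr⟩
        · exact h ⟨h1, fun e => absurd (Sum.inr_injective (toLex.injective e)) (by decide)⟩
      · exact Sum.Lex.inr_lt_inr_iff.2 (by decide))
  refine ⟨h', fun k x hx _ h₂ => ?_, fun k x hx _ h₁ => ?_⟩
  · exact (hh' x hx (Or.inl (Or.inr ⟨hx, Or.inl h₂⟩))).trans
      ((glue_agree_left _ p₂ hg x _ (Or.inr ⟨hx, Or.inl h₂⟩)).trans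
        (glue_agree_right p₀ p₁ h₀₁ x _ ⟨hx, Or.inl h₂⟩))
  · exact (hh' x hx (Or.inr ⟨hx, h₁⟩)).trans (glue_agree_right _ p₂ hg x _ ⟨hx, h₁⟩)

/-- Outer horns `S ⋆ {1} ∪ ∂S ⋆ {0, 1}` whose last edge is degenerate can be filled. -/
theorem exists_fill_outer [SSet.Quasicategory E] [Finite S] [Nonempty S]
    (f : PMap (outerCx S) E) (hf : f.Degen (Sum.inrₗ 0) (Sum.inrₗ 1)) :
    ∃ g : PMap (⊤ : LowerSet (Set (S ⊕ₗ Fin 2))) E, g.Agree f := by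
  obtain ⟨h, hh₁, hh₂⟩ := exists_homotopy_inverse' f hf
  -- Below ∂S the vertices 0, 1, 2 now carry `e'` on 0 → 1, `e` on 1 → 2 and an identity on 0 → 2,
  -- and `p₁` puts the given simplex S ⋆ {1} over the edge from 0 to 2. Since S is nonempty, 0 is an
  -- inner vertex. The extension contains S ⋆ {1, 2}, in which the part over ∂S is `e` and the part
  -- over 2 is the given simplex: this is the required filler.
  let p₀ : PMap (properCx S (Fin 3)) E :=
    h.pull (joinMap OrderHom.id mono34) _ fun s hs _ h => hs (hasAll_joinMap_image.1 h)
  have hcx (s : Set (S ⊕ₗ Fin 3)) :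
      joinMap OrderHom.id (OrderHom.const _ 1) '' s ∈ outerCx S := fun _ h₀ => by
    obtain ⟨j, -, e⟩ := inr_mem_joinMap_image.1 h₀
    exact absurd e (by fin_cases j <;> decide)
  let p₁ : PMap (mkCx (fun s : Set (S ⊕ₗ Fin 3) => Sum.inrₗ 1 ∉ s) fun s t h hs h' => hs (h h')) E :=
    f.pull (joinMap OrderHom.id (OrderHom.const _ 1)) _ fun s _ _ => hcx s
  have h₀₁ : p₀.Agree p₁ := by
    intro k x h₀ h₁
    have e : (joinMap OrderHom.id mono4).comp ((joinMap OrderHom.id mono34).comp x) =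
        (joinMap OrderHom.id (OrderHom.const _ 1)).comp x :=
      joinMap_comp_comp x (fun _ _ => rfl) fun j _ => by fin_cases j <;> rfl
    refine (hh₁ _ _ ?_ ?_).trans (f.app_congr e _ _)
    · rw [e, range_joinMap_comp]
      exact hcx _
    · rw [range_joinMap_comp]
      intro hx
      obtain ⟨j, hj, e⟩ := inr_mem_joinMap_image.1 hx
      fin_cases j
      exacts [absurd e (by decide), h₁ hj, absurd e (by decide)]
  obtain ⟨g, hg⟩ := exists_extension_inner_fixed (B := ⊤) (glue p₀ p₁ h₀₁) (Sum.inrₗ 0) (by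
      intro s hs hsA hc
      have ha : HasAll s := by_contra fun h => hsA (Or.inl h)
      have h1 : Sum.inrₗ 1 ∈ s := by_contra fun h => hsA (Or.inr h)
      refine ⟨trivial, ?_, ?_, ⟨_, ha (Classical.arbitrary S), Sum.Lex.inl_lt_inr _ _⟩, _, h1, ?_⟩
      · intro q _
        rcases lex_cases q with ⟨r, rfl⟩ | ⟨j, rfl⟩
        · exact Or.inl (Sum.Lex.inl_le_inr _ _)
        · exact Or.inr (Sum.Lex.inr_le_inr_iff.2 (Fin.zero_le _))
      · rintro (h | h)
        · exact h fun r => ⟨ha r, fun e => absurd (toLex.injective e) Sum.inl_ne_inr⟩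
        · exact h ⟨h1, fun e => absurd (Sum.inr_injective (toLex.injective e)) (by decide)⟩
      · exact Sum.Lex.inr_lt_inr_iff.2 (by decide))
  refine ⟨g.pull (joinMap OrderHom.id mono23) _ fun _ _ _ => trivial, fun k x _ hx => ?_⟩
  by_cases ha : HasAll (Set.range x)
  · have e : (joinMap OrderHom.id (OrderHom.const _ 1)).comp
        ((joinMap OrderHom.id mono23).comp x) = x := by
      refine (joinMap_comp_comp x (φ'' := OrderHom.id) (ψ'' := OrderHom.id) (fun _ _ => rfl)
        fun j hj => ?_).trans ?_
      · fin_cases j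
        exacts [absurd hj (hx ha), rfl]
      · ext i
        change joinMap _ _ (x i) = x i
        rcases lex_cases (x i) with ⟨r, e⟩ | ⟨p, e⟩ <;> rw [e] <;> rfl
    have h₁ : Sum.inrₗ 1 ∉ Set.range ((joinMap OrderHom.id mono23).comp x) := by
      rw [range_joinMap_comp]
      intro h
      obtain ⟨j, hj, e⟩ := inr_mem_joinMap_image.1 h
      fin_cases j
      exacts [hx ha hj, absurd e (by decide)]
    refine (hg _ _ (Or.inr h₁)).trans ((glue_agree_right p₀ p₁ h₀₁ _ _ h₁).trans ?_)
    exact f.app_congr e _ _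
  · have e : (joinMap OrderHom.id mono4').comp ((joinMap OrderHom.id mono34).comp
        ((joinMap OrderHom.id mono23).comp x)) = x := by
      rw [joinMap_comp_comp (φ'' := OrderHom.id) (ψ'' := mono34.comp mono23) x (fun _ _ => rfl)
        fun _ _ => rfl]
      refine (joinMap_comp_comp x (φ'' := OrderHom.id) (ψ'' := OrderHom.id) (fun _ _ => rfl)
        fun j hj => by fin_cases j <;> rfl).trans ?_
      ext i
      change joinMap _ _ (x i) = x i
      rcases lex_cases (x i) with ⟨r, e⟩ | ⟨p, e⟩ <;> rw [e] <;> rfl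
    have h₀ : Set.range ((joinMap OrderHom.id mono23).comp x) ∈ properCx S (Fin 3) := by
      rw [range_joinMap_comp]
      exact fun h => ha (hasAll_joinMap_image.1 h)
    refine (hg _ _ (Or.inl h₀)).trans ((glue_agree_left p₀ p₁ h₀₁ _ _ h₀).trans ?_)
    refine (hh₂ _ _ (e.symm ▸ hx) ?_).trans (f.app_congr e _ _)
    rw [range_joinMap_comp, range_joinMap_comp]
    intro h
    obtain ⟨j, hj, e⟩ := inr_mem_joinMap_image.1 h
    obtain ⟨i, hi, e'⟩ := inr_mem_joinMap_image.1 hj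
    fin_cases i <;> subst e' <;> exact absurd e (by decide)

end PMap

end Special

/-! ### Opposites -/

section Opposites

variable {Q : Type} [PartialOrder Q] {E : SSet.{u}}

/-- A simplex in reverse order, in the opposite poset. -/
def revHom {k : ℕ} (x : Fin (k + 1) →o Qᵒᵈ) : Fin (k + 1) →o Q where
  toFun i := OrderDual.ofDual (x i.rev)
  monotone' _ _ h := x.monotone (Fin.rev_le_rev.2 h)

lemma range_revHom {k : ℕ} (x : Fin (k + 1) →o Qᵒᵈ) : Set.range (revHom x) = Set.range x :=
  Fin.revPerm.surjective.range_comp x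

/-- A simplex in reverse order, in the opposite poset. -/
def revHom' {k : ℕ} (x : Fin (k + 1) →o Q) : Fin (k + 1) →o Qᵒᵈ where
  toFun i := OrderDual.toDual (x i.rev)
  monotone' _ _ h := x.monotone (Fin.rev_le_rev.2 h)

lemma range_revHom' {k : ℕ} (x : Fin (k + 1) →o Q) : Set.range (revHom' x) = Set.range x :=
  Fin.revPerm.surjective.range_comp x

lemma rev_map_rev_map {a b : SimplexCategory} (f : a ⟶ b) :
    SimplexCategory.rev.map (SimplexCategory.rev.map f) = f := by
  ext i : 3
  change (f.toOrderHom i.rev.rev).rev.rev = f.toOrderHom i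
  rw [Fin.rev_rev, Fin.rev_rev]

/-- A simplex of the standard simplex in reverse order. -/
def revSimplex {n : ℕ} {m : SimplexCategoryᵒᵖ} (x : (Δ[n] : SSet.{u}).obj m) :
    (Δ[n] : SSet.{u}).obj m :=
  SSet.stdSimplex.objMk (n := ⦋n⦌) (m := m)
    (SimplexCategory.rev.map (SimplexCategory.mkHom (SSet.stdSimplex.asOrderHom x))).toOrderHom

lemma revSimplex_revSimplex {n : ℕ} {m : SimplexCategoryᵒᵖ} (x : (Δ[n] : SSet.{u}).obj m) :
    revSimplex (revSimplex x) = x :=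
  SSet.stdSimplex.objEquiv.injective (rev_map_rev_map (SSet.stdSimplex.objEquiv x))

lemma revSimplex_map {n : ℕ} {m m' : SimplexCategoryᵒᵖ} (α : m ⟶ m')
    (x : (Δ[n] : SSet.{u}).obj m) :
    revSimplex ((Δ[n] : SSet.{u}).map α x) =
      (Δ[n] : SSet.{u}).map (SimplexCategory.rev.map α.unop).op (revSimplex x) := by
  apply SSet.stdSimplex.objEquiv.injective
  exact SimplexCategory.rev.map_comp α.unop (SSet.stdSimplex.objEquiv x)

lemma revSimplex_mem_horn {n : ℕ} {i : Fin (n + 1)} {m : SimplexCategoryᵒᵖ}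
    {x : (Δ[n] : SSet.{u}).obj m} (hx : x ∈ (Λ[n, i.rev] : (Δ[n] : SSet.{u}).Subcomplex).obj m) :
    revSimplex x ∈ (Λ[n, i] : (Δ[n] : SSet.{u}).Subcomplex).obj m := by
  intro h
  apply hx
  rw [Set.eq_univ_iff_forall] at h ⊢
  intro j
  rcases h j.rev with ⟨l, hl⟩ | h
  · exact Or.inl ⟨l.rev, Fin.rev_injective hl⟩
  · exact Or.inr (by rw [← Fin.rev_rev j]; exact congrArg Fin.rev h)

/-- Reversal of vertices turns the inner horn with index `i` into the inner horn with index `i.rev`.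
The instance lets horns at the first vertex be deduced from horns at the last one. -/
instance [SSet.Quasicategory E] : SSet.Quasicategory E.op where
  hornFilling' n i σ h₀ hn := by
    let τ : (Λ[n + 2, i.rev] : SSet.{u}) ⟶ E :=
      { app m := ↾fun x => SSet.opObjEquiv (σ.app m ⟨revSimplex x.1, revSimplex_mem_horn x.2⟩)
        naturality m m' α := by
          ext x
          have := ConcreteCategory.congr_hom (σ.naturality (SimplexCategory.rev.map α.unop).op)
            ⟨revSimplex x.1, revSimplex_mem_horn x.2⟩
          refine Eq.trans ?_ (Eq.trans this ?_)
          · exact congrArg (fun y => σ.app m' y) (Subtype.ext (revSimplex_map α x.1))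
          · exact congrArg (fun β : unop m' ⟶ unop m => E.map β.op
              (SSet.opObjEquiv (σ.app m ⟨revSimplex x.1, revSimplex_mem_horn x.2⟩)))
              (rev_map_rev_map α.unop) }
    obtain ⟨ψ, hψ⟩ := SSet.Quasicategory.hornFilling (S := E) (n := n + 2) (i := i.rev)
      (by rw [← Fin.rev_last]; exact Fin.rev_lt_rev.2 hn)
      (by rw [← Fin.rev_zero]; exact Fin.rev_lt_rev.2 h₀) τ
    refine ⟨{ app := fun m => ↾fun x => SSet.opObjEquiv.symm (ψ.app m (revSimplex x))
              naturality := fun m m' α => ?_ }, ?_⟩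
    · ext x
      have := ConcreteCategory.congr_hom (ψ.naturality (SimplexCategory.rev.map α.unop).op)
        (revSimplex x)
      exact Eq.trans (congrArg (fun y => ψ.app m' y) (revSimplex_map α x)) this
    · ext m x
      have hx : revSimplex x.1 ∈ (Λ[n + 2, i.rev] : (Δ[n + 2] : SSet.{u}).Subcomplex).obj m :=
        revSimplex_mem_horn (by rw [Fin.rev_rev]; exact x.2)
      have := ConcreteCategory.congr_hom (NatTrans.congr_app hψ m) ⟨_, hx⟩
      refine Eq.trans ?_ this
      exact congrArg (fun y => σ.app m y) (Subtype.ext (revSimplex_revSimplex x.1).symm)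

namespace PMap

/-- The opposite partial diagram. -/
def opposite {A : LowerSet (Set Q)} (f : PMap A E) (A' : LowerSet (Set Qᵒᵈ))
    (h : ∀ s : Set Q, (s : Set Qᵒᵈ) ∈ A' → s ∈ A) : PMap A' E.op where
  app x hx := SSet.opObjEquiv.symm (f.app (revHom x) (h _ (by rw [range_revHom]; exact hx)))
  nat {k l} α x hx hx' := by
    let β : Fin (l + 1) →o Fin (k + 1) := (SimplexCategory.rev.map (SimplexCategory.mkHom α)).toOrderHom
    have e : revHom (x.comp α) = (revHom x).comp β := by
      ext i
      exact congrArg x (Fin.rev_rev (α i.rev)).symm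
    exact (f.app_congr e _ (e ▸ h _ (by rw [range_revHom]; exact hx'))).trans
      (f.nat β (revHom x) (h _ (by rw [range_revHom]; exact hx)) _)

lemma revHom_revHom {k : ℕ} (x : Fin (k + 1) →o Q) :
    revHom (revHom' x) = x := by
  ext i
  exact congrArg x (Fin.rev_rev i)

/-- The partial diagram with a given opposite. -/
def unopposite {A : LowerSet (Set Qᵒᵈ)} (f : PMap A E.op) (A' : LowerSet (Set Q))
    (h : ∀ s : Set Q, s ∈ A' → (s : Set Qᵒᵈ) ∈ A) : PMap A' E where
  app x hx := SSet.opObjEquiv (f.app (revHom' x)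
    (h _ (by rw [range_revHom']; exact hx)))
  nat {k l} α x hx hx' := by
    let β : Fin (l + 1) →o Fin (k + 1) := (SimplexCategory.rev.map (SimplexCategory.mkHom α)).toOrderHom
    have e : revHom' (x.comp α) = (revHom' x).comp β := by
      ext i
      exact congrArg x (Fin.rev_rev (α i.rev)).symm
    refine (f.app_congr e _ (e ▸ h _ (by rw [range_revHom']; exact hx'))).trans
      ((f.nat β (revHom' x)
        (h _ (by rw [range_revHom']; exact hx)) _).trans ?_)
    exact congrArg (fun β : ⦋l⦌ ⟶ ⦋k⦌ => E.map β.op (SSet.opObjEquiv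
      (f.app (revHom' x) (h _ (by rw [range_revHom']; exact hx)))))
      (rev_map_rev_map (SimplexCategory.mkHom α))

/-- Horns opposite to the last vertex can be filled if the last edge is degenerate. -/
theorem exists_fill_right [SSet.Quasicategory E] [Finite Q]
    {v a b : Q} (hv : ∀ q, q ≤ v) (hav : a < v) (ha : ∀ q, q ≤ a ∨ q = v) (hba : b < a)
    (f : PMap (hornCx v) E) (hf : f.Degen a v) : ∃ g : PMap (⊤ : LowerSet (Set Q)) E, g.Agree f := by
  classical
  -- The poset is S ⋆ {a < v}, and S is nonempty because of `b`. A chain lies in the horn opposite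
  -- to `v` when it omits `a` or an element of S; this is the condition that defines `outerCx S`.
  let S := {q : Q // q ≠ v ∧ q ≠ a}
  have : Nonempty S := ⟨⟨b, (hba.trans hav).ne, hba.ne⟩⟩
  let φ : S ⊕ₗ Fin 2 →o Q :=
    { toFun := fun x => Sum.elim (fun s : S => s.1) (fun j : Fin 2 => if j = 0 then a else v) (ofLex x)
      monotone' := fun x y h => by
        rcases lex_cases x with ⟨r, rfl⟩ | ⟨i, rfl⟩ <;> rcases lex_cases y with ⟨r', rfl⟩ | ⟨j, rfl⟩
        · have h' : r ≤ r' := Sum.Lex.inl_le_inl_iff.1 h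
          exact h'
        · change r.1 ≤ if j = 0 then a else v
          split_ifs
          · exact (ha r.1).resolve_right r.2.1
          · exact hv _
        · exact absurd h Sum.Lex.not_inr_le_inl
        · have h' := Sum.Lex.inr_le_inr_iff.1 h
          change (if i = 0 then a else v) ≤ if j = 0 then a else v
          split_ifs with h₁ h₂ h₃
          · exact le_rfl
          · exact hav.le
          · exact absurd (le_antisymm (h₃ ▸ h') (Fin.zero_le _)) h₁
          · exact le_rfl }
  let ψ : Q →o S ⊕ₗ Fin 2 :=
    { toFun := fun q => if hq : q ≠ v ∧ q ≠ a then Sum.inlₗ ⟨q, hq⟩ else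
        Sum.inrₗ (if q = a then 0 else 1)
      monotone' := fun x y h => by
        dsimp only
        by_cases hx : x ≠ v ∧ x ≠ a <;> by_cases hy : y ≠ v ∧ y ≠ a
        · rw [dif_pos hx, dif_pos hy]
          exact Sum.Lex.inl_le_inl_iff.2 h
        · rw [dif_pos hx, dif_neg hy]
          exact Sum.Lex.inl_le_inr _ _
        · refine absurd ?_ hx
          have hya := (ha y).resolve_right hy.1
          refine ⟨fun e => ?_, fun e => hy.2 (le_antisymm hya (e ▸ h))⟩
          exact lt_irrefl _ ((hya.trans_lt hav).trans_le (e ▸ h))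
        · rw [dif_neg hx, dif_neg hy]
          refine Sum.Lex.inr_le_inr_iff.2 ?_
          split_ifs with h₁ h₂ h₃
          · exact le_rfl
          · exact Fin.zero_le _
          · have hx' : x = v := by_contra fun e => hx ⟨e, h₁⟩
            exact absurd (hav.trans_le (hx' ▸ h)) (h₃ ▸ lt_irrefl _)
          · exact le_rfl }
  have hφψ : φ.comp ψ = OrderHom.id := by
    ext q
    change φ (if hq : q ≠ v ∧ q ≠ a then Sum.inlₗ ⟨q, hq⟩ else Sum.inrₗ (if q = a then 0 else 1)) = q
    split_ifs with h₁ h₂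
    · rfl
    · exact h₂.symm
    · exact (by_contra fun e => h₁ ⟨fun e' => e e'.symm, h₂⟩ : v = q)
  obtain ⟨g, hg⟩ := exists_fill_outer (f.pull φ (outerCx S) fun s hs _ h => by
      refine hs (fun r => ?_) ?_
      · obtain ⟨q, hq, e⟩ := h r.2.1
        rcases lex_cases q with ⟨r', rfl⟩ | ⟨j, rfl⟩
        · rwa [← show r' = r from Subtype.ext e]
        · by_cases hj : j = 0
          · exact absurd (e.symm.trans (if_pos hj)) r.2.2
          · exact absurd (e.symm.trans (if_neg hj)) r.2.1
      · obtain ⟨q, hq, e⟩ := h hav.ne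
        rcases lex_cases q with ⟨r', rfl⟩ | ⟨j, rfl⟩
        · exact absurd e r'.2.2
        · by_cases hj : j = 0
          · rwa [← hj]
          · exact absurd ((if_neg hj).symm.trans e) hav.ne')
    (by
      intro k x y hx hy hx' hy'
      refine hf _ _ _ _ (fun i => ?_) fun i => ?_
      · exact (hx' i).imp (congrArg φ) (congrArg φ)
      · exact (hy' i).imp (congrArg φ) (congrArg φ))
  refine ⟨g.pull ψ _ fun _ _ _ => trivial, fun k x _ hx => ?_⟩
  have e : φ.comp (ψ.comp x) = x := by
    rw [← OrderHom.comp_assoc, hφψ]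
    rfl
  refine (hg _ _ fun h h₀ => hx fun q hq => ?_).trans (f.app_congr e _ _)
  by_cases hqa : q = a
  · obtain ⟨i, hi⟩ := h₀
    refine ⟨i, ?_⟩
    rw [hqa, ← e]
    exact congrArg φ hi
  · obtain ⟨i, hi⟩ := h ⟨q, hq, hqa⟩
    refine ⟨i, ?_⟩
    rw [← e]
    exact congrArg φ hi

/-- Horns opposite to the first vertex can be filled if the first edge is degenerate. -/
theorem exists_fill_left [SSet.Quasicategory E] [Finite Q]
    {v a b : Q} (hv : ∀ q, v ≤ q) (hav : v < a) (ha : ∀ q, a ≤ q ∨ q = v) (hba : a < b)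
    (f : PMap (hornCx v) E) (hf : f.Degen a v) : ∃ g : PMap (⊤ : LowerSet (Set Q)) E, g.Agree f := by
  obtain ⟨g, hg⟩ := exists_fill_right (Q := Qᵒᵈ) (E := E.op) (v := v) (a := a)
    (b := b) hv hav ha hba (f.opposite (hornCx (T := Qᵒᵈ) v) fun s hs => hs) (by
      intro k x y hx hy hx' hy'
      exact congrArg SSet.opObjEquiv.symm (hf _ _ _ _ (fun i => hx' i.rev) fun i => hy' i.rev))
  refine ⟨g.unopposite ⊤ fun _ _ => trivial, fun k x _ hx => ?_⟩
  refine (congrArg SSet.opObjEquiv (hg _ _ (by rw [range_revHom']; exact hx))).trans ?_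
  exact f.app_congr (revHom_revHom x) _ _

/-- The horn of `insert v s` opposite to `v` can be filled, because `v` lies between two elements of
`s` or because it is linked to the next element of `s` by a degenerate edge. -/
def Pivotal {A : LowerSet (Set Q)} (f : PMap A E) (s : Set Q) (v : Q) : Prop :=
  (∃ a ∈ s, ∃ b ∈ s, a < v ∧ v < b) ∨
  (∃ a ∈ s, a < v ∧ (∀ q ∈ s, q ≤ a) ∧ (∃ b ∈ s, b ≠ a) ∧ {a, v} ∈ A ∧ f.Degen a v) ∨
  ∃ a ∈ s, v < a ∧ (∀ q ∈ s, a ≤ q) ∧ (∃ b ∈ s, b ≠ a) ∧ {a, v} ∈ A ∧ f.Degen a v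

lemma Degen.of_agree {A B : LowerSet (Set Q)} {f : PMap A E} {g : PMap B E} {a b : Q}
    (h : f.Degen a b) (hgf : g.Agree f) (hA : {a, b} ∈ A) : g.Degen a b := by
  have hm : ∀ {k : ℕ} (x : Fin (k + 1) →o Q), (∀ i, x i = a ∨ x i = b) → Set.range x ∈ A := by
    intro k x hx
    refine A.lower ?_ hA
    rintro _ ⟨i, rfl⟩
    exact hx i
  intro k x y hx hy hx' hy'
  rw [hgf x hx (hm x hx'), hgf y hy (hm y hy'), h x y (hm x hx') (hm y hy') hx' hy']

lemma Degen.pull {Q' : Type} [PartialOrder Q'] {A : LowerSet (Set Q)} {f : PMap A E} (φ : Q' →o Q)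
    {a b : Q'} (h : f.Degen (φ a) (φ b)) (B : LowerSet (Set Q'))
    (hB : ∀ s ∈ B, IsChain (· ≤ ·) s → φ '' s ∈ A) : (f.pull φ B hB).Degen a b :=
  fun _ _ _ _ _ hx' hy' => h _ _ _ _ (fun i => (hx' i).imp (congrArg φ) (congrArg φ))
    fun i => (hy' i).imp (congrArg φ) (congrArg φ)

/-- Degeneracy of the end edge is a condition on the initial diagram `f`, where that edge is already
defined, so it is inherited by every intermediate extension `f'`. -/
lemma exists_attach_pivotal [SSet.Quasicategory E] [Finite Q] {A A' : LowerSet (Set Q)}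
    {f : PMap A E} (f' : PMap A' E) (hf : f'.Agree f) {s : Set Q} {v : Q}
    (hc : IsChain (· ≤ ·) (insert v s)) (hvs : v ∉ s)
    (key : ∀ t ⊆ insert v s, t ∈ A' ↔ ¬ s ⊆ t) (h : f.Pivotal s v) :
    ∃ g : PMap (A' ⊔ LowerSet.Iic (insert v s)) E, g.Agree f' := by
  rcases h with ⟨a, ha, b, hb, hav, hvb⟩ | ⟨a, ha, hav, hmax, ⟨b, hb, hba⟩, hA, hD⟩ |
    ⟨a, ha, hav, hmin, ⟨b, hb, hba⟩, hA, hD⟩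
  · exact exists_attach_inner f' hc hvs key ha hb hav hvb
  · refine exists_attach_of_fill f' hvs key (exists_fill_right (a := ⟨a, Or.inr ha⟩)
      (b := ⟨b, Or.inr hb⟩) ?_ hav ?_ (lt_of_le_of_ne (hmax b hb) fun e => hba (congrArg Subtype.val e)) _
      (Degen.pull _ (hD.of_agree hf hA) _ _))
    · rintro ⟨q, rfl | hq⟩
      exacts [le_rfl, (hmax q hq).trans hav.le]
    · rintro ⟨q, rfl | hq⟩
      exacts [Or.inr rfl, Or.inl (hmax q hq)]
  · refine exists_attach_of_fill f' hvs key (exists_fill_left (a := ⟨a, Or.inr ha⟩)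
      (b := ⟨b, Or.inr hb⟩) ?_ hav ?_ (lt_of_le_of_ne (hmin b hb) fun e => hba (congrArg Subtype.val e).symm) _
      (Degen.pull _ (hD.of_agree hf hA) _ _))
    · rintro ⟨q, rfl | hq⟩
      exacts [le_rfl, hav.le.trans (hmin q hq)]
    · rintro ⟨q, rfl | hq⟩
      exacts [Or.inr rfl, Or.inl (hmin q hq)]

/-- Extension of partial diagrams with pivots that depend on two marked elements of a chain: an
element `m₁` selected from `s ∩ M₁`, and an element `m₂` selected from `s ∩ M₂ m₁`. -/
theorem exists_extension_comma [SSet.Quasicategory E] [Finite Q] {A B : LowerSet (Set Q)}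
    (f : PMap A E) (M₁ : Set Q) (M₂ : Q → Set Q) (sel₁ sel₂ : Set Q → Q → Prop)
    (hs₁ : ∀ t m m', sel₁ t m → sel₁ t m' → m = m')
    (hs₂ : ∀ t m m', sel₂ t m → sel₂ t m' → m = m') (κ : Q → Q → Q)
    (h : ∀ s ∈ B, s ∉ A → IsChain (· ≤ ·) s → ∃ m₁ m₂, sel₁ (s ∩ M₁) m₁ ∧ sel₂ (s ∩ M₂ m₁) m₂ ∧
      κ m₁ m₂ ∉ M₁ ∧ κ m₁ m₂ ∉ M₂ m₁ ∧ insert (κ m₁ m₂) s ∈ B ∧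
      (∀ q ∈ s, q ≤ κ m₁ m₂ ∨ κ m₁ m₂ ≤ q) ∧ s \ {κ m₁ m₂} ∉ A ∧
      (κ m₁ m₂ ∉ s → f.Pivotal s (κ m₁ m₂))) :
    ∃ g : PMap B E, g.Agree f := by
  -- The pivot avoids both sets of markers. Inserting or removing it leaves `m₁` and `m₂` unchanged,
  -- hence also the pivot.
  let Z : Set Q → Q → Prop := fun s v => ∃ m₁ m₂, sel₁ (s ∩ M₁) m₁ ∧ sel₂ (s ∩ M₂ m₁) m₂ ∧
    v = κ m₁ m₂ ∧ v ∉ M₁ ∧ v ∉ M₂ m₁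
  have hZ : ∀ s v w, Z s v → Z s w → v = w := by
    rintro s v w ⟨m₁, m₂, h₁, h₂, rfl, -⟩ ⟨m₁', m₂', h₁', h₂', rfl, -⟩
    obtain rfl := hs₁ _ _ _ h₁ h₁'
    obtain rfl := hs₂ _ _ _ h₂ h₂'
    rfl
  have hins : ∀ (s : Set Q) (v : Q) (M : Set Q), v ∉ M → insert v s ∩ M = s ∩ M := by
    intro s v M hv
    ext q
    refine ⟨fun ⟨h, hM⟩ => ⟨h.resolve_left fun e => hv (e ▸ hM), hM⟩, fun ⟨h, hM⟩ => ⟨Or.inr h, hM⟩⟩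
  have hdel : ∀ (s : Set Q) (v : Q) (M : Set Q), v ∉ M → (s \ {v}) ∩ M = s ∩ M := by
    intro s v M hv
    ext q
    exact ⟨fun ⟨h, hM⟩ => ⟨h.1, hM⟩, fun ⟨h, hM⟩ => ⟨⟨h, fun e => hv ((show q = v from e) ▸ hM)⟩, hM⟩⟩
  have hB : ∀ s ∈ B, s ∉ A → IsChain (· ≤ ·) s → ∀ v, Z s v → insert v s ∈ B ∧
      IsChain (· ≤ ·) (insert v s) ∧ s \ {v} ∉ A ∧ (v ∉ s → f.Pivotal s v) := by
    intro s hs hsA hc v hv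
    obtain ⟨m₁, m₂, h₁, h₂, h₃, h₄, h₅, h₆, h₇, h₈⟩ := h s hs hsA hc
    obtain rfl := hZ s v (κ m₁ m₂) hv ⟨m₁, m₂, h₁, h₂, rfl, h₃, h₄⟩
    exact ⟨h₅, hc.insert fun q hq _ => (h₆ q hq).symm, h₇, h₈⟩
  -- The rank counts marked elements. Exchanging `z` for the pivot lowers it if `z` is marked; if
  -- not, the new chain has the same pivot and already contains it. The set that quantifies over all
  -- selected `m` is `M₂ m₁`, written without a choice of `m₁`.
  refine exists_extension_of_fill f Z (fun s => toLex ((s ∩ M₁).ncard,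
    (s ∩ {q | ∀ m, sel₁ (s ∩ M₁) m → q ∈ M₂ m}).ncard)) ?_ hZ ?_ ?_ ?_ ?_
  · intro s hs hsA hc
    obtain ⟨m₁, m₂, h₁, h₂, h₃, h₄, -⟩ := h s hs hsA hc
    have hv : Z s (κ m₁ m₂) := ⟨m₁, m₂, h₁, h₂, rfl, h₃, h₄⟩
    obtain ⟨h₅, h₆, h₇, -⟩ := hB s hs hsA hc _ hv
    exact ⟨_, hv, h₅, h₆, h₇⟩
  · rintro s v ⟨m₁, m₂, h₁, h₂, rfl, h₃, h₄⟩
    exact ⟨m₁, m₂, by rwa [hins _ _ _ h₃], by rwa [hins _ _ _ h₄], rfl, h₃, h₄⟩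
  · rintro s v ⟨m₁, m₂, h₁, h₂, rfl, h₃, h₄⟩
    exact ⟨m₁, m₂, by rwa [hdel _ _ _ h₃], by rwa [hdel _ _ _ h₄], rfl, h₃, h₄⟩
  · rintro s v z w hs hsA hc ⟨m₁, m₂, h₁, h₂, rfl, h₃, h₄⟩ hvs hz - hw hws
    set v := κ m₁ m₂
    have hlt : ∀ M : Set Q, v ∉ M → z ∈ M → (insert v (s \ {z}) ∩ M).ncard < (s ∩ M).ncard := by
      intro M hv hzM
      rw [hins _ _ _ hv]
      refine Set.ncard_lt_ncard ⟨fun q hq => ⟨hq.1.1, hq.2⟩, fun h => ?_⟩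
      exact (h ⟨hz, hzM⟩).1.2 rfl
    have heq : ∀ M : Set Q, v ∉ M → z ∉ M → insert v (s \ {z}) ∩ M = s ∩ M :=
      fun M hv hzM => (hins _ _ _ hv).trans (hdel _ _ _ hzM)
    rw [Prod.Lex.toLex_lt_toLex]
    by_cases hz₁ : z ∈ M₁
    · exact Or.inl (hlt M₁ h₃ hz₁)
    · have e₁ := heq M₁ h₃ hz₁
      have hM : {q | ∀ m, sel₁ (s ∩ M₁) m → q ∈ M₂ m} = M₂ m₁ := by
        ext q
        exact ⟨fun h => h m₁ h₁, fun h m hm => hs₁ _ _ _ h₁ hm ▸ h⟩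
      refine Or.inr ⟨congrArg Set.ncard e₁, ?_⟩
      simp only [e₁, hM]
      by_cases hz₂ : z ∈ M₂ m₁
      · exact hlt _ h₄ hz₂
      · refine absurd (Or.inl ?_) hws
        exact hZ _ _ _ hw ⟨m₁, m₂, by rwa [e₁], by rwa [heq _ h₄ hz₂], rfl, h₃, h₄⟩
  · intro A' f' hA hf s v hs hsA hc hv hvs key
    exact exists_attach_pivotal f' hf hc hvs key
      ((hB s hs hsA (hc.mono (Set.subset_insert _ _)) v hv).2.2.2 hvs)

/-- Extension of partial diagrams with pivots that depend on one marked element of a chain. -/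
theorem exists_extension_marker [SSet.Quasicategory E] [Finite Q] {A B : LowerSet (Set Q)}
    (f : PMap A E) (M : Set Q) (sel : Set Q → Q → Prop)
    (hs : ∀ t m m', sel t m → sel t m' → m = m') (κ : Q → Q)
    (h : ∀ s ∈ B, s ∉ A → IsChain (· ≤ ·) s → ∃ m, sel (s ∩ M) m ∧ κ m ∉ M ∧ insert (κ m) s ∈ B ∧
      (∀ q ∈ s, q ≤ κ m ∨ κ m ≤ q) ∧ s \ {κ m} ∉ A ∧ (κ m ∉ s → f.Pivotal s (κ m))) :
    ∃ g : PMap B E, g.Agree f := by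
  refine exists_extension_comma f M (fun _ => M) sel sel hs hs (fun m _ => κ m) ?_
  intro s hsB hsA hc
  obtain ⟨m, h₁, h₂, h₃⟩ := h s hsB hsA hc
  exact ⟨m, m, h₁, h₁, h₂, h₂, h₃⟩

lemma isGreatest_unique (t : Set Q) (m m' : Q) (h : IsGreatest t m) (h' : IsGreatest t m') :
    m = m' := h.unique h'

lemma isLeast_unique (t : Set Q) (m m' : Q) (h : IsLeast t m) (h' : IsLeast t m') :
    m = m' := h.unique h'

lemma _root_.IsChain.exists_isGreatest [Finite Q] {s : Set Q} (hs : IsChain (· ≤ ·) s)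
    (h : s.Nonempty) : ∃ m, IsGreatest s m := by
  obtain ⟨m, hm⟩ := s.toFinite.exists_maximal h
  exact ⟨m, hm.1, fun q hq => (hs.total hq hm.1).elim id fun h' => hm.2 hq h'⟩

lemma _root_.IsChain.exists_isLeast [Finite Q] {s : Set Q} (hs : IsChain (· ≤ ·) s)
    (h : s.Nonempty) : ∃ m, IsLeast s m := by
  obtain ⟨m, hm⟩ := s.toFinite.exists_minimal h
  exact ⟨m, hm.1, fun q hq => (hs.total hq hm.1).elim (fun h' => hm.2 hq h') id⟩

end PMap

end Opposites

/-! ### Exact inclusions of subposets -/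

section Exactness

variable {P Q R : Type} [PartialOrder P] [PartialOrder Q] [PartialOrder R] {E : SSet.{u}}

/-- The inclusion of the second factor of a join. -/
def inrEmb (R P : Type) [PartialOrder R] [PartialOrder P] : P ↪o R ⊕ₗ P where
  toFun := Sum.inrₗ
  inj' _ _ h := Sum.inr_injective (toLex.injective h)
  map_rel_iff' := Sum.Lex.inr_le_inr_iff

/-- The chains in a join `R ⋆ P` that do not contain all of `R`, or whose elements in `P` belong
to `U`. -/
def exCx (R : Type) (U : Set P) : LowerSet (Set (R ⊕ₗ P)) :=
  mkCx (fun s => (∀ p, Sum.inrₗ p ∈ s → p ∈ U) ∨ ¬ HasAll s)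
    fun _ _ h hs => hs.imp (fun h₁ p hp => h₁ p (h hp)) fun h₁ h₂ => h₁ (h₂.mono h)

lemma isChain_image (φ : P →o Q) {s : Set P} (hs : IsChain (· ≤ ·) s) :
    IsChain (· ≤ ·) (φ '' s) := by
  rintro _ ⟨p, hp, rfl⟩ _ ⟨q, hq, rfl⟩ -
  exact (hs.total hp hq).imp (fun h => φ.monotone h) fun h => φ.monotone h

lemma inr_ne_inl {r : R} {p : P} : (Sum.inrₗ p : R ⊕ₗ P) ≠ Sum.inlₗ r :=
  fun h => Sum.inr_ne_inl (toLex.injective h)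

lemma inrₗ_inj {p q : P} : (Sum.inrₗ p : R ⊕ₗ P) = Sum.inrₗ q ↔ p = q :=
  ⟨fun h => Sum.inr_injective (toLex.injective h), fun h => h ▸ rfl⟩

lemma inlₗ_inj {p q : R} : (Sum.inlₗ p : R ⊕ₗ P) = Sum.inlₗ q ↔ p = q :=
  ⟨fun h => Sum.inl_injective (toLex.injective h), fun h => h ▸ rfl⟩

/-- The inclusion of a subset in a larger one. -/
def inclEmb {V W : Set P} (h : V ⊆ W) : ↥V ↪o ↥W where
  toFun := Set.inclusion h
  inj' := Set.inclusion_injective h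
  map_rel_iff' := Iff.rfl

namespace PMap

/-- The partial diagram `f` restricts to `D` along the order embedding `ι`. -/
def Over {A : LowerSet (Set Q)} (f : PMap A E) (ι : P ↪o Q) (D : PMap (⊤ : LowerSet (Set P)) E) :
    Prop :=
  ∀ ⦃k : ℕ⦄ (x : Fin (k + 1) →o P) (h : Set.range ((ι : P →o Q).comp x) ∈ A),
    f.app ((ι : P →o Q).comp x) h = D.app x trivial

lemma Over.of_agree {A B : LowerSet (Set Q)} {f : PMap A E} {g : PMap B E} {ι : P ↪o Q}
    {D : PMap (⊤ : LowerSet (Set P)) E} (h : f.Over ι D) (hgf : g.Agree f)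
    (hA : ∀ s : Set P, IsChain (· ≤ ·) s → ι '' s ∈ A) : g.Over ι D :=
  fun _ x hx => (hgf _ hx (range_comp_mem' (ι : P →o Q) x (hA _ (isChain_range x)))).trans (h x _)

/-- The restriction of a diagram on `P` to a subset `V`. -/
def sub (D : PMap (⊤ : LowerSet (Set P)) E) (V : Set P) : PMap (⊤ : LowerSet (Set V)) E :=
  D.pull (OrderHom.Subtype.val (· ∈ V)) ⊤ fun _ _ _ => trivial

/-- The limit of the diagram `D` is also the limit of its restriction to `U`: families of cones
extend uniquely from `U` to the whole poset. -/
def IsExact (D : PMap (⊤ : LowerSet (Set P)) E) (U : Set P) : Prop :=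
  ∀ (n : ℕ) (f : PMap (exCx (Fin (n + 1)) U) E), f.Over (inrEmb _ _) D →
    ∃ g : PMap (⊤ : LowerSet (Set (Fin (n + 1) ⊕ₗ P))) E, g.Agree f

/-- The inclusion of `U` in `V` is exact for the restriction of `D` to `V`. -/
def Exact (D : PMap (⊤ : LowerSet (Set P)) E) (U V : Set P) : Prop :=
  (D.sub V).IsExact (Subtype.val ⁻¹' U)

/-- Extension of partial diagrams along an exact inclusion. -/
theorem IsExact.exists_extension [Finite Q] {D : PMap (⊤ : LowerSet (Set P)) E} {U : Set P}
    (hD : D.IsExact U) {A B : LowerSet (Set Q)} (f : PMap A E) (ι : P ↪o Q) (hf : f.Over ι D)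
    (h : ∀ s ∈ B, s ∉ A → IsChain (· ≤ ·) s → (s \ Set.range ι).Nonempty ∧
      (∀ q ∈ s \ Set.range ι, ∀ p, q ≤ ι p) ∧ ∀ μ : Set P, IsChain (· ≤ ·) μ →
        (s \ Set.range ι) ∪ ι '' μ ∈ B ∧ ((s \ Set.range ι) ∪ ι '' μ ∈ A ↔ μ ⊆ U)) :
    ∃ g : PMap B E, g.Agree f := by
  -- Instead of single horns, whole blocks ρ ⋆ P are attached, where ρ is the part of a missing
  -- chain outside the image of `ι`; small ρ come first. The invariant says that of the block of a
  -- missing chain nothing is present beyond ρ ⋆ U and the chains over proper parts of ρ.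
  suffices H : ∀ (N : ℕ) (A' : LowerSet (Set Q)) (f' : PMap A' E), A ≤ A' → f'.Agree f →
      (∀ s ∈ B, s ∉ A' → IsChain (· ≤ ·) s → ∀ μ : Set P, IsChain (· ≤ ·) μ →
        (s \ Set.range ι) ∪ ι '' μ ∈ A' → μ ⊆ U) →
      {s | s ∈ B ∧ IsChain (· ≤ ·) s ∧ s ∉ A'}.ncard ≤ N → ∃ g : PMap B E, g.Agree f from
    H _ A f le_rfl (fun _ _ _ _ => rfl)
      (fun s hs hsA hc μ hμ => ((h s hs hsA hc).2.2 μ hμ).2.1) le_rfl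
  intro N
  induction N with
  | zero =>
    intro A' f' hA hf' inv hN
    rw [Nat.le_zero, Set.ncard_eq_zero, Set.eq_empty_iff_forall_notMem] at hN
    refine ⟨f'.res B fun s hs hc => by_contra fun h => hN s ⟨hs, hc, h⟩, ?_⟩
    exact fun _ x _ hx => hf' x _ hx
  | succ N ih =>
    intro A' f' hA hf' inv hN
    rcases {s | s ∈ B ∧ IsChain (· ≤ ·) s ∧ s ∉ A'}.eq_empty_or_nonempty with he | hne
    · exact ih A' f' hA hf' inv (by rw [he, Set.ncard_empty]; exact Nat.zero_le _)
    obtain ⟨s, ⟨hsB, hc, hsA'⟩, hmin⟩ := Set.exists_min_image _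
      (fun s => (s \ Set.range ι).ncard) (Set.toFinite _) hne
    have hsA : s ∉ A := fun h => hsA' (hA h)
    obtain ⟨hρ, hle, hμ⟩ := h s hsB hsA hc
    set ρ : Set Q := s \ Set.range ι with hρdef
    have hιA : ∀ μ : Set P, IsChain (· ≤ ·) μ → ι '' μ ∈ A := by
      intro μ hc'
      by_contra hA
      obtain ⟨q, ⟨p, -, rfl⟩, hp⟩ := (h (ι '' μ) (B.lower (Set.subset_union_right) (hμ μ hc').1) hA
        (isChain_image (ι : P →o Q) hc')).1
      exact hp ⟨p, rfl⟩
    have hρc : IsChain (· ≤ ·) ρ := hc.mono Set.sdiff_subset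
    have := Fintype.ofFinite ↥ρ
    let : LinearOrder ↥ρ := { (inferInstance : PartialOrder ↥ρ) with
      le_total := fun x y => hρc.total x.2 y.2
      toDecidableLE := Classical.decRel _ }
    obtain ⟨d, hd⟩ : ∃ d, Fintype.card ↥ρ = d + 1 :=
      Nat.exists_eq_succ_of_ne_zero (Fintype.card_pos_iff.2 hρ.to_subtype).ne'
    let e : Fin (d + 1) ≃o ↥ρ := monoEquivOfFin ↥ρ hd
    -- All of ρ lies below the image of `ι`, so the block is the join of the simplex on ρ with P.
    let τ : Fin (d + 1) ⊕ₗ P ↪o Q := OrderEmbedding.ofMapLEIff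
      (fun x => Sum.elim (fun i => (e i).1) ι (ofLex x)) (by
        intro x y
        rcases lex_cases x with ⟨i, rfl⟩ | ⟨p, rfl⟩ <;> rcases lex_cases y with ⟨j, rfl⟩ | ⟨p', rfl⟩
        · exact e.le_iff_le.trans Sum.Lex.inl_le_inl_iff.symm
        · exact iff_of_true (hle _ (e i).2 p') (Sum.Lex.inl_le_inr _ _)
        · refine iff_of_false (fun h => ?_) Sum.Lex.not_inr_le_inl
          exact (e j).2.2 ⟨p, le_antisymm h (hle _ (e j).2 p)⟩
        · exact ι.le_iff_le.trans Sum.Lex.inr_le_inr_iff.symm)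
    have hτl : ∀ i, τ (Sum.inlₗ i) = (e i).1 := fun _ => rfl
    have hτr : ∀ p, τ (Sum.inrₗ p) = ι p := fun _ => rfl
    have himg : ∀ t : Set (Fin (d + 1) ⊕ₗ P), IsChain (· ≤ ·) t → ∃ μ : Set P, IsChain (· ≤ ·) μ ∧
        (∀ p, p ∈ μ ↔ Sum.inrₗ p ∈ t) ∧ τ '' t ⊆ ρ ∪ ι '' μ ∧ (τ '' t) \ Set.range ι ⊆ ρ := by
      intro t ht
      refine ⟨{p | Sum.inrₗ p ∈ t}, fun p hp p' hp' hne => ?_, fun p => Iff.rfl, ?_, ?_⟩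
      · exact (ht.total hp hp').imp Sum.Lex.inr_le_inr_iff.1 Sum.Lex.inr_le_inr_iff.1
      · rintro _ ⟨x, hx, rfl⟩
        rcases lex_cases x with ⟨i, rfl⟩ | ⟨p, rfl⟩
        exacts [Or.inl (e i).2, Or.inr ⟨p, hx, rfl⟩]
      · rintro _ ⟨⟨x, hx, rfl⟩, hn⟩
        rcases lex_cases x with ⟨i, rfl⟩ | ⟨p, rfl⟩
        exacts [(e i).2, absurd ⟨p, rfl⟩ hn]
    -- Chains over all of ρ are present when their part in P lies in `U`. Chains that omit an
    -- element of ρ are present because ρ was chosen of least cardinality.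
    have hpull : ∀ t ∈ exCx (Fin (d + 1)) U, IsChain (· ≤ ·) t → τ '' t ∈ A' := by
      intro t ht htc
      obtain ⟨μ, hμc, hμt, hsub, hsub'⟩ := himg t htc
      rcases ht with ht | ht
      · exact hA (A.lower hsub ((hμ μ hμc).2.2 fun p hp => ht p ((hμt p).1 hp)))
      · by_contra hn
        have := hmin (τ '' t) ⟨B.lower hsub (hμ μ hμc).1,
          isChain_image (τ : _ →o Q) htc, hn⟩
        have heq := Set.eq_of_subset_of_ncard_le hsub' this
        apply ht
        intro i
        obtain ⟨⟨x, hx, hxi⟩, -⟩ := heq.symm.subset (e i).2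
        rwa [← τ.injective (hxi.trans (hτl i).symm)]
    obtain ⟨g, hg⟩ := hD d (f'.pull (τ : _ →o Q) _ hpull) (by
      intro k x hx
      exact (hf.of_agree hf' hιA) x _)
    obtain ⟨g', hg', -⟩ := exists_attach τ f' g (by
      intro k x hx
      refine (hg x trivial ?_).symm
      by_cases ha : HasAll (Set.range x)
      · left
        obtain ⟨μ, hμc, hμt, hsub, -⟩ := himg _ (isChain_range x)
        have : ρ ∪ ι '' μ ⊆ Set.range ((τ : _ →o Q).comp x) := by
          rintro q (hq | ⟨p, hp, rfl⟩)
          · obtain ⟨i, hi⟩ := ha (e.symm ⟨q, hq⟩)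
            refine ⟨i, ?_⟩
            change τ (x i) = q
            rw [hi, hτl, e.apply_symm_apply]
          · obtain ⟨i, hi⟩ := (hμt p).1 hp
            exact ⟨i, congrArg τ hi⟩
        intro p hp
        exact inv s hsB hsA' hc μ hμc (A'.lower this hx) ((hμt p).2 hp)
      · exact Or.inr ha)
    have hsτ : ∀ t : Set Q, t \ Set.range ι ⊆ ρ → t ⊆ Set.range τ := by
      intro t ht q hq
      by_cases hqι : q ∈ Set.range ι
      · obtain ⟨p, rfl⟩ := hqι
        exact ⟨Sum.inrₗ p, rfl⟩
      · exact ⟨Sum.inlₗ (e.symm ⟨q, ht ⟨hq, hqι⟩⟩), by rw [hτl, e.apply_symm_apply]⟩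
    refine ih _ g' (hA.trans le_sup_left) (hg'.trans hf' fun _ h => hA h.2) ?_ ?_
    · rintro t htB htA htc μ hμc (hm | hm)
      · exact inv t htB (fun h => htA (Or.inl h)) htc μ hμc hm
      · refine absurd (Or.inr (hsτ t fun q hq => ?_)) htA
        obtain ⟨x, hx⟩ := hm (Or.inl hq)
        rcases lex_cases x with ⟨i, rfl⟩ | ⟨p, rfl⟩
        · rw [← hx]
          exact (e i).2
        · exact absurd ⟨p, hx⟩ hq.2
    · refine Nat.lt_succ_iff.1 (lt_of_lt_of_le (Set.ncard_lt_ncard ?_) hN)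
      refine ⟨fun t ht => ⟨ht.1, ht.2.1, fun h => ht.2.2 (Or.inl h)⟩, fun h => ?_⟩
      exact (h ⟨hsB, hc, hsA'⟩).2.2 (Or.inr (hsτ s Set.Subset.rfl))

lemma IsExact.of_orderIso {P' : Type} [PartialOrder P'] (e : P ≃o P')
    {D : PMap (⊤ : LowerSet (Set P)) E} {D' : PMap (⊤ : LowerSet (Set P')) E} {U : Set P}
    {U' : Set P'} (h : D.IsExact U) (hU : ∀ p, p ∈ U → e p ∈ U')
    (hD : ∀ ⦃k : ℕ⦄ (x : Fin (k + 1) →o P), D'.app ((e : P →o P').comp x) trivial = D.app x trivial)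
    (hU' : ∀ p, e p ∈ U' → p ∈ U) : D'.IsExact U' := by
  intro n f hf
  obtain ⟨g, hg⟩ := h n (f.pull (joinMap OrderHom.id (e : P →o P')) _ (by
      intro s hs _
      refine hs.imp (fun hs p hp => ?_) fun hs => hasAll_joinMap_image.not.2 hs
      obtain ⟨p', hp', rfl⟩ := inr_mem_joinMap_image.1 hp
      exact hU _ (hs p' hp'))) (fun k x hx => (hf ((e : P →o P').comp x) _).trans (hD x))
  have hid : ∀ {k : ℕ} (x : Fin (k + 1) →o Fin (n + 1) ⊕ₗ P'),
      (joinMap OrderHom.id (e : P →o P')).comp ((joinMap OrderHom.id (e.symm : P' →o P)).comp x) = x := by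
    intro k x
    ext i
    change joinMap _ _ (joinMap _ _ (x i)) = x i
    rcases lex_cases (x i) with ⟨r, h⟩ | ⟨p, h⟩ <;> rw [h]
    · rfl
    · exact congrArg Sum.inrₗ (e.apply_symm_apply p)
  refine ⟨g.pull (joinMap OrderHom.id (e.symm : P' →o P)) _ fun _ _ _ => trivial,
    fun k x _ hx => (hg _ _ ?_).trans (f.app_congr (hid x) _ _)⟩
  rw [range_joinMap_comp]
  refine hx.imp (fun hs p hp => ?_) fun hs => hasAll_joinMap_image.not.2 hs
  obtain ⟨p', hp', rfl⟩ := inr_mem_joinMap_image.1 hp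
  exact hU' _ (by
    change e (e.symm p') ∈ U'
    rw [e.apply_symm_apply]
    exact hs p' hp')

/-- Exactness of an inclusion in terms of an order embedding. -/
lemma exact_iff_of_embedding {P' : Type} [PartialOrder P'] (F : P' ↪o P)
    {D : PMap (⊤ : LowerSet (Set P)) E} {D' : PMap (⊤ : LowerSet (Set P')) E}
    (hD : ∀ ⦃k : ℕ⦄ (x : Fin (k + 1) →o P'), D.app ((F : P' →o P).comp x) trivial = D'.app x trivial)
    {U V : Set P} {U' : Set P'} (hV : ∀ p, p ∈ V ↔ p ∈ Set.range F) (hU : ∀ p, F p ∈ U ↔ p ∈ U') :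
    D.Exact U V ↔ D'.IsExact U' := by
  obtain rfl : V = Set.range F := Set.ext hV
  let e : P' ≃o Set.range F := F.orderIso
  refine ⟨fun h => h.of_orderIso e.symm ?_ ?_ ?_, fun h => h.of_orderIso e ?_ ?_ ?_⟩
  · rintro ⟨_, p, rfl⟩ hp
    rw [show e.symm ⟨F p, _⟩ = p from e.symm_apply_apply p]
    exact (hU p).1 hp
  · intro k x
    refine (hD _).symm.trans (D.app_congr ?_ _ _)
    ext i
    exact congrArg Subtype.val (e.apply_symm_apply (x i))
  · rintro ⟨_, p, rfl⟩ hp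
    rw [show e.symm ⟨F p, _⟩ = p from e.symm_apply_apply p] at hp
    exact (hU p).2 hp
  · exact fun p hp => (hU p).2 hp
  · exact fun k x => hD x
  · exact fun p hp => (hU p).1 hp

variable [Finite P] {D : PMap (⊤ : LowerSet (Set P)) E} {U V W : Set P}

lemma Over.incl {A : LowerSet (Set (R ⊕ₗ ↥W))} {f : PMap A E} (hf : f.Over (inrEmb _ _) (D.sub W))
    (hVW : V ⊆ W) : f.Over ((inclEmb hVW).trans (inrEmb _ _)) (D.sub V) :=
  fun _ x hx => hf ((inclEmb hVW : ↥V →o ↥W).comp x) hx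

/-- Composite of trivial fibrations of slices: a family of cones on Δⁿ ⋆ U ∪ ∂Δⁿ ⋆ W is first
extended to Δⁿ ⋆ V ∪ ∂Δⁿ ⋆ W, and then to Δⁿ ⋆ W. -/
lemma Exact.trans (hUV : U ⊆ V) (hVW : V ⊆ W) (h₁ : D.Exact U V) (h₂ : D.Exact V W) :
    D.Exact U W := by
  intro n f hf
  let ι := (inclEmb hVW).trans (inrEmb (Fin (n + 1)) ↥W)
  obtain ⟨g, hg⟩ := IsExact.exists_extension h₁ (B := exCx (Fin (n + 1)) (Subtype.val ⁻¹' V)) f ι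
    (hf.incl hVW) (by
      intro s hs hsA hc
      have ha : HasAll s := by_contra fun h => hsA (Or.inr h)
      have hsV := hs.resolve_right (not_not.2 ha)
      have hl : ∀ q ∈ s \ Set.range ι, ∃ r, q = Sum.inlₗ r := by
        rintro q ⟨hq, hqι⟩
        rcases lex_cases q with ⟨r, rfl⟩ | ⟨p, rfl⟩
        exacts [⟨r, rfl⟩, absurd ⟨⟨p.1, hsV p hq⟩, rfl⟩ hqι]
      refine ⟨⟨Sum.inlₗ 0, ha 0, fun ⟨_, h⟩ => inr_ne_inl h⟩, fun q hq p => ?_, fun μ hμ => ?_⟩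
      · obtain ⟨r, rfl⟩ := hl q hq
        exact Sum.Lex.inl_le_inr _ _
      · have hp : ∀ p, Sum.inrₗ p ∈ (s \ Set.range ι) ∪ ι '' μ → ∃ v ∈ μ, v.1 = p.1 := by
          rintro p (hp | ⟨v, hv, e⟩)
          · obtain ⟨r, h⟩ := hl _ hp
            exact absurd h inr_ne_inl
          · exact ⟨v, hv, congrArg Subtype.val (inrₗ_inj.1 e)⟩
        refine ⟨Or.inl fun p h => ?_, ?_, fun h => Or.inl fun p hp' => ?_⟩
        · obtain ⟨v, -, e⟩ := hp p h
          exact (e ▸ v.2 : p.1 ∈ V)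
        · rintro (h | h) v hv
          · exact h ⟨v.1, hVW v.2⟩ (Or.inr ⟨v, hv, rfl⟩)
          · exact absurd (fun r => Or.inl ⟨ha r, fun ⟨_, h⟩ => inr_ne_inl h⟩) h
        · obtain ⟨v, hv, e⟩ := hp p hp'
          exact (e ▸ h hv : p.1 ∈ U))
  obtain ⟨g', hg'⟩ := h₂ n g (hf.of_agree hg fun s _ => Or.inr fun h => by
    obtain ⟨_, -, h⟩ := h 0
    exact inr_ne_inl h)
  exact ⟨g', hg'.trans hg fun s hs => hs.2.imp_left fun h p hp => hUV (h p hp)⟩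

/-- If the limit over `W` is the limit over `V` and the limit over `U`, then the limit over `V` is
the limit over `U`. -/
lemma Exact.of_trans (hUV : U ⊆ V) (hVW : V ⊆ W) (h₁ : D.Exact U W) (h₂ : D.Exact V W) :
    D.Exact U V := by
  intro n f hf
  let j : Fin (n + 1) ⊕ₗ ↥V ↪o Fin (n + 1) ⊕ₗ ↥W := OrderEmbedding.ofMapLEIff
    (joinMap OrderHom.id (inclEmb hVW : ↥V →o ↥W)) (by
      intro x y
      rcases lex_cases x with ⟨i, rfl⟩ | ⟨p, rfl⟩ <;> rcases lex_cases y with ⟨k, rfl⟩ | ⟨q, rfl⟩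
      · exact Sum.Lex.inl_le_inl_iff.trans Sum.Lex.inl_le_inl_iff.symm
      · exact iff_of_true (Sum.Lex.inl_le_inr _ _) (Sum.Lex.inl_le_inr _ _)
      · exact iff_of_false Sum.Lex.not_inr_le_inl Sum.Lex.not_inr_le_inl
      · exact ((inrEmb (Fin (n + 1)) ↥W).le_iff_le (a := inclEmb hVW p) (b := inclEmb hVW q)).trans
          (inrEmb (Fin (n + 1)) ↥V).le_iff_le.symm)
  let j' : Fin (n + 1) ⊕ₗ ↥V →o Fin (n + 1) ⊕ₗ ↥W := j
  have hj : ∀ s : Set (Fin (n + 1) ⊕ₗ ↥V), HasAll (j '' s) ↔ HasAll s :=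
    fun s => hasAll_joinMap_image (ψ := (inclEmb hVW : ↥V →o ↥W))
  have hjr : ∀ p, Sum.inrₗ p ∈ Set.range j → p.1 ∈ V := by
    rintro p ⟨x, hx⟩
    rcases lex_cases x with ⟨i, rfl⟩ | ⟨v, rfl⟩
    · exact absurd hx.symm inr_ne_inl
    · exact inrₗ_inj.1 hx ▸ v.2
  let p₁ := f.push j (mkCx (fun s => (∀ p, Sum.inrₗ p ∈ s → p.1 ∈ V) ∧
      ((∀ p, Sum.inrₗ p ∈ s → p.1 ∈ U) ∨ ¬ HasAll s)) fun _ _ h hs => ⟨fun p hp => hs.1 p (h hp),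
        hs.2.imp (fun h₁ p hp => h₁ p (h hp)) fun h₁ h₂ => h₁ (h₂.mono h)⟩) (by
    intro s hs
    have hsub : s ⊆ Set.range j := by
      intro q hq
      rcases lex_cases q with ⟨i, rfl⟩ | ⟨p, rfl⟩
      exacts [⟨Sum.inlₗ i, rfl⟩, ⟨Sum.inrₗ ⟨p.1, hs.1 p hq⟩, rfl⟩]
    refine ⟨hsub, hs.2.imp (fun h p hp => h _ hp) fun h => ?_⟩
    rwa [← hj, Set.image_preimage_eq_of_subset hsub])
  let p₂ := (D.sub W).push (inrEmb (Fin (n + 1)) ↥W) (mkCx HasNone fun _ _ h hs => hs.mono h) (by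
    intro s hs
    refine ⟨fun q hq => ?_, trivial⟩
    rcases lex_cases q with ⟨i, rfl⟩ | ⟨p, rfl⟩
    exacts [absurd hq (hs i), ⟨p, rfl⟩])
  have hp₂ : p₂.Over (inrEmb _ _) (D.sub W) := fun k x hx => push_app (inrEmb (Fin (n + 1)) ↥W) (D.sub W) _ _ x hx (show Set.range x ∈ (⊤ : LowerSet (Set ↥W)) from trivial)
  have h₁₂ : p₁.Agree p₂ := by
    intro k x hx hx'
    have hV : ∀ i, ∃ v : ↥V, x i = Sum.inrₗ ⟨v.1, hVW v.2⟩ := by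
      intro i
      rcases lex_cases (x i) with ⟨r, e⟩ | ⟨p, e⟩
      exacts [absurd ⟨i, e⟩ (hx' r), ⟨⟨p.1, hx.1 p ⟨i, e⟩⟩, e⟩]
    choose y hy using hV
    let y' : Fin (k + 1) →o ↥V := ⟨y, fun a b hab => by
      have := x.monotone hab
      rw [hy, hy] at this
      exact (inrEmb (Fin (n + 1)) ↥W).le_iff_le.1 this⟩
    have e : x = j'.comp ((inrEmb (Fin (n + 1)) ↥V : ↥V →o Fin (n + 1) ⊕ₗ ↥V).comp y') :=
      OrderHom.ext _ _ (funext hy)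
    refine (p₁.app_congr e hx (e ▸ hx)).trans (Eq.trans ?_ (p₂.app_congr e hx' (e ▸ hx')).symm)
    refine (push_app _ _ _ _ _ (e ▸ hx) (Or.inr fun h => ?_)).trans ((hf y' _).trans
      (hp₂ ((inclEmb hVW : ↥V →o ↥W).comp y') (e ▸ hx')).symm)
    obtain ⟨i, hi⟩ := h 0
    exact inr_ne_inl hi
  -- The given boundary ∂Δⁿ ⋆ V is lifted to ∂Δⁿ ⋆ W through the exactness of `V` in `W`. Exactness
  -- of `U` in `W` then fills the interior, and restriction to `V` gives the filler.
  obtain ⟨g, hg⟩ := IsExact.exists_extension h₂ (B := exCx (Fin (n + 1)) (Subtype.val ⁻¹' U))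
    (glue p₁ p₂ h₁₂) (inrEmb _ _) (hp₂.of_agree (glue_agree_right _ _ _) fun s _ r h => by
      obtain ⟨_, -, h⟩ := h
      exact inr_ne_inl h) (by
    intro s hs hsA hc
    have hn : ¬ HasNone s := fun h => hsA (Or.inr h)
    have hV : ¬ ∀ p, Sum.inrₗ p ∈ s → p.1 ∈ V := fun h => hsA (Or.inl ⟨h, hs⟩)
    have ha : ¬ HasAll s := hs.resolve_left fun h => hV fun p hp => hUV (h p hp)
    have hl : ∀ q ∈ s \ Set.range (inrEmb (Fin (n + 1)) ↥W), ∃ r, q = Sum.inlₗ r := by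
      rintro q ⟨hq, hqι⟩
      rcases lex_cases q with ⟨r, rfl⟩ | ⟨p, rfl⟩
      exacts [⟨r, rfl⟩, absurd ⟨p, rfl⟩ hqι]
    obtain ⟨r, hr⟩ := not_forall_not.1 hn
    refine ⟨⟨Sum.inlₗ r, hr, fun ⟨_, h⟩ => inr_ne_inl h⟩, fun q hq p => ?_, fun μ hμ => ?_⟩
    · obtain ⟨r, rfl⟩ := hl q hq
      exact Sum.Lex.inl_le_inr _ _
    · have ha' : ¬ HasAll (s \ Set.range (inrEmb (Fin (n + 1)) ↥W) ∪ inrEmb (Fin (n + 1)) ↥W '' μ) := by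
        refine fun h => ha fun r => ?_
        rcases h r with h | ⟨_, -, h⟩
        exacts [h.1, absurd h inr_ne_inl]
      refine ⟨Or.inr ha', ?_, fun h => Or.inl ⟨?_, Or.inr ha'⟩⟩
      · rintro (h | h) p hp
        · exact h.1 p (Or.inr ⟨p, hp, rfl⟩)
        · exact absurd (Or.inl ⟨hr, fun ⟨_, h⟩ => inr_ne_inl h⟩) (h r)
      · rintro p (hp | ⟨p', hp', e⟩)
        · obtain ⟨r, h⟩ := hl _ hp
          exact absurd h inr_ne_inl
        · exact inrₗ_inj.1 e ▸ h hp')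
  obtain ⟨g', hg'⟩ := h₁ n g ((hp₂.of_agree (glue_agree_right _ _ _) fun s _ r h => by
      obtain ⟨_, -, h⟩ := h
      exact inr_ne_inl h).of_agree hg fun s _ => Or.inr fun r h => by
      obtain ⟨_, -, h⟩ := h
      exact inr_ne_inl h)
  have hjW : ∀ s ∈ exCx (Fin (n + 1)) (Subtype.val ⁻¹' U), j '' s ∈
      exCx (Fin (n + 1)) (Subtype.val ⁻¹' U) := by
    refine fun s hs => hs.imp (fun hs p hp => ?_) fun hs => (hj s).not.2 hs
    obtain ⟨p', hp', rfl⟩ := inr_mem_joinMap_image.1 hp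
    exact hs p' hp'
  refine ⟨g'.pull j' _ fun _ _ _ => trivial, fun k x _ hx => ?_⟩
  have hx' : Set.range (j'.comp x) ∈ exCx (Fin (n + 1)) (Subtype.val ⁻¹' U) :=
    range_comp_mem' j' x (hjW _ hx)
  have hx'' : Set.range (j'.comp x) ∈ mkCx (fun s => (∀ p, Sum.inrₗ p ∈ s → p.1 ∈ V) ∧
      ((∀ p, Sum.inrₗ p ∈ s → p.1 ∈ U) ∨ ¬ HasAll s)) fun _ _ h hs => ⟨fun p hp => hs.1 p (h hp),
        hs.2.imp (fun h₁ p hp => h₁ p (h hp)) fun h₁ h₂ => h₁ (h₂.mono h)⟩ :=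
    ⟨fun p hp => hjr p (Set.range_comp_subset_range x j hp), hx'⟩
  exact (hg' _ _ hx').trans ((hg _ _ (Or.inl hx'')).trans ((glue_agree_left p₁ p₂ h₁₂ _ _ hx'').trans
    (push_app j f _ _ x hx'' hx)))

/-- The levels of the cylinder `R × {0, 1}` below `P`. -/
def level (R P : Type) [PartialOrder R] [PartialOrder P] (i : Fin 2) : R ⊕ₗ P →o (R × Fin 2) ⊕ₗ P :=
  joinMap ⟨fun r => (r, i), fun _ _ h => ⟨h, le_rfl⟩⟩ OrderHom.id

/-- The projection of the cylinder. -/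
def cylProj (R P : Type) [PartialOrder R] [PartialOrder P] : (R × Fin 2) ⊕ₗ P →o R ⊕ₗ P :=
  joinMap OrderHom.fst OrderHom.id

lemma inr_mem_cylProj {s : Set ((R × Fin 2) ⊕ₗ P)} {p : P} :
    Sum.inrₗ p ∈ cylProj R P '' s ↔ Sum.inrₗ p ∈ s :=
  inr_mem_joinMap_image.trans ⟨fun ⟨_, h, e⟩ => e ▸ h, fun h => ⟨p, h, rfl⟩⟩

lemma inl_mem_cylProj {s : Set ((R × Fin 2) ⊕ₗ P)} {r : R} :
    Sum.inlₗ r ∈ cylProj R P '' s ↔ ∃ i, Sum.inlₗ (r, i) ∈ s := by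
  refine ⟨?_, fun ⟨i, h⟩ => ⟨_, h, rfl⟩⟩
  rintro ⟨q, hq, e⟩
  rcases lex_cases q with ⟨x, rfl⟩ | ⟨p, rfl⟩
  · exact ⟨x.2, inlₗ_inj.1 e ▸ hq⟩
  · exact absurd e inr_ne_inl

/-- If the limits over `V` and over `W` are the limit over `U`, then the limit over `W` is the
limit over `V`. -/
lemma Exact.of_trans_left [SSet.Quasicategory E] (hUV : U ⊆ V) (hVW : V ⊆ W) (h₁ : D.Exact U V)
    (h₂ : D.Exact U W) : D.Exact V W := by
  intro n f hf
  -- The filler `g'` agrees with `f` over `U` and on ∂Δⁿ ⋆ W, but over `V` only up to homotopy. The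
  -- correction is made on the join of the cylinder Δⁿ × Δ¹ with `W`, with `f` on level 0 and `g'`
  -- on level 1.
  obtain ⟨g', hg'⟩ := h₂ n (f.res _ fun s hs _ => hs.imp_left fun h p hp => hUV (h p hp))
    fun _ x _ => hf x _
  let π := cylProj (Fin (n + 1)) ↥W
  let p₁ : PMap (mkCx (fun s : Set ((Fin (n + 1) × Fin 2) ⊕ₗ ↥W) => ∀ r, Sum.inlₗ (r, 0) ∉ s)
      fun _ _ h hs r hr => hs r (h hr)) E := g'.pull π _ fun _ _ _ => trivial
  let p₀ : PMap (mkCx (fun s : Set ((Fin (n + 1) × Fin 2) ⊕ₗ ↥W) =>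
      π '' s ∈ exCx (Fin (n + 1)) (Subtype.val ⁻¹' U) ∨
      (∀ r, Sum.inlₗ (r, 1) ∉ s) ∧ π '' s ∈ exCx (Fin (n + 1)) (Subtype.val ⁻¹' V))
      fun _ _ h hs => hs.imp (fun hs => LowerSet.lower _ (Set.image_mono h) hs)
        fun hs => ⟨fun r hr => hs.1 r (h hr), LowerSet.lower _ (Set.image_mono h) hs.2⟩) E :=
    f.pull π _ fun s hs _ => hs.elim (fun h => h.imp_left fun h p hp => hUV (h p hp)) And.right
  have h₀₁ : p₀.Agree p₁ := by
    intro k x hx hx'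
    refine (hg' _ trivial ?_).symm
    rw [show Set.range (π.comp x) = π '' Set.range x from Set.range_comp π x]
    refine hx.elim id fun hx => Or.inr fun h => ?_
    obtain ⟨i, hi⟩ := inl_mem_cylProj.1 (h 0)
    fin_cases i
    exacts [hx' 0 hi, hx.1 0 hi]
  let ι := (inclEmb hVW).trans (inrEmb (Fin (n + 1) × Fin 2) ↥W)
  have hπι : ∀ s : Set ↥V, π '' (ι '' s) ∈ exCx (Fin (n + 1)) (Subtype.val ⁻¹' U) := by
    refine fun s => Or.inr fun h => ?_
    obtain ⟨i, _, -, h⟩ := inl_mem_cylProj.1 (h 0)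
    exact inr_ne_inl h
  have hιO : p₀.Over ι (D.sub V) := fun k x hx => hf ((inclEmb hVW : ↥V →o ↥W).comp x) _
  -- Over `U` and over ∂Δⁿ the cylinder is constant. Exactness of `U` in `V` provides the homotopy
  -- over `V` between `f` and `g'`.
  obtain ⟨g₁, hg₁⟩ := IsExact.exists_extension h₁ (glue p₀ p₁ h₀₁) ι
    (B := mkCx (fun s => (∀ p, Sum.inrₗ p ∈ s → p.1 ∈ V) ∨ ¬ HasAll (π '' s) ∨
      ∀ r, Sum.inlₗ (r, 0) ∉ s) fun s t h hs => hs.imp (fun hs p hp => hs p (h hp)) fun hs => hs.imp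
        (fun hs h' => hs (h'.mono (Set.image_mono h))) fun hs r hr => hs r (h hr))
    (hιO.of_agree (glue_agree_left _ _ _) fun s _ => Or.inl (hπι s)) (by
      intro s hs hsA hc
      have ha : HasAll (π '' s) := by_contra fun h => hsA (Or.inl (Or.inl (Or.inr h)))
      have h0 : ¬ ∀ r, Sum.inlₗ (r, 0) ∉ s := fun h => hsA (Or.inr h)
      have hV : ∀ p, Sum.inrₗ p ∈ s → p.1 ∈ V := hs.resolve_right (by
        rintro (h | h)
        exacts [h ha, h0 h])
      have h1 : ¬ ∀ r, Sum.inlₗ (r, 1) ∉ s := fun h => hsA (Or.inl (Or.inr ⟨h, Or.inl fun p hp =>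
        hV p (inr_mem_cylProj.1 hp)⟩))
      have hl : ∀ q ∈ s \ Set.range ι, ∃ r, q = Sum.inlₗ r := by
        rintro q ⟨hq, hqι⟩
        rcases lex_cases q with ⟨r, rfl⟩ | ⟨p, rfl⟩
        exacts [⟨r, rfl⟩, absurd ⟨⟨p.1, hV p hq⟩, rfl⟩ hqι]
      have hm : ∀ r, Sum.inlₗ r ∈ s → Sum.inlₗ r ∈ s \ Set.range ι :=
        fun r hr => ⟨hr, fun ⟨_, h⟩ => inr_ne_inl h⟩
      obtain ⟨r₀, h0⟩ := not_forall_not.1 h0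
      obtain ⟨r₁, h1⟩ := not_forall_not.1 h1
      refine ⟨⟨_, hm _ h0⟩, fun q hq p => ?_, fun μ hμ => ?_⟩
      · obtain ⟨r, rfl⟩ := hl q hq
        exact Sum.Lex.inl_le_inr _ _
      · have hp : ∀ p, Sum.inrₗ p ∈ (s \ Set.range ι) ∪ ι '' μ → ∃ v ∈ μ, v.1 = p.1 := by
          rintro p (hp | ⟨v, hv, e⟩)
          · obtain ⟨r, h⟩ := hl _ hp
            exact absurd h inr_ne_inl
          · exact ⟨v, hv, congrArg Subtype.val (inrₗ_inj.1 e)⟩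
        have ha' : HasAll (π '' ((s \ Set.range ι) ∪ ι '' μ)) := by
          intro r
          obtain ⟨i, hi⟩ := inl_mem_cylProj.1 (ha r)
          exact inl_mem_cylProj.2 ⟨i, Or.inl (hm _ hi)⟩
        refine ⟨Or.inl fun p h => ?_, ?_, fun h => Or.inl (Or.inl (Or.inl fun p hp' => ?_))⟩
        · obtain ⟨v, -, e⟩ := hp p h
          exact (e ▸ v.2 : p.1 ∈ V)
        · rintro (((h | h) | ⟨h, -⟩) | h)
          · exact fun v hv => h ⟨v.1, hVW v.2⟩ (inr_mem_cylProj.2 (Or.inr ⟨v, hv, rfl⟩))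
          · exact absurd ha' h
          · exact absurd (Or.inl (hm _ h1)) (h r₁)
          · exact absurd (Or.inl (hm _ h0)) (h r₀)
        · obtain ⟨v, hv, e⟩ := hp p (inr_mem_cylProj.1 hp')
          exact (e ▸ h hv : p.1 ∈ U))
  -- The homotopy is composed with `g'`: after the last element `(m, 0)` of level 0 the element `(m,
  -- 1)` is inserted. This is an inner pivot, because a missing chain continues with an element of
  -- `W` outside `V`. Level 0 of the result is the filler.
  obtain ⟨g₂, hg₂⟩ := exists_extension_marker (B := ⊤) g₁ {q | ∃ r, q = Sum.inlₗ (r, 0)} IsGreatest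
    isGreatest_unique (fun q => toLex (Sum.map (fun x => (x.1, 1)) id (ofLex q))) (by
      intro s _ hs hc
      have ha : HasAll (π '' s) := by_contra fun h => hs (Or.inr (Or.inl h))
      have hV : ¬ ∀ p, Sum.inrₗ p ∈ s → p.1 ∈ V := fun h => hs (Or.inl h)
      have h0 : ¬ ∀ r, Sum.inlₗ (r, 0) ∉ s := fun h => hs (Or.inr (Or.inr h))
      obtain ⟨r₀, h0⟩ := not_forall_not.1 h0
      push Not at hV
      obtain ⟨p, hp, hpV⟩ := hV
      obtain ⟨_, ⟨hms, m, rfl⟩, hm⟩ := (hc.mono Set.inter_subset_left).exists_isGreatest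
        ⟨_, h0, r₀, rfl⟩ (s := s ∩ {q | ∃ r, q = Sum.inlₗ (r, 0)})
      have hne : (Sum.inlₗ (m, 1) : (Fin (n + 1) × Fin 2) ⊕ₗ ↥W) ∉
          {q | ∃ r, q = Sum.inlₗ (r, 0)} := by
        rintro ⟨r, h⟩
        exact absurd (congrArg Prod.snd (inlₗ_inj.1 h)) (by simp)
      have hlt : (Sum.inlₗ (m, 0) : (Fin (n + 1) × Fin 2) ⊕ₗ ↥W) < Sum.inlₗ (m, 1) :=
        Sum.Lex.inl_lt_inl_iff.2 (Prod.mk_lt_mk.2 (Or.inr ⟨le_rfl, by decide⟩))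
      refine ⟨_, ⟨⟨hms, m, rfl⟩, hm⟩, hne, trivial, fun q hq => ?_, ?_, fun _ => Or.inl
        ⟨_, hms, _, hp, hlt, Sum.Lex.inl_lt_inr _ _⟩⟩
      · rcases lex_cases q with ⟨⟨r, i⟩, rfl⟩ | ⟨p, rfl⟩
        · fin_cases i
          · exact Or.inl ((hm ⟨hq, r, rfl⟩).trans hlt.le)
          · right
            rcases hc.total hms hq with h | h
            · have h' := Sum.Lex.inl_le_inl_iff.1 h
              exact Sum.Lex.inl_le_inl_iff.2 (Prod.mk_le_mk.2 ⟨h'.1, le_rfl⟩)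
            · have h' := (Sum.Lex.inl_le_inl_iff.1 h).2
              exact absurd h' (by simp)
        · exact Or.inr (Sum.Lex.inl_le_inr _ _)
      · rintro (h | h | h)
        · exact hpV (h p ⟨hp, inr_ne_inl⟩)
        · refine h fun r => ?_
          obtain ⟨i, hi⟩ := inl_mem_cylProj.1 (ha r)
          by_cases hr : Sum.inlₗ (r, i) = (Sum.inlₗ (m, 1) : (Fin (n + 1) × Fin 2) ⊕ₗ ↥W)
          · obtain ⟨rfl, rfl⟩ := Prod.mk.injEq .. ▸ inlₗ_inj.1 hr
            exact inl_mem_cylProj.2 ⟨0, hms, hlt.ne⟩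
          · exact inl_mem_cylProj.2 ⟨i, hi, hr⟩
        · exact h m ⟨hms, hlt.ne⟩)
  refine ⟨g₂.pull (level (Fin (n + 1)) ↥W 0) _ fun _ _ _ => trivial, fun k x _ hx => ?_⟩
  have e : π.comp ((level (Fin (n + 1)) ↥W 0).comp x) = x := by
    ext i
    change π (level _ _ 0 (x i)) = x i
    rcases lex_cases (x i) with ⟨r, e⟩ | ⟨p, e⟩ <;> rw [e] <;> rfl
  have h₀ : Set.range ((level (Fin (n + 1)) ↥W 0).comp x) ∈
      mkCx (fun s : Set ((Fin (n + 1) × Fin 2) ⊕ₗ ↥W) =>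
      π '' s ∈ exCx (Fin (n + 1)) (Subtype.val ⁻¹' U) ∨
      (∀ r, Sum.inlₗ (r, 1) ∉ s) ∧ π '' s ∈ exCx (Fin (n + 1)) (Subtype.val ⁻¹' V))
      fun _ _ h hs => hs.imp (fun hs => LowerSet.lower _ (Set.image_mono h) hs)
        fun hs => ⟨fun r hr => hs.1 r (h hr), LowerSet.lower _ (Set.image_mono h) hs.2⟩ := by
    refine Or.inr ⟨?_, ?_⟩
    · rintro r ⟨i, hi⟩
      change level _ _ 0 (x i) = _ at hi
      rcases lex_cases (x i) with ⟨r', e⟩ | ⟨p, e⟩ <;> rw [e] at hi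
      · exact absurd (show (0 : Fin 2) = 1 from congrArg Prod.snd (inlₗ_inj.1 hi)) (by decide)
      · exact inr_ne_inl hi
    · rw [← Set.range_comp]
      exact (congrArg (fun y : Fin (k + 1) →o _ => Set.range y) e).symm ▸ hx
  have h₁ : Set.range ((level (Fin (n + 1)) ↥W 0).comp x) ∈ mkCx (fun s => (∀ p, Sum.inrₗ p ∈ s →
      p.1 ∈ V) ∨ ¬ HasAll (π '' s) ∨ ∀ r, Sum.inlₗ (r, 0) ∉ s) fun s t h hs =>
      hs.imp (fun hs p hp => hs p (h hp)) fun hs => hs.imp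
        (fun hs h' => hs (h'.mono (Set.image_mono h))) fun hs r hr => hs r (h hr) := by
    rcases h₀ with h | ⟨-, h⟩
    · exact h.imp (fun h p hp => hUV (h p (inr_mem_cylProj.2 hp))) Or.inl
    · exact h.imp (fun h p hp => h p (inr_mem_cylProj.2 hp)) Or.inl
  exact (hg₂ _ trivial h₁).trans ((hg₁ _ h₁ (Or.inl h₀)).trans
    ((glue_agree_left p₀ p₁ h₀₁ _ _ h₀).trans (f.app_congr e _ _)))

/-- If the elements of `U` below each further element have a greatest element, then the limit over
`V` is the limit over `U`. -/
lemma Exact.of_isGreatest [SSet.Quasicategory E] (h : ∀ v ∈ V, v ∉ U → ∃ u, u ∈ V ∧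
    IsGreatest (U ∩ Set.Iic v) u) : D.Exact U V := by
  classical
  intro n f hf
  choose! u huV hu using h
  -- The function `u` is a coreflection of `V` onto `U`. For the least `m` of a chain outside `U`,
  -- elements of `U` in the chain are either below `u m` or above `m`, so `u m` can be inserted; all
  -- of Δⁿ lies below it, hence the horn is inner.
  obtain ⟨g, hg⟩ := exists_extension_marker (B := ⊤) f {q | ∃ p : ↥V, p.1 ∉ U ∧ q = Sum.inrₗ p}
    IsLeast isLeast_unique (fun q => toLex (Sum.map id (fun p : ↥V => if hp : p.1 ∈ U then p else
      ⟨u p.1, huV p.1 p.2 hp⟩) (ofLex q))) (by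
      intro s _ hs hc
      have ha : HasAll s := by_contra fun h => hs (Or.inr h)
      have hU : ¬ ∀ p, Sum.inrₗ p ∈ s → p ∈ Subtype.val ⁻¹' U := fun h => hs (Or.inl h)
      push Not at hU
      obtain ⟨p, hp, hpU⟩ := hU
      obtain ⟨_, ⟨hms, m, hmU, rfl⟩, hm⟩ := (hc.mono Set.inter_subset_left).exists_isLeast
        ⟨_, hp, p, hpU, rfl⟩ (s := s ∩ {q | ∃ p : ↥V, p.1 ∉ U ∧ q = Sum.inrₗ p})
      have hκ : (toLex (Sum.map id (fun p : ↥V => if hp : p.1 ∈ U then p else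
          ⟨u p.1, huV p.1 p.2 hp⟩) (ofLex (Sum.inrₗ m))) : Fin (n + 1) ⊕ₗ ↥V) =
          Sum.inrₗ ⟨u m.1, huV m.1 m.2 hmU⟩ := congrArg Sum.inrₗ (dif_neg hmU)
      have hum := hu m.1 m.2 hmU
      have hlt : (Sum.inrₗ ⟨u m.1, huV m.1 m.2 hmU⟩ : Fin (n + 1) ⊕ₗ ↥V) < Sum.inrₗ m :=
        Sum.Lex.inr_lt_inr_iff.2 (lt_of_le_of_ne hum.1.2 fun e => hmU (by
          rw [← congrArg Subtype.val e]
          exact hum.1.1))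
      refine ⟨_, ⟨⟨hms, m, hmU, rfl⟩, hm⟩, ?_⟩
      rw [hκ]
      refine ⟨?_, trivial, fun q hq => ?_, ?_, fun _ => Or.inl ⟨_, ha 0, _, hms,
        Sum.Lex.inl_lt_inr _ _, hlt⟩⟩
      · rintro ⟨r, hr, e⟩
        exact hr (inrₗ_inj.1 e ▸ hum.1.1)
      · rcases lex_cases q with ⟨r, rfl⟩ | ⟨p, rfl⟩
        · exact Or.inl (Sum.Lex.inl_le_inr _ _)
        · by_cases hpU : p.1 ∈ U
          · rcases hc.total hq hms with h | h
            · exact Or.inl (Sum.Lex.inr_le_inr_iff.2 (hum.2 ⟨hpU, show p ≤ m from Sum.Lex.inr_le_inr_iff.1 h⟩))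
            · exact Or.inr (hlt.le.trans h)
          · exact Or.inr (hlt.le.trans (hm ⟨hq, p, hpU, rfl⟩))
      · rintro (h | h)
        · exact hmU (h m ⟨hms, hlt.ne'⟩)
        · exact h fun r => ⟨ha r, fun e => inr_ne_inl e.symm⟩)
  exact ⟨g, hg⟩

/-- Adding one element to `U`, if the limit over the elements of `U` above it is its value. -/
lemma Exact.of_insert {v : P} (h : D.Exact (U ∩ Set.Ioi v) (insert v (U ∩ Set.Ioi v))) :
    D.Exact U (insert v U) := by
  intro n f hf
  have hsub : insert v (U ∩ Set.Ioi v) ⊆ insert v U := Set.insert_subset_insert Set.inter_subset_left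
  by_cases hvU : v ∈ U
  · refine ⟨f.res ⊤ fun s _ _ => Or.inl fun p _ => ?_, fun _ _ _ _ => rfl⟩
    exact p.2.elim (fun e => by rw [Set.mem_preimage, e]; exact hvU) id
  -- A missing chain contains `v`. Its elements in the poset that are `v` or above `v` belong to the
  -- image of `ι`, and everything else in it lies below `v`, hence below the whole image.
  let ι := (inclEmb hsub).trans (inrEmb (Fin (n + 1)) ↥(insert v U))
  have hι : ∀ p, Sum.inrₗ p ∈ Set.range ι ↔ p.1 = v ∨ p.1 ∈ U ∧ v < p.1 := by
    refine fun p => ⟨?_, fun h => ⟨⟨p.1, h⟩, rfl⟩⟩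
    rintro ⟨p', e⟩
    rw [← inrₗ_inj.1 e]
    exact p'.2
  refine IsExact.exists_extension h f ι (hf.incl hsub) ?_
  intro s _ hsA hc
  have ha : HasAll s := by_contra fun h => hsA (Or.inr h)
  have hv : Sum.inrₗ ⟨v, Or.inl rfl⟩ ∈ s := by
    by_contra hv
    refine hsA (Or.inl fun p hp => p.2.resolve_left fun e => hv ?_)
    rwa [show (⟨v, Or.inl rfl⟩ : ↥(insert v U)) = p from Subtype.ext e.symm]
  have hl : ∀ q ∈ s \ Set.range ι, q ≤ Sum.inrₗ ⟨v, Or.inl rfl⟩ := by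
    rintro q ⟨hq, hqι⟩
    rcases lex_cases q with ⟨r, rfl⟩ | ⟨p, rfl⟩
    · exact Sum.Lex.inl_le_inr _ _
    · refine (hc.total hq hv).resolve_right fun h => hqι ((hι p).2 ?_)
      have h' : (⟨v, Or.inl rfl⟩ : ↥(insert v U)) ≤ p := Sum.Lex.inr_le_inr_iff.1 h
      refine p.2.imp id fun hU => ⟨hU, lt_of_le_of_ne h' fun e => hvU ?_⟩
      exact e ▸ hU
  refine ⟨⟨Sum.inlₗ 0, ha 0, fun ⟨_, h⟩ => inr_ne_inl h⟩, fun q hq p => (hl q hq).trans ?_,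
    fun μ hμ => ⟨trivial, ?_, fun h => Or.inl fun p hp => ?_⟩⟩
  · refine Sum.Lex.inr_le_inr_iff.2 ?_
    exact p.2.elim (fun e => e.symm.le) fun h => h.2.le
  · rintro (h | h) p hp
    · have h' := h (inclEmb hsub p) (Or.inr ⟨p, hp, rfl⟩)
      exact ⟨h', p.2.elim (fun e => absurd (e ▸ h') hvU) And.right⟩
    · exact absurd (fun r => Or.inl ⟨ha r, fun ⟨_, h⟩ => inr_ne_inl h⟩) h
  · rcases hp with ⟨-, hp⟩ | ⟨p', hp', e⟩
    · refine p.2.resolve_left fun e => hp ((hι p).2 (Or.inl e))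
    · rw [← inrₗ_inj.1 e]
      exact (h hp').1

/-- If the value at each further element is the limit over the elements of `U` above it, then the
limit over `V` is the limit over `U`. -/
lemma Exact.of_forall_exact (hUV : U ⊆ V)
    (h : ∀ v ∈ V, v ∉ U → D.Exact (U ∩ Set.Ioi v) (insert v (U ∩ Set.Ioi v))) : D.Exact U V := by
  obtain ⟨N, hN⟩ : ∃ N, (V \ U).ncard = N := ⟨_, rfl⟩
  induction N generalizing V with
  | zero =>
    rw [Set.ncard_eq_zero, Set.sdiff_eq_empty] at hN
    intro n f hf
    exact ⟨f.res ⊤ fun s _ _ => Or.inl fun p _ => hN p.2, fun _ _ _ _ => rfl⟩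
  | succ N ih =>
    -- A maximal element of `V \ U` is added last: every element of `V` above it lies in `U`, so the
    -- hypothesis on `v` is about the right set.
    obtain ⟨v, hv⟩ := (V \ U).toFinite.exists_maximal (Set.nonempty_of_ncard_ne_zero (by omega))
    have hsub : U ⊆ V \ {v} := fun p hp => ⟨hUV hp, fun e => hv.1.2 ((e : p = v) ▸ hp)⟩
    have e : V = insert v (V \ {v}) := (Set.insert_sdiff_self_of_mem hv.1.1).symm
    refine Exact.trans hsub Set.sdiff_subset (ih hsub (fun w hw => h w hw.1) ?_) ?_
    · have h₁ := Set.ncard_sdiff_singleton_add_one hv.1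
      rw [show (V \ {v}) \ U = (V \ U) \ {v} from Set.sdiff_sdiff_comm]
      omega
    · have h' : (V \ {v}) ∩ Set.Ioi v = U ∩ Set.Ioi v := by
        ext p
        refine ⟨fun ⟨hp, hvp⟩ => ⟨by_contra fun hpU => ?_, hvp⟩, fun ⟨hp, hvp⟩ => ⟨hsub hp, hvp⟩⟩
        exact hp.2 (le_antisymm (hv.2 ⟨hp.1, hpU⟩ (le_of_lt hvp)) (le_of_lt hvp))
      have := Exact.of_insert (D := D) (U := V \ {v}) (v := v) (by
        rw [h']
        exact h v hv.1.1 hv.1.2)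
      rwa [← e] at this

/-- The limit over a degenerate edge is the value at its second vertex. -/
lemma Exact.of_degen [SSet.Quasicategory E] {a b : P} (hab : a < b) (hD : D.Degen a b) :
    D.Exact {b} {a, b} := by
  intro n f hf
  have hA : ({Sum.inrₗ ⟨a, Or.inl rfl⟩, Sum.inrₗ ⟨b, Or.inr rfl⟩} :
      Set (Fin (n + 1) ⊕ₗ ↥({a, b} : Set P))) ∈ exCx (Fin (n + 1)) (Subtype.val ⁻¹' {b}) :=
    Or.inr fun h => (h 0).elim (fun h => inr_ne_inl h.symm) fun h => inr_ne_inl (Set.mem_singleton_iff.1 h).symm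
  have hdeg : f.Degen (Sum.inrₗ ⟨a, Or.inl rfl⟩) (Sum.inrₗ ⟨b, Or.inr rfl⟩) := by
    have hx : ∀ {k : ℕ} (x : Fin (k + 1) →o Fin (n + 1) ⊕ₗ ↥({a, b} : Set P)),
        (∀ i, x i = Sum.inrₗ ⟨a, Or.inl rfl⟩ ∨ x i = Sum.inrₗ ⟨b, Or.inr rfl⟩) →
        ∃ y : Fin (k + 1) →o ↥({a, b} : Set P), (∀ i, (y i).1 = a ∨ (y i).1 = b) ∧
          x = (inrEmb (Fin (n + 1)) ↥({a, b} : Set P) : ↥({a, b} : Set P) →o Fin (n + 1) ⊕ₗ ↥({a, b} : Set P)).comp y := by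
      intro k x hx
      have hsub : Set.range x ⊆ Set.range (inrEmb (Fin (n + 1)) ↥({a, b} : Set P)) := by
        rintro _ ⟨i, rfl⟩
        rcases hx i with h | h <;> rw [h]
        exacts [⟨_, rfl⟩, ⟨_, rfl⟩]
      exact ⟨lift (inrEmb _ _) x hsub, fun i => (lift (inrEmb _ _) x hsub i).2, (comp_lift _ _ _).symm⟩
    intro k x y hx' hy' hxi hyi
    obtain ⟨x', hx₁, rfl⟩ := hx x hxi
    obtain ⟨y', hy₁, rfl⟩ := hx y hyi
    exact (hf x' hx').trans ((hD _ _ _ _ hx₁ hy₁).trans (hf y' hy').symm)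
  have hlt : (Sum.inrₗ ⟨a, Or.inl rfl⟩ : Fin (n + 1) ⊕ₗ ↥({a, b} : Set P)) <
      Sum.inrₗ ⟨b, Or.inr rfl⟩ := Sum.Lex.inr_lt_inr_iff.2 hab
  have hcase : ∀ q : Fin (n + 1) ⊕ₗ ↥({a, b} : Set P), (∃ r, q = Sum.inlₗ r) ∨
      q = Sum.inrₗ ⟨a, Or.inl rfl⟩ ∨ q = Sum.inrₗ ⟨b, Or.inr rfl⟩ := by
    intro q
    rcases lex_cases q with ⟨r, rfl⟩ | ⟨⟨p, rfl | rfl⟩, rfl⟩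
    exacts [Or.inl ⟨r, rfl⟩, Or.inr (Or.inl rfl), Or.inr (Or.inr rfl)]
  -- The pivot `b` comes after all elements of a chain that does not contain it. The horn is
  -- therefore outer, with last edge a → b, which is degenerate.
  refine exists_extension_marker (B := ⊤) f {Sum.inrₗ ⟨a, Or.inl rfl⟩} IsLeast isLeast_unique
    (fun _ => Sum.inrₗ ⟨b, Or.inr rfl⟩) ?_
  intro s _ hs hc
  have ha : HasAll s := by_contra fun h => hs (Or.inr h)
  have has : Sum.inrₗ ⟨a, Or.inl rfl⟩ ∈ s := by
    by_contra h
    refine hs (Or.inl fun p hp => p.2.resolve_left fun e => h ?_)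
    rwa [show (⟨a, Or.inl rfl⟩ : ↥({a, b} : Set P)) = p from Subtype.ext e.symm]
  refine ⟨_, ⟨⟨has, rfl⟩, fun q hq => le_of_eq (Set.mem_singleton_iff.1 hq.2).symm⟩, fun h =>
    hlt.ne' h, trivial, fun q _ => Or.inl ?_, ?_, fun hb => Or.inr (Or.inl ⟨_, has, hlt, fun q hq => ?_,
      ⟨_, ha 0, fun e => inr_ne_inl e.symm⟩, hA, hdeg⟩)⟩
  · rcases hcase q with ⟨r, rfl⟩ | rfl | rfl
    exacts [Sum.Lex.inl_le_inr _ _, hlt.le, le_rfl]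
  · rintro (h | h)
    · exact hab.ne (h ⟨a, Or.inl rfl⟩ ⟨has, hlt.ne⟩)
    · exact h fun r => ⟨ha r, fun e => inr_ne_inl e.symm⟩
  · rcases hcase q with ⟨r, rfl⟩ | rfl | rfl
    exacts [Sum.Lex.inl_le_inr _ _, le_rfl, absurd hq hb]

end PMap

end Exactness

/-! ### The cylinder between fat and thin cones -/

section Cylinder

variable {R P : Type} [PartialOrder R] [OrderTop R] [PartialOrder P] [OrderBot P] {E : SSet.{u}}

/-- The vertices `(r, 0, ⊥)` of the thin apex, `(r, 1, a)` and `(r, 2, a)` of the fat cone and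
`(⊤, 3, a)` of the base. -/
def IsVertex (q : R × Fin 4 × P) : Prop :=
  (q.2.1 = 0 ↔ q.2.2 = ⊥) ∧ (q.2.1 = 3 → q.1 = ⊤)

/-- The elements of `R` that occur in a chain outside the base. -/
def supp (s : Set (R × Fin 4 × P)) : Set R := {r | ∃ q ∈ s, q.1 = r ∧ q.2.1 ≠ 3}

omit [PartialOrder R] [OrderTop R] [PartialOrder P] [OrderBot P] in
lemma supp_mono {s t : Set (R × Fin 4 × P)} (h : s ⊆ t) : supp s ⊆ supp t :=
  fun _ ⟨q, hq, h'⟩ => ⟨q, h hq, h'⟩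

/-- The chains of the cylinder with support in `S'` that have their support in `S` or whose kinds
belong to a member of `𝒦`. -/
def cylCx (P : Type) [PartialOrder P] [OrderBot P] (S S' : LowerSet (Set R)) (𝒦 : Set (Set (Fin 4))) :
    LowerSet (Set (R × Fin 4 × P)) :=
  mkCx (fun s => (∀ q ∈ s, IsVertex q) ∧ supp s ∈ S' ∧
    (supp s ∈ S ∨ ∃ K ∈ 𝒦, ∀ q ∈ s, q.2.1 ∈ K)) fun _ _ h hs =>
    ⟨fun q hq => hs.1 q (h hq), S'.lower (supp_mono h) hs.2.1, hs.2.2.imp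
      (fun hs => S.lower (supp_mono h) hs) fun ⟨K, hK, hs⟩ => ⟨K, hK, fun q hq => hs q (h hq)⟩⟩

/-- The chains of the fat cone, of the apex and of the base. -/
def fatKinds : Set (Set (Fin 4)) := {{1, 2}, {0, 1}, {2, 3}}

/-- The chains of the thin cone, of the apex and of the base. -/
def thinKinds : Set (Set (Fin 4)) := {{0, 3}, {0, 1}, {2, 3}}

open Classical in
/-- The projection of the cylinder to the thin cone. -/
noncomputable def collapse (R P : Type) [PartialOrder R] [OrderTop R] [PartialOrder P] [OrderBot P] :
    R × Fin 4 × P →o R × Fin 4 × P where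
  toFun q := if q.2.1 ≤ 1 then (q.1, 0, ⊥) else (⊤, 3, q.2.2)
  monotone' q q' h := by
    have h₁ : q.2.1 ≤ q'.2.1 := h.2.1
    dsimp only
    split_ifs with h₂ h₃ h₃
    · exact ⟨h.1, le_rfl, le_rfl⟩
    · exact ⟨le_top, by simp, bot_le⟩
    · exact absurd (h₁.trans h₃) h₂
    · exact ⟨le_rfl, le_rfl, h.2.2⟩

lemma collapse_low {q : R × Fin 4 × P} (h : q.2.1 ≤ 1) : collapse R P q = (q.1, 0, ⊥) := if_pos h

lemma collapse_high {q : R × Fin 4 × P} (h : 2 ≤ q.2.1) : collapse R P q = (⊤, 3, q.2.2) :=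
  if_neg fun h' => absurd (h.trans h') (by decide)

namespace PMap

/-- The diagram is constant in the direction of the cone on the apex and in the direction of `R` on
the base. -/
def IsCone {A : LowerSet (Set (R × Fin 4 × P))} (f : PMap A E) : Prop :=
  ∀ ⦃k : ℕ⦄ (x : Fin (k + 1) →o R × Fin 4 × P) (hx : Set.range x ∈ A)
    (hx' : Set.range ((collapse R P).comp x) ∈ A),
    ((∀ i, (x i).2.1 ≤ 1) ∨ ∀ i, 2 ≤ (x i).2.1) → f.app x hx = f.app ((collapse R P).comp x) hx'

variable [SSet.Quasicategory E] [Finite R] [Finite P] {S S' : LowerSet (Set R)}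

/-- The pivots are of the inner kinds 1 and 2, so inner horns suffice and the diagram need not be a
cone. No pivot changes the support of a chain; this allows the chains with support in `S` to be
prescribed in advance. -/
lemma exists_extension_fat (f : PMap (cylCx P S S' fatKinds) E) :
    ∃ g : PMap (cylCx P S S' {Set.univ}) E, g.Agree f := by
  -- The base first: after the last vertex `(r, 1, a)` of kind 1, and before a vertex of kind 3, the
  -- vertex `(r, 2, a)` is inserted.
  obtain ⟨g, hg⟩ := exists_extension_marker (B := cylCx P S S' {{1, 2, 3}, {0, 1}}) f
    {q | q.2.1 = 1} IsGreatest isGreatest_unique (fun q => (q.1, 2, q.2.2)) (by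
      intro s hs hsA hc
      have hS : supp s ∉ S := fun h => hsA ⟨hs.1, hs.2.1, Or.inl h⟩
      obtain ⟨K, rfl | rfl, hK⟩ := hs.2.2.resolve_left hS
      swap
      · exact absurd ⟨hs.1, hs.2.1, Or.inr ⟨_, by simp [fatKinds], hK⟩⟩ hsA
      have h1 : ∃ q ∈ s, q.2.1 = 1 := by
        by_contra! h
        refine hsA ⟨hs.1, hs.2.1, Or.inr ⟨{2, 3}, by simp [fatKinds], fun q hq => ?_⟩⟩
        exact (hK q hq).resolve_left (h q hq)
      have h3 : ∃ q ∈ s, q.2.1 = 3 := by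
        by_contra! h
        refine hsA ⟨hs.1, hs.2.1, Or.inr ⟨{1, 2}, by simp [fatKinds], fun q hq => ?_⟩⟩
        exact (hK q hq).imp id fun h' => h'.resolve_right (h q hq)
      obtain ⟨q₁, hq₁, hk₁⟩ := h1
      obtain ⟨⟨r, k, a⟩, ⟨hms, hk⟩, hm⟩ := (hc.mono Set.inter_subset_left).exists_isGreatest
        ⟨q₁, hq₁, hk₁⟩ (s := s ∩ {q | q.2.1 = 1})
      obtain rfl : k = 1 := hk
      obtain ⟨q₃, hq₃, hk₃⟩ := h3
      have hvalid := hs.1 _ hms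
      have ha : a ≠ ⊥ := fun h => absurd (hvalid.1.2 h) (by simp)
      have hsupp : supp (insert (r, 2, a) s) = supp s := by
        refine subset_antisymm ?_ (supp_mono (Set.subset_insert _ _))
        rintro _ ⟨q, rfl | hq, rfl, h⟩
        exacts [⟨_, hms, rfl, by simp⟩, ⟨q, hq, rfl, h⟩]
      have hsupp' : supp (s \ {(r, 2, a)}) = supp s := by
        refine subset_antisymm (supp_mono Set.sdiff_subset) ?_
        rintro _ ⟨q, hq, rfl, h⟩
        by_cases hqv : q = (r, 2, a)
        · exact ⟨_, ⟨hms, by simp⟩, hqv ▸ rfl, by simp⟩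
        · exact ⟨q, ⟨hq, hqv⟩, rfl, h⟩
      have hle : ∀ q ∈ s, 2 ≤ q.2.1 → (r, 2, a) ≤ q := fun q hq hk => by
        have := (hc.total hms hq).resolve_right fun h => absurd (show (2 : Fin 4) ≤ 1 from hk.trans h.2.1) (by decide)
        exact ⟨this.1, hk, this.2.2⟩
      refine ⟨(r, 1, a), ⟨⟨hms, rfl⟩, hm⟩, by simp, ⟨?_, hsupp ▸ hs.2.1, Or.inr
        ⟨{1, 2, 3}, by simp, ?_⟩⟩, ?_, ?_, fun _ => Or.inl ⟨_, hms, q₃, hq₃, ?_, ?_⟩⟩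
      · rintro q (rfl | hq)
        exacts [⟨iff_of_false (by simp) ha, by simp⟩, hs.1 q hq]
      · rintro q (rfl | hq)
        exacts [by simp, hK q hq]
      · intro q hq
        rcases hK q hq with h | h
        · exact Or.inl ((hm ⟨hq, h⟩).trans ⟨le_rfl, by simp, le_rfl⟩)
        · exact Or.inr (hle q hq (by rcases h with h | h <;> rw [h]; decide))
      · rintro ⟨-, -, h | ⟨K, hK, h⟩⟩
        · exact hS (hsupp' ▸ h)
        · have h₁ := h _ ⟨hms, by simp⟩
          have h₃ := h _ ⟨hq₃, by rintro rfl; simp at hk₃⟩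
          rw [hk₃] at h₃
          rcases hK with rfl | rfl | rfl <;> simp at h₁ h₃
      · exact lt_of_le_of_ne ⟨le_rfl, by simp, le_rfl⟩ (by simp)
      · exact lt_of_le_of_ne (hle q₃ hq₃ (by rw [hk₃]; decide)) (by rintro rfl; simp at hk₃))
  -- Then the apex: after the last vertex `(r, 0, ⊥)` the vertex `(r, 1, a)` is inserted, where `a`
  -- comes from the next vertex that is not of the form `(r, 1, ·)`. The vertices of that form are
  -- excluded from the second marker because the pivot is one of them.
  obtain ⟨g', hg'⟩ := exists_extension_comma (B := cylCx P S S' {Set.univ}) g {q | q.2.1 = 0}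
    (fun m => {q | q.2.1 ≠ 0 ∧ ¬ (q.2.1 = 1 ∧ q.1 = m.1)}) IsGreatest IsLeast isGreatest_unique
    isLeast_unique (fun m u => (m.1, 1, u.2.2)) (by
      intro s hs hsA hc
      have hS : supp s ∉ S := fun h => hsA ⟨hs.1, hs.2.1, Or.inl h⟩
      have h0 : ∃ q ∈ s, q.2.1 = 0 := by
        by_contra! h
        refine hsA ⟨hs.1, hs.2.1, Or.inr ⟨{1, 2, 3}, by simp, fun q hq => ?_⟩⟩
        have := h q hq
        generalize q.2.1 = k at this
        fin_cases k <;> simp_all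
      have h2 : ∃ q ∈ s, 2 ≤ q.2.1 := by
        by_contra! h
        refine hsA ⟨hs.1, hs.2.1, Or.inr ⟨{0, 1}, by simp, fun q hq => ?_⟩⟩
        have := h q hq
        generalize q.2.1 = k at this
        fin_cases k <;> simp_all
      obtain ⟨q₀, hq₀, hk₀⟩ := h0
      obtain ⟨q₂, hq₂, hk₂⟩ := h2
      obtain ⟨⟨r, k, b⟩, ⟨hms, hk⟩, hm⟩ := (hc.mono Set.inter_subset_left).exists_isGreatest
        ⟨q₀, hq₀, hk₀⟩ (s := s ∩ {q | q.2.1 = 0})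
      obtain rfl : k = 0 := hk
      obtain rfl : b = ⊥ := (hs.1 _ hms).1.1 rfl
      have hq₂' : q₂ ∈ s ∩ {q | q.2.1 ≠ 0 ∧ ¬ (q.2.1 = 1 ∧ q.1 = r)} := by
        refine ⟨hq₂, ?_, fun h => ?_⟩
        · intro h
          rw [h] at hk₂
          exact absurd hk₂ (by decide)
        · rw [h.1] at hk₂
          exact absurd hk₂ (by decide)
      obtain ⟨⟨r', l, a⟩, ⟨hus, hl0, hl1⟩, hu⟩ := (hc.mono Set.inter_subset_left).exists_isLeast
        ⟨q₂, hq₂'⟩ (s := s ∩ {q | q.2.1 ≠ 0 ∧ ¬ (q.2.1 = 1 ∧ q.1 = r)})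
      dsimp only at hl0 hl1
      have ha : a ≠ ⊥ := fun h => hl0 ((hs.1 _ hus).1.2 h)
      have hl : 1 ≤ l := by
        fin_cases l <;> simp_all
      have hmu : (r, 0, ⊥) ≤ (r', l, a) := (hc.total hms hus).resolve_right fun h =>
        hl0 (le_antisymm h.2.1 (Fin.zero_le _))
      have hvu : (r, 1, a) ≤ (r', l, a) := ⟨hmu.1, hl, le_rfl⟩
      have hsupp : supp (insert (r, 1, a) s) = supp s := by
        refine subset_antisymm ?_ (supp_mono (Set.subset_insert _ _))
        rintro _ ⟨q, rfl | hq, rfl, h⟩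
        exacts [⟨_, hms, rfl, by simp⟩, ⟨q, hq, rfl, h⟩]
      have hsupp' : supp (s \ {(r, 1, a)}) = supp s := by
        refine subset_antisymm (supp_mono Set.sdiff_subset) ?_
        rintro _ ⟨q, hq, rfl, h⟩
        by_cases hqv : q = (r, 1, a)
        · exact ⟨_, ⟨hms, by simp⟩, hqv ▸ rfl, by simp⟩
        · exact ⟨q, ⟨hq, hqv⟩, rfl, h⟩
      refine ⟨(r, 0, ⊥), (r', l, a), ⟨⟨hms, rfl⟩, hm⟩, ⟨⟨hus, hl0, hl1⟩, hu⟩, by simp, by simp,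
        ⟨?_, hsupp ▸ hs.2.1, Or.inr ⟨Set.univ, rfl, fun _ _ => trivial⟩⟩, ?_, ?_,
        fun _ => Or.inl ⟨_, hms, _, hus, ?_, ?_⟩⟩
      · rintro q (rfl | hq)
        exacts [⟨iff_of_false (by simp) ha, by simp⟩, hs.1 q hq]
      · intro q hq
        by_cases hk0 : q.2.1 = 0
        · exact Or.inl ((hm ⟨hq, hk0⟩).trans ⟨le_rfl, by simp, bot_le⟩)
        · by_cases hk1 : q.2.1 = 1 ∧ q.1 = r
          · rcases hc.total hq hus with h | h
            · exact Or.inl ⟨hk1.2.le, hk1.1.le, h.2.2⟩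
            · refine absurd ⟨le_antisymm (h.2.1.trans hk1.1.le) hl, ?_⟩ hl1
              exact le_antisymm (h.1.trans hk1.2.le) hmu.1
          · exact Or.inr (hvu.trans (hu ⟨hq, hk0, hk1⟩))
      · rintro ⟨-, -, h | ⟨K, hK, h⟩⟩
        · exact hS (hsupp' ▸ h)
        · have h₁ := h _ ⟨hms, by simp⟩
          have h₂ := h _ ⟨hq₂, by rintro rfl; exact absurd (show (2 : Fin 4) ≤ 1 from hk₂) (by decide)⟩
          generalize q₂.2.1 = k at hk₂ h₂
          rcases hK with rfl | rfl
          · simp at h₁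
          · fin_cases k <;> simp_all
      · exact lt_of_le_of_ne ⟨le_rfl, by simp, bot_le⟩ (by simp)
      · refine lt_of_le_of_ne hvu fun h => hl1 ⟨?_, ?_⟩
        · exact (congrArg (fun q => q.2.1) h).symm
        · exact (congrArg (fun q => q.1) h).symm)
  refine ⟨g', hg'.trans hg fun s hs => ⟨hs.1.1, hs.1.2.1, hs.2.2.2.imp_right fun ⟨K, hK, h⟩ => ?_⟩⟩
  rcases hK with rfl | rfl | rfl
  · exact ⟨{1, 2, 3}, by simp, fun q hq => (h q hq).imp id Or.inl⟩
  · exact ⟨{0, 1}, by simp, h⟩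
  · exact ⟨{1, 2, 3}, by simp, fun q hq => Or.inr (h q hq)⟩

/-- The edges that are collapsed in a cone are degenerate. -/
lemma IsCone.degen {A : LowerSet (Set (R × Fin 4 × P))} {f : PMap A E} (hf : f.IsCone)
    {q q' : R × Fin 4 × P} (hk : q.2.1 ≤ 1 ∧ q'.2.1 ≤ 1 ∨ 2 ≤ q.2.1 ∧ 2 ≤ q'.2.1)
    (h : collapse R P q = q') (h' : collapse R P q' = q') (hA : {q, q'} ∈ A) : f.Degen q q' := by
  have hq' : ({q'} : Set _) ∈ A := A.lower (by simp) hA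
  have key : ∀ {k : ℕ} (x : Fin (k + 1) →o R × Fin 4 × P) (hx : Set.range x ∈ A),
      (∀ i, x i = q ∨ x i = q') → f.app x hx = f.app (OrderHom.const _ q') (A.lower (by
        rintro _ ⟨i, rfl⟩
        rfl) hq') := by
    intro k x hx hxi
    have e : (collapse R P).comp x = OrderHom.const _ q' := by
      ext1
      funext i
      change collapse R P (x i) = q'
      rcases hxi i with e | e <;> rw [e] <;> assumption
    refine (hf x hx ?_ ?_).trans (f.app_congr e _ _)
    · rw [e]
      exact A.lower (by
        rintro _ ⟨i, rfl⟩
        rfl) hq'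
    · refine hk.imp (fun hk i => ?_) fun hk i => ?_
      all_goals
        rcases hxi i with e | e <;> rw [e]
        exacts [hk.1, hk.2]
  intro k x y hx hy hxi hyi
  rw [key x hx hxi, key y hy hyi]

/-- Here the pivots are of the outer kinds 0 and 3 and may become the first or last vertex of a
chain. The horn is then outer, and its end edge is one of those that a cone collapses, so it is
degenerate. -/
lemma exists_extension_thin (f : PMap (cylCx P S S' thinKinds) E) (hf : f.IsCone) :
    ∃ g : PMap (cylCx P S S' {Set.univ}) E, g.Agree f := by
  obtain ⟨g, hg⟩ := exists_extension_marker (B := cylCx P S S' {{0, 1, 3}, {2, 3}}) f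
    {q | q.2.1 = 1} IsLeast isLeast_unique (fun q => (q.1, 0, ⊥)) (by
      intro s hs hsA hc
      have hS : supp s ∉ S := fun h => hsA ⟨hs.1, hs.2.1, Or.inl h⟩
      obtain ⟨K, rfl | rfl, hK⟩ := hs.2.2.resolve_left hS
      swap
      · exact absurd ⟨hs.1, hs.2.1, Or.inr ⟨_, by simp [thinKinds], hK⟩⟩ hsA
      have h1 : ∃ q ∈ s, q.2.1 = 1 := by
        by_contra! h
        refine hsA ⟨hs.1, hs.2.1, Or.inr ⟨{0, 3}, by simp [thinKinds], fun q hq => ?_⟩⟩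
        exact (hK q hq).imp id fun h' => h'.resolve_left (h q hq)
      have h3 : ∃ q ∈ s, q.2.1 = 3 := by
        by_contra! h
        refine hsA ⟨hs.1, hs.2.1, Or.inr ⟨{0, 1}, by simp [thinKinds], fun q hq => ?_⟩⟩
        exact (hK q hq).imp id fun h' => h'.resolve_right (h q hq)
      obtain ⟨q₁, hq₁, hk₁⟩ := h1
      obtain ⟨⟨r, k, a⟩, ⟨hms, hk⟩, hm⟩ := (hc.mono Set.inter_subset_left).exists_isLeast
        ⟨q₁, hq₁, hk₁⟩ (s := s ∩ {q | q.2.1 = 1})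
      obtain rfl : k = 1 := hk
      obtain ⟨q₃, hq₃, hk₃⟩ := h3
      have hvalid := hs.1 _ hms
      have hsupp : supp (insert (r, 0, ⊥) s) = supp s := by
        refine subset_antisymm ?_ (supp_mono (Set.subset_insert _ _))
        rintro _ ⟨q, rfl | hq, rfl, h⟩
        exacts [⟨_, hms, rfl, by simp⟩, ⟨q, hq, rfl, h⟩]
      have hsupp' : supp (s \ {(r, 0, ⊥)}) = supp s := by
        refine subset_antisymm (supp_mono Set.sdiff_subset) ?_
        rintro _ ⟨q, hq, rfl, h⟩
        by_cases hqv : q = (r, 0, ⊥)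
        · exact ⟨_, ⟨hms, by simp⟩, hqv ▸ rfl, by simp⟩
        · exact ⟨q, ⟨hq, hqv⟩, rfl, h⟩
      have hvv : IsVertex ((r, 0, ⊥) : R × Fin 4 × P) := ⟨iff_of_true rfl rfl, by simp⟩
      have hlt : ((r, 0, ⊥) : R × Fin 4 × P) < (r, 1, a) :=
        lt_of_le_of_ne ⟨le_rfl, by simp, bot_le⟩ (by simp)
      have h0le : ∀ q ∈ s, q.2.1 = 0 → q ≤ (r, 0, ⊥) := fun q hq h => by
        have h' := (hc.total hq hms).resolve_right fun h' => absurd (h'.2.1.trans h.le) (by simp)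
        exact ⟨h'.1, h.le, ((hs.1 q hq).1.1 h).le⟩
      have hmle : ∀ q ∈ s, q.2.1 ≠ 0 → (r, 1, a) ≤ q := fun q hq h => by
        rcases (hK q hq).resolve_left h with h | h
        · exact hm ⟨hq, h⟩
        · refine (hc.total hms hq).resolve_right fun h' => absurd (h.symm.le.trans h'.2.1) ?_
          exact not_le.2 (show (1 : Fin 4) < 3 by decide)
      refine ⟨(r, 1, a), ⟨⟨hms, rfl⟩, hm⟩, by simp, ⟨?_, hsupp ▸ hs.2.1, Or.inr
        ⟨{0, 1, 3}, by simp, ?_⟩⟩, ?_, ?_, fun hvs => ?_⟩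
      · rintro q (rfl | hq)
        exacts [hvv, hs.1 q hq]
      · rintro q (rfl | hq)
        exacts [by simp, hK q hq]
      · intro q hq
        by_cases h : q.2.1 = 0
        · exact Or.inl (h0le q hq h)
        · exact Or.inr (hlt.le.trans (hmle q hq h))
      · rintro ⟨-, -, h | ⟨K, hK, h⟩⟩
        · exact hS (hsupp' ▸ h)
        · have h₁ := h _ ⟨hms, by simp⟩
          have h₃ := h _ ⟨hq₃, by rintro rfl; simp at hk₃⟩
          rw [hk₃] at h₃
          rcases hK with rfl | rfl | rfl <;> simp at h₁ h₃
      -- With another vertex of kind 0 in the chain the pivot `(r, 0, ⊥)` is inner. Without one it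
      -- is the first vertex, and the edge to `(r, 1, a)` is degenerate.
      · by_cases h0 : ∃ q ∈ s, q.2.1 = 0
        · obtain ⟨q, hq, h0⟩ := h0
          exact Or.inl ⟨q, hq, _, hms, lt_of_le_of_ne (h0le q hq h0) fun e => hvs (e ▸ hq), hlt⟩
        · push Not at h0
          have hA : ({(r, 1, a), (r, 0, ⊥)} : Set (R × Fin 4 × P)) ∈ cylCx P S S' thinKinds := by
            refine ⟨?_, S'.lower ?_ hs.2.1, Or.inr ⟨{0, 1}, by simp [thinKinds], ?_⟩⟩
            · rintro q (rfl | rfl)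
              exacts [hvalid, hvv]
            · rintro _ ⟨q, rfl | rfl, rfl, h⟩
              exacts [⟨_, hms, rfl, by simp⟩, ⟨_, hms, rfl, by simp⟩]
            · rintro q (rfl | rfl) <;> simp
          refine Or.inr (Or.inr ⟨_, hms, hlt, fun q hq => hmle q hq (h0 q hq), ⟨q₃, hq₃, ?_⟩, hA,
            hf.degen (Or.inl ⟨le_rfl, by simp⟩) ?_ ?_ hA⟩)
          · rintro rfl
            simp at hk₃
          · exact collapse_low (q := (r, 1, a)) le_rfl
          · exact collapse_low (q := (r, 0, ⊥)) (by simp))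
  have hA₀ : cylCx P S S' thinKinds ≤ cylCx P S S' {{0, 1, 3}, {2, 3}} := by
    refine fun s hs => ⟨hs.1, hs.2.1, hs.2.2.imp_right fun ⟨K, hK, h⟩ => ?_⟩
    rcases hK with rfl | rfl | rfl
    · exact ⟨{0, 1, 3}, by simp, fun q hq => (h q hq).imp id Or.inr⟩
    · exact ⟨{0, 1, 3}, by simp, fun q hq => (h q hq).imp id Or.inl⟩
    · exact ⟨{2, 3}, by simp, h⟩
  -- The dual step at the base: after the last vertex `(r, 2, a)` of kind 2 comes `(⊤, 3, a)`, which
  -- is the last vertex of the chain if there is none of kind 3.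
  obtain ⟨g', hg'⟩ := exists_extension_marker (B := cylCx P S S' {Set.univ}) g {q | q.2.1 = 2}
    IsGreatest isGreatest_unique (fun q => (⊤, 3, q.2.2)) (by
      intro s hs hsA hc
      have hS : supp s ∉ S := fun h => hsA ⟨hs.1, hs.2.1, Or.inl h⟩
      have h2 : ∃ q ∈ s, q.2.1 = 2 := by
        by_contra! h
        refine hsA ⟨hs.1, hs.2.1, Or.inr ⟨{0, 1, 3}, by simp, fun q hq => ?_⟩⟩
        have := h q hq
        generalize q.2.1 = k at this
        fin_cases k <;> simp_all
      have h1 : ∃ q ∈ s, q.2.1 ≤ 1 := by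
        by_contra! h
        refine hsA ⟨hs.1, hs.2.1, Or.inr ⟨{2, 3}, by simp, fun q hq => ?_⟩⟩
        have := h q hq
        generalize q.2.1 = k at this
        fin_cases k <;> simp_all
      obtain ⟨q₂, hq₂, hk₂⟩ := h2
      obtain ⟨q₁, hq₁, hk₁⟩ := h1
      obtain ⟨⟨r, k, a⟩, ⟨hms, hk⟩, hm⟩ := (hc.mono Set.inter_subset_left).exists_isGreatest
        ⟨q₂, hq₂, hk₂⟩ (s := s ∩ {q | q.2.1 = 2})
      obtain rfl : k = 2 := hk
      have hvalid := hs.1 _ hms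
      have ha : a ≠ ⊥ := fun h => absurd (hvalid.1.2 h) (by simp)
      have hsupp : supp (insert (⊤, 3, a) s) = supp s := by
        refine subset_antisymm ?_ (supp_mono (Set.subset_insert _ _))
        rintro _ ⟨q, rfl | hq, rfl, h⟩
        exacts [absurd rfl h, ⟨q, hq, rfl, h⟩]
      have hsupp' : supp (s \ {(⊤, 3, a)}) = supp s := by
        refine subset_antisymm (supp_mono Set.sdiff_subset) ?_
        rintro _ ⟨q, hq, rfl, h⟩
        exact ⟨q, ⟨hq, by rintro rfl; exact h rfl⟩, rfl, h⟩
      have hvv : IsVertex ((⊤, 3, a) : R × Fin 4 × P) := ⟨iff_of_false (by simp) ha, fun _ => rfl⟩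
      have hlt : ((r, 2, a) : R × Fin 4 × P) < (⊤, 3, a) :=
        lt_of_le_of_ne ⟨le_top, by simp, le_rfl⟩ (by simp)
      have h3le : ∀ q ∈ s, q.2.1 = 3 → (⊤, 3, a) ≤ q := fun q hq h => by
        have h' := (hc.total hms hq).resolve_right fun h' => absurd (h.symm.le.trans h'.2.1)
          (not_le.2 (show (2 : Fin 4) < 3 by decide))
        exact ⟨((hs.1 q hq).2 h).symm.le, h.symm.le, h'.2.2⟩
      have hlem : ∀ q ∈ s, q.2.1 ≠ 3 → q ≤ (r, 2, a) := fun q hq h => by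
        by_cases h₂ : q.2.1 = 2
        · exact hm ⟨hq, h₂⟩
        · refine (hc.total hq hms).resolve_right fun h' => ?_
          have : (2 : Fin 4) ≤ q.2.1 := h'.2.1
          generalize q.2.1 = k at this h h₂
          fin_cases k <;> simp_all
      refine ⟨(r, 2, a), ⟨⟨hms, rfl⟩, hm⟩, by simp, ⟨?_, hsupp ▸ hs.2.1, Or.inr
        ⟨Set.univ, rfl, fun _ _ => trivial⟩⟩, ?_, ?_, fun hvs => ?_⟩
      · rintro q (rfl | hq)
        exacts [hvv, hs.1 q hq]
      · intro q hq
        by_cases h : q.2.1 = 3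
        · exact Or.inr (h3le q hq h)
        · exact Or.inl ((hlem q hq h).trans hlt.le)
      · rintro ⟨-, -, h | ⟨K, hK, h⟩⟩
        · exact hS (hsupp' ▸ h)
        · have h₁ := h _ ⟨hms, by simp⟩
          have h₃ := h _ ⟨hq₁, by rintro rfl; exact absurd (show (3 : Fin 4) ≤ 1 from hk₁) (by decide)⟩
          generalize q₁.2.1 = k at hk₁ h₃
          rcases hK with rfl | rfl
          · simp at h₁
          · fin_cases k <;> simp_all
      · by_cases h3 : ∃ q ∈ s, q.2.1 = 3
        · obtain ⟨q, hq, h3⟩ := h3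
          exact Or.inl ⟨_, hms, q, hq, hlt, lt_of_le_of_ne (h3le q hq h3) fun e => hvs (e ▸ hq)⟩
        · push Not at h3
          have hA : ({(r, 2, a), (⊤, 3, a)} : Set (R × Fin 4 × P)) ∈ cylCx P S S' thinKinds := by
            refine ⟨?_, S'.lower ?_ hs.2.1, Or.inr ⟨{2, 3}, by simp [thinKinds], ?_⟩⟩
            · rintro q (rfl | rfl)
              exacts [hvalid, hvv]
            · rintro _ ⟨q, rfl | rfl, rfl, h⟩
              exacts [⟨_, hms, rfl, by simp⟩, absurd rfl h]
            · rintro q (rfl | rfl) <;> simp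
          refine Or.inr (Or.inl ⟨_, hms, hlt, fun q hq => hlem q hq (h3 q hq), ⟨q₁, hq₁, ?_⟩, hA₀ hA,
            (hf.degen (Or.inr ⟨le_rfl, by simp⟩) ?_ ?_ hA).of_agree hg hA⟩)
          · rintro rfl
            exact absurd (show (2 : Fin 4) ≤ 1 from hk₁) (by decide)
          · exact collapse_high (q := (r, 2, a)) le_rfl
          · exact collapse_high (q := (⊤, 3, a)) (by simp))
  exact ⟨g', hg'.trans hg fun s hs => hA₀ hs.2⟩

end PMap

end Cylinder

/-! ### Families of cones as partial diagrams on the cylinder -/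

section Nerves

variable {J : Type} [PartialOrder J] {E : SSet.{u}}

/-- The simplex of the nerve of a poset given by a monotone map. -/
def nerveMk {m : SimplexCategoryᵒᵖ} (x : Fin (m.unop.len + 1) →o J) : (N.{u} J).obj m :=
  ULift.up x.monotone.functor

/-- The monotone map given by a simplex of the nerve of a poset. -/
def nerveHom {m : SimplexCategoryᵒᵖ} (x : (N.{u} J).obj m) : Fin (m.unop.len + 1) →o J :=
  ⟨fun i => x.down.obj i, fun _ _ h => leOfHom (x.down.map (homOfLE h))⟩

lemma nerveMk_nerveHom {m : SimplexCategoryᵒᵖ} (x : (N.{u} J).obj m) : nerveMk (nerveHom x) = x :=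
  ULift.ext _ _ (CategoryTheory.Functor.ext (fun _ => rfl) fun _ _ _ => Subsingleton.elim _ _)

lemma nerve_ext {m : SimplexCategoryᵒᵖ} {x y : (N.{u} J).obj m} (h : ∀ i, nerveHom x i = nerveHom y i) :
    x = y := by
  rw [← nerveMk_nerveHom x, ← nerveMk_nerveHom y, OrderHom.ext _ _ (funext h)]

/-- A diagram indexed by the nerve of a poset, as a partial diagram. -/
def PMap.ofNerve (D : N.{u} J ⟶ E) : PMap (⊤ : LowerSet (Set J)) E where
  app {k} x _ := D.app (op ⦋k⦌) (nerveMk (m := op ⦋k⦌) x)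
  nat {k _} α x _ _ := ConcreteCategory.congr_hom (D.naturality (SimplexCategory.mkHom α).op)
    (nerveMk (m := op ⦋k⦌) x)

/-- A simplicial set of chains in `{0, …, n}` with image in `S'`. -/
structure Shape (S : SSet.{u}) (n : ℕ) (S' : LowerSet (Set (Fin (n + 1)))) where
  toHom {m : SimplexCategoryᵒᵖ} (x : S.obj m) : Fin (m.unop.len + 1) →o Fin (n + 1)
  mem {m : SimplexCategoryᵒᵖ} (x : S.obj m) : Set.range (toHom x) ∈ S'
  ofHom {m : SimplexCategoryᵒᵖ} (x : Fin (m.unop.len + 1) →o Fin (n + 1)) : Set.range x ∈ S' → S.obj m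
  toHom_ofHom {m : SimplexCategoryᵒᵖ} (x : Fin (m.unop.len + 1) →o Fin (n + 1)) (h) :
    toHom (ofHom x h) = x
  ofHom_toHom {m : SimplexCategoryᵒᵖ} (x : S.obj m) : ofHom (toHom x) (mem x) = x
  map {m m' : SimplexCategoryᵒᵖ} (α : m ⟶ m') (x : S.obj m) :
    toHom (S.map α x) = (toHom x).comp α.unop.toOrderHom

lemma Shape.ofHom_comp {S : SSet.{u}} {n : ℕ} {S' : LowerSet (Set (Fin (n + 1)))} (sh : Shape S n S')
    {m m' : SimplexCategoryᵒᵖ} (α : m ⟶ m') (x : Fin (m.unop.len + 1) →o Fin (n + 1))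
    (h : Set.range x ∈ S') (h' : Set.range (x.comp α.unop.toOrderHom) ∈ S') :
    sh.ofHom (x.comp α.unop.toOrderHom) h' = S.map α (sh.ofHom x h) := by
  rw [← sh.ofHom_toHom (S.map α (sh.ofHom x h))]
  congr 1
  rw [sh.map, sh.toHom_ofHom]

/-- The shape of the standard simplex. -/
def simplexShape (n : ℕ) : Shape.{u} Δ[n] n ⊤ where
  toHom x := SSet.stdSimplex.asOrderHom x
  mem _ := trivial
  ofHom {m} x _ := SSet.stdSimplex.objMk (n := ⦋n⦌) (m := m) x
  toHom_ofHom _ _ := rfl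
  ofHom_toHom _ := rfl
  map _ _ := rfl

/-- The proper subsets of `{0, …, n}`. -/
def bdrySets (n : ℕ) : LowerSet (Set (Fin (n + 1))) :=
  ⟨{s | s ≠ Set.univ}, fun _ _ h hs h' => hs (Set.univ_subset_iff.1 (h' ▸ h))⟩

/-- The shape of the boundary of the standard simplex. -/
def boundaryShape (n : ℕ) : Shape.{u} (∂Δ[n] : SSet.{u}) n (bdrySets n) where
  toHom x := SSet.stdSimplex.asOrderHom x.1
  mem x := fun h => x.2 (Set.range_eq_univ.1 h)
  ofHom {m} x h := ⟨SSet.stdSimplex.objMk (n := ⦋n⦌) (m := m) x, fun h' => h (Set.range_eq_univ.2 h')⟩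
  toHom_ofHom _ _ := rfl
  ofHom_toHom _ := rfl
  map _ _ := rfl

end Nerves

section Realization

variable {P : Type} [PartialOrder P] [OrderBot P] {E : SSet.{u}} {n : ℕ}

/-- A chain in the apex of the cylinder. -/
def lowChain (P : Type) [PartialOrder P] [OrderBot P] {k : ℕ} (x : Fin (k + 1) →o Fin (n + 1)) :
    Fin (k + 1) →o Fin (n + 1) × Fin 4 × P :=
  ⟨fun i => (x i, 0, ⊥), fun _ _ h => ⟨x.monotone h, le_rfl, le_rfl⟩⟩

/-- A chain in the base of the cylinder. -/
def highChain (n : ℕ) {k : ℕ} (a : Fin (k + 1) →o NonBot P) :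
    Fin (k + 1) →o Fin (n + 1) × Fin 4 × P :=
  ⟨fun i => (⊤, 3, (a i).1), fun _ _ h => ⟨le_rfl, le_rfl, a.monotone h⟩⟩

/-- A chain in the fat cone. -/
def fatChain {k : ℕ} (a : Fin (k + 1) →o NonBot P) (x : Fin (k + 1) →o Fin (n + 1))
    (t : Fin (k + 1) →o Fin 2) : Fin (k + 1) →o Fin (n + 1) × Fin 4 × P :=
  ⟨fun i => (x i, (t i).succ.castSucc, (a i).1), fun _ _ h => ⟨x.monotone h,
    Fin.succ_le_succ_iff.2 (t.monotone h), a.monotone h⟩⟩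

lemma lowChain_mem {S' : LowerSet (Set (Fin (n + 1)))} {k : ℕ} (x : Fin (k + 1) →o Fin (n + 1))
    (h : Set.range x ∈ S') : Set.range (lowChain P x) ∈ cylCx P ⊥ S' fatKinds := by
  refine ⟨?_, S'.lower ?_ h, Or.inr ⟨{0, 1}, by simp [fatKinds], ?_⟩⟩
  · rintro _ ⟨i, rfl⟩
    exact ⟨iff_of_true rfl rfl, fun h => absurd (show (0 : Fin 4) = 3 from h) (by decide)⟩
  · rintro _ ⟨_, ⟨i, rfl⟩, rfl, -⟩
    exact ⟨i, rfl⟩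
  · rintro _ ⟨i, rfl⟩
    exact Or.inl rfl

lemma highChain_mem {S' : LowerSet (Set (Fin (n + 1)))} (h : ∅ ∈ S') {k : ℕ}
    (a : Fin (k + 1) →o NonBot P) : Set.range (highChain n a) ∈ cylCx P ⊥ S' fatKinds := by
  refine ⟨?_, S'.lower ?_ h, Or.inr ⟨{2, 3}, by simp [fatKinds], ?_⟩⟩
  · rintro _ ⟨i, rfl⟩
    exact ⟨iff_of_false (show ¬ (3 : Fin 4) = 0 by decide) (a i).2, fun _ => rfl⟩
  · rintro _ ⟨_, ⟨i, rfl⟩, rfl, h⟩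
    exact absurd rfl h
  · rintro _ ⟨i, rfl⟩
    exact Or.inr rfl

lemma fatChain_mem {S' : LowerSet (Set (Fin (n + 1)))} {k : ℕ} (a : Fin (k + 1) →o NonBot P)
    (x : Fin (k + 1) →o Fin (n + 1)) (t : Fin (k + 1) →o Fin 2) (h : Set.range x ∈ S') :
    Set.range (fatChain a x t) ∈ cylCx P ⊥ S' fatKinds := by
  have h₀ : ∀ t : Fin 2, t.succ.castSucc ≠ 0 := by decide
  have h₃ : ∀ t : Fin 2, t.succ.castSucc ≠ 3 := by decide
  have h₁₂ : ∀ t : Fin 2, t.succ.castSucc ∈ ({1, 2} : Set (Fin 4)) := by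
    intro t
    fin_cases t
    exacts [Or.inl rfl, Or.inr rfl]
  refine ⟨?_, S'.lower ?_ h, Or.inr ⟨{1, 2}, by simp [fatKinds], ?_⟩⟩
  · rintro _ ⟨i, rfl⟩
    exact ⟨iff_of_false (h₀ _) (a i).2, fun h => absurd h (h₃ _)⟩
  · rintro _ ⟨_, ⟨i, rfl⟩, rfl, -⟩
    exact ⟨i, rfl⟩
  · rintro _ ⟨i, rfl⟩
    exact h₁₂ _

variable {d : N.{u} (NonBot P) ⟶ E} {S : SSet.{u}} {S' : LowerSet (Set (Fin (n + 1)))}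

namespace PMap

/-- The partial diagram `f` on the cylinder restricts to the family of cones `c`. -/
structure Realizes {A : LowerSet (Set (Fin (n + 1) × Fin 4 × P))} (f : PMap A E)
    (sh : Shape S n S') (c : ConeFamily d S) : Prop where
  isCone : f.IsCone
  low : ∀ ⦃k : ℕ⦄ (x : Fin (k + 1) →o Fin (n + 1)) (h : Set.range x ∈ S') (h'),
    f.app (lowChain P x) h' = c.pt.app (op ⦋k⦌) (sh.ofHom (m := op ⦋k⦌) x h)
  fat : ∀ ⦃k : ℕ⦄ (a : Fin (k + 1) →o NonBot P) (x : Fin (k + 1) →o Fin (n + 1))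
    (t : Fin (k + 1) →o Fin 2) (h : Set.range x ∈ S') (h'),
    f.app (fatChain a x t) h' = c.htpy.app (op ⦋k⦌) ((nerveMk (m := op ⦋k⦌) a,
      sh.ofHom (m := op ⦋k⦌) x h), SSet.stdSimplex.objMk (n := ⦋1⦌) (m := op ⦋k⦌) t)
  high : ∀ ⦃k : ℕ⦄ (a : Fin (k + 1) →o NonBot P) (h'),
    f.app (highChain n a) h' = d.app (op ⦋k⦌) (nerveMk (m := op ⦋k⦌) a)

/-- Every partial cone on the cylinder restricts to a family of cones. -/
theorem exists_coneFamily {A : LowerSet (Set (Fin (n + 1) × Fin 4 × P))} (f : PMap A E)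
    (sh : Shape S n S') (h₀ : ∅ ∈ S') (hA : cylCx P ⊥ S' fatKinds ≤ A) (hf : f.IsCone)
    (hd : ∀ ⦃k : ℕ⦄ (a : Fin (k + 1) →o NonBot P) (h'),
      f.app (highChain n a) h' = d.app (op ⦋k⦌) (nerveMk (m := op ⦋k⦌) a)) :
    ∃ c : ConeFamily d S, f.Realizes sh c := by
  let pt : S ⟶ E :=
    { app m := ↾fun x => f.app (lowChain P (sh.toHom x)) (hA (lowChain_mem _ (sh.mem x)))
      naturality m m' α := by
        ext x
        refine Eq.trans ?_ (f.nat α.unop.toOrderHom (lowChain P (sh.toHom x)) _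
          (range_comp_mem (hA (lowChain_mem _ (sh.mem x))) _))
        exact f.app_congr (congrArg (lowChain P) (sh.map α x)) _ _ }
  let htpy : (N.{u} (NonBot P) ⊗ S) ⊗ Δ[1] ⟶ E :=
    { app m := ↾fun x => f.app (fatChain (nerveHom x.1.1) (sh.toHom x.1.2)
        (SSet.stdSimplex.asOrderHom x.2)) (hA (fatChain_mem _ _ _ (sh.mem x.1.2)))
      naturality m m' α := by
        ext x
        refine Eq.trans ?_ (f.nat α.unop.toOrderHom (fatChain (nerveHom x.1.1) (sh.toHom x.1.2)
          (SSet.stdSimplex.asOrderHom x.2)) _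
          (range_comp_mem (hA (fatChain_mem _ _ _ (sh.mem x.1.2))) _))
        refine f.app_congr ?_ _ _
        change fatChain _ (sh.toHom (S.map α x.1.2)) _ = _
        rw [sh.map]
        rfl }
  refine ⟨⟨pt, htpy, ?_, ?_⟩, hf, ?_, ?_, hd⟩
  · ext m x
    have hk₀ : (0 : Fin 2).succ.castSucc ≤ 1 := by decide
    have e : (collapse (Fin (n + 1)) P).comp (fatChain (nerveHom x.1) (sh.toHom x.2)
        (OrderHom.const _ 0)) = lowChain P (sh.toHom x.2) := by
      ext1
      funext i
      exact collapse_low (q := (sh.toHom x.2 i, 1, (nerveHom x.1 i).1)) le_rfl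
    exact (hf (fatChain (nerveHom x.1) (sh.toHom x.2) (OrderHom.const _ 0))
      (hA (fatChain_mem _ _ _ (sh.mem x.2))) (e ▸ hA (lowChain_mem _ (sh.mem x.2)))
      (Or.inl fun _ => hk₀)).trans (f.app_congr e _ _)
  · ext m x
    have hk₁ : 2 ≤ (1 : Fin 2).succ.castSucc := by decide
    have e : (collapse (Fin (n + 1)) P).comp (fatChain (nerveHom x.1) (sh.toHom x.2)
        (OrderHom.const _ 1)) = highChain n (nerveHom x.1) := by
      ext1
      funext i
      exact collapse_high (q := (sh.toHom x.2 i, 2, (nerveHom x.1 i).1)) le_rfl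
    refine (hf (fatChain (nerveHom x.1) (sh.toHom x.2) (OrderHom.const _ 1))
      (hA (fatChain_mem _ _ _ (sh.mem x.2))) (e ▸ hA (highChain_mem h₀ _))
      (Or.inr fun _ => hk₁)).trans ((f.app_congr e _ (hA (highChain_mem h₀ _))).trans
      ((hd _ _).trans ?_))
    exact congrArg (fun y => d.app m y) (nerveMk_nerveHom x.1)
  · intro k x h h'
    exact f.app_congr (congrArg (lowChain P) (sh.toHom_ofHom (m := op ⦋k⦌) x h).symm) _ _
  · intro k a x t h h'
    exact f.app_congr (congrArg (fun y => fatChain a y t) (sh.toHom_ofHom (m := op ⦋k⦌) x h).symm) _ _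

lemma _root_.InftyCat.ConeFamily.htpy_const_zero (c : ConeFamily d S) {m : SimplexCategoryᵒᵖ}
    (a : (N.{u} (NonBot P)).obj m) (x : S.obj m) :
    c.htpy.app m ((a, x), SSet.stdSimplex.objMk (n := ⦋1⦌) (m := m) (OrderHom.const _ 0)) =
      c.pt.app m x := by
  have h := NatTrans.congr_app c.htpy_zero m
  exact ConcreteCategory.congr_hom h (show (N.{u} (NonBot P) ⊗ S).obj m from (a, x))

lemma _root_.InftyCat.ConeFamily.htpy_const_one (c : ConeFamily d S) {m : SimplexCategoryᵒᵖ}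
    (a : (N.{u} (NonBot P)).obj m) (x : S.obj m) :
    c.htpy.app m ((a, x), SSet.stdSimplex.objMk (n := ⦋1⦌) (m := m) (OrderHom.const _ 1)) =
      d.app m a := by
  have h := NatTrans.congr_app c.htpy_one m
  exact ConcreteCategory.congr_hom h (show (N.{u} (NonBot P) ⊗ S).obj m from (a, x))

/-- The elements of `R` in a chain. -/
def fstChain {k : ℕ} (x : Fin (k + 1) →o Fin (n + 1) × Fin 4 × P) : Fin (k + 1) →o Fin (n + 1) :=
  ⟨fun i => (x i).1, fun _ _ h => (x.monotone h).1⟩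

/-- The elements of `P` in a chain. -/
def sndChain {k : ℕ} (x : Fin (k + 1) →o Fin (n + 1) × Fin 4 × P) (h : ∀ i, (x i).2.2 ≠ ⊥) :
    Fin (k + 1) →o NonBot P :=
  ⟨fun i => ⟨(x i).2.2, h i⟩, fun _ _ h => (x.monotone h).2.2⟩

/-- The coordinate of a chain in the interval. -/
def kindChain {k : ℕ} (x : Fin (k + 1) →o Fin (n + 1) × Fin 4 × P) : Fin (k + 1) →o Fin 2 :=
  (⟨![0, 0, 1, 1], by decide⟩ : Fin 4 →o Fin 2).comp
    ⟨fun i => (x i).2.1, fun _ _ h => (x.monotone h).2.1⟩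

lemma range_fstChain {𝒦 : Set (Set (Fin 4))} {S₀ : LowerSet (Set (Fin (n + 1)))} {k : ℕ}
    {x : Fin (k + 1) →o Fin (n + 1) × Fin 4 × P} (hx : Set.range x ∈ cylCx P S₀ S' 𝒦)
    (h : ∀ i, (x i).2.1 ≠ 3) : Set.range (fstChain x) ∈ S' := by
  refine S'.lower ?_ hx.2.1
  rintro _ ⟨i, rfl⟩
  exact ⟨_, ⟨i, rfl⟩, rfl, h i⟩

lemma ne_bot_of_mem {𝒦 : Set (Set (Fin 4))} {S₀ : LowerSet (Set (Fin (n + 1)))} {k : ℕ}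
    {x : Fin (k + 1) →o Fin (n + 1) × Fin 4 × P} (hx : Set.range x ∈ cylCx P S₀ S' 𝒦)
    (h : ∀ i, (x i).2.1 ≠ 0) (i : Fin (k + 1)) : (x i).2.2 ≠ ⊥ :=
  fun e => h i ((hx.1 _ ⟨i, rfl⟩).1.2 e)

/-- Each chain of the fat complex lies in the fat cone or is collapsed into the apex or the base.
Hence a partial cone on this complex is determined by the family of cones that it realizes. -/
lemma fat_cases {k : ℕ} {x : Fin (k + 1) →o Fin (n + 1) × Fin 4 × P}
    (hx : Set.range x ∈ cylCx P ⊥ S' fatKinds) :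
    (∃ a, ∃ y : Fin (k + 1) →o Fin (n + 1), ∃ t, Set.range y ∈ S' ∧ x = fatChain a y t) ∨
    ((∀ i, (x i).2.1 ≤ 1) ∧ ∃ y : Fin (k + 1) →o Fin (n + 1), Set.range y ∈ S' ∧ (collapse _ P).comp x = lowChain P y) ∨
    (∀ i, 2 ≤ (x i).2.1) ∧ ∃ a, (collapse _ P).comp x = highChain n a := by
  obtain ⟨K, rfl | rfl | rfl, hK⟩ := hx.2.2.resolve_left id
  · have hk : ∀ i, (x i).2.1 = 1 ∨ (x i).2.1 = 2 := fun i => hK _ ⟨i, rfl⟩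
    have h₀ : ∀ i, (x i).2.1 ≠ 0 := fun i => by rcases hk i with h | h <;> rw [h] <;> decide
    have h₃ : ∀ i, (x i).2.1 ≠ 3 := fun i => by rcases hk i with h | h <;> rw [h] <;> decide
    refine Or.inl ⟨sndChain x (ne_bot_of_mem hx h₀), fstChain x, kindChain x,
      range_fstChain hx h₃, ?_⟩
    ext1
    funext i
    refine Prod.ext rfl (Prod.ext ?_ rfl)
    change (x i).2.1 = ((![0, 0, 1, 1] : Fin 4 → Fin 2) (x i).2.1).succ.castSucc
    rcases hk i with h | h <;> rw [h] <;> rfl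
  · have hk : ∀ i, (x i).2.1 ≤ 1 := fun i => by
      rcases hK _ ⟨i, rfl⟩ with h | h <;> rw [h]
      exact Fin.zero_le _
    refine Or.inr (Or.inl ⟨hk, fstChain x, range_fstChain hx fun i h => ?_, ?_⟩)
    · exact absurd (h ▸ hk i) (by decide)
    · ext1
      funext i
      exact collapse_low (hk i)
  · have hk : ∀ i, 2 ≤ (x i).2.1 := fun i => by
      rcases hK _ ⟨i, rfl⟩ with h | h <;> rw [h]
      decide
    refine Or.inr (Or.inr ⟨hk, sndChain x (ne_bot_of_mem hx fun i h => ?_), ?_⟩)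
    · exact absurd (h ▸ hk i) (by decide)
    · ext1
      funext i
      exact collapse_high (hk i)

/-- Every family of cones is the restriction of a partial cone on the cylinder. -/
theorem exists_realizes (sh : Shape S n S') (c : ConeFamily d S) :
    ∃ f : PMap (cylCx P ⊥ S' fatKinds) E, f.Realizes sh c := by
  have hl : ∀ {k : ℕ} (x : Fin (k + 1) →o Fin (n + 1) × Fin 4 × P),
      Set.range x ∈ cylCx P ⊥ S' {{0, 1}} → ∀ i, (x i).2.1 = 0 ∨ (x i).2.1 = 1 := by
    intro k x hx i
    obtain ⟨K, rfl, h⟩ := hx.2.2.resolve_left id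
    exact h _ ⟨i, rfl⟩
  have hf : ∀ {k : ℕ} (x : Fin (k + 1) →o Fin (n + 1) × Fin 4 × P),
      Set.range x ∈ cylCx P ⊥ S' {{1, 2}} → ∀ i, (x i).2.1 = 1 ∨ (x i).2.1 = 2 := by
    intro k x hx i
    obtain ⟨K, rfl, h⟩ := hx.2.2.resolve_left id
    exact h _ ⟨i, rfl⟩
  have hh : ∀ {k : ℕ} (x : Fin (k + 1) →o Fin (n + 1) × Fin 4 × P),
      Set.range x ∈ cylCx P ⊥ S' {{2, 3}} → ∀ i, (x i).2.1 = 2 ∨ (x i).2.1 = 3 := by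
    intro k x hx i
    obtain ⟨K, rfl, h⟩ := hx.2.2.resolve_left id
    exact h _ ⟨i, rfl⟩
  have hl₃ : ∀ {k : ℕ} {x : Fin (k + 1) →o Fin (n + 1) × Fin 4 × P}
      (_ : Set.range x ∈ cylCx P ⊥ S' {{0, 1}}) (i), (x i).2.1 ≠ 3 := fun h i => by
    rcases hl _ h i with h | h <;> rw [h] <;> decide
  have hf₃ : ∀ {k : ℕ} {x : Fin (k + 1) →o Fin (n + 1) × Fin 4 × P}
      (_ : Set.range x ∈ cylCx P ⊥ S' {{1, 2}}) (i), (x i).2.1 ≠ 3 := fun h i => by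
    rcases hf _ h i with h | h <;> rw [h] <;> decide
  have hf₀ : ∀ {k : ℕ} {x : Fin (k + 1) →o Fin (n + 1) × Fin 4 × P}
      (_ : Set.range x ∈ cylCx P ⊥ S' {{1, 2}}) (i), (x i).2.1 ≠ 0 := fun h i => by
    rcases hf _ h i with h | h <;> rw [h] <;> decide
  have hh₀ : ∀ {k : ℕ} {x : Fin (k + 1) →o Fin (n + 1) × Fin 4 × P}
      (_ : Set.range x ∈ cylCx P ⊥ S' {{2, 3}}) (i), (x i).2.1 ≠ 0 := fun h i => by
    rcases hh _ h i with h | h <;> rw [h] <;> decide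
  -- Three pieces are glued: the family of apexes on kinds 0 and 1, the diagram `d` on kinds 2 and
  -- 3, and the homotopy on kinds 1 and 2. They agree on the overlaps by the two end conditions of a
  -- family of cones.
  let pl : PMap (cylCx P ⊥ S' {{0, 1}}) E :=
    { app := fun {k} x hx => c.pt.app (op ⦋k⦌)
        (sh.ofHom (m := op ⦋k⦌) (fstChain x) (range_fstChain hx (hl₃ hx)))
      nat := fun {k _} α x hx hx' => by
        refine Eq.trans ?_ (ConcreteCategory.congr_hom
          (c.pt.naturality (SimplexCategory.mkHom α).op) _)
        exact congrArg (fun y => c.pt.app _ y) (sh.ofHom_comp (SimplexCategory.mkHom α).op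
          (fstChain x) (range_fstChain hx (hl₃ hx)) (range_fstChain hx' (hl₃ hx'))) }
  let ph : PMap (cylCx P ⊥ S' {{2, 3}}) E :=
    { app := fun {k} x hx => d.app (op ⦋k⦌)
        (nerveMk (m := op ⦋k⦌) (sndChain x (ne_bot_of_mem hx (hh₀ hx))))
      nat := fun {k _} α x hx hx' => ConcreteCategory.congr_hom
          (d.naturality (SimplexCategory.mkHom α).op)
          (nerveMk (m := op ⦋k⦌) (sndChain x (ne_bot_of_mem hx (hh₀ hx)))) }
  let pf : PMap (cylCx P ⊥ S' {{1, 2}}) E :=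
    { app := fun {k} x hx => c.htpy.app (op ⦋k⦌)
        ((nerveMk (m := op ⦋k⦌) (sndChain x (ne_bot_of_mem hx (hf₀ hx))),
          sh.ofHom (m := op ⦋k⦌) (fstChain x) (range_fstChain hx (hf₃ hx))),
          SSet.stdSimplex.objMk (n := ⦋1⦌) (m := op ⦋k⦌) (kindChain x))
      nat := fun {k _} α x hx hx' => by
        refine Eq.trans ?_ (ConcreteCategory.congr_hom
          (c.htpy.naturality (SimplexCategory.mkHom α).op) _)
        refine congrArg (fun y => c.htpy.app _ y) (Prod.ext (Prod.ext rfl ?_) rfl)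
        exact sh.ofHom_comp (SimplexCategory.mkHom α).op
          (fstChain x) (range_fstChain hx (hf₃ hx)) (range_fstChain hx' (hf₃ hx')) }
  have hkc : ∀ {k : ℕ} (x : Fin (k + 1) →o Fin (n + 1) × Fin 4 × P) (t : Fin 2),
      (∀ i, (x i).2.1 = t.succ.castSucc) → kindChain x = OrderHom.const _ t := by
    intro k x t h
    ext1
    funext i
    change (![0, 0, 1, 1] : Fin 4 → Fin 2) (x i).2.1 = t
    rw [h i]
    fin_cases t <;> rfl
  have hlf : pl.Agree pf := by
    intro k x hx hx'
    have e := hkc x 0 fun i => by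
      rcases hl _ hx i with h | h
      · exact absurd h (hf₀ hx' i)
      · exact h
    refine (c.htpy_const_zero (nerveMk (m := op ⦋k⦌) (sndChain x
      (ne_bot_of_mem hx' (hf₀ hx')))) _).symm.trans ?_
    exact congrArg (fun t => c.htpy.app (op ⦋k⦌) ((nerveMk (m := op ⦋k⦌) (sndChain x
      (ne_bot_of_mem hx' (hf₀ hx'))), sh.ofHom (m := op ⦋k⦌) (fstChain x)
      (range_fstChain hx' (hf₃ hx'))), SSet.stdSimplex.objMk (n := ⦋1⦌) (m := op ⦋k⦌) t)) e.symm
  have hfh : pf.Agree ph := by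
    intro k x hx' hx
    have e := hkc x 1 fun i => by
      rcases hh _ hx i with h | h
      · exact h
      · exact absurd h (hf₃ hx' i)
    refine Eq.trans ?_ (c.htpy_const_one _ (sh.ofHom (m := op ⦋k⦌) (fstChain x)
      (range_fstChain hx' (hf₃ hx'))))
    exact congrArg (fun t => c.htpy.app (op ⦋k⦌) ((nerveMk (m := op ⦋k⦌) (sndChain x
      (ne_bot_of_mem hx' (hf₀ hx'))), sh.ofHom (m := op ⦋k⦌) (fstChain x)
      (range_fstChain hx' (hf₃ hx'))), SSet.stdSimplex.objMk (n := ⦋1⦌) (m := op ⦋k⦌) t)) e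
  have hlh : pl.Agree ph := by
    intro k x hx hx'
    rcases hl _ hx 0 with h | h
    · exact absurd h (hh₀ hx' 0)
    · rcases hh _ hx' 0 with h' | h' <;> rw [h] at h' <;> exact absurd h' (by decide)
  let g := glue (glue pl pf hlf) ph (glue_agree _ _ _ _ hlh hfh)
  have hgl : g.Agree pl := fun k x hx hx' =>
    (glue_agree_left _ _ _ x hx (Or.inl hx')).trans (glue_agree_left _ _ _ x _ hx')
  have hgf : g.Agree pf := fun k x hx hx' =>
    (glue_agree_left _ _ _ x hx (Or.inr hx')).trans (glue_agree_right _ _ _ x _ hx')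
  have hgh : g.Agree ph := glue_agree_right _ _ _
  have hdom : ∀ s ∈ cylCx P ⊥ S' fatKinds,
      s ∈ cylCx P ⊥ S' {{0, 1}} ⊔ cylCx P ⊥ S' {{1, 2}} ⊔ cylCx P ⊥ S' {{2, 3}} := by
    rintro s ⟨h₁, h₂, h | ⟨K, rfl | rfl | rfl, h⟩⟩
    exacts [h.elim, Or.inl (Or.inr ⟨h₁, h₂, Or.inr ⟨_, rfl, h⟩⟩),
      Or.inl (Or.inl ⟨h₁, h₂, Or.inr ⟨_, rfl, h⟩⟩), Or.inr ⟨h₁, h₂, Or.inr ⟨_, rfl, h⟩⟩]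
  have hlm : ∀ {k : ℕ} (x : Fin (k + 1) →o Fin (n + 1) × Fin 4 × P),
      Set.range x ∈ cylCx P ⊥ S' fatKinds → (∀ i, (x i).2.1 ≤ 1) →
      Set.range x ∈ cylCx P ⊥ S' {{0, 1}} := by
    intro k x hx h
    refine ⟨hx.1, hx.2.1, Or.inr ⟨_, rfl, ?_⟩⟩
    rintro _ ⟨i, rfl⟩
    have := h i
    generalize (x i).2.1 = j at this
    fin_cases j <;> simp_all
  have hhm : ∀ {k : ℕ} (x : Fin (k + 1) →o Fin (n + 1) × Fin 4 × P),
      Set.range x ∈ cylCx P ⊥ S' fatKinds → (∀ i, 2 ≤ (x i).2.1) →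
      Set.range x ∈ cylCx P ⊥ S' {{2, 3}} := by
    intro k x hx h
    refine ⟨hx.1, hx.2.1, Or.inr ⟨_, rfl, ?_⟩⟩
    rintro _ ⟨i, rfl⟩
    have := h i
    generalize (x i).2.1 = j at this
    fin_cases j <;> simp_all
  refine ⟨g.res _ fun s hs _ => hdom s hs, ?_, fun k x h h' => ?_, fun k a x t h h' => ?_,
    fun k a h' => ?_⟩
  · intro k x hx hx' hk
    rcases hk with hk | hk
    · have hk' : ∀ i, (((collapse _ P).comp x) i).2.1 ≤ 1 := fun i =>
        (congrArg (fun q => q.2.1) (collapse_low (hk i))).le.trans (Fin.zero_le _)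
      refine (hgl x (hdom _ hx) (hlm x hx hk)).trans
        (Eq.trans ?_ (hgl _ (hdom _ hx') (hlm _ hx' hk')).symm)
      have e : fstChain ((collapse _ P).comp x) = fstChain x := by
        ext1
        funext i
        exact congrArg (fun q => q.1) (collapse_low (hk i))
      change c.pt.app (op ⦋k⦌) _ = c.pt.app (op ⦋k⦌) _
      congr 2
      exact e.symm
    · have hk' : ∀ i, 2 ≤ (((collapse _ P).comp x) i).2.1 := fun i =>
        (by decide : (2 : Fin 4) ≤ 3).trans (congrArg (fun q => q.2.1) (collapse_high (hk i))).symm.le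
      refine (hgh x (hdom _ hx) (hhm x hx hk)).trans
        (Eq.trans ?_ (hgh _ (hdom _ hx') (hhm _ hx' hk')).symm)
      change d.app (op ⦋k⦌) _ = d.app (op ⦋k⦌) _
      congr 2
      ext1
      funext i
      exact Subtype.ext (congrArg (fun q => q.2.2) (collapse_high (hk i))).symm
  · exact hgl _ (hdom _ h') (hlm _ h' fun i => Fin.zero_le _)
  · have hm : Set.range (fatChain a x t) ∈ cylCx P ⊥ S' {{1, 2}} := by
      refine ⟨h'.1, h'.2.1, Or.inr ⟨_, rfl, ?_⟩⟩
      rintro _ ⟨i, rfl⟩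
      change (t i).succ.castSucc ∈ _
      generalize t i = j
      fin_cases j
      exacts [Or.inl rfl, Or.inr rfl]
    refine (hgf _ (hdom _ h') hm).trans ?_
    have e : kindChain (fatChain a x t) = t := by
      ext1
      funext i
      change (![0, 0, 1, 1] : Fin 4 → Fin 2) (t i).succ.castSucc = t i
      generalize t i = j
      fin_cases j <;> rfl
    exact congrArg (fun t => c.htpy.app (op ⦋k⦌) ((nerveMk (m := op ⦋k⦌) a, sh.ofHom (m := op ⦋k⦌) x h),
      SSet.stdSimplex.objMk (n := ⦋1⦌) (m := op ⦋k⦌) t)) e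
  · exact hgh _ (hdom _ h') (hhm _ h' fun i => (by decide : (2 : Fin 4) ≤ 3))

/-- Partial cones that restrict to the same family of cones agree on the fat cone. -/
lemma Realizes.app_eq {A B : LowerSet (Set (Fin (n + 1) × Fin 4 × P))} {f : PMap A E} {g : PMap B E}
    {sh : Shape S n S'} {c : ConeFamily d S} (hf : f.Realizes sh c) (hg : g.Realizes sh c)
    (h₀ : ∅ ∈ S') (hA : cylCx P ⊥ S' fatKinds ≤ A) (hB : cylCx P ⊥ S' fatKinds ≤ B) {k : ℕ}
    (x : Fin (k + 1) →o Fin (n + 1) × Fin 4 × P) (hx : Set.range x ∈ cylCx P ⊥ S' fatKinds)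
    (hxf : Set.range x ∈ A) (hxg : Set.range x ∈ B) : f.app x hxf = g.app x hxg := by
  rcases fat_cases hx with ⟨a, y, t, hy, rfl⟩ | ⟨hk, y, hy, e⟩ | ⟨hk, a, e⟩
  · rw [hf.fat a y t hy, hg.fat a y t hy]
  · have hm : Set.range ((collapse _ P).comp x) ∈ cylCx P ⊥ S' fatKinds := e ▸ lowChain_mem y hy
    rw [hf.isCone x hxf (hA hm) (Or.inl hk), hg.isCone x hxg (hB hm) (Or.inl hk),
      f.app_congr e _ (hA (lowChain_mem y hy)), g.app_congr e _ (hB (lowChain_mem y hy)),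
      hf.low y hy, hg.low y hy]
  · have hm : Set.range ((collapse _ P).comp x) ∈ cylCx P ⊥ S' fatKinds := e ▸ highChain_mem h₀ a
    rw [hf.isCone x hxf (hA hm) (Or.inr hk), hg.isCone x hxg (hB hm) (Or.inr hk),
      f.app_congr e _ (hA (highChain_mem h₀ a)), g.app_congr e _ (hB (highChain_mem h₀ a)),
      hf.high a, hg.high a]

lemma Realizes.unique {A : LowerSet (Set (Fin (n + 1) × Fin 4 × P))} {f : PMap A E}
    {sh : Shape S n S'} {c c' : ConeFamily d S} (hf : f.Realizes sh c) (hf' : f.Realizes sh c')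
    (hA : cylCx P ⊥ S' fatKinds ≤ A) : c = c' := by
  apply ConeFamily.ext
  · ext m x
    have h := hf.low (k := m.unop.len) (sh.toHom x) (sh.mem x) (hA (lowChain_mem _ (sh.mem x)))
    have h' := hf'.low (k := m.unop.len) (sh.toHom x) (sh.mem x) (hA (lowChain_mem _ (sh.mem x)))
    have e : sh.ofHom (m := m) (sh.toHom x) (sh.mem x) = x := sh.ofHom_toHom x
    exact (congrArg (fun y => c.pt.app m y) e).symm.trans ((h.symm.trans h').trans
      (congrArg (fun y => c'.pt.app m y) e))
  · ext m ⟨⟨a, x⟩, t⟩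
    have hm := hA (fatChain_mem (nerveHom a) (sh.toHom x) (SSet.stdSimplex.asOrderHom t) (sh.mem x))
    have h := hf.fat (k := m.unop.len) (nerveHom a) (sh.toHom x) (SSet.stdSimplex.asOrderHom t)
      (sh.mem x) hm
    have h' := hf'.fat (k := m.unop.len) (nerveHom a) (sh.toHom x) (SSet.stdSimplex.asOrderHom t)
      (sh.mem x) hm
    have e : (((nerveMk (m := m) (nerveHom a), sh.ofHom (m := m) (sh.toHom x) (sh.mem x)),
      SSet.stdSimplex.objMk (n := ⦋1⦌) (m := m) (SSet.stdSimplex.asOrderHom t)) :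
        ((N.{u} (NonBot P) ⊗ S) ⊗ Δ[1]).obj m) = ((a, x), t) :=
      Prod.ext (Prod.ext (nerveMk_nerveHom a) (sh.ofHom_toHom x)) rfl
    exact (congrArg (fun y => c.htpy.app m y) e).symm.trans ((h.symm.trans h').trans
      (congrArg (fun y => c'.htpy.app m y) e))

lemma Realizes.of_app_eq {A B : LowerSet (Set (Fin (n + 1) × Fin 4 × P))} {f : PMap A E}
    {g : PMap B E} {sh : Shape S n S'} {c : ConeFamily d S} (hf : f.Realizes sh c) (hg : g.IsCone)
    (h₀ : ∅ ∈ S') (hA : cylCx P ⊥ S' fatKinds ≤ A)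
    (h : ∀ ⦃k : ℕ⦄ (x : Fin (k + 1) →o Fin (n + 1) × Fin 4 × P),
      Set.range x ∈ cylCx P ⊥ S' fatKinds → ∀ (hx : Set.range x ∈ A) (hx' : Set.range x ∈ B),
      g.app x hx' = f.app x hx) : g.Realizes sh c where
  isCone := hg
  low _ x hx h' := (h _ (lowChain_mem x hx) (hA (lowChain_mem x hx)) h').trans (hf.low x hx _)
  fat _ a x t hx h' :=
    (h _ (fatChain_mem a x t hx) (hA (fatChain_mem a x t hx)) h').trans (hf.fat a x t hx _)
  high _ a h' := (h _ (highChain_mem h₀ a) (hA (highChain_mem h₀ a)) h').trans (hf.high a _)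

/-- The map of cylinders induced by a map of the ordinals. -/
def cylMap {n' : ℕ} (P : Type) [PartialOrder P] (θ : Fin (n' + 1) →o Fin (n + 1)) :
    Fin (n' + 1) × Fin 4 × P →o Fin (n + 1) × Fin 4 × P :=
  ⟨fun q => (θ q.1, q.2), fun _ _ h => ⟨θ.monotone h.1, h.2⟩⟩

lemma IsCone.pull {n' : ℕ} {A : LowerSet (Set (Fin (n + 1) × Fin 4 × P))} {f : PMap A E}
    (hf : f.IsCone) (θ : Fin (n' + 1) →o Fin (n + 1)) (hθ : θ ⊤ = ⊤)
    (B : LowerSet (Set (Fin (n' + 1) × Fin 4 × P)))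
    (hB : ∀ s ∈ B, IsChain (· ≤ ·) s → cylMap P θ '' s ∈ A) :
    (f.pull (cylMap P θ) B hB).IsCone := by
  intro k x hx hx' hk
  have e : (collapse _ P).comp ((cylMap P θ).comp x) = (cylMap P θ).comp ((collapse _ P).comp x) := by
    ext1
    funext i
    change collapse _ P (cylMap P θ (x i)) = cylMap P θ (collapse _ P (x i))
    by_cases h : (x i).2.1 ≤ 1
    · exact (collapse_low (q := cylMap P θ (x i)) h).trans
        (congrArg (cylMap P θ) (collapse_low h)).symm
    · have h' : 2 ≤ (x i).2.1 := by omega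
      refine (collapse_high (q := cylMap P θ (x i)) h').trans (Eq.trans ?_
        (congrArg (cylMap P θ) (collapse_high h')).symm)
      exact Prod.ext hθ.symm rfl
  have hm := range_comp_mem' (cylMap P θ) _ (hB _ hx' (isChain_range _))
  exact (hf _ _ (e ▸ hm) hk).trans (f.app_congr e _ _)

/-- Reindexing a family of cones corresponds to restriction along a map of cylinders. The map of
ordinals must preserve `⊤`, since the base of the cylinder is placed over `⊤`. -/
lemma Realizes.restrict {n' : ℕ} {A : LowerSet (Set (Fin (n + 1) × Fin 4 × P))} {f : PMap A E}
    {sh : Shape S n S'} {c : ConeFamily d S} (hf : f.Realizes sh c) {T : SSet.{u}}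
    {T' : LowerSet (Set (Fin (n' + 1)))} (sh' : Shape T n' T') (φ : T ⟶ S)
    (θ : Fin (n' + 1) →o Fin (n + 1)) (hθ : θ ⊤ = ⊤)
    (hT : ∀ ⦃k : ℕ⦄ (x : Fin (k + 1) →o Fin (n' + 1)) (h : Set.range x ∈ T'),
      ∃ h' : Set.range (θ.comp x) ∈ S',
        φ.app (op ⦋k⦌) (sh'.ofHom (m := op ⦋k⦌) x h) = sh.ofHom (m := op ⦋k⦌) (θ.comp x) h')
    (B : LowerSet (Set (Fin (n' + 1) × Fin 4 × P)))
    (hB : ∀ s ∈ B, IsChain (· ≤ ·) s → cylMap P θ '' s ∈ A) :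
    (f.pull (cylMap P θ) B hB).Realizes sh' (c.restrict φ) where
  isCone := hf.isCone.pull θ hθ B hB
  low k x h h' := by
    obtain ⟨h₁, e⟩ := hT x h
    exact (hf.low (θ.comp x) h₁ _).trans (congrArg (fun y => c.pt.app (op ⦋k⦌) y) e.symm)
  fat k a x t h h' := by
    obtain ⟨h₁, e⟩ := hT x h
    exact (hf.fat a (θ.comp x) t h₁ _).trans (congrArg (fun y => c.htpy.app (op ⦋k⦌)
      ((nerveMk (m := op ⦋k⦌) a, y), SSet.stdSimplex.objMk (n := ⦋1⦌) (m := op ⦋k⦌) t)) e.symm)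
  high k a h' := by
    have e : (cylMap P θ).comp (highChain n' a) = highChain n a := by
      ext1
      funext i
      exact Prod.ext hθ rfl
    have hm := range_comp_mem' (cylMap P θ) _ (hB _ h' (isChain_range _))
    exact (f.app_congr e _ (e ▸ hm)).trans (hf.high a _)

end PMap

end Realization

/-! ### Limit cones and exactness -/

section LimitCones

variable {P : Type} [PartialOrder P] [OrderBot P] {E : SSet.{u}} {n : ℕ}

open Classical in
/-- The thin cone over the last vertex. -/
noncomputable def baseIncl (n : ℕ) (P : Type) [PartialOrder P] [OrderBot P] :
    P →o Fin (n + 1) × Fin 4 × P where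
  toFun p := (⊤, if p = ⊥ then 0 else 3, p)
  monotone' p p' h := by
    refine ⟨le_rfl, ?_, h⟩
    dsimp only
    split_ifs with h₁ h₂ h₂
    · exact le_rfl
    · exact Fin.zero_le _
    · exact absurd (le_bot_iff.1 (h₂ ▸ h)) h₁
    · exact le_rfl

/-- The base point of the thin cone. -/
def coneProj (n : ℕ) (P : Type) [PartialOrder P] [OrderBot P] : Fin (n + 1) × Fin 4 × P →o P where
  toFun q := if q.2.1 ≤ 1 then ⊥ else q.2.2
  monotone' q q' h := by
    have h₁ : q.2.1 ≤ q'.2.1 := h.2.1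
    dsimp only
    split_ifs with h₂ h₃
    · exact le_rfl
    · exact bot_le
    · exact absurd (h₁.trans ‹_›) h₂
    · exact h.2.2

/-- The inclusion of the thin cones in the cylinder. -/
noncomputable def thinIncl (n : ℕ) (P : Type) [PartialOrder P] [OrderBot P] :
    Fin (n + 1) ⊕ₗ P →o Fin (n + 2) × Fin 4 × P where
  toFun x := Sum.elim (fun r => (r.castSucc, 0, ⊥)) (baseIncl (n + 1) P) (ofLex x)
  monotone' x y h := by
    rcases lex_cases x with ⟨r, rfl⟩ | ⟨p, rfl⟩ <;> rcases lex_cases y with ⟨r', rfl⟩ | ⟨p', rfl⟩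
    · have h' : r ≤ r' := Sum.Lex.inl_le_inl_iff.1 h
      exact ⟨h', le_rfl, le_rfl⟩
    · exact ⟨le_top, Fin.zero_le _, bot_le⟩
    · exact absurd h Sum.Lex.not_inr_le_inl
    · exact (baseIncl (n + 1) P).monotone (Sum.Lex.inr_le_inr_iff.1 h)

/-- The projection of the cylinder to the thin cones. -/
def thinProj (n : ℕ) (P : Type) [PartialOrder P] [OrderBot P] :
    Fin (n + 2) × Fin 4 × P →o Fin (n + 1) ⊕ₗ P where
  toFun q := if h : q.2.1 ≤ 1 ∧ q.1.1 < n + 1 then Sum.inlₗ ⟨q.1.1, h.2⟩ else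
    Sum.inrₗ (coneProj _ P q)
  monotone' q q' h := by
    have h₁ : q.2.1 ≤ q'.2.1 := h.2.1
    have h₂ : q.1.1 ≤ q'.1.1 := h.1
    dsimp only
    split_ifs with h₃ h₄ h₅
    · exact Sum.Lex.inl_le_inl_iff.2 h₂
    · exact Sum.Lex.inl_le_inr _ _
    · exact absurd ⟨h₁.trans h₅.1, h₂.trans_lt h₅.2⟩ h₃
    · exact Sum.Lex.inr_le_inr_iff.2 ((coneProj _ P).monotone h)

lemma thinProj_neg {q : Fin (n + 2) × Fin 4 × P} (h : ¬ (q.2.1 ≤ 1 ∧ q.1.1 < n + 1)) :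
    thinProj n P q = Sum.inrₗ (coneProj _ P q) := dif_neg h

open Classical in
lemma thinProj_thinIncl (y : Fin (n + 1) ⊕ₗ P) : thinProj n P (thinIncl n P y) = y := by
  rcases lex_cases y with ⟨r, rfl⟩ | ⟨p, rfl⟩
  · exact dif_pos ⟨Fin.zero_le _, r.2⟩
  · refine (dif_neg fun h => absurd h.2 ?_).trans (congrArg Sum.inrₗ ?_)
    · exact lt_irrefl (n + 1)
    · change (if (if p = ⊥ then (0 : Fin 4) else 3) ≤ 1 then ⊥ else p) = p
      by_cases hp : p = ⊥
      · rw [if_pos hp, if_pos (Fin.zero_le _), hp]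
      · rw [if_neg hp, if_neg (by decide)]

lemma baseIncl_coneProj {q : Fin (n + 1) × Fin 4 × P} (hq : IsVertex q)
    (h : q.2.1 ≤ 1 → q.1 = ⊤) : baseIncl n P (coneProj n P q) = collapse _ P q := by
  by_cases hk : q.2.1 ≤ 1
  · rw [collapse_low hk, h hk]
    have e : coneProj n P q = ⊥ := if_pos hk
    rw [e]
    exact Prod.ext rfl (Prod.ext (if_pos rfl) rfl)
  · have hk' : 2 ≤ q.2.1 := by omega
    rw [collapse_high hk']
    have e : coneProj n P q = q.2.2 := if_neg hk
    rw [e]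
    refine Prod.ext rfl (Prod.ext (if_neg fun h' => ?_) rfl)
    rw [hq.1.2 h'] at hk'
    exact absurd hk' (by decide)

/-- The collapse factors through the join Δⁿ ⋆ P, embedded by `thinIncl` in the cylinder over Δⁿ⁺¹.
The dimension rises by one because the least element of P becomes the last vertex of Δⁿ⁺¹. -/
lemma thinIncl_thinProj {q : Fin (n + 2) × Fin 4 × P} (hq : IsVertex q) :
    thinIncl n P (thinProj n P q) = collapse _ P q := by
  by_cases h : q.2.1 ≤ 1 ∧ q.1.1 < n + 1
  · rw [collapse_low h.1, show thinProj n P q = Sum.inlₗ ⟨q.1.1, h.2⟩ from dif_pos h]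
    rfl
  · rw [show thinProj n P q = Sum.inrₗ (coneProj _ P q) from dif_neg h]
    refine baseIncl_coneProj hq fun hk => Fin.ext ?_
    have := not_and.1 h hk
    have := q.1.2
    change q.1.1 = n + 1
    omega

lemma thinProj_collapse (q : Fin (n + 2) × Fin 4 × P) :
    thinProj n P (collapse _ P q) = thinProj n P q := by
  by_cases hk : q.2.1 ≤ 1
  · rw [collapse_low hk]
    have e : coneProj (n + 1) P (q.1, 0, ⊥) = coneProj _ P q := by
      change (if (0 : Fin 4) ≤ 1 then (⊥ : P) else ⊥) = if q.2.1 ≤ 1 then ⊥ else q.2.2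
      rw [if_pos hk, ite_self]
    by_cases h : q.1.1 < n + 1
    · exact (dif_pos ⟨Fin.zero_le (1 : Fin 4), h⟩).trans (dif_pos ⟨hk, h⟩ :
        thinProj n P q = Sum.inlₗ ⟨q.1.1, h⟩).symm
    · exact (dif_neg fun h' => h h'.2).trans ((congrArg Sum.inrₗ e).trans
        (dif_neg fun h' => h h'.2 : thinProj n P q = Sum.inrₗ (coneProj _ P q)).symm)
  · have hk' : 2 ≤ q.2.1 := by omega
    rw [collapse_high hk']
    have e : coneProj (n + 1) P (⊤, 3, q.2.2) = coneProj _ P q := by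
      change (if (3 : Fin 4) ≤ 1 then (⊥ : P) else q.2.2) = if q.2.1 ≤ 1 then ⊥ else q.2.2
      rw [if_neg hk, if_neg (by decide)]
    have e₁ : thinProj n P (⊤, 3, q.2.2) = Sum.inrₗ (coneProj (n + 1) P (⊤, 3, q.2.2)) :=
      thinProj_neg fun h => absurd h.2 (lt_irrefl (n + 1))
    have e₂ : thinProj n P q = Sum.inrₗ (coneProj (n + 1) P q) := thinProj_neg fun h => hk h.1
    rw [e₁, e₂, e]

variable {S S' : LowerSet (Set (Fin (n + 1)))} {𝒦 : Set (Set (Fin 4))}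

/-- The condition `IsCone` concerns only chains of kinds {0, 1} and {2, 3}. These belong to the fat
and to the thin complex alike, so that extensions from either remain cones. -/
lemma mem_cylCx_of_kinds {𝒦' : Set (Set (Fin 4))} (h₀₁ : {0, 1} ∈ 𝒦') (h₂₃ : {2, 3} ∈ 𝒦')
    {s : Set (Fin (n + 1) × Fin 4 × P)} (hs : s ∈ cylCx P S S' 𝒦)
    (h : (∀ q ∈ s, q.2.1 ≤ 1) ∨ ∀ q ∈ s, 2 ≤ q.2.1) : s ∈ cylCx P ⊥ S' 𝒦' := by
  refine ⟨hs.1, hs.2.1, Or.inr ?_⟩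
  rcases h with h | h
  · refine ⟨_, h₀₁, fun q hq => ?_⟩
    have := h q hq
    generalize q.2.1 = j at this
    fin_cases j <;> simp_all
  · refine ⟨_, h₂₃, fun q hq => ?_⟩
    have := h q hq
    generalize q.2.1 = j at this
    fin_cases j <;> simp_all

lemma cylMap_mem {n' : ℕ} (θ : Fin (n' + 1) →o Fin (n + 1)) (hθ : θ ⊤ = ⊤)
    {S₀ T' : LowerSet (Set (Fin (n' + 1)))} {𝒦' : Set (Set (Fin 4))}
    {s : Set (Fin (n' + 1) × Fin 4 × P)} (hs : s ∈ cylCx P S₀ T' 𝒦') (h : θ '' supp s ∈ S')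
    (h' : ∃ K ∈ 𝒦, ∀ q ∈ s, q.2.1 ∈ K) : PMap.cylMap P θ '' s ∈ cylCx P S S' 𝒦 := by
  refine ⟨?_, S'.lower ?_ h, Or.inr ?_⟩
  · rintro _ ⟨q, hq, rfl⟩
    exact ⟨(hs.1 q hq).1, fun h => (congrArg θ ((hs.1 q hq).2 h)).trans hθ⟩
  · rintro _ ⟨_, ⟨q, hq, rfl⟩, rfl, h⟩
    exact ⟨q.1, ⟨q, hq, rfl, h⟩, rfl⟩
  · obtain ⟨K, hK, h⟩ := h'
    refine ⟨K, hK, ?_⟩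
    rintro _ ⟨q, hq, rfl⟩
    exact h q hq

lemma mem_cylCx_univ {s : Set (Fin (n + 1) × Fin 4 × P)} (hs : s ∈ cylCx P S S' 𝒦) :
    s ∈ cylCx P ⊥ S' {Set.univ} :=
  ⟨hs.1, hs.2.1, Or.inr ⟨_, rfl, fun _ _ => trivial⟩⟩

/-- The subsets of the set of the greatest element. -/
def topSets (n : ℕ) : LowerSet (Set (Fin (n + 1))) := LowerSet.Iic {⊤}

lemma fst_eq_top {s : Set (Fin (n + 1) × Fin 4 × P)} (hs : s ∈ cylCx P S (topSets n) 𝒦)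
    {q : Fin (n + 1) × Fin 4 × P} (hq : q ∈ s) : q.1 = ⊤ := by
  by_cases h : q.2.1 = 3
  · exact (hs.1 q hq).2 h
  · exact hs.2.1 ⟨q, hq, rfl, h⟩

/-- The map to the point and the last vertex. -/
def toPoint (n : ℕ) : Fin (n + 1) →o Fin 1 := OrderHom.const _ 0

def ofPoint (n : ℕ) : Fin 1 →o Fin (n + 1) := OrderHom.const _ ⊤

lemma baseIncl_mem (s : Set P) : baseIncl n P '' s ∈ cylCx P ⊥ ⊤ {Set.univ} := by
  refine ⟨?_, trivial, Or.inr ⟨_, rfl, fun _ _ => trivial⟩⟩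
  rintro _ ⟨p, -, rfl⟩
  classical
  refine ⟨?_, fun _ => rfl⟩
  change (if p = ⊥ then (0 : Fin 4) else 3) = 0 ↔ p = ⊥
  split_ifs with h
  · exact iff_of_true rfl h
  · exact iff_of_false (by decide) h

namespace PMap

lemma IsCone.of_agree {A B : LowerSet (Set (Fin (n + 1) × Fin 4 × P))} {f : PMap A E} {g : PMap B E}
    (hf : f.IsCone) (hgf : g.Agree f) (h : ∀ s ∈ B, ((∀ q ∈ s, q.2.1 ≤ 1) ∨ ∀ q ∈ s, 2 ≤ q.2.1) →
      s ∈ A) : g.IsCone := by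
  intro k x hx hx' hk
  have h₁ : Set.range x ∈ A := h _ hx (hk.imp (fun hk => by rintro _ ⟨i, rfl⟩; exact hk i)
    fun hk => by rintro _ ⟨i, rfl⟩; exact hk i)
  have h₂ : Set.range ((collapse _ P).comp x) ∈ A := by
    refine h _ hx' (hk.imp (fun hk => ?_) fun hk => ?_)
    · rintro _ ⟨i, rfl⟩
      exact (congrArg (fun q => q.2.1) (collapse_low (hk i))).le.trans (Fin.zero_le _)
    · rintro _ ⟨i, rfl⟩
      exact (by decide : (2 : Fin 4) ≤ 3).trans
        (congrArg (fun q => q.2.1) (collapse_high (hk i))).symm.le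
  exact (hgf x hx h₁).trans ((hf x h₁ h₂ hk).trans (hgf _ hx' h₂).symm)

/-- On the thin complex a cone factors through the collapse: chains of kinds {0, 3} are fixed by it,
and the remaining chains are those covered by `IsCone`. -/
lemma IsCone.app_collapse {A : LowerSet (Set (Fin (n + 1) × Fin 4 × P))} {f : PMap A E}
    (hf : f.IsCone) {k : ℕ} (x : Fin (k + 1) →o Fin (n + 1) × Fin 4 × P) (hx : Set.range x ∈ A)
    (hx' : Set.range ((collapse _ P).comp x) ∈ A)
    (h : Set.range x ∈ cylCx P ⊥ S' thinKinds) : f.app x hx = f.app ((collapse _ P).comp x) hx' := by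
  obtain ⟨K, rfl | rfl | rfl, hK⟩ := h.2.2.resolve_left id
  · refine f.app_congr ?_ _ _
    ext1
    funext i
    have hv := h.1 _ ⟨i, rfl⟩
    rcases hK _ ⟨i, rfl⟩ with hk | hk
    · refine Eq.trans ?_ (collapse_low (hk.le.trans (Fin.zero_le _))).symm
      exact Prod.ext rfl (Prod.ext hk (hv.1.1 hk))
    · refine Eq.trans ?_ (collapse_high ((by decide : (2 : Fin 4) ≤ 3).trans (le_of_eq hk.symm))).symm
      exact Prod.ext (hv.2 hk) (Prod.ext hk rfl)
  · refine hf x hx hx' (Or.inl fun i => ?_)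
    rcases hK _ ⟨i, rfl⟩ with hk | hk <;> rw [hk]
    exact Fin.zero_le _
  · refine hf x hx hx' (Or.inr fun i => ?_)
    rcases hK _ ⟨i, rfl⟩ with hk | hk <;> rw [hk]
    decide

lemma exists_glue_cyl (p₁ : PMap (cylCx P ⊥ S' 𝒦) E) (p₂ : PMap (cylCx P S S ∅) E)
    (h : p₁.Agree p₂) : ∃ g : PMap (cylCx P S S' 𝒦) E, g.Agree p₁ ∧ g.Agree p₂ := by
  refine ⟨(glue p₁ p₂ h).res _ fun s hs _ => ?_, fun _ x _ hx => (glue_agree_left p₁ p₂ h) x (Or.inl hx) hx,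
    fun _ x _ hx => (glue_agree_right p₁ p₂ h) x (Or.inr hx) hx⟩
  exact hs.2.2.symm.imp (fun h => ⟨hs.1, hs.2.1, Or.inr h⟩) fun h => ⟨hs.1, h, Or.inl h⟩

variable {d : N.{u} (NonBot P) ⟶ E}

/-- A cone, placed over the last vertex of the cylinder. -/
def lastSlice (W : PMap (cylCx P (⊥ : LowerSet (Set (Fin 1))) ⊤ {Set.univ}) E) (n : ℕ) :
    PMap (cylCx P (topSets n) (topSets n) ∅) E :=
  W.pull (cylMap P (toPoint n)) _ fun _ hs _ =>
    cylMap_mem _ rfl hs trivial ⟨_, rfl, fun _ _ => trivial⟩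

variable {W : PMap (cylCx P (⊥ : LowerSet (Set (Fin 1))) ⊤ {Set.univ}) E} {c : ConeFamily d Δ[0]}
  {m : ℕ}

lemma ofPoint_mem {A : LowerSet (Set (Fin (n + 1) × Fin 4 × P))}
    (hA : cylCx P ⊥ (topSets n) fatKinds ≤ A) {s : Set (Fin 1 × Fin 4 × P)}
    (hs : s ∈ cylCx P ⊥ ⊤ fatKinds) : cylMap P (ofPoint n) '' s ∈ A := by
  refine hA (cylMap_mem (ofPoint n) rfl hs ?_ (hs.2.2.resolve_left id))
  rintro _ ⟨_, -, rfl⟩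
  rfl

lemma cylMap_ofPoint_toPoint {S : LowerSet (Set (Fin (n + 1)))} {k : ℕ}
    {x : Fin (k + 1) →o Fin (n + 1) × Fin 4 × P}
    (hx : Set.range x ∈ cylCx P S (topSets n) 𝒦) :
    (cylMap P (ofPoint n)).comp ((cylMap P (toPoint n)).comp x) = x := by
  ext1
  funext i
  exact Prod.ext (fst_eq_top hx ⟨i, rfl⟩).symm rfl

lemma topSets_le : topSets (m + 1) ≤ bdrySets (m + 1) := by
  intro s hs h
  have h₀ : (0 : Fin (m + 2)) ∈ s := h ▸ Set.mem_univ _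
  exact absurd (congrArg Fin.val (hs h₀)) (Nat.succ_ne_zero m).symm

lemma cylCx_mono {S T : LowerSet (Set (Fin (n + 1)))} {S₁ T₁ : LowerSet (Set (Fin (n + 1)))}
    {𝒦' : Set (Set (Fin 4))} (h : S ≤ S₁) (h' : T ≤ T₁) (h𝒦 : 𝒦 ⊆ 𝒦') :
    cylCx P S T 𝒦 ≤ cylCx P S₁ T₁ 𝒦' :=
  fun _ hs => ⟨hs.1, h' hs.2.1, hs.2.2.imp (fun hs => h hs) fun ⟨K, hK, hs⟩ => ⟨K, h𝒦 hK, hs⟩⟩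

lemma Realizes.restrict_lastVertex {A : LowerSet (Set (Fin (m + 2) × Fin 4 × P))} {f : PMap A E}
    {b : ConeFamily d (∂Δ[m + 1] : SSet.{u})} (hf : f.Realizes (boundaryShape (m + 1)) b)
    (hA : cylCx P ⊥ (topSets (m + 1)) fatKinds ≤ A) :
    (f.pull (cylMap P (ofPoint (m + 1))) (cylCx P ⊥ ⊤ fatKinds) fun _ hs _ =>
      ofPoint_mem hA hs).Realizes (simplexShape 0) (b.restrict (lastVertex m)) := by
  refine hf.restrict (simplexShape 0) (lastVertex m) (ofPoint (m + 1)) rfl ?_ _ _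
  intro k x h
  refine ⟨topSets_le ?_, rfl⟩
  rintro _ ⟨_, rfl⟩
  rfl

/-- A boundary of families whose last vertex is `c` coincides over that vertex with `W`. The slice
of the cylinder over the last vertex can therefore be prescribed to be `W` when the boundary is
extended to the cylinder. -/
lemma Realizes.agree_lastSlice (hW : W.Realizes (simplexShape 0) c)
    {f : PMap (cylCx P ⊥ (bdrySets (m + 1)) fatKinds) E}
    {b : ConeFamily d (∂Δ[m + 1] : SSet.{u})} (hf : f.Realizes (boundaryShape (m + 1)) b)
    (hb : b.restrict (lastVertex m) = c) : f.Agree (lastSlice W (m + 1)) := by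
  intro k x hx hx'
  have hA : cylCx P ⊥ (topSets (m + 1)) fatKinds ≤ cylCx P ⊥ (bdrySets (m + 1)) fatKinds :=
    cylCx_mono le_rfl topSets_le subset_rfl
  have h := hf.restrict_lastVertex hA
  rw [hb] at h
  have hm : Set.range ((cylMap P (toPoint (m + 1))).comp x) ∈
      cylCx P (⊥ : LowerSet (Set (Fin 1))) ⊤ fatKinds :=
    range_comp_mem' _ _ (cylMap_mem _ rfl hx trivial (hx.2.2.resolve_left id))
  refine Eq.trans ?_ (h.app_eq hW trivial le_rfl (fun _ hs => mem_cylCx_univ hs) _ hm hm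
    (mem_cylCx_univ hm))
  exact f.app_congr (cylMap_ofPoint_toPoint hx').symm _ _

lemma app_highChain_of_agree (hW : W.Realizes (simplexShape 0) c)
    {A : LowerSet (Set (Fin (n + 1) × Fin 4 × P))} {g : PMap A E} (hg : g.Agree (lastSlice W n))
    {k : ℕ} (a : Fin (k + 1) →o NonBot P) (h) :
    g.app (highChain n a) h = d.app (op ⦋k⦌) (nerveMk (m := op ⦋k⦌) a) := by
  have h₁ := highChain_mem (n := n) (S' := topSets n) (Set.empty_subset _) a
  exact (hg _ h ⟨h₁.1, h₁.2.1, Or.inl h₁.2.1⟩).trans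
    (hW.high a (mem_cylCx_univ (highChain_mem (S' := ⊤) trivial a)))

lemma Realizes.restrict_eq_of_agree (hW : W.Realizes (simplexShape 0) c)
    {A : LowerSet (Set (Fin (m + 2) × Fin 4 × P))} {g : PMap A E}
    (hg : g.Agree (lastSlice W (m + 1))) {b : ConeFamily d (∂Δ[m + 1] : SSet.{u})}
    (hb : g.Realizes (boundaryShape (m + 1)) b)
    (hA : cylCx P ⊥ (topSets (m + 1)) fatKinds ≤ A) : b.restrict (lastVertex m) = c := by
  have h := hb.restrict_lastVertex hA
  refine h.unique (hW.of_app_eq h.isCone trivial (fun _ hs => mem_cylCx_univ hs) ?_) le_rfl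
  intro k x hx hx' _
  have h₁ := ofPoint_mem (n := m + 1) le_rfl hx
  refine (hg _ _ (range_comp_mem' _ _ ⟨h₁.1, h₁.2.1, Or.inl h₁.2.1⟩)).trans (W.app_congr ?_ _ _)
  ext1
  funext i
  exact Prod.ext (Subsingleton.elim _ _) rfl

open Classical in
lemma baseIncl_kind (p : P) : (baseIncl n P p).2.1 = 0 ∧ p = ⊥ ∨ (baseIncl n P p).2.1 = 3 := by
  by_cases h : p = ⊥
  · exact Or.inl ⟨if_pos h, h⟩
  · exact Or.inr (if_neg h)

lemma thinIncl_kind (y : Fin (n + 1) ⊕ₗ P) : (thinIncl n P y).2.1 ∈ ({0, 3} : Set (Fin 4)) := by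
  rcases lex_cases y with ⟨r, rfl⟩ | ⟨p, rfl⟩
  · exact Or.inl rfl
  · exact (baseIncl_kind (n := n + 1) p).imp And.left id

lemma thinIncl_mem (s : Set (Fin (n + 1) ⊕ₗ P)) :
    thinIncl n P '' s ∈ cylCx P ⊥ ⊤ {Set.univ} := by
  refine ⟨?_, trivial, Or.inr ⟨_, rfl, fun _ _ => trivial⟩⟩
  rintro _ ⟨y, -, rfl⟩
  rcases lex_cases y with ⟨r, rfl⟩ | ⟨p, rfl⟩
  · exact ⟨iff_of_true rfl rfl, fun h => absurd (show (0 : Fin 4) = 3 from h) (by decide)⟩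
  · exact (baseIncl_mem (n := n + 1) {p}).1 _ ⟨p, rfl, rfl⟩

/-- The vertices of Δⁿ⁺¹ are those of Δⁿ and, as the last one, the least element of P. A chain of
the extension problem omits one of them, so it lives over ∂Δⁿ⁺¹. -/
lemma supp_thinIncl_ne_univ {s : Set (Fin (n + 1) ⊕ₗ P)} (hs : s ∈ exCx (Fin (n + 1)) ({⊥}ᶜ : Set P)) :
    supp (thinIncl n P '' s) ≠ Set.univ := by
  intro h
  have h₁ : HasAll s := by
    intro r
    obtain ⟨_, ⟨y, hy, rfl⟩, e, h'⟩ := h.symm ▸ Set.mem_univ r.castSucc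
    rcases lex_cases y with ⟨r', rfl⟩ | ⟨p, rfl⟩
    · rwa [← Fin.castSucc_injective _ e]
    · have e' : n + 1 = r.1 := congrArg Fin.val e
      exact absurd r.2 (by omega)
  refine hs.elim (fun h₂ => ?_) fun h₂ => h₂ h₁
  obtain ⟨_, ⟨y, hy, rfl⟩, e, h'⟩ := h.symm ▸ Set.mem_univ (⊤ : Fin (n + 2))
  rcases lex_cases y with ⟨r', rfl⟩ | ⟨p, rfl⟩
  · have e' : r'.1 = n + 1 := congrArg Fin.val e
    exact absurd r'.2 (by omega)
  · rcases baseIncl_kind (n := n + 1) p with h₃ | h₃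
    · exact h₂ p hy h₃.2
    · exact h' h₃

lemma image_thinProj_mem {s : Set (Fin (n + 2) × Fin 4 × P)}
    {S₀ : LowerSet (Set (Fin (n + 2)))} (hs : s ∈ cylCx P S₀ (bdrySets (n + 1)) 𝒦) :
    thinProj n P '' s ∈ exCx (Fin (n + 1)) ({⊥}ᶜ : Set P) := by
  by_contra h
  have h' := not_or.1 h
  obtain ⟨h₁, h₂⟩ := h'
  push Not at h₁ h₂
  refine hs.2.1 (Set.eq_univ_of_forall fun r => ?_)
  by_cases hr : r.1 < n + 1
  · obtain ⟨q, hq, e⟩ := h₂ ⟨r.1, hr⟩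
    by_cases h : q.2.1 ≤ 1 ∧ q.1.1 < n + 1
    · rw [show thinProj n P q = Sum.inlₗ ⟨q.1.1, h.2⟩ from dif_pos h, inlₗ_inj] at e
      exact ⟨q, hq, Fin.ext (Fin.mk.inj_iff.1 e), fun h' => absurd (h' ▸ h.1) (by decide)⟩
    · rw [show thinProj n P q = Sum.inrₗ (coneProj _ P q) from dif_neg h] at e
      exact absurd e inr_ne_inl
  · obtain ⟨p, ⟨q, hq, e⟩, hp⟩ := h₁
    by_cases h : q.2.1 ≤ 1 ∧ q.1.1 < n + 1
    · rw [show thinProj n P q = Sum.inlₗ ⟨q.1.1, h.2⟩ from dif_pos h] at e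
      exact absurd e.symm inr_ne_inl
    · rw [show thinProj n P q = Sum.inrₗ (coneProj _ P q) from dif_neg h, inrₗ_inj] at e
      have hp' : p = ⊥ := by simpa using hp
      by_cases hk : q.2.1 ≤ 1
      · have h₃ := not_and.1 h hk
        refine ⟨q, hq, Fin.ext ?_, fun h' => absurd (h' ▸ hk) (by decide)⟩
        have := q.1.2
        have := r.2
        omega
      · have e' : coneProj (n + 1) P q = q.2.2 := if_neg hk
        have h₀ := (hs.1 q hq).1.2 (e'.symm.trans (e.trans hp'))
        exact absurd (h₀ ▸ Fin.zero_le _) hk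

variable [SSet.Quasicategory E] [Finite P] {D : PMap (⊤ : LowerSet (Set P)) E}

/-- An extension problem for Δⁿ ⋆ P is a family of thin cones over ∂Δⁿ⁺¹ that ends in the given
cone. It is extended to the cylinder and restricted to fat cones; the limit property fills these
over Δⁿ⁺¹, and the filler is extended over the cylinder and read off on the thin cones. -/
theorem isExact_of_isLimit (hW : W.Realizes (simplexShape 0) c)
    (hD : ∀ ⦃k : ℕ⦄ (x : Fin (k + 1) →o P) (h),
      W.app ((baseIncl 0 P).comp x) h = D.app x trivial) (hc : c.IsLimit) : D.IsExact {⊥}ᶜ := by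
  intro n f hf
  let p₁ : PMap (cylCx P ⊥ (bdrySets (n + 1)) thinKinds) E := f.pull (thinProj n P) _
    fun _ hs _ => image_thinProj_mem hs
  have hp₁ : p₁.IsCone := by
    intro k x hx hx' _
    refine f.app_congr ?_ _ _
    ext1
    funext i
    exact (thinProj_collapse (x i)).symm
  have h₁₂ : p₁.Agree (lastSlice W (n + 1)) := by
    intro k x hx hx'
    have e : (thinProj n P).comp x = (inrEmb (Fin (n + 1)) P : P →o Fin (n + 1) ⊕ₗ P).comp
        ((coneProj (n + 1) P).comp x) := by
      ext1
      funext i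
      refine dif_neg fun h => ?_
      have h' := h.2
      have h₁ : (x i).1 = ⊤ := fst_eq_top hx' ⟨i, rfl⟩
      rw [h₁] at h'
      exact lt_irrefl _ h'
    have hm := range_comp_mem' (thinProj n P) x (image_thinProj_mem hx)
    refine (f.app_congr e _ (e ▸ hm)).trans ((hf _ _).trans ?_)
    rw [← hD _ (range_comp_mem' _ _ (baseIncl_mem _))]
    have hy : Set.range ((cylMap P (toPoint (n + 1))).comp x) ∈
        cylCx P (⊥ : LowerSet (Set (Fin 1))) ⊤ thinKinds :=
      range_comp_mem' _ _ (cylMap_mem _ rfl hx trivial (hx.2.2.resolve_left id))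
    have e' : (baseIncl 0 P).comp ((coneProj (n + 1) P).comp x) =
        (collapse (Fin 1) P).comp ((cylMap P (toPoint (n + 1))).comp x) := by
      ext1
      funext i
      exact baseIncl_coneProj (hy.1 _ ⟨i, rfl⟩) fun _ => Subsingleton.elim (α := Fin 1) _ _
    have hm' := range_comp_mem' (baseIncl 0 P) ((coneProj (n + 1) P).comp x) (baseIncl_mem _)
    exact (W.app_congr e' _ (e' ▸ hm')).trans
      (hW.isCone.app_collapse _ (mem_cylCx_univ hy) (e' ▸ hm') hy).symm
  -- Over the last vertex the cylinder is fixed to be `W`, so that the family of fat cones ends in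
  -- `c` itself and not merely in an equivalent cone.
  obtain ⟨g₀, hg₁, hg₂⟩ := exists_glue_cyl p₁ _ h₁₂
  have hg₀ : g₀.IsCone := hp₁.of_agree hg₁ fun s hs h =>
    mem_cylCx_of_kinds (by simp [thinKinds]) (by simp [thinKinds]) hs h
  obtain ⟨g₁, hg⟩ := exists_extension_thin g₀ hg₀
  have hgc : g₁.IsCone := hg₀.of_agree hg fun s hs h => cylCx_mono bot_le le_rfl subset_rfl
    (mem_cylCx_of_kinds (by simp [thinKinds]) (by simp [thinKinds]) hs h)
  have hgW : g₁.Agree (lastSlice W (n + 1)) := fun k x hx hx' =>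
    (hg x hx ⟨hx'.1, topSets_le hx'.2.1, Or.inl hx'.2.1⟩).trans (hg₂ _ _ hx')
  have hA : cylCx P ⊥ (bdrySets (n + 1)) fatKinds ≤
      cylCx P (topSets (n + 1)) (bdrySets (n + 1)) {Set.univ} := fun s hs =>
    cylCx_mono bot_le le_rfl subset_rfl (mem_cylCx_univ hs)
  obtain ⟨b, hb⟩ := exists_coneFamily g₁ (boundaryShape (n + 1)) Set.empty_ne_univ hA hgc
    fun k a h => app_highChain_of_agree hW hgW a h
  obtain ⟨b', hb'⟩ := hc n b (hW.restrict_eq_of_agree hgW hb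
    ((cylCx_mono le_rfl topSets_le subset_rfl).trans hA))
  obtain ⟨F, hF⟩ := exists_realizes (simplexShape (n + 1)) b'
  have hle : cylCx P (⊥ : LowerSet (Set (Fin (n + 2)))) (bdrySets (n + 1)) fatKinds ≤
    cylCx P ⊥ ⊤ fatKinds := cylCx_mono le_rfl le_top subset_rfl
  have hFb := hF.restrict (boundaryShape (n + 1))
    (∂Δ[n + 1] : (Δ[n + 1] : SSet.{u}).Subcomplex).ι OrderHom.id rfl (fun k x h => ⟨trivial, rfl⟩)
    (cylCx P ⊥ (bdrySets (n + 1)) fatKinds) fun s hs _ => hle (by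
      rwa [show ⇑(cylMap P (OrderHom.id : Fin (n + 2) →o _)) = id from rfl, Set.image_id])
  rw [hb'] at hFb
  have hFg : F.Agree (g₁.res (cylCx P (bdrySets (n + 1)) (bdrySets (n + 1)) ∅) fun s hs _ =>
      cylCx_mono bot_le le_rfl subset_rfl (mem_cylCx_univ hs)) := by
    intro k x hx hx'
    have hxb : Set.range x ∈ cylCx P ⊥ (bdrySets (n + 1)) fatKinds := ⟨hx.1, hx'.2.1, hx.2.2⟩
    exact hFb.app_eq hb Set.empty_ne_univ le_rfl hA x hxb hxb _
  obtain ⟨g₂, h₂F, h₂g⟩ := exists_glue_cyl F _ hFg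
  -- The cylinder over ∂Δⁿ⁺¹ is kept as already constructed, so the restriction to thin cones
  -- extends the original data strictly.
  obtain ⟨g₃, hg₃⟩ := exists_extension_fat g₂
  refine ⟨g₃.pull (thinIncl n P) ⊤ fun s _ _ => cylCx_mono bot_le le_rfl subset_rfl
    (thinIncl_mem s), ?_⟩
  intro k x _ hx
  have hm := range_comp_mem' (thinIncl n P) x (thinIncl_mem _)
  have hb : Set.range ((thinIncl n P).comp x) ∈ cylCx P ⊥ (bdrySets (n + 1)) thinKinds := by
    refine ⟨hm.1, fun h => ?_, Or.inr ⟨{0, 3}, by simp [thinKinds], ?_⟩⟩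
    · refine supp_thinIncl_ne_univ hx ?_
      rwa [← Set.range_comp]
    · rintro _ ⟨i, rfl⟩
      exact thinIncl_kind _
  have h₁ : Set.range ((thinIncl n P).comp x) ∈ cylCx P (bdrySets (n + 1)) (bdrySets (n + 1)) ∅ :=
    ⟨hm.1, hb.2.1, Or.inl hb.2.1⟩
  refine (hg₃ _ _ ⟨hm.1, trivial, Or.inl hb.2.1⟩).trans ((h₂g _ _ h₁).trans ((hg _ _
    (cylCx_mono bot_le le_rfl subset_rfl hb)).trans ((hg₁ _ _ hb).trans (f.app_congr ?_ _ _))))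
  ext1
  funext i
  exact thinProj_thinIncl _

/-- The transport in the other direction: a boundary of fat cones ending in `c` is extended to the
cylinder, exactness fills the corresponding thin cones, and these are extended back over the
cylinder, which is left unchanged over ∂Δⁿ⁺¹. -/
theorem isLimit_of_isExact (hW : W.Realizes (simplexShape 0) c)
    (hD : ∀ ⦃k : ℕ⦄ (x : Fin (k + 1) →o P) (h),
      W.app ((baseIncl 0 P).comp x) h = D.app x trivial) (hDe : D.IsExact {⊥}ᶜ) : c.IsLimit := by
  intro n b hb
  obtain ⟨F, hF⟩ := exists_realizes (boundaryShape (n + 1)) b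
  obtain ⟨g₀, hg₁, hg₂⟩ := exists_glue_cyl F _ (hW.agree_lastSlice hF hb)
  have hg₀ : g₀.IsCone := hF.isCone.of_agree hg₁ fun s hs h =>
    mem_cylCx_of_kinds (by simp [fatKinds]) (by simp [fatKinds]) hs h
  obtain ⟨g₁, hg⟩ := exists_extension_fat g₀
  have hgc : g₁.IsCone := hg₀.of_agree hg fun s hs h => cylCx_mono bot_le le_rfl subset_rfl
    (mem_cylCx_of_kinds (by simp [fatKinds]) (by simp [fatKinds]) hs h)
  have hgW : g₁.Agree (lastSlice W (n + 1)) := fun k x hx hx' =>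
    (hg x hx ⟨hx'.1, topSets_le hx'.2.1, Or.inl hx'.2.1⟩).trans (hg₂ _ _ hx')
  have hdom : ∀ s ∈ exCx (Fin (n + 1)) ({⊥}ᶜ : Set P), thinIncl n P '' s ∈
      cylCx P (topSets (n + 1)) (bdrySets (n + 1)) {Set.univ} := fun s hs =>
    ⟨(thinIncl_mem s).1, supp_thinIncl_ne_univ hs, Or.inr ⟨_, rfl, fun _ _ => trivial⟩⟩
  let f : PMap (exCx (Fin (n + 1)) ({⊥}ᶜ : Set P)) E :=
    g₁.pull (thinIncl n P) _ fun s hs _ => hdom s hs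
  obtain ⟨g₂, hgf⟩ := hDe n f (by
    intro k x hx
    have hm := range_comp_mem' (thinIncl n P) _ (hdom _ hx)
    have hs : supp (Set.range ((thinIncl n P).comp ((inrEmb (Fin (n + 1)) P :
        P →o Fin (n + 1) ⊕ₗ P).comp x))) ∈ topSets (n + 1) := by
      rintro _ ⟨_, ⟨i, rfl⟩, rfl, -⟩
      rfl
    have hm₀ := range_comp_mem' (baseIncl 0 P) x (baseIncl_mem _)
    refine (hgW _ hm ⟨hm.1, hs, Or.inl hs⟩).trans ((W.app_congr ?_ _ hm₀).trans (hD x hm₀))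
    ext1
    funext i
    exact Prod.ext (Subsingleton.elim (α := Fin 1) _ _) rfl)
  let p : PMap (cylCx P (⊥ : LowerSet (Set (Fin (n + 2)))) ⊤ thinKinds) E :=
    g₂.pull (thinProj n P) _ fun _ _ _ => trivial
  have hp : p.IsCone := by
    intro k x hx hx' _
    refine g₂.app_congr ?_ _ _
    ext1
    funext i
    exact (thinProj_collapse (x i)).symm
  have hpg : p.Agree (g₁.res (cylCx P (bdrySets (n + 1)) (bdrySets (n + 1)) ∅) fun s hs _ =>
      cylCx_mono bot_le le_rfl subset_rfl (mem_cylCx_univ hs)) := by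
    intro k x hx hx'
    have hb : Set.range x ∈ cylCx P ⊥ (bdrySets (n + 1)) thinKinds := ⟨hx.1, hx'.2.1, hx.2.2⟩
    have h₁ := range_comp_mem' (thinProj n P) x (image_thinProj_mem hb)
    have e : (thinIncl n P).comp ((thinProj n P).comp x) = (collapse _ P).comp x := by
      ext1
      funext i
      exact thinIncl_thinProj (hx.1 _ ⟨i, rfl⟩)
    have h₂ := range_comp_mem' (thinIncl n P) _ (hdom _ h₁)
    exact (hgf _ _ h₁).trans ((g₁.app_congr e h₂ (e ▸ h₂)).trans
      (hgc.app_collapse x (cylCx_mono bot_le le_rfl subset_rfl (mem_cylCx_univ hb)) _ hb).symm)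
  obtain ⟨g₃, h₃p, h₃g⟩ := exists_glue_cyl p _ hpg
  have hg₃ : g₃.IsCone := hp.of_agree h₃p fun s hs h =>
    mem_cylCx_of_kinds (by simp [thinKinds]) (by simp [thinKinds]) hs h
  obtain ⟨g₄, h₄⟩ := exists_extension_thin g₃ hg₃
  have hg₄ : g₄.IsCone := hg₃.of_agree h₄ fun s hs h => cylCx_mono bot_le le_rfl subset_rfl
    (mem_cylCx_of_kinds (by simp [thinKinds]) (by simp [thinKinds]) hs h)
  have h₄g : ∀ ⦃k : ℕ⦄ (x : Fin (k + 1) →o Fin (n + 2) × Fin 4 × P) (hx hx'),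
      Set.range x ∈ cylCx P ⊥ (bdrySets (n + 1)) {Set.univ} → g₄.app x hx = g₁.app x hx' := by
    intro k x hx hx' hm
    have hm' : Set.range x ∈ cylCx P (bdrySets (n + 1)) (bdrySets (n + 1)) ∅ :=
      ⟨hm.1, hm.2.1, Or.inl hm.2.1⟩
    exact (h₄ _ _ ⟨hm.1, trivial, Or.inl hm.2.1⟩).trans (h₃g _ _ hm')
  have hA : cylCx P ⊥ (bdrySets (n + 1)) fatKinds ≤
      cylCx P (topSets (n + 1)) (bdrySets (n + 1)) {Set.univ} := fun s hs =>
    cylCx_mono bot_le le_rfl subset_rfl (mem_cylCx_univ hs)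
  have hA₄ : cylCx P ⊥ ⊤ fatKinds ≤ cylCx P (bdrySets (n + 1)) ⊤ {Set.univ} := fun s hs =>
    cylCx_mono bot_le le_rfl subset_rfl (mem_cylCx_univ hs)
  have h₄W : g₄.Agree (lastSlice W (n + 1)) := fun k x hx hx' => by
    have hm : Set.range x ∈ cylCx P ⊥ (bdrySets (n + 1)) {Set.univ} :=
      cylCx_mono le_rfl topSets_le subset_rfl (mem_cylCx_univ hx')
    have hx₁ : Set.range x ∈ cylCx P (topSets (n + 1)) (bdrySets (n + 1)) {Set.univ} :=
      cylCx_mono bot_le le_rfl subset_rfl hm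
    exact (h₄g x hx hx₁ hm).trans (hgW x hx₁ hx')
  obtain ⟨b', hb'⟩ := exists_coneFamily g₄ (simplexShape (n + 1)) trivial hA₄ hg₄
    fun k a h => app_highChain_of_agree hW h₄W a h
  refine ⟨b', ?_⟩
  have hle : cylCx P (⊥ : LowerSet (Set (Fin (n + 2)))) (bdrySets (n + 1)) fatKinds ≤
    cylCx P ⊥ ⊤ fatKinds := cylCx_mono le_rfl le_top subset_rfl
  have hbb := hb'.restrict (boundaryShape (n + 1))
    (∂Δ[n + 1] : (Δ[n + 1] : SSet.{u}).Subcomplex).ι OrderHom.id rfl (fun k x h => ⟨trivial, rfl⟩)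
    (cylCx P ⊥ (bdrySets (n + 1)) fatKinds) fun s hs _ => hA₄ (hle (by
      rwa [show ⇑(cylMap P (OrderHom.id : Fin (n + 2) →o _)) = id from rfl, Set.image_id]))
  refine hbb.unique (hF.of_app_eq hbb.isCone Set.empty_ne_univ le_rfl ?_) le_rfl
  intro k x hx _ _
  refine (h₄g x _ (hA hx) (mem_cylCx_univ hx)).trans ((hg _ _ ?_).trans (hg₁ _ _ hx))
  exact cylCx_mono bot_le le_rfl subset_rfl hx

lemma coneProj_collapse (q : Fin (n + 1) × Fin 4 × P) :
    coneProj n P (collapse _ P q) = coneProj n P q := by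
  by_cases hk : q.2.1 ≤ 1
  · rw [collapse_low hk]
    change (if (0 : Fin 4) ≤ 1 then (⊥ : P) else ⊥) = if q.2.1 ≤ 1 then ⊥ else q.2.2
    rw [if_pos hk, ite_self]
  · rw [collapse_high (by omega)]
    change (if (3 : Fin 4) ≤ 1 then (⊥ : P) else q.2.2) = if q.2.1 ≤ 1 then ⊥ else q.2.2
    rw [if_neg hk, if_neg (by decide)]

lemma coneProj_baseIncl (p : P) : coneProj n P (baseIncl n P p) = p := by
  rcases baseIncl_kind (n := n) p with h | h
  · have h₁ : (baseIncl n P p).2.1 ≤ 1 := h.1 ▸ Fin.zero_le (1 : Fin 4)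
    exact (if_pos h₁).trans h.2.symm
  · have h₁ : ¬ (baseIncl n P p).2.1 ≤ 1 := h ▸ (by decide : ¬ (3 : Fin 4) ≤ 1)
    exact if_neg h₁

/-- A diagram on a poset with bottom element is a limit diagram if and only if it is exact at the
complement of the bottom element. -/
theorem _root_.InftyCat.isLimitDiagram_iff (D : N.{u} P ⟶ E) :
    IsLimitDiagram D ↔ (ofNerve D).IsExact {⊥}ᶜ := by
  -- The cylinder over a point projects to P. Pulled back along this projection, the diagram has `D`
  -- as its thin part and `coneOfDiagram D` as its fat part, so both theorems apply with the same
  -- `W`.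
  let W : PMap (cylCx P (⊥ : LowerSet (Set (Fin 1))) ⊤ {Set.univ}) E :=
    (ofNerve D).pull (coneProj 0 P) _ fun _ _ _ => trivial
  have hW : W.Realizes (simplexShape 0) (coneOfDiagram D) := by
    refine ⟨?_, fun k x h h' => ?_, fun k a x t h h' => ?_, fun k a h' => ?_⟩
    · intro k x hx hx' _
      refine (ofNerve D).app_congr ?_ trivial trivial
      ext1
      funext i
      exact (coneProj_collapse (x i)).symm
    · refine congrArg (D.app (op ⦋k⦌)) (nerve_ext fun i => ?_)
      rfl
    · refine congrArg (D.app (op ⦋k⦌)) (nerve_ext fun i => ?_)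
      change (if (t i).succ.castSucc ≤ 1 then (⊥ : P) else (a i).1) = if t i = 0 then ⊥ else (a i).1
      generalize t i = j
      fin_cases j <;> rfl
    · refine congrArg (D.app (op ⦋k⦌)) (nerve_ext fun i => ?_)
      rfl
  have hD : ∀ ⦃k : ℕ⦄ (x : Fin (k + 1) →o P) (h),
      W.app ((baseIncl 0 P).comp x) h = (ofNerve D).app x trivial := by
    intro k x h
    refine (ofNerve D).app_congr ?_ trivial trivial
    ext1
    funext i
    exact coneProj_baseIncl _
  exact ⟨isExact_of_isLimit hW hD, isLimit_of_isExact hW hD⟩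

/-- The limit cone supplied by `HasFiniteLimits` is fat. Its extension to the cylinder contains a
thin cone over the same base, and that is the diagram on P. -/
theorem exists_isExact (hE : HasFiniteLimits E) [(N.{u} (NonBot P)).Finite]
    (d : N.{u} (NonBot P) ⟶ E) : ∃ D : PMap (⊤ : LowerSet (Set P)) E, D.IsExact {⊥}ᶜ ∧
      ∀ ⦃k : ℕ⦄ (a : Fin (k + 1) →o NonBot P),
        D.app ((OrderHom.Subtype.val (· ≠ (⊥ : P))).comp a) trivial =
          d.app (op ⦋k⦌) (nerveMk (m := op ⦋k⦌) a) := by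
  obtain ⟨c, hc⟩ := hE _ d
  obtain ⟨F, hF⟩ := exists_realizes (simplexShape 0) c
  obtain ⟨W, hWF⟩ := exists_extension_fat F
  have hW : W.Realizes (simplexShape 0) c := by
    refine hF.of_app_eq (hF.isCone.of_agree hWF fun s hs h => ?_) trivial le_rfl
      fun k x _ hx hx' => hWF x hx' hx
    exact mem_cylCx_of_kinds (by simp [fatKinds]) (by simp [fatKinds]) hs h
  refine ⟨W.pull (baseIncl 0 P) ⊤ fun _ _ _ => baseIncl_mem _, isExact_of_isLimit hW
    (fun _ _ _ => rfl) hc, fun k a => ?_⟩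
  have hm := mem_cylCx_univ (highChain_mem (n := 0) (S' := ⊤) trivial a)
  refine (W.app_congr ?_ _ hm).trans (hW.high a hm)
  classical
  ext1
  funext i
  exact Prod.ext rfl (Prod.ext (if_neg (a i).2) rfl)

end PMap

/-- A chain with more entries than J has elements takes the same value at two consecutive places, so
it is degenerate. -/
lemma finite_N (J : Type) [PartialOrder J] [Finite J] : (N.{u} J).Finite := by
  cases nonempty_fintype J
  have hd : (N.{u} J).HasDimensionLT (Fintype.card J) := by
    refine ⟨fun n hn => Set.eq_univ_of_forall fun x => ?_⟩
    have hx : ¬ Function.Injective (nerveHom x) := fun h => by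
      have := Fintype.card_le_of_injective _ h
      rw [Fintype.card_fin] at this
      exact absurd (this.trans hn) (Nat.not_succ_le_self n)
    obtain ⟨i, hi⟩ : ∃ i : Fin n, nerveHom x i.castSucc = nerveHom x i.succ := by
      by_contra! h
      exact hx (Fin.strictMono_iff_lt_succ.2 fun i =>
        ((nerveHom x).monotone (Fin.castSucc_lt_succ (i := i)).le).lt_of_ne (h i)).injective
    obtain _ | n := n
    · exact i.elim0
    have e : (N.{u} J).σ i ((N.{u} J).δ i.castSucc x) = x := by
      refine nerve_ext fun j => ?_
      change nerveHom x (i.castSucc.succAbove (i.predAbove j)) = nerveHom x j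
      by_cases h : j = i.castSucc
      · rw [h, Fin.predAbove_castSucc_self, Fin.succAbove_castSucc_self, hi]
      · rw [Fin.succAbove_predAbove h]
    rw [← e]
    exact SSet.σ_mem_degenerate _ _ _
  have : ∀ n, Finite ((N.{u} J) _⦋n⦌) := fun n =>
    Finite.of_injective (fun x i => nerveHom x i) fun x y h => nerve_ext fun i => congrFun h i
  exact SSet.finite_of_hasDimensionLT _ (Fintype.card J) fun _ _ => inferInstance

end LimitCones

/-! ### Families of limits -/

section Products

variable {P Q : Type} [PartialOrder P] [OrderBot P] [PartialOrder Q] {E : SSet.{u}}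

/-- The chains of a product with proper projection to the ordinal. -/
def fstCx (m : ℕ) (Q : Type) : LowerSet (Set (Fin (m + 1) × Q)) :=
  mkCx (fun s => Prod.fst '' s ≠ Set.univ) fun _ _ h hs h' =>
    hs (Set.univ_subset_iff.1 (h' ▸ Set.image_mono h))

/-- The chains of a product with projection in `A`. -/
def sndCx (m : ℕ) (A : LowerSet (Set Q)) : LowerSet (Set (Fin (m + 1) × Q)) :=
  mkCx (fun s => Prod.snd '' s ∈ A) fun _ _ h hs => A.lower (Set.image_mono h) hs

/-- The chains that do not contain the whole complement of the cone `ι`, or do not contain its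
apex. -/
def coneCx (ι : P ↪o Q) : LowerSet (Set Q) :=
  mkCx (fun s => ι ⊥ ∉ s ∨ ¬ (Set.range ι)ᶜ ⊆ s) fun _ _ h hs =>
    hs.imp (fun h₁ h₂ => h₁ (h h₂)) fun h₁ h₂ => h₁ (h₂.trans h)

/-- The inclusion of a fibre of the projection to the ordinal. -/
def slice (m : ℕ) (Q : Type) [PartialOrder Q] (j : Fin (m + 1)) : Q ↪o Fin (m + 1) × Q where
  toFun q := (j, q)
  inj' _ _ h := (Prod.mk.inj h).2
  map_rel_iff' := ⟨fun h => h.2, fun h => ⟨le_rfl, h⟩⟩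

/-- In positive dimension a single vertex of the ordinal is a proper face; conditions on fibres over
vertices can thus be read off from the boundary. -/
lemma slice_mem {m : ℕ} (hm : 0 < m) (j : Fin (m + 1)) (s : Set Q) : slice m Q j '' s ∈ fstCx m Q := by
  intro h
  have hj : ∀ r : Fin (m + 1), r = j := by
    intro r
    obtain ⟨_, ⟨q, -, rfl⟩, rfl⟩ := h.symm ▸ Set.mem_univ r
    rfl
  have := congrArg Fin.val ((hj 0).trans (hj ⊤).symm)
  exact absurd this hm.ne

namespace PMap

variable [SSet.Quasicategory E] [Finite P] [Finite Q]

/-- Families of cones parametrized by a simplex extend if the last one is a limit. -/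
theorem exists_extension_prod (ι : P ↪o Q) (hι : ∀ q ∉ Set.range ι, ∀ p, q ≤ ι p) {m : ℕ}
    (hm : 0 < m) (f : PMap (fstCx m Q ⊔ sndCx m (coneCx ι)) E)
    {D : PMap (⊤ : LowerSet (Set P)) E} (hD : D.IsExact {⊥}ᶜ) (hf : f.Over (ι.trans (slice m Q ⊤)) D) :
    ∃ g : PMap (⊤ : LowerSet (Set (Fin (m + 1) × Q))) E, g.Agree f := by
  -- `B` enlarges the given domain by the chains that can be added without the limit property: those
  -- that avoid the vertex `(⊤, ι ⊥)`.
  let B : LowerSet (Set (Fin (m + 1) × Q)) := fstCx m Q ⊔ mkCx (fun s => (⊤, ι ⊥) ∉ s ∨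
    ¬ (Set.range ι)ᶜ ⊆ Prod.snd '' s) fun _ _ h hs => hs.imp (fun h₁ h₂ => h₁ (h h₂))
      fun h₁ h₂ => h₁ (h₂.trans (Set.image_mono h))
  have hB : ∀ s, s ∉ B → Prod.fst '' s = Set.univ ∧ (⊤, ι ⊥) ∈ s ∧ (Set.range ι)ᶜ ⊆ Prod.snd '' s := by
    intro s hs
    have h := not_or.1 hs
    have h' := not_or.1 h.2
    exact ⟨not_not.1 h.1, not_not.1 h'.1, not_not.1 h'.2⟩
  let M₁ : Set (Fin (m + 1) × Q) := {q | q.2 = ι ⊥}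
  let M₂ : Fin (m + 1) × Q → Set (Fin (m + 1) × Q) := fun q₁ => {q | q₁.1 < q.1}
  -- Prism filling. After the last vertex over `ι ⊥`, the next vertex with larger first coordinate
  -- is reached through the corner that keeps the old first coordinate and has the new second
  -- coordinate. Such a next vertex exists because the chain meets all of the ordinal but avoids
  -- `(⊤, ι ⊥)`.
  obtain ⟨f₁, h₁⟩ := exists_extension_comma (B := B) f M₁ M₂
    IsGreatest IsLeast isGreatest_unique isLeast_unique (fun q₁ q₂ => (q₁.1, q₂.2)) (by
      intro s hs hsA hc
      have h := not_or.1 hsA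
      have h' := not_or.1 h.2
      have hfst : Prod.fst '' s = Set.univ := not_not.1 h.1
      have hbot : ι ⊥ ∈ Prod.snd '' s := not_not.1 h'.1
      have hall : (Set.range ι)ᶜ ⊆ Prod.snd '' s := not_not.1 h'.2
      have htop : (⊤, ι ⊥) ∉ s := by
        rcases hs with hs | hs
        · exact absurd hfst hs
        · exact hs.resolve_right fun h => h hall
      obtain ⟨⟨k, _⟩, hk, rfl⟩ := hbot
      obtain ⟨q₁, hq₁⟩ := (hc.mono (Set.inter_subset_left (t := M₁))).exists_isGreatest
        ⟨_, hk, rfl⟩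
      have hq₁' : q₁.2 = ι ⊥ := hq₁.1.2
      obtain ⟨t, ht, ht'⟩ : ∃ t ∈ s, q₁.1 < t.1 := by
        obtain ⟨t, ht, e⟩ := hfst.symm ▸ Set.mem_univ (⊤ : Fin (m + 1))
        refine ⟨t, ht, lt_of_le_of_ne (e ▸ le_top) fun e' => htop ?_⟩
        rw [← hq₁', ← e, ← e']
        exact hq₁.1.1
      obtain ⟨q₂, hq₂⟩ := (hc.mono (Set.inter_subset_left (t := M₂ q₁))).exists_isLeast
        ⟨t, ht, ht'⟩
      have hlt : q₁.1 < q₂.1 := hq₂.1.2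
      have hq₁₂ : q₁ ≤ q₂ := (hc.total hq₁.1.1 hq₂.1.1).resolve_right fun h =>
        absurd hlt (not_lt.2 h.1)
      have hne : q₂.2 ≠ ι ⊥ := fun h => absurd hlt (not_lt.2 (hq₁.2 ⟨hq₂.1.1, h⟩).1)
      refine ⟨q₁, q₂, hq₁, hq₂, hne, lt_irrefl q₁.1, Or.inr (Or.inl ?_), ?_, ?_, fun hκ => ?_⟩
      · rintro (h | h)
        · exact hne (Prod.mk.inj h).2.symm
        · exact htop h
      · intro q hq
        by_cases hk : q₁.1 < q.1
        · exact Or.inr ⟨hk.le, (hq₂.2 ⟨hq, hk⟩).2⟩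
        · refine Or.inl ⟨not_lt.1 hk, ((hc.total hq hq₂.1.1).resolve_right fun h => hk ?_).2⟩
          exact hlt.trans_le h.1
      · rintro (h | h | h)
        · refine h (Set.eq_univ_of_forall fun r => ?_)
          by_cases hr : r = q₁.1
          · exact ⟨q₁, ⟨hq₁.1.1, fun e => hne ((congrArg Prod.snd (show q₁ = (q₁.1, q₂.2) from e)).symm.trans hq₁')⟩, hr.symm⟩
          · obtain ⟨q, hq, rfl⟩ := hfst.symm ▸ Set.mem_univ r
            exact ⟨q, ⟨hq, fun e => hr (by rw [show q = (q₁.1, q₂.2) from e])⟩, rfl⟩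
        · exact h ⟨q₁, ⟨hq₁.1.1, fun e => hne ((congrArg Prod.snd (show q₁ = (q₁.1, q₂.2) from e)).symm.trans hq₁')⟩, hq₁'⟩
        · refine h fun q hq => ?_
          obtain ⟨x, hx, rfl⟩ := hall hq
          by_cases e : x = (q₁.1, q₂.2)
          · exact ⟨q₂, ⟨hq₂.1.1, fun e' => hlt.ne' (by rw [show q₂ = (q₁.1, q₂.2) from e'])⟩, by rw [e]⟩
          · exact ⟨x, ⟨hx, e⟩, rfl⟩
      · exact Or.inl ⟨q₁, hq₁.1.1, q₂, hq₂.1.1,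
          lt_of_le_of_ne ⟨le_rfl, hq₁₂.2⟩ fun e => hκ (e ▸ hq₁.1.1),
          lt_of_le_of_ne ⟨hlt.le, le_rfl⟩ fun e => hκ (e ▸ hq₂.1.1)⟩)
  have hmem : ∀ s : Set P, (ι.trans (slice m Q ⊤)) '' s ∈ fstCx m Q := fun s => by
    have h := slice_mem hm ⊤ (ι '' s)
    rwa [← Set.image_comp] at h
  -- The remaining chains contain `(⊤, ι ⊥)`. Their part outside the cone over `⊤` lies below that
  -- cone, so exactness of the last fibre supplies the extension.
  obtain ⟨g, hg⟩ := hD.exists_extension (B := ⊤) f₁ (ι.trans (slice m Q ⊤))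
    (hf.of_agree h₁ fun s _ => Or.inl (hmem s)) (by
      intro s _ hs hc
      obtain ⟨hfst, htop, hall⟩ := hB s hs
      obtain ⟨x, hx, hx'⟩ := hfst.symm ▸ Set.mem_univ (0 : Fin (m + 1))
      refine ⟨⟨x, hx, ?_⟩, ?_, fun μ _ => ⟨trivial, ?_, ?_⟩⟩
      · rintro ⟨p, rfl⟩
        exact absurd (congrArg Fin.val hx') hm.ne'
      · rintro q ⟨hq, hq'⟩ p
        rcases hc.total hq htop with h | h
        · exact h.trans ⟨le_rfl, ι.monotone bot_le⟩
        · have e : q.1 = ⊤ := le_antisymm le_top h.1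
          have hr : q.2 ∉ Set.range ι := by
            rintro ⟨p', hp'⟩
            exact hq' ⟨p', Prod.ext e.symm hp'⟩
          exact ⟨le_top, hι _ hr p⟩
      · rintro (h | h | h) p hp rfl
        · refine h (Set.eq_univ_of_forall fun r => ?_)
          by_cases hr : r = ⊤
          · exact ⟨_, Or.inr ⟨_, hp, rfl⟩, hr.symm⟩
          · obtain ⟨q, hq, rfl⟩ := hfst.symm ▸ Set.mem_univ r
            refine ⟨q, Or.inl ⟨hq, ?_⟩, rfl⟩
            rintro ⟨p', rfl⟩
            exact hr rfl
        · exact h (Or.inr ⟨_, hp, rfl⟩)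
        · refine h fun q hq => ?_
          obtain ⟨x, hx, rfl⟩ := hall hq
          refine ⟨x, Or.inl ⟨hx, ?_⟩, rfl⟩
          rintro ⟨p', rfl⟩
          exact hq ⟨p', rfl⟩
      · intro h
        refine Or.inr (Or.inl ?_)
        rintro (h' | ⟨p, hp, e⟩)
        · exact h'.2 ⟨⊥, rfl⟩
        · exact h hp (ι.injective (Prod.mk.inj e).2))
  refine ⟨g, hg.trans h₁ ?_⟩
  rintro s ⟨-, hs | hs⟩
  · exact Or.inl hs
  · refine Or.inr (hs.imp (fun h h' => h ⟨_, h', rfl⟩) id)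

end PMap

end Products

/-! ### Retracts of limit cones. -/

section Retracts

variable {P : Type} [PartialOrder P] [OrderBot P] {E : SSet.{u}}

open Classical in
/-- The inclusion of a cone in a join that replaces the apex by an element of `R`. -/
noncomputable def apexEmb {R : Type} [PartialOrder R] (P : Type) [PartialOrder P] [OrderBot P] (r : R) :
    P ↪o R ⊕ₗ P where
  toFun p := if p = ⊥ then Sum.inlₗ r else Sum.inrₗ p
  inj' p p' h := by
    dsimp only at h
    split_ifs at h with h₁ h₂ h₂
    · rw [h₁, h₂]
    · exact absurd h.symm inr_ne_inl
    · exact absurd h inr_ne_inl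
    · exact inrₗ_inj.1 h
  map_rel_iff' {p p'} := by
    change (if p = ⊥ then Sum.inlₗ r else Sum.inrₗ p : R ⊕ₗ P) ≤
      (if p' = ⊥ then Sum.inlₗ r else Sum.inrₗ p' : R ⊕ₗ P) ↔ p ≤ p'
    split_ifs with h₁ h₂ h₂
    · exact iff_of_true le_rfl (h₁ ▸ bot_le)
    · exact iff_of_true (Sum.Lex.inl_le_inr _ _) (h₁ ▸ bot_le)
    · exact iff_of_false Sum.Lex.not_inr_le_inl fun h => h₁ (le_bot_iff.1 (h₂ ▸ h))
    · exact Sum.Lex.inr_le_inr_iff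

lemma apexEmb_bot {R : Type} [PartialOrder R] (r : R) : apexEmb P r ⊥ = Sum.inlₗ r := if_pos rfl

lemma apexEmb_of_ne {R : Type} [PartialOrder R] (r : R) {p : P} (h : p ≠ ⊥) :
    apexEmb P r p = Sum.inrₗ p := if_neg h

/-- The map that collapses `R` to the apex. -/
def foldApex (R P : Type) [PartialOrder R] [PartialOrder P] [OrderBot P] : R ⊕ₗ P →o P where
  toFun q := Sum.elim (fun _ => ⊥) id (ofLex q)
  monotone' x y h := by
    rcases lex_cases x with ⟨r, rfl⟩ | ⟨p, rfl⟩ <;> rcases lex_cases y with ⟨r', rfl⟩ | ⟨p', rfl⟩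
    · exact le_rfl
    · exact bot_le
    · exact absurd h Sum.Lex.not_inr_le_inl
    · exact Sum.Lex.inr_le_inr_iff.1 h

lemma foldApex_apexEmb {R : Type} [PartialOrder R] (r : R) (p : P) :
    foldApex R P (apexEmb P r p) = p := by
  by_cases h : p = ⊥
  · rw [h, apexEmb_bot]
    rfl
  · rw [apexEmb_of_ne r h]
    rfl

namespace PMap

variable [SSet.Quasicategory E] [Finite P]

/-- A retract of a limit cone is a limit cone. -/
theorem IsExact.of_retract {D D₁ : PMap (⊤ : LowerSet (Set P)) E}
    (H : PMap (⊤ : LowerSet (Set (Fin 2 ⊕ₗ P))) E)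
    (h₁ : H.Over (apexEmb P 1) D₁)
    (h₂ : ∀ ⦃k : ℕ⦄ (x : Fin (k + 1) →o Fin 2 ⊕ₗ P), (∀ i, x i ≠ Sum.inlₗ 1) →
      H.app x trivial = D.app ((foldApex (Fin 2) P).comp x) trivial)
    (hD : D₁.IsExact {⊥}ᶜ) : D.IsExact {⊥}ᶜ := by
  intro n f hf
  let Q := Fin (n + 1) ⊕ₗ (Fin 2 ⊕ₗ P)
  -- Three apexes c₀ → c₁ → c₂ belong to `D`, `D₁` and `D`, with c₀ → c₂ degenerate. The given
  -- family of cones uses c₀; it will be filled at c₁ and brought back through c₂.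
  let c₀ : Q := Sum.inrₗ (Sum.inlₗ 0)
  let c₁ : Q := Sum.inrₗ (Sum.inlₗ 1)
  let c₂ : Q := Sum.inrₗ (Sum.inrₗ ⊥)
  have hcases : ∀ q : Q, (∃ r, q = Sum.inlₗ r) ∨ q = c₀ ∨ q = c₁ ∨ q = c₂ ∨
      ∃ p : P, p ≠ ⊥ ∧ q = Sum.inrₗ (Sum.inrₗ p) := by
    intro q
    rcases lex_cases q with h | ⟨q, rfl⟩
    · exact Or.inl h
    rcases lex_cases q with ⟨r, rfl⟩ | ⟨p, rfl⟩
    · fin_cases r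
      · exact Or.inr (Or.inl rfl)
      · exact Or.inr (Or.inr (Or.inl rfl))
    · by_cases hp : p = ⊥
      · exact Or.inr (Or.inr (Or.inr (Or.inl (by rw [hp]))))
      · exact Or.inr (Or.inr (Or.inr (Or.inr ⟨p, hp, rfl⟩)))
  let ψ : Q →o Fin (n + 1) ⊕ₗ P := joinMap OrderHom.id (foldApex (Fin 2) P)
  let π : Q →o Fin 2 ⊕ₗ P :=
    { toFun := fun q => Sum.elim (fun _ => Sum.inlₗ 0) id (ofLex q)
      monotone' := by
        intro x y h
        rcases lex_cases x with ⟨r, rfl⟩ | ⟨p, rfl⟩ <;> rcases lex_cases y with ⟨r', rfl⟩ | ⟨p', rfl⟩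
        · exact le_rfl
        · change Sum.inlₗ 0 ≤ p'
          rcases lex_cases p' with ⟨r', rfl⟩ | ⟨p', rfl⟩
          · exact Sum.Lex.inl_le_inl_iff.2 (Fin.zero_le _)
          · exact Sum.Lex.inl_le_inr _ _
        · exact absurd h Sum.Lex.not_inr_le_inl
        · exact Sum.Lex.inr_le_inr_iff.1 h }
  have hψπ : ∀ p, Sum.inrₗ (foldApex (Fin 2) P (π (Sum.inrₗ p))) = ψ (Sum.inrₗ p) := fun _ => rfl
  let X₁ : LowerSet (Set Q) := mkCx (fun s => c₁ ∉ s ∧ c₂ ∉ s ∧ ¬ (HasAll s ∧ c₀ ∈ s))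
    fun _ _ h hs => ⟨fun h' => hs.1 (h h'), fun h' => hs.2.1 (h h'),
      fun h' => hs.2.2 ⟨h'.1.mono h, h h'.2⟩⟩
  let X₂ : LowerSet (Set Q) := mkCx HasNone fun _ _ h hs => hs.mono h
  let pf : PMap X₁ E := f.pull ψ X₁ fun s hs _ => by
    by_cases hall : HasAll s
    · refine Or.inl fun p hp => ?_
      obtain ⟨q, hq, rfl⟩ := inr_mem_joinMap_image.1 hp
      rintro e
      rcases hcases (Sum.inrₗ q) with ⟨r, h⟩ | h | h | h | ⟨p, hp, h⟩
      · exact inr_ne_inl h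
      · exact hs.2.2 ⟨hall, h ▸ hq⟩
      · exact hs.1 (h ▸ hq)
      · exact hs.2.1 (h ▸ hq)
      · rw [inrₗ_inj.1 h] at e
        exact hp e
    · exact Or.inr fun h => hall (hasAll_joinMap_image.1 h)
  let pH : PMap X₂ E := H.pull π X₂ fun _ _ _ => trivial
  have hXfH : pf.Agree pH := by
    intro k x hx hx'
    have e : ψ.comp x = (inrEmb (Fin (n + 1)) P : P →o Fin (n + 1) ⊕ₗ P).comp
        ((foldApex (Fin 2) P).comp (π.comp x)) := by
      ext1
      funext i
      change ψ (x i) = Sum.inrₗ (foldApex (Fin 2) P (π (x i)))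
      rcases lex_cases (x i) with ⟨r, h⟩ | ⟨p, h⟩
      · exact absurd ⟨i, h⟩ (hx' r)
      · rw [h]
        rfl
    have hm := range_comp_mem' ψ x (A := exCx (Fin (n + 1)) ({⊥}ᶜ : Set P)) (Or.inr ?_)
    refine (f.app_congr e hm (e ▸ hm)).trans ((hf _ _).trans (h₂ _ fun i h => ?_).symm)
    · rcases hcases (x i) with ⟨r, h'⟩ | h' | h' | h' | ⟨p, hp, h'⟩
      · exact hx' r ⟨i, h'⟩
      · have h₃ : π (x i) = Sum.inlₗ 0 := congrArg π h'
        exact absurd (inlₗ_inj.1 (h₃.symm.trans h)) (by decide)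
      · exact hx.1 ⟨i, h'⟩
      · exact inr_ne_inl ((congrArg π h').symm.trans h)
      · exact inr_ne_inl ((congrArg π h').symm.trans h)
    · exact fun h => hx' 0 (hasAll_joinMap_image.1 h 0)
  let g₀ := glue pf pH hXfH
  let ι₁ : P ↪o Q := (apexEmb P (1 : Fin 2)).trans (inrEmb _ _)
  have hι₁ : ι₁ ⊥ = c₁ := congrArg Sum.inrₗ (apexEmb_bot _)
  have hι₁' : ∀ p, p ≠ ⊥ → ι₁ p = Sum.inrₗ (Sum.inrₗ p) := fun p hp =>
    congrArg Sum.inrₗ (apexEmb_of_ne _ hp)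
  have hr₀ : c₀ ∉ Set.range ι₁ := by
    rintro ⟨p, hp⟩
    by_cases h : p = ⊥
    · rw [h, hι₁] at hp
      exact absurd (inlₗ_inj.1 (inrₗ_inj.1 hp)) (by decide)
    · rw [hι₁' p h] at hp
      exact inr_ne_inl (inrₗ_inj.1 hp)
  have hr₂ : c₂ ∉ Set.range ι₁ := by
    rintro ⟨p, hp⟩
    by_cases h : p = ⊥
    · rw [h, hι₁] at hp
      exact inr_ne_inl (inrₗ_inj.1 hp).symm
    · rw [hι₁' p h] at hp
      exact h (inrₗ_inj.1 (inrₗ_inj.1 hp))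
  have hrl : ∀ r, (Sum.inlₗ r : Q) ∉ Set.range ι₁ := by
    rintro r ⟨p, hp⟩
    exact inr_ne_inl hp
  let Ba : LowerSet (Set Q) := mkCx (fun s => c₂ ∉ s ∧ ¬ (HasAll s ∧ c₀ ∈ s))
    fun _ _ h hs => ⟨fun h' => hs.1 (h h'), fun h' => hs.2 ⟨h'.1.mono h, h h'.2⟩⟩
  have hBa : ∀ s ∈ Ba, ∀ μ : Set P, (s \ Set.range ι₁) ∪ ι₁ '' μ ∈ Ba := by
    refine fun s hs μ => ⟨?_, ?_⟩
    · rintro (h | ⟨p, -, h⟩)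
      · exact hs.1 h.1
      · exact hr₂ ⟨p, h⟩
    · rintro ⟨hall, h⟩
      refine hs.2 ⟨fun r => ?_, ?_⟩
      · exact ((hall r).resolve_right fun ⟨p, _, h⟩ => hrl r ⟨p, h⟩).1
      · exact (h.resolve_right fun ⟨p, _, h⟩ => hr₀ ⟨p, h⟩).1
  have hg₀ : g₀.Over ι₁ D₁ := by
    intro k x hx
    have hx' : Set.range ((ι₁ : P →o Q).comp x) ∈ X₂ := by
      rintro r ⟨i, hi⟩
      exact hrl r ⟨x i, hi⟩
    exact (glue_agree_right _ _ _ _ hx hx').trans (h₁ x trivial)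
  -- The limit property of `D₁` extends the family to the apex c₁. Chains that contain both c₀ and
  -- all of Δⁿ stay undefined.
  obtain ⟨ga, hga⟩ := hD.exists_extension (B := Ba) g₀ ι₁ hg₀ (by
    intro s hs hsA hc
    have hsA' := not_or.1 hsA
    have hnone : ∃ r, Sum.inlₗ r ∈ s := by
      by_contra! h
      exact hsA'.2 h
    obtain ⟨r, hr⟩ := hnone
    refine ⟨⟨_, hr, hrl r⟩, ?_, fun μ _ => ⟨hBa s hs μ, ?_, ?_⟩⟩
    · rintro q ⟨hq, hq'⟩ p
      have hp : ∃ p', ι₁ p = Sum.inrₗ p' ∧ Sum.inlₗ 0 ≤ p' := by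
        refine ⟨apexEmb P 1 p, rfl, ?_⟩
        by_cases h : p = ⊥
        · rw [h, apexEmb_bot]
          exact Sum.Lex.inl_le_inl_iff.2 (Fin.zero_le _)
        · rw [apexEmb_of_ne _ h]
          exact Sum.Lex.inl_le_inr _ _
      obtain ⟨p', e, hp'⟩ := hp
      rw [e]
      rcases hcases q with ⟨r, rfl⟩ | rfl | rfl | rfl | ⟨p, hp, rfl⟩
      · exact Sum.Lex.inl_le_inr _ _
      · exact Sum.Lex.inr_le_inr_iff.2 hp'
      · exact absurd ⟨⊥, hι₁⟩ hq'
      · exact absurd hq hs.1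
      · exact absurd ⟨p, hι₁' p hp⟩ hq'
    · rintro (h | h) p hp rfl
      · exact h.1 (Or.inr ⟨_, hp, hι₁⟩)
      · exact h r (Or.inl ⟨hr, hrl r⟩)
    · intro hμ
      refine Or.inl ⟨?_, hBa s hs μ⟩
      rintro (h | ⟨p, hp, h⟩)
      · exact h.2 ⟨⊥, hι₁⟩
      · exact hμ hp (ι₁.injective (h.trans hι₁.symm)))
  have hX₂ : ∀ s ∈ X₂, ¬ (HasAll s ∧ c₀ ∈ s) := fun s hs h => hs 0 (h.1 0)
  have haH : ga.Agree pH := hga.trans (glue_agree_right _ _ _) fun s hs => Or.inr hs.2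
  let Bb : LowerSet (Set Q) := mkCx (fun s => ¬ (HasAll s ∧ c₀ ∈ s))
    fun _ _ h hs => fun h' => hs ⟨h'.1.mono h, h h'.2⟩
  have hle₁ : ∀ q : Q, q ≤ c₁ ∨ c₁ ≤ q := by
    intro q
    rcases hcases q with ⟨r, rfl⟩ | rfl | rfl | rfl | ⟨p, hp, rfl⟩
    · exact Or.inl (Sum.Lex.inl_le_inr _ _)
    · exact Or.inl (Sum.Lex.inr_le_inr_iff.2 (Sum.Lex.inl_le_inl_iff.2 (Fin.zero_le _)))
    · exact Or.inl le_rfl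
    · exact Or.inr (Sum.Lex.inr_le_inr_iff.2 (Sum.Lex.inl_le_inr _ _))
    · exact Or.inr (Sum.Lex.inr_le_inr_iff.2 (Sum.Lex.inl_le_inr _ _))
  have hc₀₁ : c₀ ≠ c₁ := fun h => absurd (inlₗ_inj.1 (inrₗ_inj.1 h)) (by decide)
  have hc₂₀ : c₂ ≠ c₀ := fun h => inr_ne_inl (inrₗ_inj.1 h)
  have hc₂₁ : c₂ ≠ c₁ := fun h => inr_ne_inl (inrₗ_inj.1 h)
  have hc₁₂ : c₁ < c₂ := lt_of_le_of_ne
    (Sum.Lex.inr_le_inr_iff.2 (Sum.Lex.inl_le_inr _ _)) hc₂₁.symm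
  have hc₀₂ : c₀ < c₂ := lt_of_le_of_ne
    (Sum.Lex.inr_le_inr_iff.2 (Sum.Lex.inl_le_inr _ _)) hc₂₀.symm
  -- Composition with c₁ → c₂ : a missing chain contains c₂ and a vertex of Δⁿ, and c₁ lies strictly
  -- between them.
  obtain ⟨gb, hgb⟩ := exists_extension_inner_fixed (B := Bb) (glue ga pH haH) c₁ (by
    intro s hs hsA hc
    have hsA' := not_or.1 hsA
    have hc₂ : c₂ ∈ s := by
      by_contra h
      exact hsA'.1 ⟨h, hs⟩
    obtain ⟨r, hr⟩ : ∃ r, Sum.inlₗ r ∈ s := by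
      by_contra! h
      exact hsA'.2 h
    refine ⟨fun h => hs ⟨fun r => (h.1 r).resolve_left fun e => inr_ne_inl e.symm,
      h.2.resolve_left hc₀₁⟩, fun q _ => hle₁ q, ?_,
      ⟨_, hr, lt_of_le_of_ne (Sum.Lex.inl_le_inr _ _) fun e => inr_ne_inl e.symm⟩, c₂, hc₂, hc₁₂⟩
    rintro (h | h)
    · exact h.1 ⟨hc₂, hc₂₁⟩
    · exact h r ⟨hr, fun e => inr_ne_inl (show Sum.inlₗ r = c₁ from e).symm⟩)
  have hbH : gb.Agree pH := hgb.trans (glue_agree_right _ _ _) fun s hs => Or.inr hs.2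
  let Bc : LowerSet (Set Q) := mkCx (fun s => c₁ ∉ s) fun _ _ h hs h' => hs (h h')
  have hdeg : gb.Degen c₀ c₂ := by
    have key : ∀ {k : ℕ} (x : Fin (k + 1) →o Q) (hx : Set.range x ∈ Bb),
        (∀ i, x i = c₀ ∨ x i = c₂) → gb.app x hx = D.app (OrderHom.const _ ⊥) trivial := by
      intro k x hx hxi
      have hx₂ : Set.range x ∈ X₂ := by
        rintro r ⟨i, hi⟩
        rcases hxi i with e | e <;> exact inr_ne_inl (e.symm.trans hi)
      refine (hbH x hx hx₂).trans ((h₂ _ fun i h => ?_).trans (D.app_congr ?_ trivial trivial))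
      · rcases hxi i with e | e
        · have h₃ : π (x i) = Sum.inlₗ 0 := congrArg π e
          exact absurd (inlₗ_inj.1 (h₃.symm.trans h)) (by decide)
        · exact inr_ne_inl ((congrArg π e).symm.trans h)
      · ext1
        funext i
        change foldApex (Fin 2) P (π (x i)) = ⊥
        rcases hxi i with e | e <;> rw [e] <;> rfl
    intro k x y hx hy hxi hyi
    rw [key x hx hxi, key y hy hyi]
  -- The filler over c₂ is transported to c₀ along the degenerate edge. Chains through c₁ are
  -- dropped: otherwise c₂ would not always be adjacent to c₀.
  obtain ⟨gc, hgc⟩ := exists_extension_marker (B := Bc) gb {c₀} IsGreatest isGreatest_unique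
    (fun _ => c₂) (by
      intro s hs hsA hc
      obtain ⟨hall, hc₀⟩ := not_not.1 hsA
      refine ⟨c₀, ⟨⟨hc₀, rfl⟩, fun q hq => hq.2.le⟩, hc₂₀, ?_, ?_, ?_, fun hc₂ => ?_⟩
      · exact fun h => hs (h.resolve_left hc₂₁.symm)
      · intro q hq
        rcases hcases q with ⟨r, rfl⟩ | rfl | rfl | rfl | ⟨p, hp, rfl⟩
        · exact Or.inl (Sum.Lex.inl_le_inr _ _)
        · exact Or.inl hc₀₂.le
        · exact absurd hq hs
        · exact Or.inl le_rfl
        · exact Or.inr (Sum.Lex.inr_le_inr_iff.2 (Sum.Lex.inr_le_inr_iff.2 bot_le))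
      · exact fun h => h ⟨fun r => ⟨hall r, fun e => inr_ne_inl (show Sum.inlₗ r = c₂ from e).symm⟩,
          hc₀, hc₂₀.symm⟩
      · by_cases hb : ∃ b ∈ s, c₂ < b
        · obtain ⟨b, hb, hb'⟩ := hb
          exact Or.inl ⟨c₀, hc₀, b, hb, hc₀₂, hb'⟩
        · refine Or.inr (Or.inl ⟨c₀, hc₀, hc₀₂, fun q hq => ?_, ⟨_, hall 0,
            fun e => inr_ne_inl e.symm⟩, ?_, hdeg⟩)
          · rcases hcases q with ⟨r, rfl⟩ | rfl | rfl | rfl | ⟨p, hp, rfl⟩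
            · exact Sum.Lex.inl_le_inr _ _
            · exact le_rfl
            · exact absurd hq hs
            · exact absurd hq hc₂
            · refine absurd ⟨_, hq, lt_of_le_of_ne (Sum.Lex.inr_le_inr_iff.2
                (Sum.Lex.inr_le_inr_iff.2 bot_le)) fun e => hp ?_⟩ hb
              exact (inrₗ_inj.1 (inrₗ_inj.1 e)).symm
          · rintro ⟨h, -⟩
            rcases h 0 with h | h <;> exact inr_ne_inl h.symm)
  let χ : Fin (n + 1) ⊕ₗ P →o Q := joinMap OrderHom.id (apexEmb P (0 : Fin 2))
  have hψχ : ∀ q, ψ (χ q) = q := by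
    intro q
    rcases lex_cases q with ⟨r, rfl⟩ | ⟨p, rfl⟩
    · rfl
    · exact congrArg Sum.inrₗ (foldApex_apexEmb _ p)
  have hχ : ∀ p q, q = c₀ ∨ q = c₁ ∨ q = c₂ → χ p = q → p = Sum.inrₗ ⊥ ∧ q = c₀ := by
    rintro p q hq rfl
    rcases lex_cases p with ⟨r, rfl⟩ | ⟨p, rfl⟩
    · rcases hq with h | h | h <;> exact absurd h.symm inr_ne_inl
    · by_cases hp : p = ⊥
      · rw [hp]
        exact ⟨rfl, congrArg Sum.inrₗ (apexEmb_bot _)⟩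
      · have e : χ (Sum.inrₗ p) = Sum.inrₗ (Sum.inrₗ p) := congrArg Sum.inrₗ (apexEmb_of_ne _ hp)
        rw [e] at hq
        rcases hq with h | h | h
        · exact absurd (inrₗ_inj.1 h) inr_ne_inl
        · exact absurd (inrₗ_inj.1 h) inr_ne_inl
        · exact absurd (inrₗ_inj.1 (inrₗ_inj.1 h)) hp
  refine ⟨gc.pull χ ⊤ fun s _ _ => ?_, fun k x _ hx => ?_⟩
  · rintro ⟨p, -, hp⟩
    exact hc₀₁ (hχ p c₁ (Or.inr (Or.inl rfl)) hp).2.symm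
  · have h₁ : Set.range (χ.comp x) ∈ X₁ := by
      refine ⟨?_, ?_, ?_⟩
      · rintro ⟨i, hi⟩
        exact hc₀₁ (hχ (x i) c₁ (Or.inr (Or.inl rfl)) hi).2.symm
      · rintro ⟨i, hi⟩
        exact hc₂₀ (hχ (x i) c₂ (Or.inr (Or.inr rfl)) hi).2
      · rintro ⟨hall, ⟨i, hi⟩⟩
        refine hx.elim (fun h => h ⊥ ⟨i, (hχ (x i) c₀ (Or.inl rfl) hi).1⟩ rfl) fun h => h fun r => ?_
        obtain ⟨i, hi⟩ := hall r
        exact ⟨i, (hψχ (x i)).symm.trans (congrArg ψ hi)⟩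
    have hb : Set.range (χ.comp x) ∈ Bb := h₁.2.2
    have ha : Set.range (χ.comp x) ∈ Ba := h₁.2
    refine (hgc _ _ hb).trans ((hgb _ _ (Or.inl ha)).trans ((glue_agree_left _ _ haH _ _ ha).trans
      ((hga _ _ (Or.inl h₁)).trans ((glue_agree_left _ _ hXfH _ _ h₁).trans ?_))))
    refine f.app_congr ?_ _ _
    ext1
    funext i
    exact hψχ (x i)

end PMap

end Retracts

/-! ### Lifting families of diagrams -/

section Families

variable {Q : Type} [PartialOrder Q] {L C : SSet.{u}} {A : LowerSet (Set Q)}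

lemma PMap.ext {E : SSet.{u}} {f g : PMap A E}
    (h : ∀ {k : ℕ} (x : Fin (k + 1) →o Q) (hx : Set.range x ∈ A), f.app x hx = g.app x hx) : f = g := by
  cases f
  cases g
  congr
  funext k x hx
  exact h x hx

/-- A family of partial diagrams in `C` indexed by a simplicial set `L`. -/
structure Fam (L : SSet.{u}) (A : LowerSet (Set Q)) (C : SSet.{u}) where
  app : ∀ {m : SimplexCategoryᵒᵖ}, L.obj m → ∀ x : Fin (m.unop.len + 1) →o Q, Set.range x ∈ A → C.obj m
  nat : ∀ {m m' : SimplexCategoryᵒᵖ} (α : m ⟶ m') (ℓ : L.obj m) (x : Fin (m.unop.len + 1) →o Q)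
    (h : Set.range x ∈ A) (h' : Set.range (x.comp α.unop.toOrderHom) ∈ A),
    app (L.map α ℓ) (x.comp α.unop.toOrderHom) h' = C.map α (app ℓ x h)

/-- The morphism of the simplex category given by a monotone map, in the opposite category. -/
def opHom {m m' : SimplexCategoryᵒᵖ} (α : Fin (m'.unop.len + 1) →o Fin (m.unop.len + 1)) : m ⟶ m' :=
  Quiver.Hom.op (X := m'.unop) (Y := m.unop) (SimplexCategory.Hom.mk α)

/-- The projections of a chain in a product. -/
def chainFst {P R : Type} [PartialOrder P] [PartialOrder R] {k : ℕ} (x : Fin (k + 1) →o P × R) :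
    Fin (k + 1) →o P := ⟨fun i => (x i).1, fun _ _ h => (x.monotone h).1⟩

def chainSnd {P R : Type} [PartialOrder P] [PartialOrder R] {k : ℕ} (x : Fin (k + 1) →o P × R) :
    Fin (k + 1) →o R := ⟨fun i => (x i).2, fun _ _ h => (x.monotone h).2⟩

/-- The chain in a product with given projections. -/
def chainMk {P R : Type} [PartialOrder P] [PartialOrder R] {k : ℕ} (x : Fin (k + 1) →o P)
    (y : Fin (k + 1) →o R) : Fin (k + 1) →o P × R :=
  ⟨fun i => (x i, y i), fun _ _ h => ⟨x.monotone h, y.monotone h⟩⟩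

lemma range_chainSnd {m k : ℕ} {x : Fin (k + 1) →o Fin (m + 1) × Q} (h : Set.range x ∈ sndCx m A) :
    Set.range (chainSnd x) ∈ A := by
  have h' : Prod.snd '' Set.range x ∈ A := h
  rwa [← Set.range_comp] at h'

lemma range_chainFst {m k : ℕ} {x : Fin (k + 1) →o Fin (m + 1) × Q} (h : Set.range x ∈ fstCx m Q) :
    Set.range (chainFst x) ≠ Set.univ := by
  have h' : Prod.fst '' Set.range x ≠ Set.univ := h
  rwa [← Set.range_comp] at h'

/-- The partial diagram over a simplex of the base of a family. -/
def Fam.fibre (d : Fam L A C) {m : SimplexCategoryᵒᵖ} (ℓ : L.obj m) : PMap (sndCx m.unop.len A) C where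
  app {k} x h := d.app (m := op ⦋k⦌) (L.map (opHom (m' := op ⦋k⦌) (chainFst x)) ℓ) (chainSnd x)
    (range_chainSnd h)
  nat {k l} α x h h' := by
    refine Eq.trans ?_ (d.nat (m := op ⦋k⦌) (m' := op ⦋l⦌) (SimplexCategory.mkHom α).op
      (L.map (opHom (m' := op ⦋k⦌) (chainFst x)) ℓ) (chainSnd x) (range_chainSnd h)
      (range_chainSnd h'))
    refine congrArg (fun ℓ' => d.app (m := op ⦋l⦌) ℓ' (chainSnd (x.comp α)) (range_chainSnd h')) ?_
    exact ConcreteCategory.congr_hom (L.map_comp (opHom (m' := op ⦋k⦌) (chainFst x))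
      (SimplexCategory.mkHom α).op) ℓ

/-- The partial diagram over a vertex of the base of a family. -/
def Fam.at (d : Fam L A C) (ℓ : L _⦋0⦌) : PMap A C where
  app {k} x h := d.app (m := op ⦋k⦌) (L.map (opHom (m' := op ⦋k⦌) (OrderHom.const _ 0)) ℓ) x h
  nat {k l} α x h h' := by
    refine Eq.trans ?_ (d.nat (m := op ⦋k⦌) (m' := op ⦋l⦌) (SimplexCategory.mkHom α).op
      (L.map (opHom (m' := op ⦋k⦌) (OrderHom.const _ 0)) ℓ) x h h')
    refine congrArg (fun ℓ' => d.app (m := op ⦋l⦌) ℓ' (x.comp α) h') ?_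
    exact ConcreteCategory.congr_hom (L.map_comp (opHom (m := op ⦋0⦌) (m' := op ⦋k⦌) (OrderHom.const _ 0))
      (SimplexCategory.mkHom α).op) ℓ

/-- The map of products induced by a map of ordinals. -/
def prodMapFst (Q : Type) [PartialOrder Q] {m m' : ℕ} (α : Fin (m' + 1) →o Fin (m + 1)) :
    Fin (m' + 1) × Q →o Fin (m + 1) × Q :=
  ⟨fun q => (α q.1, q.2), fun _ _ h => ⟨α.monotone h.1, h.2⟩⟩

/-- The simplicial set over `L` of extensions of the family `d` with vertices in `G`. -/
def extensions (d : Fam L A C) (G : PMap (⊤ : LowerSet (Set Q)) C → Prop) : SSet.{u} where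
  obj m := {p : L.obj m × PMap (⊤ : LowerSet (Set (Fin (m.unop.len + 1) × Q))) C //
    p.2.Agree (d.fibre p.1) ∧ ∀ j, G (p.2.pull (slice m.unop.len Q j : Q →o _) ⊤ fun _ _ _ => trivial)}
  map {m m'} α := ↾fun p => ⟨(L.map α p.1.1, p.1.2.pull (prodMapFst Q α.unop.toOrderHom) ⊤
    fun _ _ _ => trivial), by
      refine ⟨fun k x _ hx => ?_, fun j => ?_⟩
      · refine (p.2.1 _ trivial (PMap.range_comp_mem' (prodMapFst Q α.unop.toOrderHom) x ?_)).trans ?_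
        · have h : Prod.snd '' Set.range x ∈ A := hx
          change Prod.snd '' (_ '' Set.range x) ∈ A
          rwa [← Set.image_comp]
        · refine congrArg (fun ℓ' => d.app (m := op ⦋k⦌) ℓ' (chainSnd x) (range_chainSnd hx)) ?_
          exact ConcreteCategory.congr_hom (L.map_comp α (opHom (m' := op ⦋k⦌) (chainFst x))) p.1.1
      · exact p.2.2 (α.unop.toOrderHom j)⟩
  map_id m := by
    refine ConcreteCategory.hom_ext _ _ fun p => ?_
    apply Subtype.ext
    exact Prod.ext (ConcreteCategory.congr_hom (L.map_id m) p.1.1) (PMap.ext fun _ _ => rfl)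
  map_comp α β := by
    refine ConcreteCategory.hom_ext _ _ fun p => ?_
    apply Subtype.ext
    exact Prod.ext (ConcreteCategory.congr_hom (L.map_comp α β) p.1.1) (PMap.ext fun _ _ => rfl)

/-- The projection from extensions to the base. -/
def extensionsProj (d : Fam L A C) (G : PMap (⊤ : LowerSet (Set Q)) C → Prop) : extensions d G ⟶ L where
  app _ := ↾fun p => p.1.1

variable {d : Fam L A C} {G : PMap (⊤ : LowerSet (Set Q)) C → Prop}

/-- The partial diagram given by the boundary of a simplex of extensions. -/
def boundaryDiagram {n : ℕ} (t : (∂Δ[n] : SSet.{u}) ⟶ extensions d G) : PMap (fstCx n Q) C where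
  app {k} x h := (t.app (op ⦋k⦌) ((boundaryShape n).ofHom (m := op ⦋k⦌) (chainFst x)
    (range_chainFst h))).1.2.app (chainMk OrderHom.id (chainSnd x)) trivial
  nat {k l} α x h h' := by
    have e : t.app (op ⦋l⦌) ((boundaryShape n).ofHom (m := op ⦋l⦌) (chainFst (x.comp α))
        (range_chainFst h')) = (extensions d G).map (SimplexCategory.mkHom α).op (t.app (op ⦋k⦌)
        ((boundaryShape n).ofHom (m := op ⦋k⦌) (chainFst x) (range_chainFst h))) :=
      ConcreteCategory.congr_hom (t.naturality (SimplexCategory.mkHom α).op)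
        ((boundaryShape n).ofHom (m := op ⦋k⦌) (chainFst x) (range_chainFst h))
    rw [e]
    exact (t.app (op ⦋k⦌) ((boundaryShape n).ofHom (m := op ⦋k⦌) (chainFst x)
      (range_chainFst h))).1.2.nat α (chainMk OrderHom.id (chainSnd x)) trivial trivial

lemma boundaryDiagram_app {n : ℕ} (t : (∂Δ[n] : SSet.{u}) ⟶ extensions d G) {m : SimplexCategoryᵒᵖ}
    (σ : Fin (m.unop.len + 1) →o Fin (n + 1)) (hσ : Set.range σ ∈ bdrySets n) {k : ℕ}
    (x : Fin (k + 1) →o Fin (m.unop.len + 1) × Q)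
    (h : Set.range ((prodMapFst Q σ).comp x) ∈ fstCx n Q) :
    (boundaryDiagram t).app ((prodMapFst Q σ).comp x) h =
      (t.app m ((boundaryShape n).ofHom σ hσ)).1.2.app x trivial := by
  have e : t.app (op ⦋k⦌) ((boundaryShape n).ofHom (m := op ⦋k⦌) (σ.comp (chainFst x))
      (range_chainFst h)) = (extensions d G).map (opHom (m' := op ⦋k⦌) (chainFst x)) (t.app m
      ((boundaryShape n).ofHom σ hσ)) :=
    ConcreteCategory.congr_hom (t.naturality (opHom (m' := op ⦋k⦌) (chainFst x)))
      ((boundaryShape n).ofHom σ hσ)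
  change (t.app (op ⦋k⦌) ((boundaryShape n).ofHom (m := op ⦋k⦌) (σ.comp (chainFst x))
    (range_chainFst h))).1.2.app (chainMk OrderHom.id (chainSnd x)) trivial = _
  rw [e]
  rfl

/-- Extensions over the simplices of the base that extend extensions over their boundary can be
combined. -/
theorem extensionsProj_rlp
    (h₀ : ∀ ℓ : L _⦋0⦌, ∃ g : PMap (⊤ : LowerSet (Set Q)) C, g.Agree (d.at ℓ) ∧ G g)
    (h : ∀ (m : ℕ) (hm : 0 < m) (f : PMap (fstCx m Q ⊔ sndCx m A) C),
      (∀ j, G (f.pull (slice m Q j : Q →o _) ⊤ fun s _ _ => Or.inl (slice_mem hm j s))) →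
      ∃ g : PMap (⊤ : LowerSet (Set (Fin (m + 1) × Q))) C, g.Agree f) :
    SSet.modelCategoryQuillen.I.rlp (extensionsProj d G) := by
  rintro _ _ _ ⟨n⟩
  refine ⟨fun {t v} sq => ?_⟩
  let ℓ : L _⦋n⦌ := v.app (op ⦋n⦌) (SSet.stdSimplex.objMk (n := ⦋n⦌) (m := op ⦋n⦌) OrderHom.id)
  have hv : ∀ {m : SimplexCategoryᵒᵖ} (σ : (Δ[n] : SSet.{u}).obj m), v.app m σ =
      L.map (opHom (m := op ⦋n⦌) (SSet.stdSimplex.asOrderHom σ)) ℓ := by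
    intro m σ
    have e := ConcreteCategory.congr_hom (v.naturality (opHom (m := op ⦋n⦌)
      (SSet.stdSimplex.asOrderHom σ))) (SSet.stdSimplex.objMk (n := ⦋n⦌) (m := op ⦋n⦌) OrderHom.id)
    have e' : σ = (Δ[n] : SSet.{u}).map (opHom (m := op ⦋n⦌) (SSet.stdSimplex.asOrderHom σ))
        (SSet.stdSimplex.objMk (n := ⦋n⦌) (m := op ⦋n⦌) OrderHom.id) :=
      SSet.stdSimplex.ext (d := m.unop.len) _ _ fun i => rfl
    exact Eq.trans (congrArg (v.app m) e') e
  have ht : ∀ {m : SimplexCategoryᵒᵖ} (σ : (∂Δ[n] : SSet.{u}).obj m), (t.app m σ).1.1 =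
      L.map (opHom (m := op ⦋n⦌) ((boundaryShape n).toHom σ)) ℓ := by
    intro m σ
    exact (ConcreteCategory.congr_hom (NatTrans.congr_app sq.w m) σ).trans (hv σ.1)
  obtain ⟨F, hFd, hFt, hFG⟩ : ∃ F : PMap (⊤ : LowerSet (Set (Fin (n + 1) × Q))) C,
      F.Agree (d.fibre ℓ) ∧ F.Agree (boundaryDiagram t) ∧
      ∀ j, G (F.pull (slice n Q j : Q →o Fin (n + 1) × Q) ⊤ fun _ _ _ => trivial) := by
    rcases Nat.eq_zero_or_pos n with rfl | hn
    · obtain ⟨g, hg, hG⟩ := h₀ ℓ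
      refine ⟨g.pull (OrderHom.snd (α := Fin (0 + 1)) (β := Q)) ⊤ fun _ _ _ => trivial, fun k x _ hx => ?_,
        fun k x _ hx => ?_, fun j => hG⟩
      · refine (hg _ trivial (range_chainSnd hx)).trans ?_
        have e : chainFst x = OrderHom.const _ 0 := by
          ext1
          funext i
          exact Subsingleton.elim (α := Fin 1) _ _
        exact congrArg (fun y => d.app (m := op ⦋k⦌) (L.map (opHom (m' := op ⦋k⦌) y) ℓ)
          (chainSnd x) (range_chainSnd hx)) e.symm
      · refine absurd (Set.eq_univ_of_forall fun r => ?_) (range_chainFst hx)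
        exact ⟨0, Subsingleton.elim (α := Fin 1) _ _⟩
    · have hagree : (boundaryDiagram t).Agree (d.fibre ℓ) := by
        intro k x hx hx'
        refine ((t.app (op ⦋k⦌) _).2.1 _ _ ?_).trans ?_
        · change Prod.snd '' Set.range (chainMk OrderHom.id (chainSnd x)) ∈ A
          rw [← Set.range_comp]
          exact range_chainSnd hx'
        · refine congrArg (fun ℓ' => d.app (m := op ⦋k⦌) ℓ' (chainSnd x) (range_chainSnd hx')) ?_
          rw [ht]
          exact ConcreteCategory.congr_hom (L.map_id (op ⦋k⦌)) _
      have hG : ∀ j, G ((boundaryDiagram t).pull (slice n Q j : Q →o Fin (n + 1) × Q) ⊤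
          fun s _ _ => slice_mem hn j s) := by
        intro j
        have hj : Set.range (OrderHom.const (Fin 1) j) ∈ bdrySets n := fun h => by
          obtain ⟨_, h₁⟩ := h.symm ▸ Set.mem_univ (0 : Fin (n + 1))
          obtain ⟨_, h₂⟩ := h.symm ▸ Set.mem_univ (⊤ : Fin (n + 1))
          exact absurd (congrArg Fin.val (h₁.symm.trans h₂)) hn.ne
        have e : (boundaryDiagram t).pull (slice n Q j : Q →o Fin (n + 1) × Q) ⊤ (fun s _ _ => slice_mem hn j s) =
            (t.app (op ⦋0⦌) ((boundaryShape n).ofHom (m := op ⦋0⦌) (OrderHom.const _ j) hj)).1.2.pull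
              (slice 0 Q 0 : Q →o _) ⊤ fun _ _ _ => trivial :=
          PMap.ext fun x hx => boundaryDiagram_app (m := op ⦋0⦌) t (OrderHom.const _ j) hj
            ((slice 0 Q 0 : Q →o Fin (0 + 1) × Q).comp x)
            (PMap.range_comp_mem' (slice n Q j : Q →o Fin (n + 1) × Q) x (slice_mem hn j _))
        rw [e]
        exact (t.app (op ⦋0⦌) _).2.2 0
      -- Over a simplex of positive dimension the extensions over its boundary and the given partial
      -- family are glued. The vertices belong to the boundary, so the condition `G` is already
      -- satisfied at each of them.
      let f₀ := PMap.glue _ _ hagree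
      have hG₀ : ∀ j, G (f₀.pull (slice n Q j : Q →o Fin (n + 1) × Q) ⊤
          fun s _ _ => Or.inl (slice_mem hn j s)) := by
        intro j
        have e : f₀.pull (slice n Q j : Q →o Fin (n + 1) × Q) ⊤
            (fun s _ _ => Or.inl (slice_mem hn j s)) =
            (boundaryDiagram t).pull (slice n Q j : Q →o Fin (n + 1) × Q) ⊤
              fun s _ _ => slice_mem hn j s :=
          PMap.ext fun x hx => PMap.glue_agree_left _ _ hagree _
            (Or.inl (PMap.range_comp_mem' (slice n Q j : Q →o Fin (n + 1) × Q) x (slice_mem hn j _)))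
            (PMap.range_comp_mem' (slice n Q j : Q →o Fin (n + 1) × Q) x (slice_mem hn j _))
        rw [e]
        exact hG j
      obtain ⟨F, hF⟩ := h n hn f₀ hG₀
      have hFt : F.Agree (boundaryDiagram t) := hF.trans (PMap.glue_agree_left _ _ hagree)
        fun s hs => Or.inl hs.2
      refine ⟨F, hF.trans (PMap.glue_agree_right _ _ hagree) fun s hs => Or.inr hs.2, hFt,
        fun j => ?_⟩
      have e : F.pull (slice n Q j : Q →o Fin (n + 1) × Q) ⊤ (fun _ _ _ => trivial) =
          (boundaryDiagram t).pull (slice n Q j : Q →o Fin (n + 1) × Q) ⊤ fun s _ _ => slice_mem hn j s :=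
        PMap.ext fun x hx => hFt _ trivial
          (PMap.range_comp_mem' (slice n Q j : Q →o Fin (n + 1) × Q) x (slice_mem hn j _))
      rw [e]
      exact hG j
  let τ : (extensions d G) _⦋n⦌ := ⟨(ℓ, F), hFd, hFG⟩
  refine ⟨⟨⟨SSet.yonedaEquiv.symm τ, ?_, ?_⟩⟩⟩
  · ext m σ
    refine Subtype.ext (Prod.ext (ht σ).symm (PMap.ext fun {k} x hx => ?_))
    have h₁ : Prod.fst '' Set.range ((prodMapFst Q ((boundaryShape n).toHom σ)).comp x) ≠ Set.univ := by
      refine (bdrySets n).lower ?_ ((boundaryShape n).mem σ)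
      rintro _ ⟨_, ⟨i, rfl⟩, rfl⟩
      exact ⟨_, rfl⟩
    refine (hFt ((prodMapFst Q ((boundaryShape n).toHom σ)).comp x) trivial h₁).trans ?_
    exact boundaryDiagram_app t ((boundaryShape n).toHom σ) ((boundaryShape n).mem σ) x h₁
  · ext m σ
    exact (hv σ).symm

/-- Families of partial diagrams extend if they extend over the simplices of the base. -/
theorem exists_fam
    (h₀ : ∀ ℓ : L _⦋0⦌, ∃ g : PMap (⊤ : LowerSet (Set Q)) C, g.Agree (d.at ℓ) ∧ G g)
    (h : ∀ (m : ℕ) (hm : 0 < m) (f : PMap (fstCx m Q ⊔ sndCx m A) C),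
      (∀ j, G (f.pull (slice m Q j : Q →o _) ⊤ fun s _ _ => Or.inl (slice_mem hm j s))) →
      ∃ g : PMap (⊤ : LowerSet (Set (Fin (m + 1) × Q))) C, g.Agree f) :
    ∃ d' : Fam L (⊤ : LowerSet (Set Q)) C,
      (∀ {m : SimplexCategoryᵒᵖ} (ℓ : L.obj m) (x : Fin (m.unop.len + 1) →o Q) (hx : Set.range x ∈ A),
        d'.app ℓ x trivial = d.app ℓ x hx) ∧ ∀ ℓ, G (d'.at ℓ) := by
  -- Lifting against boundary inclusions implies lifting against all monomorphisms. Applied to ∅ → L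
  -- it gives a section of the projection.
  have hrlp := extensionsProj_rlp h₀ h
  rw [← SSet.rlp_monomorphisms] at hrlp
  have := hrlp (Limits.initial.to L) inferInstance
  have sq : CommSq (Limits.initial.to (extensions d G)) (Limits.initial.to L) (extensionsProj d G)
    (𝟙 L) := ⟨Limits.initial.hom_ext _ _⟩
  let s := sq.lift
  have hs : ∀ {m : SimplexCategoryᵒᵖ} (ℓ : L.obj m), (s.app m ℓ).1.1 = ℓ := fun {m} ℓ => by
    have h := ConcreteCategory.congr_hom (NatTrans.congr_app sq.fac_right m) ℓ
    exact h
  have hmap : ∀ {m m' : SimplexCategoryᵒᵖ} (α : m ⟶ m') (ℓ : L.obj m), s.app m' (L.map α ℓ) =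
      (extensions d G).map α (s.app m ℓ) := fun α ℓ =>
    ConcreteCategory.congr_hom (s.naturality α) ℓ
  -- The section assigns to an m-simplex of L a diagram on Δᵐ × Q; the family takes its value on the
  -- graph of the chain `x`.
  let d' : Fam L (⊤ : LowerSet (Set Q)) C :=
    { app := fun {m} ℓ x _ => (s.app m ℓ).1.2.app (chainMk OrderHom.id x) trivial
      nat := fun {m m'} α ℓ x _ _ => by
        rw [hmap]
        exact (s.app m ℓ).1.2.nat α.unop.toOrderHom (chainMk OrderHom.id x) trivial trivial }
  refine ⟨d', fun {m} ℓ x hx => ?_, fun ℓ => ?_⟩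
  · refine ((s.app m ℓ).2.1 _ _ ?_).trans ?_
    · change Prod.snd '' Set.range (chainMk OrderHom.id x) ∈ A
      rwa [← Set.range_comp]
    · refine congrArg (fun ℓ' => d.app ℓ' x hx) ?_
      rw [hs]
      exact ConcreteCategory.congr_hom (L.map_id m) _
  · have e : d'.at ℓ = (s.app (op ⦋0⦌) ℓ).1.2.pull (slice 0 Q 0 : Q →o _) ⊤ fun _ _ _ => trivial := by
      refine PMap.ext fun {k} x hx => ?_
      change (s.app (op ⦋k⦌) (L.map _ ℓ)).1.2.app (chainMk OrderHom.id x) trivial = _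
      rw [hmap]
      rfl
    rw [e]
    exact (s.app (op ⦋0⦌) ℓ).2.2 0

end Families

/-! ### Limits in functor categories -/

namespace PMap

/-! ### Maps between cones over the same diagram. -/

section Comparison

variable {P : Type} [PartialOrder P] [OrderBot P] {E : SSet.{u}}

/-- Two cones over one diagram, with the apex of `D` at `⊥` and the apex of `D'` at the new vertex.
Chains through both apexes are left undefined; an extension to them is a map from the apex of `D'`
to the apex of `D` over the diagram. -/
lemma exists_glue_apex {D D' : PMap (⊤ : LowerSet (Set P)) E}
    (h : ∀ ⦃k : ℕ⦄ (x : Fin (k + 1) →o P), (∀ i, x i ≠ ⊥) → D.app x trivial = D'.app x trivial) :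
    ∃ q : PMap (coneCx (inrEmb (Fin 1) P)) E, ∀ ⦃k : ℕ⦄ (x : Fin (k + 1) →o Fin 1 ⊕ₗ P) (hx),
      ((∀ i, x i ≠ Sum.inlₗ 0) → q.app x hx = D.app ((foldApex (Fin 1) P).comp x) trivial) ∧
      ((∀ i, x i ≠ Sum.inrₗ ⊥) → q.app x hx = D'.app ((foldApex (Fin 1) P).comp x) trivial) := by
  let q₁ : PMap (mkCx (fun s : Set (Fin 1 ⊕ₗ P) => Sum.inlₗ 0 ∉ s) fun _ _ h hs h' => hs (h h')) E :=
    D.pull (foldApex (Fin 1) P) _ fun _ _ _ => trivial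
  let q₂ : PMap (mkCx (fun s : Set (Fin 1 ⊕ₗ P) => Sum.inrₗ ⊥ ∉ s) fun _ _ h hs h' => hs (h h')) E :=
    D'.pull (foldApex (Fin 1) P) _ fun _ _ _ => trivial
  have hq : q₁.Agree q₂ := by
    intro k x hx hx'
    refine h _ fun i e => ?_
    rcases lex_cases (x i) with ⟨r, hi⟩ | ⟨p, hi⟩
    · exact hx ⟨i, hi.trans (congrArg Sum.inlₗ (Subsingleton.elim _ _))⟩
    · refine hx' ⟨i, hi.trans (congrArg Sum.inrₗ ?_)⟩
      exact (congrArg (foldApex (Fin 1) P) hi).symm.trans e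
  have hdom : ∀ s ∈ coneCx (inrEmb (Fin 1) P), Sum.inlₗ 0 ∉ s ∨ Sum.inrₗ ⊥ ∉ s := by
    refine fun s hs => hs.symm.imp (fun h h' => h fun y hy => ?_) id
    rcases lex_cases y with ⟨r, rfl⟩ | ⟨p, rfl⟩
    · rwa [Subsingleton.elim r 0]
    · exact absurd ⟨p, rfl⟩ hy
  refine ⟨(glue q₁ q₂ hq).res _ fun s hs _ => hdom s hs, fun k x hx => ⟨fun h => ?_, fun h => ?_⟩⟩
  · have h' : Set.range x ∈ mkCx (fun s : Set (Fin 1 ⊕ₗ P) => Sum.inlₗ 0 ∉ s)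
        (fun _ _ h hs h' => hs (h h')) := fun ⟨i, hi⟩ => h i hi
    exact glue_agree_left q₁ q₂ hq x (Or.inl h') h'
  · have h' : Set.range x ∈ mkCx (fun s : Set (Fin 1 ⊕ₗ P) => Sum.inrₗ ⊥ ∉ s)
        (fun _ _ h hs h' => hs (h h')) := fun ⟨i, hi⟩ => h i hi
    exact glue_agree_right q₁ q₂ hq x (Or.inr h') h'

/-- The case n = 0 of exactness is the existence of a map from another cone; its domain is that of
two cones which share their base. -/
lemma exCx_le_coneCx {s : Set (Fin 1 ⊕ₗ P)} :
    s ∈ exCx (Fin 1) ({⊥}ᶜ : Set P) ↔ s ∈ coneCx (inrEmb (Fin 1) P) := by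
  refine or_congr ⟨fun h h' => h ⊥ h' rfl, fun h p hp e => h ?_⟩ (not_congr ⟨fun h y hy => ?_,
    fun h r => h ?_⟩)
  · rwa [show p = ⊥ from e] at hp
  · rcases lex_cases y with ⟨r, rfl⟩ | ⟨p, rfl⟩
    · exact h r
    · exact absurd ⟨p, rfl⟩ hy
  · rintro ⟨p, hp⟩
    exact inr_ne_inl hp

/-- A map between cones over the same diagram, composed with the map to the limit. -/
theorem exists_retract {D D' : PMap (⊤ : LowerSet (Set P)) E} (hD : D.IsExact {⊥}ᶜ)
    (h : PMap (⊤ : LowerSet (Set (Fin 1 ⊕ₗ P))) E)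
    (h₁ : ∀ ⦃k : ℕ⦄ (x : Fin (k + 1) →o Fin 1 ⊕ₗ P), (∀ i, x i ≠ Sum.inlₗ 0) →
      h.app x trivial = D'.app ((foldApex (Fin 1) P).comp x) trivial)
    (h₂ : ∀ ⦃k : ℕ⦄ (x : Fin (k + 1) →o Fin 1 ⊕ₗ P), (∀ i, x i ≠ Sum.inrₗ ⊥) →
      h.app x trivial = D.app ((foldApex (Fin 1) P).comp x) trivial) :
    ∃ H : PMap (⊤ : LowerSet (Set (Fin 2 ⊕ₗ P))) E, H.Over (apexEmb P 1) D' ∧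
      ∀ ⦃k : ℕ⦄ (x : Fin (k + 1) →o Fin 2 ⊕ₗ P), (∀ i, x i ≠ Sum.inlₗ 1) →
        H.app x trivial = D.app ((foldApex (Fin 2) P).comp x) trivial := by
  have hDD' : ∀ ⦃k : ℕ⦄ (x : Fin (k + 1) →o P), (∀ i, x i ≠ ⊥) →
      D.app x trivial = D'.app x trivial := by
    intro k x hx
    exact (h₂ ((inrEmb (Fin 1) P : P →o Fin 1 ⊕ₗ P).comp x) fun i e => hx i (inrₗ_inj.1 e)).symm.trans
      (h₁ ((inrEmb (Fin 1) P : P →o Fin 1 ⊕ₗ P).comp x) fun i e => inr_ne_inl e)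
  obtain ⟨q, hq⟩ := exists_glue_apex hDD'
  -- The limit property of `D` gives a map `g` from the apex of `D'` to that of `D`, in the
  -- direction opposite to `h`.
  obtain ⟨g, hg⟩ := hD 0 (q.res _ fun s hs _ => exCx_le_coneCx.1 hs) fun k x hx =>
    (hq _ _).1 fun i e => inr_ne_inl e
  have hg₁ : g.Over (inrEmb (Fin 1) P) D := fun k x hx => by
    have hx' : Set.range ((inrEmb (Fin 1) P : P →o Fin 1 ⊕ₗ P).comp x) ∈ exCx (Fin 1) ({⊥}ᶜ : Set P) :=
      Or.inr fun h => inr_ne_inl (h 0).choose_spec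
    exact (hg _ hx hx').trans ((hq _ _).1 fun i e => inr_ne_inl e)
  have hg₂ : ∀ ⦃k : ℕ⦄ (x : Fin (k + 1) →o Fin 1 ⊕ₗ P), (∀ i, x i ≠ Sum.inrₗ ⊥) →
      g.app x trivial = D'.app ((foldApex (Fin 1) P).comp x) trivial := by
    intro k x hx
    have hx' : Set.range x ∈ exCx (Fin 1) ({⊥}ᶜ : Set P) := by
      refine Or.inl fun p ⟨i, hi⟩ e => hx i (hi.trans (congrArg Sum.inrₗ e))
    exact (hg x trivial hx').trans ((hq _ _).2 hx)
  let π : Fin 2 ⊕ₗ P →o Fin 1 ⊕ₗ P :=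
    { toFun := fun y => Sum.elim (fun i : Fin 2 => if i = 0 then Sum.inlₗ 0 else Sum.inrₗ ⊥) Sum.inrₗ
        (ofLex y)
      monotone' := by
        intro x y hxy
        rcases lex_cases x with ⟨r, rfl⟩ | ⟨p, rfl⟩ <;> rcases lex_cases y with ⟨r', rfl⟩ | ⟨p', rfl⟩
        · have hr : r ≤ r' := Sum.Lex.inl_le_inl_iff.1 hxy
          change (if r = 0 then Sum.inlₗ 0 else Sum.inrₗ ⊥ : Fin 1 ⊕ₗ P) ≤
            if r' = 0 then Sum.inlₗ 0 else Sum.inrₗ ⊥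
          split_ifs with e e' e'
          · exact le_rfl
          · exact Sum.Lex.inl_le_inr _ _
          · exact absurd (le_antisymm (e' ▸ hr) (Fin.zero_le _)) e
          · exact le_rfl
        · change (if r = 0 then Sum.inlₗ 0 else Sum.inrₗ ⊥ : Fin 1 ⊕ₗ P) ≤ Sum.inrₗ p'
          split_ifs with e
          · exact Sum.Lex.inl_le_inr _ _
          · exact Sum.Lex.inr_le_inr_iff.2 bot_le
        · exact absurd hxy Sum.Lex.not_inr_le_inl
        · change (Sum.inrₗ p : Fin 1 ⊕ₗ P) ≤ Sum.inrₗ p'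
          exact Sum.Lex.inr_le_inr_iff.2 (Sum.Lex.inr_le_inr_iff.1 hxy) }
  have hπ : ∀ y, foldApex (Fin 1) P (π y) = foldApex (Fin 2) P y := by
    intro y
    rcases lex_cases y with ⟨r, rfl⟩ | ⟨p, rfl⟩
    · fin_cases r <;> rfl
    · rfl
  have hπ₀ : ∀ y, y ≠ Sum.inlₗ 0 → π y ≠ Sum.inlₗ 0 := by
    intro y hy
    rcases lex_cases y with ⟨r, rfl⟩ | ⟨p, rfl⟩
    · fin_cases r
      · exact absurd rfl hy
      · exact fun e => inr_ne_inl e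
    · exact fun e => inr_ne_inl e
  have hπ₁ : ∀ y, y ≠ Sum.inlₗ 1 → y ≠ Sum.inrₗ ⊥ → π y ≠ Sum.inrₗ ⊥ := by
    intro y hy hy'
    rcases lex_cases y with ⟨r, rfl⟩ | ⟨p, rfl⟩
    · fin_cases r
      · exact fun e => inr_ne_inl e.symm
      · exact absurd rfl hy
    · intro e
      have e' : (Sum.inrₗ p : Fin 1 ⊕ₗ P) = Sum.inrₗ ⊥ := e
      exact hy' (congrArg Sum.inrₗ (inrₗ_inj.1 e'))
  let ρ : Fin 2 ⊕ₗ P →o Fin 1 ⊕ₗ P := joinMap (OrderHom.const _ 0) OrderHom.id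
  have hρ : ∀ y, foldApex (Fin 1) P (ρ y) = foldApex (Fin 2) P y := by
    intro y
    rcases lex_cases y with ⟨r, rfl⟩ | ⟨p, rfl⟩ <;> rfl
  let X (z : Fin 2 ⊕ₗ P) : LowerSet (Set (Fin 2 ⊕ₗ P)) := mkCx (fun s => z ∉ s) fun _ _ h hs h' => hs (h h')
  -- The three faces of the triangle 0 → 1 → ⊥ over the diagram: the identity of `D` opposite to 1,
  -- the map `g` opposite to 0, the map `h` opposite to `⊥`. Since the last apex is that of `D`, the
  -- case n = 1 of exactness fills the triangle.
  let f₀ : PMap (X (Sum.inlₗ 1)) E := D.pull (foldApex (Fin 2) P) _ fun _ _ _ => trivial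
  let f₁ : PMap (X (Sum.inlₗ 0)) E := g.pull ρ _ fun _ _ _ => trivial
  let f₂ : PMap (X (Sum.inrₗ ⊥)) E := h.pull π _ fun _ _ _ => trivial
  have h₀₁ : f₀.Agree f₁ := by
    intro k x hx hx'
    have e : ρ.comp x = (inrEmb (Fin 1) P : P →o Fin 1 ⊕ₗ P).comp ((foldApex (Fin 2) P).comp x) := by
      ext1
      funext i
      change ρ (x i) = Sum.inrₗ (foldApex (Fin 2) P (x i))
      rcases lex_cases (x i) with ⟨r, hi⟩ | ⟨p, hi⟩
      · fin_cases r
        · exact absurd ⟨i, hi⟩ hx'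
        · exact absurd ⟨i, hi⟩ hx
      · rw [hi]
        rfl
    exact ((g.app_congr e trivial trivial).trans (hg₁ _ trivial)).symm
  have h₀₂ : f₀.Agree f₂ := by
    intro k x hx hx'
    refine ((h₂ (π.comp x) fun i => hπ₁ _ (fun e => hx ⟨i, e⟩) fun e => hx' ⟨i, e⟩).trans
      (D.app_congr ?_ trivial trivial)).symm
    ext1
    funext i
    exact hπ (x i)
  have h₁₂ : f₁.Agree f₂ := by
    intro k x hx hx'
    refine (hg₂ (ρ.comp x) fun i e => ?_).trans ((D'.app_congr ?_ trivial trivial).trans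
      (h₁ (π.comp x) fun i => hπ₀ _ fun e => hx ⟨i, e⟩).symm)
    · have e' : ρ (x i) = Sum.inrₗ ⊥ := e
      rcases lex_cases (x i) with ⟨r, hi⟩ | ⟨p, hi⟩
      · rw [hi] at e'
        exact inr_ne_inl e'.symm
      · rw [hi] at e'
        change (Sum.inrₗ p : Fin 1 ⊕ₗ P) = Sum.inrₗ ⊥ at e'
        exact hx' ⟨i, hi.trans (congrArg Sum.inrₗ (inrₗ_inj.1 e'))⟩
    · ext1
      funext i
      exact (hρ (x i)).trans (hπ (x i)).symm
  let f₀₁ := glue f₀ f₁ h₀₁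
  have hf : f₀₁.Agree f₂ := glue_agree _ _ _ _ h₀₂ h₁₂
  let f := glue f₀₁ f₂ hf
  have hf₀ : ∀ ⦃k : ℕ⦄ (x : Fin (k + 1) →o Fin 2 ⊕ₗ P) (hx) (hx' : Set.range x ∈ X (Sum.inlₗ 1)),
      f.app x hx = f₀.app x hx' := fun k x hx hx' =>
    (glue_agree_left f₀₁ f₂ hf x hx (Or.inl hx')).trans (glue_agree_left f₀ f₁ h₀₁ x _ hx')
  have hdom : ∀ s ∈ exCx (Fin 2) ({⊥}ᶜ : Set P), s ∈ X (Sum.inlₗ 1) ⊔ X (Sum.inlₗ 0) ⊔ X (Sum.inrₗ ⊥) := by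
    rintro s (h | h)
    · exact Or.inr fun h' => h ⊥ h' rfl
    · by_cases h₀ : Sum.inlₗ 0 ∈ s
      · refine Or.inl (Or.inl fun h₁ => h fun r => ?_)
        fin_cases r
        exacts [h₀, h₁]
      · exact Or.inl (Or.inr h₀)
  obtain ⟨H, hH⟩ := hD 1 (f.res _ fun s hs _ => hdom s hs) fun k x hx =>
    hf₀ _ (hdom _ hx) fun ⟨i, hi⟩ => inr_ne_inl hi
  refine ⟨H, fun k x hx => ?_, fun k x hx => ?_⟩
  · have hx₂ : Set.range ((apexEmb P (1 : Fin 2) : P →o Fin 2 ⊕ₗ P).comp x) ∈ X (Sum.inrₗ ⊥) := by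
      rintro ⟨i, hi⟩
      have hi' : apexEmb P (1 : Fin 2) (x i) = Sum.inrₗ ⊥ := hi
      by_cases e : x i = ⊥
      · rw [e, apexEmb_bot] at hi'
        exact inr_ne_inl hi'.symm
      · rw [apexEmb_of_ne _ e] at hi'
        exact e (inrₗ_inj.1 hi')
    have hx' : Set.range ((apexEmb P (1 : Fin 2) : P →o Fin 2 ⊕ₗ P).comp x) ∈ exCx (Fin 2) ({⊥}ᶜ : Set P) :=
      Or.inl fun p hp e => hx₂ (by rwa [show p = ⊥ from e] at hp)
    refine (hH _ hx hx').trans ((glue_agree_right f₀₁ f₂ hf _ (Or.inr hx₂) hx₂).trans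
      ((h₁ _ fun i => hπ₀ _ fun e => ?_).trans (D'.app_congr ?_ trivial trivial)))
    · have e' : apexEmb P (1 : Fin 2) (x i) = Sum.inlₗ 0 := e
      by_cases hi : x i = ⊥
      · rw [hi, apexEmb_bot] at e'
        exact absurd (inlₗ_inj.1 e') (by decide)
      · rw [apexEmb_of_ne _ hi] at e'
        exact inr_ne_inl e'
    · ext1
      funext i
      exact (hπ _).trans (foldApex_apexEmb _ _)
  · have hx₁ : Set.range x ∈ X (Sum.inlₗ 1) := fun ⟨i, hi⟩ => hx i hi
    have hx' : Set.range x ∈ exCx (Fin 2) ({⊥}ᶜ : Set P) := Or.inr fun h => hx₁ (h 1)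
    exact (hH x trivial hx').trans (hf₀ x (hdom _ hx') hx₁)

end Comparison

end PMap

/-! ### Diagrams in Fun(L, C) as families of diagrams in C. -/

section Evaluation

variable {Q : Type} [PartialOrder Q] {L C : SSet.{u}} {A : LowerSet (Set Q)}

/-- The map of simplicial sets given by a diagram on a poset. -/
def PMap.toNerve {E : SSet.{u}} (D : PMap (⊤ : LowerSet (Set Q)) E) : N.{u} Q ⟶ E where
  app m := ↾fun y => D.app (k := m.unop.len) (nerveHom y) trivial
  naturality m m' α := by
    refine ConcreteCategory.hom_ext _ _ fun y => ?_
    exact D.nat α.unop.toOrderHom (nerveHom y) trivial trivial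

/-- Evaluation of simplices of the mapping space. -/
def evApp {m : SimplexCategoryᵒᵖ} (ℓ : L.obj m) (y : ((ihom L).obj C).obj m) : C.obj m :=
  ((ihom.ev L).app C).app m (ℓ, y)

lemma evApp_map {m m' : SimplexCategoryᵒᵖ} (α : m ⟶ m') (ℓ : L.obj m) (y : ((ihom L).obj C).obj m) :
    evApp (L.map α ℓ) (((ihom L).obj C).map α y) = C.map α (evApp ℓ y) := by
  have h := ConcreteCategory.congr_hom (((ihom.ev L).app C).naturality α)
    ((ℓ, y) : L.obj m × ((ihom L).obj C).obj m)
  exact h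

/-- The family of diagrams in `C` given by a diagram in `Fun(L, C)`. -/
def famOf (D : PMap A ((ihom L).obj C)) : Fam L A C where
  app {m} ℓ x h := evApp ℓ (D.app (k := m.unop.len) x h)
  nat {m m'} α ℓ x h h' :=
    (congrArg (evApp (L.map α ℓ)) (D.nat α.unop.toOrderHom x h h')).trans (evApp_map α ℓ _)

/-- The diagram in `Fun(L, C)` given by a family of diagrams in `C`. -/
def ofFam (d : Fam L (⊤ : LowerSet (Set Q)) C) : PMap (⊤ : LowerSet (Set Q)) ((ihom L).obj C) :=
  PMap.ofNerve (MonoidalClosed.curry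
    { app := fun m => ↾fun p : L.obj m × (N.{u} Q).obj m => d.app p.1 (nerveHom p.2) trivial
      naturality := fun m m' α => by
        refine ConcreteCategory.hom_ext _ _ fun p => ?_
        exact d.nat α p.1 (nerveHom p.2) trivial trivial })

lemma uncurry_app {K : SSet.{u}} (g : K ⟶ (ihom L).obj C) {m : SimplexCategoryᵒᵖ} (ℓ : L.obj m)
    (y : K.obj m) : (MonoidalClosed.uncurry g).app m (ℓ, y) = evApp ℓ (g.app m y) := by
  rw [MonoidalClosed.uncurry_eq]
  rfl

lemma famOf_ofFam_app (d : Fam L (⊤ : LowerSet (Set Q)) C) {m : SimplexCategoryᵒᵖ} (ℓ : L.obj m)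
    (x : Fin (m.unop.len + 1) →o Q) : (famOf (ofFam d)).app ℓ x trivial = d.app ℓ x trivial := by
  refine (uncurry_app _ ℓ (nerveMk x)).symm.trans ?_
  rw [MonoidalClosed.uncurry_curry]
  rfl

/-- By adjunction a k-simplex of Fun(L, C) is a map L × Δᵏ → C, and such a map is determined by its
values on simplices of the product. -/
lemma ihom_ext {k : ℕ} {a b : ((ihom L).obj C) _⦋k⦌}
    (h : ∀ {m : SimplexCategoryᵒᵖ} (α : op ⦋k⦌ ⟶ m) (ℓ : L.obj m),
      evApp ℓ (((ihom L).obj C).map α a) = evApp ℓ (((ihom L).obj C).map α b)) : a = b := by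
  refine SSet.yonedaEquiv.symm.injective (MonoidalClosed.uncurry_injective ?_)
  ext m ⟨ℓ, σ⟩
  have e : ∀ c : ((ihom L).obj C) _⦋k⦌, (SSet.yonedaEquiv.symm c).app m σ =
      ((ihom L).obj C).map (opHom (m := op ⦋k⦌) (SSet.stdSimplex.asOrderHom σ)) c := fun c => rfl
  have e' : ∀ c : ((ihom L).obj C) _⦋k⦌, (MonoidalClosed.uncurry (SSet.yonedaEquiv.symm c)).app m (ℓ, σ) =
      evApp ℓ (((ihom L).obj C).map (opHom (m := op ⦋k⦌) (SSet.stdSimplex.asOrderHom σ)) c) :=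
    fun c => (uncurry_app _ ℓ σ).trans (congrArg (evApp ℓ) (e c))
  exact (e' a).trans ((h _ ℓ).trans (e' b).symm)

lemma agree_of_famOf {B : LowerSet (Set Q)} {D : PMap A ((ihom L).obj C)} {D' : PMap B ((ihom L).obj C)}
    (h : ∀ {m : SimplexCategoryᵒᵖ} (ℓ : L.obj m) (x : Fin (m.unop.len + 1) →o Q) (hA hB),
      (famOf D).app ℓ x hA = (famOf D').app ℓ x hB) : D.Agree D' := by
  intro k x hx hx'
  refine ihom_ext fun {m} α ℓ => ?_
  have hA := PMap.range_comp_mem hx α.unop.toOrderHom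
  have hB := PMap.range_comp_mem hx' α.unop.toOrderHom
  exact (congrArg (evApp ℓ) (D.nat α.unop.toOrderHom x hx hA)).symm.trans
    ((h ℓ (x.comp α.unop.toOrderHom) hA hB).trans
      (congrArg (evApp ℓ) (D'.nat α.unop.toOrderHom x hx' hB)))

end Evaluation

/-! ### Limits in functor categories are pointwise. -/

section Pointwise

variable {P Q : Type} [PartialOrder P] [OrderBot P] [Finite P] [PartialOrder Q] [Finite Q]
  {L C : SSet.{u}} [SSet.Quasicategory C]

/-- Families of cones extend to families of cones over limit cones. -/
lemma exists_fam_of_isExact (ι : P ↪o Q) (hι : ∀ q ∉ Set.range ι, ∀ p, q ≤ ι p) (d : Fam L (coneCx ι) C)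
    (h : ∀ ℓ : L _⦋0⦌, ∃ g : PMap (⊤ : LowerSet (Set Q)) C, g.Agree (d.at ℓ) ∧
      (g.pull (ι : P →o Q) ⊤ fun _ _ _ => trivial).IsExact {⊥}ᶜ) :
    ∃ d' : PMap (⊤ : LowerSet (Set Q)) ((ihom L).obj C),
      (∀ {m : SimplexCategoryᵒᵖ} (ℓ : L.obj m) (x : Fin (m.unop.len + 1) →o Q) (hx),
        (famOf d').app ℓ x trivial = d.app ℓ x hx) ∧
      ∀ ℓ, (((famOf d').at ℓ).pull (ι : P →o Q) ⊤ fun _ _ _ => trivial).IsExact {⊥}ᶜ := by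
  obtain ⟨d', h₁, h₂⟩ := exists_fam (d := d)
    (G := fun g => (g.pull (ι : P →o Q) ⊤ fun _ _ _ => trivial).IsExact {⊥}ᶜ) h fun m hm f hf =>
      PMap.exists_extension_prod ι hι hm f (hf ⊤) fun _ _ _ => rfl
  refine ⟨ofFam d', fun ℓ x hx => (famOf_ofFam_app d' ℓ x).trans (h₁ ℓ x hx), fun ℓ => ?_⟩
  have e : (famOf (ofFam d')).at ℓ = d'.at ℓ := PMap.ext fun {k} x _ =>
    famOf_ofFam_app (m := op ⦋k⦌) d' _ x
  rw [e]
  exact h₂ ℓ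

/-- Limits in functor categories are computed pointwise. -/
theorem famOf_at_isExact (hC : HasFiniteLimits C) {D : PMap (⊤ : LowerSet (Set P)) ((ihom L).obj C)}
    (hD : D.IsExact {⊥}ᶜ) (ℓ : L _⦋0⦌) : ((famOf D).at ℓ).IsExact {⊥}ᶜ := by
  have hfin : (N.{u} (NonBot P)).Finite := finite_N (NonBot P)
  let ι : P ↪o P := RelEmbedding.refl _
  -- `D'` is a cone of pointwise limits over the diagram that underlies `D`. Its own limit property
  -- in Fun(L, C) is not needed: `D` will be exhibited as a retract of `D'`, and retracts of limit
  -- cones are limit cones at each vertex.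
  obtain ⟨D', hD'D, hD'⟩ := exists_fam_of_isExact ι (fun q hq => absurd ⟨q, rfl⟩ hq)
    (famOf (D.res (coneCx ι) fun _ _ _ => trivial)) fun ℓ => by
      let d := (famOf (D.res (coneCx ι) fun _ _ _ => trivial)).at ℓ
      obtain ⟨D₁, h₁, h₂⟩ := PMap.exists_isExact hC (PMap.toNerve
        (d.pull (OrderHom.Subtype.val (· ≠ (⊥ : P))) ⊤ fun s _ _ => Or.inl (by
          rintro ⟨p, -, hp⟩
          exact p.2 hp)))
      refine ⟨D₁, fun k x hx hx' => ?_, h₁⟩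
      have hne : ∀ i, x i ≠ ⊥ := fun i e => hx'.elim (fun h => h ⟨i, e⟩)
        fun h => h fun q hq => absurd ⟨q, rfl⟩ hq
      exact h₂ ⟨fun i => ⟨x i, hne i⟩, fun _ _ h => x.monotone h⟩
  have hoff : ∀ ⦃k : ℕ⦄ (x : Fin (k + 1) →o P), (∀ i, x i ≠ ⊥) → D'.app x trivial = D.app x trivial := by
    intro k x hx
    have hag : D'.Agree (D.res (coneCx ι) fun _ _ _ => trivial) :=
      agree_of_famOf fun ℓ x _ hx => hD'D ℓ x hx
    exact hag x trivial (Or.inl fun ⟨i, hi⟩ => hx i hi)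
  obtain ⟨q, hq⟩ := PMap.exists_glue_apex hoff
  -- A map from `D` to `D'` over the diagram. At each vertex it comes from the pointwise limit
  -- property of `D'`, and these maps are assembled over all simplices of L.
  obtain ⟨h, hh, -⟩ := exists_fam_of_isExact (inrEmb (Fin 1) P) (fun y hy p => by
    rcases lex_cases y with ⟨r, rfl⟩ | ⟨p', rfl⟩
    · exact Sum.Lex.inl_le_inr _ _
    · exact absurd ⟨p', rfl⟩ hy) (famOf q) fun ℓ => by
      obtain ⟨g, hg⟩ := hD' ℓ 0 (((famOf q).at ℓ).res _ fun s hs _ => PMap.exCx_le_coneCx.1 hs)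
        fun k x hx => congrArg (evApp (m := op ⦋k⦌) _) ((hq _ (PMap.exCx_le_coneCx.1 hx)).1
          fun i e => inr_ne_inl e)
      refine ⟨g, fun k x hx hx' => hg x hx (PMap.exCx_le_coneCx.2 hx'), ?_⟩
      have e : g.pull (inrEmb (Fin 1) P : P →o Fin 1 ⊕ₗ P) ⊤ (fun _ _ _ => trivial) =
          ((famOf D').at ℓ).pull (ι : P →o P) ⊤ fun _ _ _ => trivial := PMap.ext fun {k} x _ => by
        have hx' : Set.range ((inrEmb (Fin 1) P : P →o Fin 1 ⊕ₗ P).comp x) ∈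
            exCx (Fin 1) ({⊥}ᶜ : Set P) := Or.inr fun h => inr_ne_inl (h 0).choose_spec
        exact (hg _ trivial hx').trans (congrArg (evApp (m := op ⦋k⦌) _)
          ((hq _ (PMap.exCx_le_coneCx.1 hx')).1 fun i e => inr_ne_inl e))
      rw [e]
      exact hD' ℓ
  have hhq : h.Agree q := agree_of_famOf fun ℓ x _ hx => hh ℓ x hx
  obtain ⟨H, h₁, h₂⟩ := PMap.exists_retract (D' := D') hD h
    (fun k x hx => by
      have hx' : Set.range x ∈ coneCx (inrEmb (Fin 1) P) := Or.inr fun h => by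
        obtain ⟨i, hi⟩ := h (show Sum.inlₗ 0 ∈ _ from fun ⟨p, hp⟩ => inr_ne_inl hp)
        exact hx i hi
      exact (hhq x trivial hx').trans ((hq x hx').1 hx))
    (fun k x hx => by
      have hx' : Set.range x ∈ coneCx (inrEmb (Fin 1) P) := Or.inl fun ⟨i, hi⟩ => hx i hi
      exact (hhq x trivial hx').trans ((hq x hx').2 hx))
  refine PMap.IsExact.of_retract (D₁ := (famOf D').at ℓ) ((famOf H).at ℓ) (fun k x hx => ?_)
    (fun k x hx => ?_) (hD' ℓ)
  · exact congrArg (evApp (m := op ⦋k⦌) _) (h₁ x trivial)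
  · exact congrArg (evApp (m := op ⦋k⦌) _) (h₂ x hx)

end Pointwise

/-! ### Functors on finite posets and the calculus of exact inclusions. -/

instance : Finite Square := inferInstanceAs (Finite (Fin 2 × Fin 2))

/-- Decidability of the orders lets `decide` check the inclusions and greatest elements that occur
in the small posets below. -/
instance {α β : Type} [LE α] [LE β] [DecidableLE α] [DecidableLE β] : DecidableLE (α × β) :=
  fun _ _ => decidable_of_iff _ Prod.le_def.symm

instance {α : Type} [Preorder α] [DecidableLE α] : DecidableLT α :=
  fun _ _ => decidable_of_iff _ lt_iff_le_not_ge.symm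

/-- A functor on a poset. -/
def posetFunctor {R J : Type} [PartialOrder R] [SmallCategory J] (obj : R → J)
    (map : ∀ {p q : R}, p ≤ q → (obj p ⟶ obj q)) (map_id : ∀ p : R, map (le_refl p) = 𝟙 (obj p))
    (map_comp : ∀ {p q r : R} (h : p ≤ q) (h' : q ≤ r), map (h.trans h') = map h ≫ map h') : R ⥤ J where
  obj := obj
  map f := map (leOfHom f)
  map_id p := map_id p
  map_comp f g := map_comp (leOfHom f) (leOfHom g)

/-- The product of two functors on posets, as a functor on the product poset. -/
def pairFunctor {R S J K : Type} [PartialOrder R] [PartialOrder S] [SmallCategory J] [SmallCategory K]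
    (F : R ⥤ J) (G : S ⥤ K) : @CategoryTheory.Functor (R × S) (Preorder.smallCategory (R × S)) (J × K) _ :=
  posetFunctor (R := R × S) (fun p => ((F.obj p.1, G.obj p.2) : J × K))
    (fun h => (F.map (homOfLE h.1), G.map (homOfLE h.2)))
    (fun p => Prod.ext (F.map_id p.1) (G.map_id p.2))
    (fun h h' => Prod.ext (F.map_comp (homOfLE h.1) (homOfLE h'.1))
      (G.map_comp (homOfLE h.2) (homOfLE h'.2)))

/-- The diagram on a poset induced by a functor. -/
def diag {R J : Type} [PartialOrder R] [SmallCategory J] {C : SSet.{u}} (Φ : R ⥤ J) (M : N.{u} J ⟶ C) :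
    PMap (⊤ : LowerSet (Set R)) C := PMap.ofNerve (nMap Φ ≫ M)

/-- The restriction of a functor on a poset along an order embedding. -/
def restr {P R J : Type} [PartialOrder P] [PartialOrder R] [SmallCategory J] (e : P ↪o R) (Φ : R ⥤ J) : P ⥤ J :=
  e.monotone.functor ⋙ Φ

section Calculus

variable {P R : Type} [PartialOrder P] [OrderBot P] [Finite P] [PartialOrder R] [Finite R] {C : SSet.{u}}
  [SSet.Quasicategory C]

/-- The bridge from limit diagrams to the calculus: limit conditions on various shapes become exact
inclusions between subsets of a single poset R. -/
lemma exact_diag_iff {J : Type} [SmallCategory J] {Φ : R ⥤ J} {M : N.{u} J ⟶ C} (e : P ↪o R)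
    {F : P ⥤ J} (hF : restr e Φ = F) {U V : Set R} (hV : ∀ p, p ∈ V ↔ p ∈ Set.range e)
    (hU : ∀ p, e p ∈ U ↔ p ≠ ⊥) :
    (diag Φ M).Exact U V ↔ IsLimitDiagram (nMap F ≫ M) := by
  subst hF
  rw [isLimitDiagram_iff]
  exact PMap.exact_iff_of_embedding e (fun _ _ => rfl) hV hU

/-- The element of the square with given coordinates. -/
def Square.mk (a b : Fin 2) : Square := ((a, b) : Fin 2 × Fin 2)

lemma exact_diag_square_iff {J : Type} [SmallCategory J] {Φ : R ⥤ J} {M : N.{u} J ⟶ C} (e : Square ↪o R)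
    {F : Square ⥤ J} (hF : restr e Φ = F) :
    (diag Φ M).Exact {e (.mk 0 1), e (.mk 1 0), e (.mk 1 1)}
      (insert (e (.mk 0 0)) {e (.mk 0 1), e (.mk 1 0), e (.mk 1 1)}) ↔ IsPullbackSquare (nMap F ≫ M) := by
  have h : ∀ s : Square, s = .mk 0 0 ∨ s = .mk 0 1 ∨ s = .mk 1 0 ∨ s = .mk 1 1 := by
    rintro ⟨a, b⟩
    fin_cases a <;> fin_cases b
    exacts [Or.inl rfl, Or.inr (Or.inl rfl), Or.inr (Or.inr (Or.inl rfl)), Or.inr (Or.inr (Or.inr rfl))]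
  refine exact_diag_iff e hF (fun p => ⟨?_, ?_⟩) fun s => ?_
  · rintro (rfl | rfl | rfl | rfl) <;> exact ⟨_, rfl⟩
  · rintro ⟨s, rfl⟩
    rcases h s with rfl | rfl | rfl | rfl <;> simp
  · have h₀ : (⊥ : Square) = .mk 0 0 := rfl
    simp only [Set.mem_insert_iff, Set.mem_singleton_iff, e.injective.eq_iff]
    rw [h₀]
    have : ∀ a : Fin 2 × Fin 2, (a = (0, 1) ∨ a = (1, 0) ∨ a = (1, 1)) ↔ a ≠ (0, 0) := by decide
    exact this s

namespace PMap

variable {D : PMap (⊤ : LowerSet (Set R)) C} {U V S : Set R}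

/-- If the elements of `U` below each further element have a greatest element, then the limit over
`V` is the limit over `U`. -/
lemma Exact.of_exists_greatest (hUV : U ⊆ V)
    (h : ∀ v ∈ V, v ∉ U → ∃ u ∈ U, u ≤ v ∧ ∀ w ∈ U, w ≤ v → w ≤ u) : D.Exact U V :=
  Exact.of_isGreatest fun v hv hvU => by
    obtain ⟨u, hu, huv, hw⟩ := h v hv hvU
    exact ⟨u, hUV hu, ⟨hu, huv⟩, fun w hw' => hw w hw'.1 hw'.2⟩

/-- A limit remains a limit if the diagram is extended without changing the limit. -/
lemma Exact.insert_mono {v : R} (h : D.Exact S (insert v S)) (hSU : S ⊆ U) (hv : ∀ s ∈ S, v < s)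
    (hU : ∀ p ∈ U, p ∉ S → ∃ s ∈ S, s ≤ p ∧ ∀ s' ∈ S, s' ≤ p → s' ≤ s) : D.Exact U (insert v U) := by
  -- `S` is coreflective in `U`, and `insert v S` is coreflective in `insert v U`. The exactness of
  -- `S` in `insert v S` is then transferred by cancellation.
  refine Exact.of_trans_left hSU (Set.subset_insert _ _) (Exact.of_exists_greatest hSU hU)
    (h.trans (Set.subset_insert _ _) (Set.insert_subset_insert hSU)
      (Exact.of_exists_greatest (Set.insert_subset_insert hSU) ?_))
  rintro p (rfl | hp) hpS
  · exact absurd (Set.mem_insert _ _) hpS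
  · obtain ⟨s, hs, hsp, hs'⟩ := hU p hp fun h => hpS (Or.inr h)
    refine ⟨s, Or.inr hs, hsp, ?_⟩
    rintro s' (rfl | h) h'
    exacts [(hv s hs).le, hs' s' h h']

/-- Whether `v` can be added depends only on the elements of `U` above `v`; coreflectivity of `S` is
required for these alone. -/
lemma Exact.insert_of_exists {v : R} (h : D.Exact S (insert v S)) (hSU : S ⊆ U) (hv : ∀ s ∈ S, v < s)
    (hU : ∀ p ∈ U, v < p → p ∉ S → ∃ s ∈ S, s ≤ p ∧ ∀ s' ∈ S, s' ≤ p → s' ≤ s) :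
    D.Exact U (insert v U) :=
  Exact.of_insert (h.insert_mono (fun s hs => ⟨hSU hs, hv s hs⟩) hv fun p hp => hU p hp.1 hp.2)

/-- If each further element is a limit over an initial part of the elements of `U` above it, then the
limit over `V` is the limit over `U`. -/
lemma Exact.of_forall_exists (hUV : U ⊆ V) (h : ∀ v ∈ V, v ∉ U → ∃ S ⊆ U, D.Exact S (insert v S) ∧
    (∀ s ∈ S, v < s) ∧
    ∀ p ∈ U, v < p → p ∉ S → ∃ s ∈ S, s ≤ p ∧ ∀ s' ∈ S, s' ≤ p → s' ≤ s) : D.Exact U V :=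
  Exact.of_forall_exact hUV fun v hv hvU => by
    obtain ⟨S, hSU, hS, hvS, hs⟩ := h v hv hvU
    exact hS.insert_mono (fun s hs => ⟨hSU hs, hvS s hs⟩) hvS fun p hp hpS => hs p hp.1 hp.2 hpS

end PMap

end Calculus

/-! ### Composites of active equifibered morphisms. -/

section Composition

variable {C : SSet.{u}} [SSet.Quasicategory C] {X Y Z : SimplicialObj C}

/-- Pasting of pullback squares. -/
lemma exact_paste {D : PMap (⊤ : LowerSet (Set (Fin 2 × Fin 3))) C}
    (h₁ : D.Exact {(0, 1), (1, 0), (1, 1)} (insert (0, 0) {(0, 1), (1, 0), (1, 1)}))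
    (h₂ : D.Exact {(0, 2), (1, 1), (1, 2)} (insert (0, 1) {(0, 2), (1, 1), (1, 2)})) :
    D.Exact {(0, 2), (1, 0), (1, 2)} (insert (0, 0) {(0, 2), (1, 0), (1, 2)}) := by
  -- To the cospan of the outer rectangle are added `(1, 1)`, which lies above `(1, 0)`, then `(0,
  -- 1)` by the second square and `(0, 0)` by the first. Afterwards `(1, 1)` and `(0, 1)` are
  -- removed again by coreflection.
  have h₃ : D.Exact {(0, 2), (1, 0), (1, 2)} (insert (1, 1) {(0, 2), (1, 0), (1, 2)}) :=
    PMap.Exact.of_exists_greatest (Set.subset_insert _ _) (by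
      simp only [Set.mem_insert_iff, Set.mem_singleton_iff]; decide)
  have h₄ := h₂.insert_of_exists (U := insert (1, 1) {(0, 2), (1, 0), (1, 2)})
    (by simp only [Set.subset_def, Set.mem_insert_iff, Set.mem_singleton_iff]; decide)
    (by simp only [Set.mem_insert_iff, Set.mem_singleton_iff]; decide)
    (by simp only [Set.mem_insert_iff, Set.mem_singleton_iff]; decide)
  have h₅ := h₁.insert_of_exists (U := insert (0, 1) (insert (1, 1) {(0, 2), (1, 0), (1, 2)}))
    (by simp only [Set.subset_def, Set.mem_insert_iff, Set.mem_singleton_iff]; decide)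
    (by simp only [Set.mem_insert_iff, Set.mem_singleton_iff]; decide)
    (by simp only [Set.mem_insert_iff, Set.mem_singleton_iff]; decide)
  refine PMap.Exact.of_trans (Set.subset_insert _ _) ?_ ((h₃.trans (Set.subset_insert _ _)
    (Set.subset_insert _ _) h₄).trans ?_ (Set.subset_insert _ _) h₅)
    (PMap.Exact.of_exists_greatest ?_ ?_)
  all_goals
    simp only [Set.subset_def, Set.mem_insert_iff, Set.mem_singleton_iff]
    decide

/-- For a fixed map α the 2-simplex `σ` restricts to a diagram on `Fin 2 × Fin 3`. Its rectangles
opposite to 2, 0 and 1 are the naturality squares of `p`, `f` and `h`, so the claim is the pasting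
law. -/
theorem IsActiveEquifibered.of_isComposite {p : Y.Hom X} {f : X.Hom Z} {h : Y.Hom Z}
    (hp : IsActiveEquifibered p) (hf : IsActiveEquifibered f) (H : IsComposite p f h) :
    IsActiveEquifibered h := by
  obtain ⟨σ, h₁, h₂, h₃⟩ := H
  intro m n α hα
  have hp' := hp m n α hα
  have hf' := hf m n α hα
  rw [← h₁] at hp'
  rw [← h₂] at hf'
  rw [← h₃]
  let Φ := pairFunctor (ComposableArrows.mk₁ α.op) (𝟭 (Fin 3))
  let e (i : Fin 3) : Square ↪o Fin 2 × Fin 3 :=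
    { toFun := fun s => (s.1, i.succAbove s.2)
      inj' := fun s t h => Prod.ext (Prod.mk.inj h).1 (Fin.succAbove_right_injective (Prod.mk.inj h).2)
      map_rel_iff' := ⟨fun h => ⟨h.1, (Fin.succAboveOrderEmb i).le_iff_le.1 h.2⟩,
        fun h => ⟨h.1, (Fin.succAboveOrderEmb i).le_iff_le.2 h.2⟩⟩ }
  have hΦ (i : Fin 3) := exact_diag_square_iff (Φ := Φ) (M := σ) (e i) (F :=
      (Square.fstFunctor ⋙ ComposableArrows.mk₁ α.op).prod' Square.sndFunctor ⋙
        (𝟭 SimplexCategoryᵒᵖ).prod (Fin.succAboveOrderEmb i).monotone.functor) rfl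
  exact (hΦ 1).1 (exact_paste ((hΦ 2).2 hp') ((hΦ 0).2 hf'))

end Composition

/-! ### Cubes of pullbacks and limits of pullbacks. -/

instance : DecidableEq Square := inferInstanceAs (DecidableEq (Fin 2 × Fin 2))

instance : Fintype Square := inferInstanceAs (Fintype (Fin 2 × Fin 2))

instance : DecidableLE Square := inferInstanceAs (DecidableLE (Fin 2 × Fin 2))

section Cubes

variable {C : SSet.{u}} [SSet.Quasicategory C]

set_option linter.unusedSimpArgs false in
set_option synthInstance.maxHeartbeats 400000 in
set_option synthInstance.maxSize 2000 in
/-- The face opposite to a pullback square in a cube with two parallel pullback faces. -/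
lemma exact_cube {D : PMap (⊤ : LowerSet (Set (Fin 2 × Square))) C}
    (h : ∀ t : Fin 2, D.Exact {(t, .mk 0 1), (t, .mk 1 0), (t, .mk 1 1)}
      (insert (t, .mk 0 0) {(t, .mk 0 1), (t, .mk 1 0), (t, .mk 1 1)}))
    (hp : D.Exact {(0, .mk 1 1), (1, .mk 1 0), (1, .mk 1 1)}
      (insert (0, .mk 1 0) {(0, .mk 1 1), (1, .mk 1 0), (1, .mk 1 1)})) :
    D.Exact {(0, .mk 0 1), (1, .mk 0 0), (1, .mk 0 1)}
      (insert (0, .mk 0 0) {(0, .mk 0 1), (1, .mk 0 0), (1, .mk 0 1)}) := by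
  let B : Set (Fin 2 × Square) := {(1, .mk 1 0), (0, .mk 0 1), (1, .mk 1 1)}
  -- In the application `Square` carries T, W, Y, X at 00, 01, 10, 11, and the first coordinate is
  -- the direction of α. The limit over `B'` does not change when Y₀, T₀ and T₁ are added, nor when
  -- T₁ alone is added. By cancellation T₀ is the limit over `B'` with T₁, which reduces to W₀, T₁,
  -- W₁.
  let B' : Set (Fin 2 × Square) := {(1, .mk 1 0), (0, .mk 0 1), (1, .mk 1 1), (1, .mk 0 1), (0, .mk 1 1)}
  have h₁ : D.Exact B B' := PMap.Exact.of_exists_greatest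
      (by simp only [B, B', Set.subset_def, Set.mem_insert_iff, Set.mem_singleton_iff]; decide)
      (by simp only [B, B', Set.subset_def, Set.mem_insert_iff, Set.mem_singleton_iff]; decide)
  have h₂ : D.Exact B' (insert (0, .mk 1 0) B') :=
    hp.insert_of_exists
      (by simp only [B, B', Set.subset_def, Set.mem_insert_iff, Set.mem_singleton_iff]; decide)
      (by simp only [B, B', Set.subset_def, Set.mem_insert_iff, Set.mem_singleton_iff]; decide)
      (by simp only [B, B', Set.subset_def, Set.mem_insert_iff, Set.mem_singleton_iff]; decide)
  have h₃ : D.Exact (insert (0, .mk 1 0) B') (insert (0, .mk 0 0) (insert (0, .mk 1 0) B')) :=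
    (h 0).insert_of_exists
      (by simp only [B, B', Set.subset_def, Set.mem_insert_iff, Set.mem_singleton_iff]; decide)
      (by simp only [B, B', Set.subset_def, Set.mem_insert_iff, Set.mem_singleton_iff]; decide)
      (by simp only [B, B', Set.subset_def, Set.mem_insert_iff, Set.mem_singleton_iff]; decide)
  have h₄ : D.Exact (insert (0, .mk 0 0) (insert (0, .mk 1 0) B'))
      (insert (1, .mk 0 0) (insert (0, .mk 0 0) (insert (0, .mk 1 0) B'))) :=
    (h 1).insert_of_exists
      (by simp only [B, B', Set.subset_def, Set.mem_insert_iff, Set.mem_singleton_iff]; decide)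
      (by simp only [B, B', Set.subset_def, Set.mem_insert_iff, Set.mem_singleton_iff]; decide)
      (by simp only [B, B', Set.subset_def, Set.mem_insert_iff, Set.mem_singleton_iff]; decide)
  have h₅ : D.Exact B' (insert (1, .mk 0 0) B') :=
    (h 1).insert_of_exists
      (by simp only [B, B', Set.subset_def, Set.mem_insert_iff, Set.mem_singleton_iff]; decide)
      (by simp only [B, B', Set.subset_def, Set.mem_insert_iff, Set.mem_singleton_iff]; decide)
      (by simp only [B, B', Set.subset_def, Set.mem_insert_iff, Set.mem_singleton_iff]; decide)
  have h₆ : D.Exact B' (insert (1, .mk 0 0) (insert (0, .mk 0 0) (insert (0, .mk 1 0) B'))) :=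
    (h₂.trans (Set.subset_insert _ _) (Set.subset_insert _ _) h₃).trans
      ((Set.subset_insert _ _).trans (Set.subset_insert _ _)) (Set.subset_insert _ _) h₄
  have h₇ : insert (1, .mk 0 0) B' ⊆ insert (1, .mk 0 0) (insert (0, .mk 0 0) (insert (0, .mk 1 0) B')) :=
    Set.insert_subset_insert ((Set.subset_insert _ _).trans (Set.subset_insert _ _))
  have h₈ : D.Exact {(0, .mk 0 1), (1, .mk 0 0), (1, .mk 0 1)} (insert (1, .mk 0 0) B') :=
    PMap.Exact.of_exists_greatest
      (by simp only [B, B', Set.subset_def, Set.mem_insert_iff, Set.mem_singleton_iff]; decide)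
      (by simp only [B, B', Set.subset_def, Set.mem_insert_iff, Set.mem_singleton_iff]; decide)
  refine PMap.Exact.of_trans (Set.subset_insert _ _) ?_ (h₈.trans
      (by simp only [B, B', Set.subset_def, Set.mem_insert_iff, Set.mem_singleton_iff]; decide) h₇
    (PMap.Exact.of_trans_left (Set.subset_insert _ _) h₇ h₅ h₆))
    (PMap.Exact.of_exists_greatest (V := insert (1, .mk 0 0) (insert (0, .mk 0 0) (insert (0, .mk 1 0) B'))) ?_ ?_)
  all_goals
    simp only [B, B', Set.subset_def, Set.mem_insert_iff, Set.mem_singleton_iff]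
    decide

variable {K : Type} [PartialOrder K] [OrderBot K] [Finite K]

/-- If the values at the apexes of three vertices of a family of pullback squares are limits, then so is
the fourth. -/
lemma exact_fibre_product {D : PMap (⊤ : LowerSet (Set (K × Square))) C}
    (h : ∀ k : K, D.Exact {(k, .mk 0 1), (k, .mk 1 0), (k, .mk 1 1)}
      (insert (k, .mk 0 0) {(k, .mk 0 1), (k, .mk 1 0), (k, .mk 1 1)}))
    (hY : D.Exact {p | p.1 ≠ ⊥ ∧ p.2 = .mk 1 0} (insert (⊥, .mk 1 0) {p | p.1 ≠ ⊥ ∧ p.2 = .mk 1 0}))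
    (hW : D.Exact {p | (.mk 0 1 : Square) ≤ p.2 ∧ p ≠ (⊥, .mk 0 1)}
      (insert (⊥, .mk 0 1) {p | (.mk 0 1 : Square) ≤ p.2 ∧ p ≠ (⊥, .mk 0 1)})) :
    D.Exact {p | p.1 ≠ ⊥ ∧ p.2 = .mk 0 0} (insert (⊥, .mk 0 0) {p | p.1 ≠ ⊥ ∧ p.2 = .mk 0 0}) := by
  have hne : ∀ s : Square, s ≠ .mk 0 0 → s = .mk 0 1 ∨ s = .mk 1 0 ∨ s = .mk 1 1 := by decide
  have d₀₁ : (.mk 0 1 : Square) ≠ .mk 0 0 := by decide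
  have d₁₀ : (.mk 1 0 : Square) ≠ .mk 0 0 := by decide
  have d₁₁ : (.mk 1 1 : Square) ≠ .mk 0 0 := by decide
  have l₁₁ : (.mk 1 0 : Square) ≤ .mk 1 1 := by decide
  have n₀₀ : ¬ (.mk 0 1 : Square) ≤ .mk 0 0 := by decide
  have hbot : ∀ s : Square, .mk 0 0 ≤ s := by decide
  -- In the application the four corners are T, W, Y, X at 00, 01, 10, 11, and `⊥` stands for [n],
  -- the other elements of K for its spine. Everything is compared with `B`, the spines of W, Y and
  -- X. The spine of T consists of pullbacks, so `A`, all four spines, has the same limit as `B`; it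
  -- is also coreflected onto the spine of T.
  let B : Set (K × Square) := {p | p.1 ≠ ⊥ ∧ p.2 ≠ .mk 0 0}
  let A : Set (K × Square) := {p | p.1 ≠ ⊥}
  have hT : ∀ (k : K), ∀ s ∈ ({(k, .mk 0 1), (k, .mk 1 0), (k, .mk 1 1)} : Set (K × Square)),
      (k, .mk 0 0) < s := by
    rintro k s (rfl | rfl | rfl) <;>
    · refine lt_of_le_of_ne ⟨le_rfl, hbot _⟩ fun e => ?_
      exact absurd (Prod.mk.inj e).2 (by decide)
  have hTg : ∀ (k : K) (p : K × Square), p.2 ≠ .mk 0 0 → (k, .mk 0 0) < p →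
      ∃ s ∈ ({(k, .mk 0 1), (k, .mk 1 0), (k, .mk 1 1)} : Set (K × Square)), s ≤ p ∧
        ∀ s' ∈ ({(k, .mk 0 1), (k, .mk 1 0), (k, .mk 1 1)} : Set (K × Square)), s' ≤ p → s' ≤ s := by
    intro k p hp hkp
    refine ⟨(k, p.2), (hne p.2 hp).imp (congrArg _) (Or.imp (congrArg _) (congrArg _)), ⟨hkp.le.1, le_rfl⟩,
      fun s' hs' h' => ⟨?_, h'.2⟩⟩
    rcases hs' with rfl | rfl | rfl <;> exact le_rfl
  have hBA : B ⊆ A := fun p hp => hp.1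
  have h₁ : D.Exact {p | p.1 ≠ ⊥ ∧ p.2 = .mk 0 0} A :=
    PMap.Exact.of_exists_greatest (fun p hp => hp.1) fun v hv _ =>
      ⟨(v.1, .mk 0 0), ⟨hv, rfl⟩, ⟨le_rfl, hbot _⟩, fun w hw hwv => ⟨hwv.1, hw.2.le⟩⟩
  have h₂ : D.Exact B A := PMap.Exact.of_forall_exists hBA fun v hv hvB => by
    obtain ⟨k, s⟩ := v
    obtain rfl : s = .mk 0 0 := by_contra fun hs => hvB ⟨hv, hs⟩
    refine ⟨_, ?_, h k, hT k, fun p hp hkp _ => hTg k p hp.2 hkp⟩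
    rintro p (rfl | rfl | rfl)
    exacts [⟨hv, d₀₁⟩, ⟨hv, d₁₀⟩, ⟨hv, d₁₁⟩]
  let B₁ : Set (K × Square) := insert (⊥, .mk 1 0) B
  let B₂ : Set (K × Square) := insert (⊥, .mk 1 1) B₁
  let B₃ : Set (K × Square) := insert (⊥, .mk 0 1) B₂
  let B₄ : Set (K × Square) := insert (⊥, .mk 0 0) B₃
  have h₃ : D.Exact B B₁ := hY.insert_of_exists (fun p hp => ⟨hp.1, fun e => d₁₀ (hp.2.symm.trans e)⟩)
    (fun s hs => lt_of_le_of_ne ⟨bot_le, hs.2.ge⟩ fun e => hs.1 (congrArg Prod.fst e.symm))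
    fun p hp hlt _ => ⟨(p.1, .mk 1 0), ⟨hp.1, rfl⟩, ⟨le_rfl, hlt.le.2⟩, fun s' hs' h' => ⟨h'.1, hs'.2.le⟩⟩
  -- The value of X at `⊥` lies above the value of Y at `⊥`, which is present already. It can be
  -- added without any limit condition on X.
  have h₄ : D.Exact B₁ B₂ := PMap.Exact.of_exists_greatest (Set.subset_insert _ _) (by
    rintro v (rfl | hv) hvB
    · refine ⟨(⊥, .mk 1 0), Or.inl rfl, ⟨le_rfl, l₁₁⟩, ?_⟩
      rintro w (rfl | hw) hwv
      · exact le_rfl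
      · exact absurd (le_bot_iff.1 hwv.1) hw.1
    · exact absurd hv hvB)
  have hW₂ : ∀ p ∈ ({p | (.mk 0 1 : Square) ≤ p.2 ∧ p ≠ (⊥, .mk 0 1)} : Set (K × Square)), p ∈ B₂ := by
    rintro ⟨k, s⟩ ⟨hs, hp⟩
    by_cases hk : k = ⊥
    · subst hk
      have : ∀ s : Square, .mk 0 1 ≤ s → s = .mk 0 1 ∨ s = .mk 1 1 := by decide
      exact Or.inl (congrArg _ ((this s hs).resolve_left fun e => hp (congrArg _ e)))
    · refine Or.inr (Or.inr ⟨hk, fun e => ?_⟩)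
      rw [show s = _ from e] at hs
      exact n₀₀ hs
  have h₅ : D.Exact B₂ B₃ := hW.insert_of_exists hW₂
    (fun s hs => lt_of_le_of_ne ⟨bot_le, hs.1⟩ hs.2.symm)
    fun p hp hlt hpS => absurd ⟨hlt.le.2, hlt.ne'⟩ hpS
  have hB₃ : ∀ p ∈ B₃, p.2 ≠ .mk 0 0 := by
    rintro p (rfl | rfl | rfl | hp)
    exacts [d₀₁, d₁₁, d₁₀, hp.2]
  have h₆ : D.Exact B₃ B₄ := (h ⊥).insert_of_exists
    (by
      rintro p (rfl | rfl | rfl)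
      exacts [Or.inl rfl, Or.inr (Or.inr (Or.inl rfl)), Or.inr (Or.inl rfl)])
    (hT ⊥) fun p hp hlt _ => hTg ⊥ p (hB₃ p hp) hlt
  have h₇ : D.Exact B₄ Set.univ := PMap.Exact.of_forall_exists (Set.subset_univ _) fun v _ hvB => by
    obtain ⟨k, s⟩ := v
    have hk : k ≠ ⊥ := by
      rintro rfl
      by_cases hs : s = .mk 0 0
      · exact hvB (Or.inl (congrArg _ hs))
      · rcases hne s hs with rfl | rfl | rfl
        exacts [hvB (Or.inr (Or.inl rfl)), hvB (Or.inr (Or.inr (Or.inr (Or.inl rfl)))),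
          hvB (Or.inr (Or.inr (Or.inl rfl)))]
    obtain rfl : s = .mk 0 0 := by_contra fun hs => hvB (Or.inr (Or.inr (Or.inr (Or.inr ⟨hk, hs⟩))))
    refine ⟨_, ?_, h k, hT k, ?_⟩
    · rintro p (rfl | rfl | rfl) <;> refine Or.inr (Or.inr (Or.inr (Or.inr ⟨hk, ?_⟩)))
      exacts [d₀₁, d₁₀, d₁₁]
    · rintro p (rfl | hp) hlt _
      · exact absurd (le_bot_iff.1 hlt.le.1) hk
      · exact hTg k p (hB₃ p hp) hlt
  have s₁ : B ⊆ B₁ := Set.subset_insert _ _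
  have s₂ : B₁ ⊆ B₂ := Set.subset_insert _ _
  have s₃ : B₂ ⊆ B₃ := Set.subset_insert _ _
  have s₄ : B₃ ⊆ B₄ := Set.subset_insert _ _
  have h₈ : D.Exact B Set.univ := ((((h₃.trans s₁ s₂ h₄).trans (s₁.trans s₂) s₃ h₅).trans
    ((s₁.trans s₂).trans s₃) s₄ h₆).trans (((s₁.trans s₂).trans s₃).trans s₄) (Set.subset_univ _) h₇)
  refine PMap.Exact.of_trans (Set.subset_insert _ _) (Set.subset_univ _) (h₁.trans (fun p hp => hp.1)
    (Set.subset_univ _) (PMap.Exact.of_trans_left hBA (Set.subset_univ _) h₂ h₈))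
    (PMap.Exact.of_exists_greatest (Set.subset_univ _) fun v _ _ => ⟨(v.1, .mk 0 0), ?_,
      ⟨le_rfl, hbot _⟩, ?_⟩)
  · by_cases hv : v.1 = ⊥
    · exact Or.inl (by rw [hv])
    · exact Or.inr ⟨hv, rfl⟩
  · rintro w (rfl | hw) hwv
    exacts [⟨bot_le, le_rfl⟩, ⟨hwv.1, hw.2.le⟩]

/-- A pullback of limits is a limit. -/
lemma exact_relative {J : Type} [PartialOrder J] [Finite J]
    {D : PMap (⊤ : LowerSet (Set (WithBot (WithBot J) × Fin 2))) C}
    (h : ∀ k : Fin 2, D.Exact {p | (((⊥ : WithBot J) : WithBot (WithBot J)), k) < p ∧ p.2 = k}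
      (insert (((⊥ : WithBot J) : WithBot (WithBot J)), k)
        {p | (((⊥ : WithBot J) : WithBot (WithBot J)), k) < p ∧ p.2 = k}))
    (hsq : D.Exact {(⊥, 1), (((⊥ : WithBot J) : WithBot (WithBot J)), 0), (((⊥ : WithBot J) : WithBot (WithBot J)), 1)}
      (insert (⊥, 0) {(⊥, 1), (((⊥ : WithBot J) : WithBot (WithBot J)), 0),
        (((⊥ : WithBot J) : WithBot (WithBot J)), 1)})) :
    D.Exact {p | p.1 ≠ ((⊥ : WithBot J) : WithBot (WithBot J)) ∧ p ≠ (⊥, 0)}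
      (insert (⊥, 0) {p | p.1 ≠ ((⊥ : WithBot J) : WithBot (WithBot J)) ∧ p ≠ (⊥, 0)}) := by
  let m : WithBot (WithBot J) := ((⊥ : WithBot J) : WithBot (WithBot J))
  have hm : ∀ p : WithBot (WithBot J), p ≠ ⊥ → m ≤ p := by
    intro p hp
    obtain ⟨q, rfl⟩ := WithBot.ne_bot_iff_exists.1 hp
    exact WithBot.coe_le_coe.2 bot_le
  have hm' : ⊥ < m := WithBot.bot_lt_coe _
  let U : Set (WithBot (WithBot J) × Fin 2) := {p | p.1 ≠ m ∧ p ≠ (⊥, 0)}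
  -- The two middle objects are limits over their spines, so they can be adjoined both before and
  -- after the apex `(⊥, 0)`. With them present, `hsq` adds the apex; cancellation then removes
  -- them.
  have hext : ∀ U' : Set (WithBot (WithBot J) × Fin 2), U ⊆ U' → (∀ p ∈ U', p.1 ≠ m) →
      D.Exact U' (U' ∪ {p | p.1 = m}) := by
    intro U' hU hU'
    refine PMap.Exact.of_forall_exists Set.subset_union_left fun v hv hvU => ?_
    obtain ⟨k, t⟩ := v
    obtain rfl : k = m := hv.resolve_left hvU
    refine ⟨_, ?_, h t, fun s hs => hs.1, fun p hp hlt hpS => ?_⟩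
    · rintro p ⟨hp, rfl⟩
      have hpm : p.1 ≠ m := fun e => hp.ne (Prod.ext e.symm rfl)
      refine hU ⟨hpm, fun e => ?_⟩
      rw [e] at hp
      exact absurd hp.le.1 (not_le_of_gt hm')
    · refine ⟨(p.1, t), ⟨lt_of_le_of_ne ⟨hlt.le.1, le_rfl⟩ fun e => hU' p hp (congrArg Prod.fst e.symm), rfl⟩,
        ⟨le_rfl, hlt.le.2⟩, fun s' hs' h' => ⟨h'.1, hs'.2.le⟩⟩
  have h₁ := hext U le_rfl fun p hp => hp.1
  have h₂ := hext (insert (⊥, 0) U) (Set.subset_insert _ _) (by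
    rintro p (rfl | hp)
    exacts [hm'.ne, hp.1])
  have h₃ : D.Exact (U ∪ {p | p.1 = m}) (insert (⊥, 0) (U ∪ {p | p.1 = m})) := by
    refine hsq.insert_of_exists ?_ ?_ ?_
    · rintro p (rfl | rfl | rfl)
      · exact Or.inl ⟨hm'.ne, fun e => absurd (congrArg Prod.snd e) (by simp)⟩
      · exact Or.inr rfl
      · exact Or.inr rfl
    · rintro p (rfl | rfl | rfl)
      · exact lt_of_le_of_ne ⟨le_rfl, Fin.zero_le _⟩ fun e => absurd (congrArg Prod.snd e) (by simp)
      · exact lt_of_le_of_ne ⟨hm'.le, le_rfl⟩ fun e => hm'.ne (congrArg Prod.fst e)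
      · exact lt_of_le_of_ne ⟨hm'.le, Fin.zero_le _⟩ fun e => hm'.ne (congrArg Prod.fst e)
    · rintro ⟨k, t⟩ hp hlt hpS
      have hk : k ≠ ⊥ := by
        rintro rfl
        fin_cases t
        · exact hlt.ne rfl
        · exact hpS (Or.inl rfl)
      refine ⟨(m, t), ?_, ⟨hm k hk, le_rfl⟩, ?_⟩
      · fin_cases t
        exacts [Or.inr (Or.inl rfl), Or.inr (Or.inr rfl)]
      · rintro s' (rfl | rfl | rfl) h'
        exacts [⟨hm'.le, h'.2⟩, ⟨le_rfl, h'.2⟩, ⟨le_rfl, h'.2⟩]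
  rw [← Set.insert_union] at h₃
  exact PMap.Exact.of_trans (Set.subset_insert _ _) Set.subset_union_left
    (h₁.trans Set.subset_union_left (Set.union_subset_union_left _ (Set.subset_insert _ _)) h₃) h₂

end Cubes

/-! ### Pullbacks of relative `2`-Segal objects. -/

section FibreProducts

variable {C : SSet.{u}}

lemma exact_diag_iff_isExact {P R J : Type} [PartialOrder P] [OrderBot P] [PartialOrder R] [SmallCategory J]
    {Φ : R ⥤ J} {M : N.{u} J ⟶ C} (e : P ↪o R) {F : P ⥤ J} (hF : restr e Φ = F)
    {U V : Set R} (hV : ∀ p, p ∈ V ↔ p ∈ Set.range e) (hU : ∀ p, e p ∈ U ↔ p ≠ ⊥) :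
    (diag Φ M).Exact U V ↔ (diag F M).IsExact {⊥}ᶜ := by
  subst hF
  exact PMap.exact_iff_of_embedding e (fun _ _ => rfl) hV hU

/-- The embedding of a factor of a product of posets. -/
def sectEmbL (K : Type) {S : Type} [PartialOrder K] [PartialOrder S] (s : S) : K ↪o K × S where
  toFun k := (k, s)
  inj' _ _ h := (Prod.mk.inj h).1
  map_rel_iff' := ⟨fun h => h.1, fun h => ⟨h, le_rfl⟩⟩

/-- The embedding of a factor of a product of posets. -/
def sectEmbR {K : Type} (S : Type) [PartialOrder K] [PartialOrder S] (k : K) : S ↪o K × S where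
  toFun s := (k, s)
  inj' _ _ h := (Prod.mk.inj h).2
  map_rel_iff' := ⟨fun h => h.2, fun h => ⟨le_rfl, h⟩⟩

/-- The product of two order embeddings. -/
def prodEmb {K K' S S' : Type} [PartialOrder K] [PartialOrder S] [PartialOrder K'] [PartialOrder S']
    (e : K ↪o K') (e' : S ↪o S') : K × S ↪o K' × S' where
  toFun p := (e p.1, e' p.2)
  inj' _ _ h := Prod.ext (e.injective (Prod.mk.inj h).1) (e'.injective (Prod.mk.inj h).2)
  map_rel_iff' := ⟨fun h => ⟨e.le_iff_le.1 h.1, e'.le_iff_le.1 h.2⟩,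
    fun h => ⟨e.le_iff_le.2 h.1, e'.le_iff_le.2 h.2⟩⟩

variable [SSet.Quasicategory C]

/-- Pullbacks of simplicial objects are computed pointwise. -/
lemma isPullbackSquare_sectR (hC : HasFiniteLimits C) {J : Type} [SmallCategory J] {Q : N.{u} (J × Square) ⟶ C}
    (hQ : IsPullbackSquare (E := (ihom (N.{u} J)).obj C) (MonoidalClosed.curry (nProd J Square ≫ Q))) (j : J) :
    IsPullbackSquare (nMap (Prod.sectR j Square) ≫ Q) := by
  have h := famOf_at_isExact hC ((isLimitDiagram_iff _).1 hQ) (nVertex j)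
  refine (isLimitDiagram_iff _).2 ?_
  have e : (famOf (PMap.ofNerve (MonoidalClosed.curry (nProd J Square ≫ Q)))).at (nVertex j) =
      PMap.ofNerve (nMap (Prod.sectR j Square) ≫ Q) := by
    refine PMap.ext fun {k} x _ => ?_
    refine (uncurry_app (m := op ⦋k⦌) (MonoidalClosed.curry (nProd J Square ≫ Q)) _
      (nerveMk (m := op ⦋k⦌) x)).symm.trans ?_
    rw [MonoidalClosed.uncurry_curry]
    rfl
  rwa [e] at h

lemma pairFunctor_sectR {R S J K : Type} [PartialOrder R] [PartialOrder S] [SmallCategory J] [SmallCategory K]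
    (F : R ⥤ J) (G : S ⥤ K) (r : R) :
    restr (sectEmbR S r) (pairFunctor F G) = G ⋙ Prod.sectR (F.obj r) K :=
  CategoryTheory.Functor.hext (fun _ => rfl) fun _ _ f => heq_of_eq
    (Prod.ext (F.map_id r) rfl)

/-- Relative Segal maps, without reference to the limits over the spines. -/
lemma IsRelativeSegal.isExact {X Y : SimplicialObj C} {f : X.Hom Y} (hf : IsRelativeSegal f) {n : ℕ}
    (hn : 2 ≤ n) : (diag (pairFunctor (spineFunctor n ⋙ faceFunctor n) (𝟭 (Fin 2))) f.toMap).IsExact {⊥}ᶜ := by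
  obtain ⟨G, h₁, h₂, h₃⟩ := hf n hn
  let J := SpineFace n
  let m : WithBot (WithBot J) := ((⊥ : WithBot J) : WithBot (WithBot J))
  have hm' : ⊥ < m := WithBot.bot_lt_coe _
  have hm : ∀ p : WithBot (WithBot J), p ≠ ⊥ → m ≤ p := by
    intro p hp
    obtain ⟨q, rfl⟩ := WithBot.ne_bot_iff_exists.1 hp
    exact WithBot.coe_le_coe.2 bot_le
  let coeEmb : WithBot J ↪o WithBot (WithBot J) := WithBot.coeOrderHom
  let e₁ (k : Fin 2) : WithBot J ↪o WithBot (WithBot J) × Fin 2 := coeEmb.trans (sectEmbL _ k)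
  let apexEmb : Fin 2 ↪o WithBot (WithBot J) :=
    { toFun := (apexArrow J).obj
      inj' := by
        intro a b hab
        fin_cases a <;> fin_cases b
        exacts [rfl, absurd hab hm'.ne, absurd hab hm'.ne', rfl]
      map_rel_iff' := by
        intro a b
        fin_cases a <;> fin_cases b
        exacts [⟨fun _ => le_rfl, fun _ => le_rfl⟩, ⟨fun _ => Fin.zero_le _, fun _ => hm'.le⟩,
          ⟨fun h => absurd h (not_le_of_gt hm'), fun h => absurd h (by decide)⟩,
          ⟨fun _ => le_rfl, fun _ => le_rfl⟩] }
  let e₂ : Square ↪o WithBot (WithBot J) × Fin 2 := prodEmb apexEmb (RelEmbedding.refl _)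
  let skipEmb : WithBot J ↪o WithBot (WithBot J) :=
    { toFun := (skipMiddle J).obj
      inj' := WithBot.map_injective WithBot.coe_injective
      map_rel_iff' := fun {a b} => WithBot.map_le_iff _ (fun {_ _} => WithBot.coe_le_coe) }
  let e₃ : WithBot J × Fin 2 ↪o WithBot (WithBot J) × Fin 2 := prodEmb skipEmb (RelEmbedding.refl _)
  have h₄ := exact_relative (D := diag (pairFunctor (𝟭 (WithBot (WithBot J))) (𝟭 (Fin 2))) G)
    (fun k => (exact_diag_iff (e₁ k) (F := dropApex J ⋙ Prod.sectL (WithBot (WithBot J)) k) rfl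
      (fun p => ?_) fun p => ?_).2 (h₂ k))
    ((exact_diag_square_iff e₂ (F := (Square.fstFunctor ⋙ apexArrow J).prod' Square.sndFunctor) rfl).2 h₃)
  · have h₅ := (exact_diag_iff_isExact e₃ (F := pairFunctor (skipMiddle J) (𝟭 (Fin 2))) rfl
      (fun p => ?_) fun p => ?_).1 h₄
    · have e := congrArg (fun M => diag (pairFunctor (𝟭 (WithBot J)) (𝟭 (Fin 2))) M) h₁
      exact e ▸ h₅
    · constructor
      · rintro (rfl | ⟨hp, -⟩)
        · exact ⟨(⊥, 0), rfl⟩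
        · obtain ⟨q, t⟩ := p
          rcases eq_or_ne q ⊥ with rfl | hq
          · exact ⟨(⊥, t), rfl⟩
          · obtain ⟨q, rfl⟩ := WithBot.ne_bot_iff_exists.1 hq
            have hq' : q ≠ ⊥ := fun e => hp (congrArg WithBot.some e)
            obtain ⟨q, rfl⟩ := WithBot.ne_bot_iff_exists.1 hq'
            exact ⟨((q : WithBot J), t), rfl⟩
      · rintro ⟨⟨q, t⟩, rfl⟩
        induction q with
        | bot =>
          fin_cases t
          exacts [Or.inl rfl, Or.inr ⟨hm'.ne, fun e =>
            absurd (show (1 : Fin 2) = 0 from (Prod.mk.inj e).2) (by decide)⟩]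
        | coe q =>
          exact Or.inr ⟨fun e => absurd (WithBot.coe_injective e) (WithBot.coe_ne_bot),
            fun e => absurd (Prod.mk.inj e).1 (WithBot.coe_ne_bot)⟩
    · obtain ⟨q, t⟩ := p
      refine ⟨fun h e => h.2 (congrArg e₃ e), fun h => ⟨fun e => ?_, fun e => h (e₃.injective e)⟩⟩
      induction q with
      | bot => exact hm'.ne e
      | coe q => exact WithBot.coe_ne_bot (WithBot.coe_injective e)
  · constructor
    · rintro (rfl | ⟨hp, ht⟩)
      · exact ⟨⊥, rfl⟩
      · obtain ⟨q, t⟩ := p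
        obtain rfl : t = k := ht
        obtain ⟨q, rfl⟩ := WithBot.ne_bot_iff_exists.1 (hm'.trans_le hp.le.1).ne'
        exact ⟨q, rfl⟩
    · rintro ⟨q, rfl⟩
      rcases eq_or_ne q ⊥ with rfl | hq
      · exact Or.inl rfl
      · exact Or.inr ⟨lt_of_le_of_ne ⟨WithBot.coe_le_coe.2 bot_le, le_rfl⟩ fun e =>
          hq (WithBot.coe_injective (Prod.mk.inj e).1).symm, rfl⟩
  · refine ⟨fun h e => h.1.ne (by rw [e]; rfl), fun hq => ⟨lt_of_le_of_ne ⟨WithBot.coe_le_coe.2 bot_le, le_rfl⟩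
      fun e => hq (WithBot.coe_injective (Prod.mk.inj e).1).symm, rfl⟩⟩

variable {X Y W T : SimplicialObj C} {q : T.Hom Y} {π : T.Hom W} {p : Y.Hom X} {g : W.Hom X}

/-- The fibre product and a map α span a cube. Its two faces at the ends of α are pullbacks because
pullbacks of simplicial objects are pointwise, and the face of `p` is one by hypothesis. The face
opposite to it is the naturality square of `π`. -/
theorem IsActiveEquifibered.of_isFibreProduct (hC : HasFiniteLimits C) (hp : IsActiveEquifibered p)
    (H : IsFibreProduct q π p g) : IsActiveEquifibered π := by
  obtain ⟨Q, -, h₂, h₃, -, hQ⟩ := H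
  intro m n α hα
  have hp' := hp m n α hα
  rw [← h₃] at hp'
  rw [← h₂]
  let Φ := pairFunctor (ComposableArrows.mk₁ α.op) (𝟭 Square)
  let rightEmb (k : Fin 2) : Fin 2 ↪o Square := sectEmbR (Fin 2) k
  have h₅ (k : Fin 2) := exact_diag_square_iff (Φ := Φ) (M := Q)
    (prodEmb (RelEmbedding.refl _) (rightEmb k) : Fin 2 × Fin 2 ↪o Fin 2 × Square)
    (F := (Square.fstFunctor ⋙ ComposableArrows.mk₁ α.op).prod' Square.sndFunctor ⋙
        (𝟭 SimplexCategoryᵒᵖ).prod (Square.right k)) rfl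
  exact (h₅ 0).1 (exact_cube (fun t => (exact_diag_square_iff (Φ := Φ) (sectEmbR Square t) (pairFunctor_sectR _ _ t)).2
    (isPullbackSquare_sectR hC hQ _)) ((h₅ 1).2 hp'))

/-- Pullbacks commute with limits over the spine. The Segal condition for Y and the relative Segal
condition for `g` enter, the latter in the form that W_n is the limit of its spine, X_n and the
spine of X. -/
theorem IsSegal.of_isFibreProduct (hC : HasFiniteLimits C) (hY : IsSegal Y) (hg : IsRelativeSegal g)
    (H : IsFibreProduct q π p g) : IsSegal T := by
  obtain ⟨Q, -, h₂, h₃, h₄, hQ⟩ := H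
  intro n hn
  have hY' := hY n hn
  have hg' := hg.isExact hn
  rw [← p.source, ← h₃] at hY'
  rw [← π.source, ← h₂]
  rw [← h₄] at hg'
  let F := spineFunctor n ⋙ faceFunctor n
  let K := WithBot (SpineFace n)
  let leftEmb : Fin 2 ↪o Square := sectEmbL (Fin 2) 1
  have h₅ (s : Square) := exact_diag_iff (Φ := pairFunctor F (𝟭 Square)) (M := Q) (sectEmbL K s) rfl
    (U := {p | p.1 ≠ ⊥ ∧ p.2 = s}) (V := insert (⊥, s) {p | p.1 ≠ ⊥ ∧ p.2 = s})
    (fun p => ⟨by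
      rintro (rfl | ⟨-, rfl⟩)
      exacts [⟨⊥, rfl⟩, ⟨p.1, rfl⟩], by
      rintro ⟨k, rfl⟩
      rcases eq_or_ne k ⊥ with rfl | hk
      exacts [Or.inl rfl, Or.inr ⟨hk, rfl⟩]⟩) fun k => ⟨fun h => h.1, fun h => ⟨h, rfl⟩⟩
  refine (h₅ (.mk 0 0)).1 (exact_fibre_product (fun k => (exact_diag_square_iff
    (Φ := pairFunctor F (𝟭 Square)) (sectEmbR Square k) (pairFunctor_sectR _ _ k)).2 (isPullbackSquare_sectR hC hQ _)) ((h₅ (.mk 1 0)).2 hY')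
    ((exact_diag_iff_isExact (Φ := pairFunctor F (𝟭 Square)) (prodEmb (RelEmbedding.refl _) leftEmb : K × Fin 2 ↪o K × Square)
      (F := pairFunctor F (Square.left 1)) rfl (fun p => ?_) fun p => ?_).2 hg'))
  · constructor
    · rintro (rfl | ⟨h, -⟩)
      · exact ⟨(⊥, 0), rfl⟩
      · obtain ⟨k, a, b⟩ := p
        obtain rfl : b = 1 := le_antisymm (Fin.le_last b) h.2
        exact ⟨(k, a), rfl⟩
    · rintro ⟨⟨k, t⟩, rfl⟩
      exact or_iff_not_imp_left.2 fun e => ⟨⟨Fin.zero_le _, le_rfl⟩, e⟩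
  · exact ⟨fun h e => h.2 (by rw [e]; rfl), fun h => ⟨⟨Fin.zero_le _, le_rfl⟩, fun e =>
      h ((prodEmb (RelEmbedding.refl _) leftEmb : K × Fin 2 ↪o K × Square).injective e)⟩⟩

end FibreProducts

/-! ### Transfer of `2`-Segal squares along a relative Segal morphism. -/

section Cutting

variable {C : SSet.{u}} [SSet.Quasicategory C] {R : Type} [PartialOrder R] [OrderBot R] [Finite R]

/-- A relative limit condition over spines transfers squares of limits from the target to the source. -/
lemma exact_cut {D : PMap (⊤ : LowerSet (Set (R × Fin 2))) C} {A B I : R} {Sp : Set R} (hAI : A ≤ I)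
    (hBI : B ≤ I) (hAB : ¬ A ≤ B) (hBA : ¬ B ≤ A) (hSI : ∀ S ∈ Sp, ¬ S ≤ I)
    (hS : ∀ S ∈ Sp, A ≤ S ∨ B ≤ S) (hS' : ∀ S ∈ Sp, A ≤ S → B ≤ S → I ≤ S)
    (hX : D.Exact {(B, 1), (A, 1), (I, 1)} (insert (⊥, 1) {(B, 1), (A, 1), (I, 1)}))
    (hN : D.Exact {p | p.1 ∈ Sp ∨ p = (⊥, 1)} (insert (⊥, 0) {p | p.1 ∈ Sp ∨ p = (⊥, 1)}))
    (hB : D.Exact {p | (p.1 ∈ Sp ∧ B ≤ p.1) ∨ p = (B, 1)}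
      (insert (B, 0) {p | (p.1 ∈ Sp ∧ B ≤ p.1) ∨ p = (B, 1)}))
    (hA : D.Exact {p | ((p.1 ∈ Sp ∧ A ≤ p.1) ∨ p.1 = I) ∨ p = (A, 1)}
      (insert (A, 0) {p | ((p.1 ∈ Sp ∧ A ≤ p.1) ∨ p.1 = I) ∨ p = (A, 1)})) :
    D.Exact {(B, 0), (A, 0), (I, 0)} (insert (⊥, 0) {(B, 0), (A, 0), (I, 0)}) := by
  have h01 : ¬ (1 : Fin 2) ≤ 0 := by decide
  have hA₀ : ¬ A ≤ ⊥ := fun h => hAB (h.trans bot_le)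
  have hB₀ : ¬ B ≤ ⊥ := fun h => hBA (h.trans bot_le)
  have hfin : ∀ t : Fin 2, t = 0 ∨ t = 1 := by decide
  let M (t : Fin 2) : Set (R × Fin 2) := {(B, t), (A, t), (I, t)}
  -- In the application level 0 is W and level 1 is X, `⊥` is the face [n], and `A`, `B`, `I` are
  -- {0,…,i,j,…,n}, {i,…,j}, {i,j}. By `hN` the value W_n is the limit over `U₁`, the spines of both
  -- levels with X_n. The plan is to replace `U₁` by `M 0`, that is by W_B, W_A, W_I, through the
  -- larger set `U₄`.
  let U₁ : Set (R × Fin 2) := {p | p.1 ∈ Sp ∨ p = (⊥, 1)}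
  let U₃ : Set (R × Fin 2) := {p | p.1 ∈ Sp ∨ p.1 = A ∨ p.1 = B ∨ p.1 = I}
  let U₄ : Set (R × Fin 2) := insert (⊥, 1) U₃
  have hM : ∀ t, ∀ p ∈ U₃, t ≤ p.2 → ∃ u ∈ M t, u ≤ p ∧ ∀ w ∈ M t, w ≤ p → w ≤ u := by
    rintro t ⟨S, t'⟩ hp htp
    have hu : ∃ u : R, (u = B ∨ u = A ∨ u = I) ∧ u ≤ S ∧ (B ≤ S → B ≤ u) ∧ (A ≤ S → A ≤ u) ∧ (I ≤ S → I ≤ u) := by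
      rcases hp with hp | hp | hp | hp
      · by_cases h₁ : A ≤ S <;> by_cases h₂ : B ≤ S
        · exact ⟨I, Or.inr (Or.inr rfl), hS' S hp h₁ h₂, fun _ => hBI, fun _ => hAI, fun _ => le_rfl⟩
        · exact ⟨A, Or.inr (Or.inl rfl), h₁, fun h => absurd h h₂, fun _ => le_rfl,
            fun h => absurd (hBI.trans h) h₂⟩
        · exact ⟨B, Or.inl rfl, h₂, fun _ => le_rfl, fun h => absurd h h₁, fun h => absurd (hAI.trans h) h₁⟩
        · exact absurd (hS S hp) (not_or.2 ⟨h₁, h₂⟩)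
      · exact ⟨S, Or.inr (Or.inl hp), le_rfl, id, id, id⟩
      · exact ⟨S, Or.inl hp, le_rfl, id, id, id⟩
      · exact ⟨S, Or.inr (Or.inr hp), le_rfl, id, id, id⟩
    obtain ⟨u, hu, huS, h₁, h₂, h₃⟩ := hu
    refine ⟨(u, t), hu.imp (congrArg fun r => (r, t)) (Or.imp (congrArg fun r => (r, t))
      (congrArg fun r => (r, t))), ⟨huS, htp⟩, ?_⟩
    rintro w (rfl | rfl | rfl) hw
    exacts [⟨h₁ hw.1, le_rfl⟩, ⟨h₂ hw.1, le_rfl⟩, ⟨h₃ hw.1, le_rfl⟩]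
  have hMU : ∀ t, M t ⊆ U₃ := by
    rintro t p (rfl | rfl | rfl)
    exacts [Or.inr (Or.inr (Or.inl rfl)), Or.inr (Or.inl rfl), Or.inr (Or.inr (Or.inr rfl))]
  have hlt : ∀ {S : R} {t : Fin 2} {q : R × Fin 2}, S ≤ q.1 → t ≤ q.2 → (S ≠ q.1 ∨ t ≠ q.2) → (S, t) < q := by
    intro S t q h h' h''
    exact lt_of_le_of_ne ⟨h, h'⟩ fun e => h''.elim (fun h => h (congrArg Prod.fst e))
      fun h => h (congrArg Prod.snd e)
  have hX₁ : ∀ s ∈ M 1, (⊥, 1) < s := by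
    rintro s (rfl | rfl | rfl)
    exacts [hlt bot_le le_rfl (Or.inl fun e => hB₀ (ge_of_eq e)), hlt bot_le le_rfl (Or.inl fun e => hA₀ (ge_of_eq e)),
      hlt bot_le le_rfl (Or.inl fun e => hA₀ (hAI.trans (ge_of_eq e)))]
  have h₁ : D.Exact (M 0) U₃ := PMap.Exact.of_exists_greatest (hMU 0) fun v hv _ => hM 0 v hv (Fin.zero_le _)
  have h₂ : D.Exact U₃ U₄ := hX.insert_of_exists (hMU 1) hX₁ fun p hp hlt _ => hM 1 p hp hlt.le.2
  have h₁' : D.Exact (insert (⊥, 0) (M 0)) (insert (⊥, 0) U₃) :=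
    PMap.Exact.of_exists_greatest (Set.insert_subset_insert (hMU 0)) (by
      rintro v (rfl | hv) hvM
      · exact absurd (Or.inl rfl) hvM
      · obtain ⟨u, hu, huv, hw⟩ := hM 0 v hv (Fin.zero_le _)
        refine ⟨u, Or.inr hu, huv, ?_⟩
        rintro w (rfl | hw')
        exacts [fun _ => ⟨bot_le, Fin.zero_le _⟩, hw w hw'])
  have h₂' : D.Exact (insert (⊥, 0) U₃) (insert (⊥, 0) U₄) := by
    have := hX.insert_of_exists (U := insert (⊥, 0) U₃) ((hMU 1).trans (Set.subset_insert _ _)) hX₁ (by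
      rintro p (rfl | hp) hlt _
      exacts [absurd hlt.le.2 h01, hM 1 p hp hlt.le.2])
    rwa [Set.insert_comm] at this
  -- Enlargement from `U₁` to `U₄`, with or without W_n: X_A, X_B and X_I lie above X_n, then W_B is
  -- a limit by `hB`, W_I lies above W_B, and W_A is a limit by `hA`. The order matters, since the
  -- spine of A contains I.
  have h₃ : ∀ U : Set (R × Fin 2), U₁ ⊆ U → (∀ p ∈ U, p ∈ U₁ ∨ p = (⊥, 0)) →
      D.Exact U (U ∪ {p | p.1 = A ∨ p.1 = B ∨ p.1 = I}) := by
    intro U hU₁ hU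
    have hle : ∀ w ∈ U, w.1 ≤ I → w = (⊥, 1) ∨ w = (⊥, 0) := fun w hw hwI =>
      (hU w hw).imp_left fun h => h.resolve_left fun h => hSI _ h hwI
    have hSp : ∀ w ∈ U, ¬ w.1 ≤ ⊥ → w.1 ∈ Sp := fun w hw hwn => by
      rcases hU w hw with (h | rfl) | rfl
      exacts [h, absurd le_rfl hwn, absurd le_rfl hwn]
    let V₁ : Set (R × Fin 2) := U ∪ M 1
    let V₂ : Set (R × Fin 2) := insert (B, 0) V₁
    let V₃ : Set (R × Fin 2) := insert (I, 0) V₂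
    have e₁ : D.Exact U V₁ := PMap.Exact.of_exists_greatest Set.subset_union_left (by
      rintro v (hv | hv) hvU
      · exact absurd hv hvU
      · have hvI : v.1 ≤ I ∧ v.2 = 1 := by
          rcases hv with rfl | rfl | rfl
          exacts [⟨hBI, rfl⟩, ⟨hAI, rfl⟩, ⟨le_rfl, rfl⟩]
        refine ⟨(⊥, 1), hU₁ (Or.inr rfl), ⟨bot_le, hvI.2.ge⟩, fun w hw hwv => ?_⟩
        rcases hle w hw (hwv.1.trans hvI.1) with rfl | rfl
        exacts [le_rfl, ⟨le_rfl, Fin.zero_le _⟩])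
    have e₂ : D.Exact V₁ V₂ := by
      refine hB.insert_of_exists ?_ ?_ ?_
      · rintro p (⟨hp, -⟩ | rfl)
        exacts [Or.inl (hU₁ (Or.inl hp)), Or.inr (Or.inl rfl)]
      · rintro s (⟨hs, hBs⟩ | rfl)
        · exact hlt hBs (Fin.zero_le _) (Or.inl fun e => hSI _ hs (e ▸ hBI))
        · exact hlt le_rfl (Fin.zero_le _) (Or.inr (show (0 : Fin 2) ≠ 1 by decide))
      · rintro p (hp | rfl | rfl | rfl) hltp hpS
        · exact absurd (Or.inl ⟨hSp p hp fun h => hB₀ (hltp.le.1.trans h), hltp.le.1⟩) hpS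
        · exact absurd (Or.inr rfl) hpS
        · exact absurd hltp.le.1 hBA
        · refine ⟨(B, 1), Or.inr rfl, ⟨hBI, le_rfl⟩, ?_⟩
          rintro s' (⟨hs, -⟩ | rfl) hs'
          exacts [absurd hs'.1 (hSI _ hs), le_rfl]
    have e₃ : D.Exact V₂ V₃ := PMap.Exact.of_exists_greatest (Set.subset_insert _ _) (by
      rintro v (rfl | hv) hvV
      · refine ⟨(B, 0), Or.inl rfl, ⟨hBI, le_rfl⟩, ?_⟩
        rintro w (rfl | hw | rfl | rfl | rfl) hwv
        · exact le_rfl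
        · rcases hle w hw hwv.1 with rfl | rfl
          exacts [absurd hwv.2 h01, ⟨bot_le, le_rfl⟩]
        all_goals exact absurd hwv.2 h01
      · exact absurd hv hvV)
    have e₄ : D.Exact V₃ (insert (A, 0) V₃) := by
      refine hA.insert_of_exists ?_ ?_ ?_
      · rintro ⟨S, t⟩ ((⟨hp, -⟩ | hp) | hp)
        · exact Or.inr (Or.inr (Or.inl (hU₁ (Or.inl hp))))
        · obtain rfl : S = I := hp
          rcases hfin t with rfl | rfl
          exacts [Or.inl rfl, Or.inr (Or.inr (Or.inr (Or.inr (Or.inr rfl))))]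
        · exact Or.inr (Or.inr (Or.inr (Or.inr (Or.inl hp))))
      · rintro s ((⟨hs, hAs⟩ | hs) | rfl)
        · exact hlt hAs (Fin.zero_le _) (Or.inl fun e => hSI _ hs (e ▸ hAI))
        · exact hlt (hs ▸ hAI) (Fin.zero_le _) (Or.inl fun e => hBA (hBI.trans_eq (hs.symm.trans e.symm)))
        · exact hlt le_rfl (Fin.zero_le _) (Or.inr (show (0 : Fin 2) ≠ 1 by decide))
      · rintro p (rfl | rfl | hp | rfl | rfl | rfl) hltp hpS
        · exact absurd (Or.inl (Or.inr rfl)) hpS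
        · exact absurd hltp.le.1 hAB
        · exact absurd (Or.inl (Or.inl ⟨hSp p hp fun h => hA₀ (hltp.le.1.trans h), hltp.le.1⟩)) hpS
        · exact absurd hltp.le.1 hAB
        · exact absurd (Or.inr rfl) hpS
        · exact absurd (Or.inl (Or.inr rfl)) hpS
    have e₅ : insert (A, 0) V₃ = U ∪ {p | p.1 = A ∨ p.1 = B ∨ p.1 = I} := by
      ext ⟨S, t⟩
      constructor
      · rintro (h | h | h | h | h | h | h)
        · exact Or.inr (Or.inl (Prod.mk.inj h).1)
        · exact Or.inr (Or.inr (Or.inr (Prod.mk.inj h).1))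
        · exact Or.inr (Or.inr (Or.inl (Prod.mk.inj h).1))
        · exact Or.inl h
        · exact Or.inr (Or.inr (Or.inl (Prod.mk.inj h).1))
        · exact Or.inr (Or.inl (Prod.mk.inj h).1)
        · exact Or.inr (Or.inr (Or.inr (Prod.mk.inj h).1))
      · rintro (h | h | h | h)
        · exact Or.inr (Or.inr (Or.inr (Or.inl h)))
        all_goals
          obtain rfl := (show S = _ from h)
          rcases hfin t with rfl | rfl
        exacts [Or.inl rfl, Or.inr (Or.inr (Or.inr (Or.inr (Or.inr (Or.inl rfl))))),
          Or.inr (Or.inr (Or.inl rfl)), Or.inr (Or.inr (Or.inr (Or.inr (Or.inl rfl)))),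
          Or.inr (Or.inl rfl), Or.inr (Or.inr (Or.inr (Or.inr (Or.inr (Or.inr rfl)))))]
    rw [← e₅]
    have s₁ : U ⊆ V₁ := Set.subset_union_left
    have s₂ : V₁ ⊆ V₂ := Set.subset_insert _ _
    have s₃ : V₂ ⊆ V₃ := Set.subset_insert _ _
    exact ((e₁.trans s₁ s₂ e₂).trans (s₁.trans s₂) s₃ e₃).trans ((s₁.trans s₂).trans s₃)
      (Set.subset_insert _ _) e₄
  have hU₄ : U₁ ∪ {p | p.1 = A ∨ p.1 = B ∨ p.1 = I} = U₄ := by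
    ext p
    constructor
    · rintro ((h | h) | h)
      exacts [Or.inr (Or.inl h), Or.inl h, Or.inr (Or.inr h)]
    · rintro (h | h | h)
      exacts [Or.inl (Or.inr h), Or.inl (Or.inl h), Or.inr h]
  have h₄ := h₃ U₁ le_rfl fun p hp => Or.inl hp
  have h₅ := h₃ (insert (⊥, 0) U₁) (Set.subset_insert _ _) fun p hp => hp.symm
  rw [Set.insert_union, hU₄] at h₅
  rw [hU₄] at h₄
  have hU₁₄ : U₁ ⊆ U₄ := hU₄ ▸ Set.subset_union_left
  have h₆ : D.Exact U₄ (insert (⊥, 0) U₄) := PMap.Exact.of_trans_left hU₁₄ (Set.subset_insert _ _) h₄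
    (PMap.Exact.trans (Set.subset_insert _ _) (Set.insert_subset_insert hU₁₄) hN h₅)
  have hU₃₄ : U₃ ⊆ U₄ := Set.subset_insert _ _
  -- By `h₆` the value W_n is the limit over `U₄`. The `2`-Segal square of X removes X_n from it,
  -- and the rest is coreflected onto `M 0`.
  exact PMap.Exact.of_trans (Set.subset_insert _ _) (Set.insert_subset_insert ((hMU 0).trans hU₃₄))
    ((h₁.trans (hMU 0) hU₃₄ h₂).trans ((hMU 0).trans hU₃₄) (Set.subset_insert _ _) h₆)
    (h₁'.trans (Set.insert_subset_insert (hMU 0)) (Set.insert_subset_insert hU₃₄) h₂')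

/-- A square with two parallel degenerate sides is a pullback square. -/
lemma exact_square_of_degen {D : PMap (⊤ : LowerSet (Set R)) C} {a b c d : R} (hab : a < b) (hac : a < c)
    (hbd : b < d) (hcd : c < d) (hbc : ¬ b ≤ c) (hcb : ¬ c ≤ b) (h₁ : D.Degen a b) (h₂ : D.Degen c d) :
    D.Exact {b, c, d} (insert a {b, c, d}) := by
  -- Both {b, c, d} and the whole square have the same limit as {b}: for the first, d lies above b
  -- and c → d is degenerate; for the second, a → b is degenerate and c, d are coreflected onto a,
  -- b.
  have h₃ : D.Exact {b} {b, d} := PMap.Exact.of_exists_greatest (by simp) (by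
    rintro v (rfl | rfl) hv
    · exact absurd rfl hv
    · exact ⟨b, rfl, hbd.le, fun w hw _ => (show w = b from hw).le⟩)
  have h₄ : D.Exact {b, d} (insert c {b, d}) := (PMap.Exact.of_degen hcd h₂).insert_of_exists
    (by simp) (by rintro s rfl; exact hcd) (by
      rintro p (rfl | rfl) hp hpd
      exacts [absurd hp.le hcb, absurd rfl hpd])
  have h₅ : D.Exact {a, b} (insert a {b, c, d}) := PMap.Exact.of_exists_greatest (by
      rintro v (rfl | rfl)
      exacts [Or.inl rfl, Or.inr (Or.inl rfl)]) (by
    rintro v (rfl | rfl | rfl | rfl) hv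
    · exact absurd (Or.inl rfl) hv
    · exact absurd (Or.inr rfl) hv
    · refine ⟨a, Or.inl rfl, hac.le, ?_⟩
      rintro w (rfl | rfl) hw
      exacts [le_rfl, absurd hw hbc]
    · refine ⟨b, Or.inr rfl, hbd.le, ?_⟩
      rintro w (rfl | rfl) hw
      exacts [hab.le, le_rfl])
  have h₆ := h₃.trans (by simp) (Set.subset_insert _ _) h₄
  rw [Set.insert_comm] at h₆
  exact PMap.Exact.of_trans_left (by simp) (Set.subset_insert _ _) h₆
    ((PMap.Exact.of_degen hab h₁).trans (by simp) (by
      rintro v (rfl | rfl)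
      exacts [Or.inl rfl, Or.inr (Or.inl rfl)]) h₅)

end Cutting

/-! ### Faces of a simplex and their spines. -/

section Faces

variable {m n : ℕ}

instance : Finite (Face n)ᵒᵈ := inferInstanceAs (Finite (Face n))

/-- The set of vertices of a face. -/
def faceSet (S : (Face n)ᵒᵈ) : Finset (Fin (n + 1)) := (OrderDual.ofDual S).1

lemma faceSet_le {S T : (Face n)ᵒᵈ} : S ≤ T ↔ faceSet T ⊆ faceSet S := Iff.rfl

lemma faceSet_inj {S T : (Face n)ᵒᵈ} : faceSet S = faceSet T ↔ S = T :=
  ⟨fun h => Subtype.ext h, fun h => h ▸ rfl⟩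

instance : OrderBot (Face n)ᵒᵈ where
  bot := OrderDual.toDual ⟨Finset.univ, Finset.univ_nonempty⟩
  bot_le _ _ _ := Finset.mem_univ _

lemma simplexCategory_hom_hext {a b a' b' : SimplexCategoryᵒᵖ} (f : a ⟶ b) (f' : a' ⟶ b') (ha : a = a')
    (hb : b = b') (h : ∀ k : Fin (b.unop.len + 1), (f.unop.toOrderHom k).val =
      (f'.unop.toOrderHom (Fin.cast (by rw [hb]) k)).val) : HEq f f' := by
  subst ha hb
  refine heq_of_eq (Quiver.Hom.unop_inj ?_)
  ext k
  exact h k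

/-- The face spanned by the image of a face. -/
def imageEmb (φ : Fin (m + 1) ↪o Fin (n + 1)) : (Face m)ᵒᵈ ↪o (Face n)ᵒᵈ :=
  OrderEmbedding.ofMapLEIff (fun S => OrderDual.toDual ⟨(faceSet S).map φ.toEmbedding,
    (OrderDual.ofDual S).2.map⟩) fun _ _ => Finset.map_subset_map

lemma card_imageEmb (φ : Fin (m + 1) ↪o Fin (n + 1)) (S : (Face m)ᵒᵈ) :
    (OrderDual.ofDual (imageEmb φ S)).1.card - 1 + 1 = (OrderDual.ofDual S).1.card - 1 + 1 := by
  rw [show (OrderDual.ofDual (imageEmb φ S)).1.card = (OrderDual.ofDual S).1.card from Finset.card_map _]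

lemma orderIso_imageEmb (φ : Fin (m + 1) ↪o Fin (n + 1)) (S : (Face m)ᵒᵈ) (k) :
    ((OrderDual.ofDual (imageEmb φ S)).orderIso k).1 =
      φ ((OrderDual.ofDual S).orderIso (Fin.cast (card_imageEmb φ S) k)).1 := by
  have h := Finset.orderEmbOfFin_unique (s := faceSet (imageEmb φ S))
    (Nat.sub_add_cancel (OrderDual.ofDual (imageEmb φ S)).2.card_pos).symm
    (f := fun k => φ ((OrderDual.ofDual S).orderIso (Fin.cast (card_imageEmb φ S) k)).1)
    (fun k => Finset.mem_map_of_mem _ ((OrderDual.ofDual S).orderIso _).2)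
    (fun a b hab => φ.lt_iff_lt.2 ((OrderDual.ofDual S).orderIso.lt_iff_lt.2 hab))
  exact (congrFun h k).symm

/-- An injection preserves cardinalities and, by uniqueness, the increasing enumerations. The
functors are therefore equal, and the Segal conditions for faces can be read off in the diagram of
all faces of [n]. -/
lemma restr_imageEmb (φ : Fin (m + 1) ↪o Fin (n + 1)) : restr (imageEmb φ) (faceFunctor n) = faceFunctor m := by
  have hobj : ∀ S, (restr (imageEmb φ) (faceFunctor n)).obj S = (faceFunctor m).obj S := by
    intro S
    exact congrArg (fun k => op ⦋k - 1⦌) (Finset.card_map _)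
  refine CategoryTheory.Functor.hext hobj fun S T f => ?_
  refine simplexCategory_hom_hext _ _ (hobj S) (hobj T) fun k => ?_
  have hle : imageEmb φ S ≤ imageEmb φ T := (imageEmb φ).le_iff_le.2 (leOfHom f)
  let k' := Fin.cast (card_imageEmb φ T) k
  change ((OrderDual.ofDual (imageEmb φ S)).orderIso.symm ⟨((OrderDual.ofDual (imageEmb φ T)).orderIso k).1,
    hle ((OrderDual.ofDual (imageEmb φ T)).orderIso k).2⟩).val = ((OrderDual.ofDual S).orderIso.symm
      ⟨((OrderDual.ofDual T).orderIso k').1, leOfHom f ((OrderDual.ofDual T).orderIso k').2⟩).val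
  let j := (OrderDual.ofDual S).orderIso.symm
      ⟨((OrderDual.ofDual T).orderIso k').1, leOfHom f ((OrderDual.ofDual T).orderIso k').2⟩
  have hj : (OrderDual.ofDual (imageEmb φ S)).orderIso.symm ⟨((OrderDual.ofDual (imageEmb φ T)).orderIso k).1,
    hle ((OrderDual.ofDual (imageEmb φ T)).orderIso k).2⟩ = Fin.cast (card_imageEmb φ S).symm j := by
    rw [OrderIso.symm_apply_eq]
    refine Subtype.ext ((orderIso_imageEmb φ T k).trans ?_)
    refine Eq.trans ?_ (orderIso_imageEmb φ S _).symm
    refine congrArg φ ?_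
    exact (congrArg Subtype.val ((OrderDual.ofDual S).orderIso.apply_symm_apply
      ⟨_, leOfHom f ((OrderDual.ofDual T).orderIso k').2⟩)).symm
  rw [hj]
  rfl

/-- The one or two elements of a face `S` that are consecutive in `S`. -/
def IsSpine (S T : (Face n)ᵒᵈ) : Prop :=
  ∃ a b, a ≤ b ∧ faceSet T = {a, b} ∧ a ∈ faceSet S ∧ b ∈ faceSet S ∧ ∀ c ∈ faceSet S, c ≤ a ∨ b ≤ c

lemma IsSpine.card_le {S T : (Face n)ᵒᵈ} (h : IsSpine S T) : (faceSet T).card ≤ 2 := by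
  obtain ⟨a, b, -, h, -⟩ := h
  rw [h]
  exact Finset.card_le_two

lemma card_spineFace_le (S : SpineFace n) : (faceSet S.1).card ≤ 2 := by
  rcases S.2 with ⟨i, h⟩ | ⟨i, h⟩
  · exact (congrArg Finset.card h).trans_le (by simp)
  · exact (congrArg Finset.card h).trans_le Finset.card_le_two

/-- The embedding of the cone over the spine in the poset of faces. -/
def spineEmb (hn : 2 ≤ n) : WithBot (SpineFace n) ↪o (Face n)ᵒᵈ :=
  OrderEmbedding.ofMapLEIff (spineFunctor n).obj fun s t => by
    induction s with
    | bot => exact ⟨fun _ => bot_le, fun _ => bot_le (α := (Face n)ᵒᵈ)⟩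
    | coe S =>
      induction t with
      | bot =>
        -- For `n ≥ 2` the set [n] has more elements than any spine face. For n = 1 it would itself
        -- be a spine face.
        refine ⟨fun h => absurd (Finset.card_le_card (faceSet_le.1 h)) ?_,
          fun h => absurd h (WithBot.not_coe_le_bot S)⟩
        have h₁ : (faceSet ((spineFunctor n).obj ⊥)).card = n + 1 := Finset.card_fin _
        have h₂ := card_spineFace_le S
        have h₃ : faceSet ((spineFunctor n).obj S) = faceSet S.1 := rfl
        rw [h₁, h₃]
        omega
      | coe T => exact (WithBot.coe_le_coe (a := S) (b := T)).symm

/-- The enumeration of the vertices of a face. -/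
def faceVertexEmb (S : (Face n)ᵒᵈ) : Fin ((OrderDual.ofDual S).1.card - 1 + 1) ↪o Fin (n + 1) :=
  (OrderDual.ofDual S).orderIso.toOrderEmbedding.trans (OrderEmbedding.subtype _)

lemma mem_faceSet_iff {S : (Face n)ᵒᵈ} {c : Fin (n + 1)} : c ∈ faceSet S ↔ ∃ k, faceVertexEmb S k = c :=
  ⟨fun h => ⟨(OrderDual.ofDual S).orderIso.symm ⟨c, h⟩,
    congrArg Subtype.val ((OrderDual.ofDual S).orderIso.apply_symm_apply ⟨c, h⟩)⟩, by
    rintro ⟨k, rfl⟩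
    exact ((OrderDual.ofDual S).orderIso k).2⟩

/-- The cone over the spine of a face. -/
def faceSpineEmb (S : (Face n)ᵒᵈ) (hS : 2 ≤ (OrderDual.ofDual S).1.card - 1) :
    WithBot (SpineFace ((OrderDual.ofDual S).1.card - 1)) ↪o (Face n)ᵒᵈ :=
  (spineEmb hS).trans (imageEmb (faceVertexEmb S))

variable {S : (Face n)ᵒᵈ} (hS : 2 ≤ (OrderDual.ofDual S).1.card - 1)

lemma faceSpineEmb_bot : faceSpineEmb S hS ⊥ = S := by
  refine faceSet_inj.1 (Finset.ext fun c => ?_)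
  rw [mem_faceSet_iff (S := S)]
  exact ⟨fun h => (Finset.mem_map.1 h).imp fun k hk => hk.2,
    fun ⟨k, hk⟩ => Finset.mem_map.2 ⟨k, Finset.mem_univ _, hk⟩⟩

lemma isSpine_faceSpineEmb (T : SpineFace ((OrderDual.ofDual S).1.card - 1)) : IsSpine S (faceSpineEmb S hS T) := by
  have hT : faceSet (faceSpineEmb S hS T) = (faceSet T.1).map (faceVertexEmb S).toEmbedding := rfl
  rcases T.2 with ⟨i, h⟩ | ⟨i, h⟩
  · refine ⟨faceVertexEmb S i, faceVertexEmb S i, le_rfl, ?_, mem_faceSet_iff.2 ⟨_, rfl⟩,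
      mem_faceSet_iff.2 ⟨_, rfl⟩, fun c _ => le_total _ _⟩
    rw [hT, show faceSet T.1 = {i} from h]
    simp
  · refine ⟨faceVertexEmb S i.castSucc, faceVertexEmb S i.succ, (faceVertexEmb S).le_iff_le.2
      i.castSucc_lt_succ.le, ?_, mem_faceSet_iff.2 ⟨_, rfl⟩, mem_faceSet_iff.2 ⟨_, rfl⟩, fun c hc => ?_⟩
    · rw [hT, show faceSet T.1 = {i.castSucc, i.succ} from h]
      simp
    · obtain ⟨k, rfl⟩ := mem_faceSet_iff.1 hc
      rw [(faceVertexEmb S).le_iff_le, (faceVertexEmb S).le_iff_le]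
      rcases le_or_gt k i.castSucc with h | h
      · exact Or.inl h
      · exact Or.inr (Fin.castSucc_lt_iff_succ_le.1 h)

lemma exists_of_isSpine {T : (Face n)ᵒᵈ} (hT : IsSpine S T) :
    ∃ U : SpineFace ((OrderDual.ofDual S).1.card - 1), faceSpineEmb S hS U = T := by
  obtain ⟨a, b, hab, hT, ha, hb, hc⟩ := hT
  obtain ⟨i, rfl⟩ := mem_faceSet_iff.1 ha
  obtain ⟨j, rfl⟩ := mem_faceSet_iff.1 hb
  have hij := (faceVertexEmb S).le_iff_le.1 hab
  rcases hij.eq_or_lt with rfl | hij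
  · refine ⟨⟨OrderDual.toDual ⟨{i}, Finset.singleton_nonempty _⟩, Or.inl ⟨i, rfl⟩⟩, faceSet_inj.1 ?_⟩
    refine Eq.trans (b := ({i} : Finset _).map (faceVertexEmb S).toEmbedding) rfl ?_
    rw [hT]
    simp
  · obtain ⟨i', rfl⟩ : ∃ i' : Fin ((OrderDual.ofDual S).1.card - 1), i = i'.castSucc :=
      ⟨⟨i.val, by omega⟩, rfl⟩
    obtain rfl : j = i'.succ := by
      refine le_antisymm ?_ (Fin.castSucc_lt_iff_succ_le.1 hij)
      refine (faceVertexEmb S).le_iff_le.1 ((hc _ (mem_faceSet_iff.2 ⟨i'.succ, rfl⟩)).resolve_left fun h => ?_)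
      exact absurd ((faceVertexEmb S).le_iff_le.1 h) (not_le_of_gt i'.castSucc_lt_succ)
    refine ⟨⟨OrderDual.toDual ⟨{i'.castSucc, i'.succ}, Finset.insert_nonempty _ _⟩, Or.inr ⟨i', rfl⟩⟩,
      faceSet_inj.1 ?_⟩
    refine Eq.trans (b := ({i'.castSucc, i'.succ} : Finset _).map (faceVertexEmb S).toEmbedding) rfl ?_
    rw [hT]
    simp

variable {C : SSet.{u}} [SSet.Quasicategory C] {W X : SimplicialObj C} {g : W.Hom X}

/-- The relative Segal condition for a face. -/
lemma IsRelativeSegal.exact_face (hg : IsRelativeSegal g) (S : (Face n)ᵒᵈ)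
    (hS : 2 ≤ (faceSet S).card) :
    (diag (pairFunctor (faceFunctor n) (𝟭 (Fin 2))) g.toMap).Exact {p | IsSpine S p.1 ∨ p = (S, 1)}
      (insert (S, 0) {p | IsSpine S p.1 ∨ p = (S, 1)}) := by
  -- A face with two elements is one of its own spine faces, so nothing is added. Larger faces have
  -- dimension at least 2, where the relative Segal condition applies.
  rcases hS.eq_or_lt with h | h
  · obtain ⟨a, b, hab, hS⟩ := Finset.card_eq_two.1 h.symm
    have hSS : IsSpine S S := by
      rcases le_total a b with h | h
      · refine ⟨a, b, h, hS, by simp [hS], by simp [hS], fun c hc => ?_⟩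
        rw [hS, Finset.mem_insert, Finset.mem_singleton] at hc
        exact hc.imp (fun h => h.le) fun h => h.ge
      · refine ⟨b, a, h, hS.trans (Finset.pair_comm _ _), by simp [hS], by simp [hS], fun c hc => ?_⟩
        rw [hS, Finset.mem_insert, Finset.mem_singleton] at hc
        exact hc.symm.imp (fun h => h.le) fun h => h.ge
    have e := Set.insert_eq_of_mem (s := {p | IsSpine S p.1 ∨ p = (S, (1 : Fin 2))})
      (a := (S, 0))
      (Or.inl hSS)
    rw [e]
    exact PMap.Exact.of_exists_greatest le_rfl fun v hv hv' => absurd hv hv'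
  · have hS' : 2 ≤ (OrderDual.ofDual S).1.card - 1 := Nat.le_sub_one_of_lt h
    have hSS : ¬ IsSpine S S := fun hSS => absurd hSS.card_le (not_le_of_gt h)
    let e : WithBot (SpineFace ((OrderDual.ofDual S).1.card - 1)) × Fin 2 ↪o (Face n)ᵒᵈ × Fin 2 :=
      prodEmb (faceSpineEmb S hS') (RelEmbedding.refl _)
    have hF : restr e (pairFunctor (faceFunctor n) (𝟭 (Fin 2))) =
        pairFunctor (spineFunctor _ ⋙ faceFunctor ((OrderDual.ofDual S).1.card - 1)) (𝟭 (Fin 2)) :=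
      congrArg (fun F => pairFunctor (spineFunctor ((OrderDual.ofDual S).1.card - 1) ⋙ F) (𝟭 (Fin 2)))
        (restr_imageEmb (faceVertexEmb S))
    refine (exact_diag_iff_isExact e hF
      (fun p => ?_) fun p => ?_).2 (hg.isExact hS')
    · obtain ⟨T, t⟩ := p
      constructor
      · rintro (h | h | h)
        · exact ⟨(⊥, 0), h ▸ Prod.ext (faceSpineEmb_bot hS') rfl⟩
        · obtain ⟨U, hU⟩ := exists_of_isSpine hS' h
          exact ⟨(U, t), Prod.ext hU rfl⟩
        · exact ⟨(⊥, 1), h ▸ Prod.ext (faceSpineEmb_bot hS') rfl⟩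
      · rintro ⟨⟨s, t'⟩, h⟩
        obtain rfl : t' = t := (Prod.mk.inj h).2
        obtain rfl : faceSpineEmb S hS' s = T := (Prod.mk.inj h).1
        induction s with
        | bot =>
          have ht : t' = 0 ∨ t' = 1 := by omega
          exact ht.imp (fun h => Prod.ext (faceSpineEmb_bot hS') h) fun h =>
            Or.inr (Prod.ext (faceSpineEmb_bot hS') h)
        | coe s => exact Or.inr (Or.inl (isSpine_faceSpineEmb hS' s))
    · obtain ⟨s, t⟩ := p
      induction s with
      | bot =>
        have ht : t = 0 ∨ t = 1 := by omega
        rcases ht with rfl | rfl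
        · refine ⟨fun h => h.elim (fun h => ?_) fun h => absurd (show (0 : Fin 2) = 1 from (Prod.mk.inj h).2)
            (by decide), fun h => absurd rfl h⟩
          exact absurd ((faceSpineEmb_bot hS').subst (motive := IsSpine S) h) hSS
        · refine ⟨fun _ e => absurd (show (1 : Fin 2) = 0 from (Prod.mk.inj e).2) (by decide), fun _ =>
            Or.inr (Prod.ext (faceSpineEmb_bot hS') rfl)⟩
      | coe s =>
        exact ⟨fun _ e => WithBot.coe_ne_bot (Prod.mk.inj e).1, fun _ => Or.inl (isSpine_faceSpineEmb hS' s)⟩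

end Faces

/-! ### The source of a relative Segal morphism with `2`-Segal target. -/

section TwoSegal

variable {n : ℕ} {i j : Fin (n + 1)} {C : SSet.{u}} [SSet.Quasicategory C] {W X : SimplicialObj C}
  {g : W.Hom X}

lemma mem_cutSquare {h : i < j} {s : Square} {k : Fin (n + 1)} : k ∈ faceSet ((cutSquare i j h).obj s) ↔
    (s.1 = 1 → k ≤ i ∨ j ≤ k) ∧ (s.2 = 1 → i ≤ k ∧ k ≤ j) :=
  Finset.mem_filter.trans (and_iff_right (Finset.mem_univ k))

lemma cutSquare_bot (h : i < j) : (cutSquare i j h).obj (.mk 0 0) = ⊥ :=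
  faceSet_inj.1 (Finset.ext fun k => ⟨fun _ => Finset.mem_univ k, fun _ => mem_cutSquare.2
    ⟨fun h => absurd h (show (0 : Fin 2) ≠ 1 by decide), fun h => absurd h (show (0 : Fin 2) ≠ 1 by decide)⟩⟩)

lemma mem_cutSquare_left {h : i < j} {k : Fin (n + 1)} :
    k ∈ faceSet ((cutSquare i j h).obj (.mk 1 0)) ↔ k ≤ i ∨ j ≤ k :=
  mem_cutSquare.trans ⟨fun h => h.1 rfl, fun h => ⟨fun _ => h, fun e =>
    absurd e (show (0 : Fin 2) ≠ 1 by decide)⟩⟩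

lemma mem_cutSquare_right {h : i < j} {k : Fin (n + 1)} :
    k ∈ faceSet ((cutSquare i j h).obj (.mk 0 1)) ↔ i ≤ k ∧ k ≤ j :=
  mem_cutSquare.trans ⟨fun h => h.2 rfl, fun h => ⟨fun e => absurd e (show (0 : Fin 2) ≠ 1 by decide),
    fun _ => h⟩⟩

lemma mem_cutSquare_both {h : i < j} {k : Fin (n + 1)} :
    k ∈ faceSet ((cutSquare i j h).obj (.mk 1 1)) ↔ k = i ∨ k = j := by
  refine mem_cutSquare.trans ⟨fun h => ?_, ?_⟩
  · have h₁ := h.1 rfl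
    have h₂ := h.2 rfl
    exact h₁.imp (fun h => le_antisymm h h₂.1) fun h => le_antisymm h₂.2 h
  · rintro (rfl | rfl)
    exacts [⟨fun _ => Or.inl le_rfl, fun _ => ⟨le_rfl, h.le⟩⟩, ⟨fun _ => Or.inr le_rfl, fun _ => ⟨h.le, le_rfl⟩⟩]

/-- When the cut is trivial, `cutSquare` takes the same value at different corners. The edge between
such corners is sent to an identity, hence to a degenerate edge. -/
lemma degen_diag {h : i < j} {s t : Square} (hst : (cutSquare i j h).obj s = (cutSquare i j h).obj t) :
    (diag (cutSquare i j h ⋙ faceFunctor n) W).Degen s t := by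
  intro k x y _ _ hx hy
  have e : (nMap (cutSquare i j h)).app (op ⦋k⦌) (nerveMk (m := op ⦋k⦌) x) =
      (nMap (cutSquare i j h)).app (op ⦋k⦌) (nerveMk (m := op ⦋k⦌) y) := by
    refine nerve_ext fun l => ?_
    change (cutSquare i j h).obj (x l) = (cutSquare i j h).obj (y l)
    rcases hx l with h₁ | h₁ <;> rcases hy l with h₂ | h₂ <;> rw [h₁, h₂]
    exacts [hst, hst.symm]
  exact congrArg (fun z => (nMap (faceFunctor n) ≫ W).app (op ⦋k⦌) z) e

/-- The squares for the trivial subdivisions of a polygon. -/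
lemma isPullbackSquare_cutSquare_of_eq {h : i < j}
    (H : (cutSquare i j h).obj (.mk 0 0) = (cutSquare i j h).obj (.mk 1 0) ∧
        (cutSquare i j h).obj (.mk 0 1) = (cutSquare i j h).obj (.mk 1 1) ∨
      (cutSquare i j h).obj (.mk 0 0) = (cutSquare i j h).obj (.mk 0 1) ∧
        (cutSquare i j h).obj (.mk 1 0) = (cutSquare i j h).obj (.mk 1 1)) :
    IsPullbackSquare (nMap (cutSquare i j h ⋙ faceFunctor n) ≫ W) := by
  refine (exact_diag_square_iff (Φ := cutSquare i j h ⋙ faceFunctor n) (RelEmbedding.refl _) rfl).1 ?_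
  rcases H with ⟨h₁, h₂⟩ | ⟨h₁, h₂⟩
  · have := exact_square_of_degen (D := diag (cutSquare i j h ⋙ faceFunctor n) W) (a := .mk 0 0)
      (b := .mk 1 0) (c := .mk 0 1) (d := .mk 1 1) (by decide) (by decide) (by decide) (by decide)
      (by decide) (by decide) (degen_diag h₁) (degen_diag h₂)
    rwa [Set.insert_comm (Square.mk 1 0) (Square.mk 0 1)] at this
  · exact exact_square_of_degen (D := diag (cutSquare i j h ⋙ faceFunctor n) W) (a := .mk 0 0)
      (b := .mk 0 1) (c := .mk 1 0) (d := .mk 1 1) (by decide) (by decide) (by decide) (by decide)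
      (by decide) (by decide) (degen_diag h₁) (degen_diag h₂)

/-- The face {i,…,j} is an interval, so elements consecutive in it are consecutive in [n]. -/
lemma isSpine_cut_right {h : i < j} {T : (Face n)ᵒᵈ} : IsSpine ((cutSquare i j h).obj (.mk 0 1)) T ↔
    IsSpine ⊥ T ∧ (cutSquare i j h).obj (.mk 0 1) ≤ T := by
  constructor
  · rintro ⟨a, b, hab, hT, ha, hb, hc⟩
    have ha' := mem_cutSquare_right.1 ha
    have hb' := mem_cutSquare_right.1 hb
    refine ⟨⟨a, b, hab, hT, Finset.mem_univ _, Finset.mem_univ _, fun c _ => ?_⟩, faceSet_le.2 ?_⟩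
    · by_cases hcB : c ∈ faceSet ((cutSquare i j h).obj (.mk 0 1))
      · exact hc c hcB
      · rw [mem_cutSquare_right] at hcB
        omega
    · rw [hT]
      intro c hc
      rcases Finset.mem_insert.1 hc with rfl | hc
      · exact ha
      · rwa [Finset.mem_singleton.1 hc]
  · rintro ⟨⟨a, b, hab, hT, -, -, hc⟩, hle⟩
    have hle' := faceSet_le.1 hle
    rw [hT] at hle'
    exact ⟨a, b, hab, hT, hle' (by simp), hle' (by simp), fun c _ => hc c (Finset.mem_univ _)⟩

/-- The face {0,…,i,j,…,n} omits only elements between i and j, so the only pair in it that may fail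
to be consecutive in [n] is {i, j}. -/
lemma isSpine_cut_left {h : i < j} {T : (Face n)ᵒᵈ} : IsSpine ((cutSquare i j h).obj (.mk 1 0)) T ↔
    (IsSpine ⊥ T ∧ (cutSquare i j h).obj (.mk 1 0) ≤ T) ∨ T = (cutSquare i j h).obj (.mk 1 1) := by
  constructor
  · rintro ⟨a, b, hab, hT, ha, hb, hc⟩
    have ha' := mem_cutSquare_left.1 ha
    have hb' := mem_cutSquare_left.1 hb
    by_cases hab' : a = i ∧ b = j
    · obtain ⟨rfl, rfl⟩ := hab'
      refine Or.inr (faceSet_inj.1 (Finset.ext fun k => ?_))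
      rw [hT, mem_cutSquare_both, Finset.mem_insert, Finset.mem_singleton]
    · have hi := hc i (mem_cutSquare_left.2 (Or.inl le_rfl))
      have hj := hc j (mem_cutSquare_left.2 (Or.inr le_rfl))
      refine Or.inl ⟨⟨a, b, hab, hT, Finset.mem_univ _, Finset.mem_univ _, fun c _ => ?_⟩, faceSet_le.2 ?_⟩
      · by_cases hcA : c ∈ faceSet ((cutSquare i j h).obj (.mk 1 0))
        · exact hc c hcA
        · rw [mem_cutSquare_left] at hcA
          omega
      · rw [hT]
        intro c hc
        rcases Finset.mem_insert.1 hc with rfl | hc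
        · exact ha
        · rwa [Finset.mem_singleton.1 hc]
  · rintro (⟨⟨a, b, hab, hT, -, -, hc⟩, hle⟩ | rfl)
    · have hle' := faceSet_le.1 hle
      rw [hT] at hle'
      exact ⟨a, b, hab, hT, hle' (by simp), hle' (by simp), fun c _ => hc c (Finset.mem_univ _)⟩
    · refine ⟨i, j, h.le, Finset.ext fun k => ?_, mem_cutSquare_left.2 (Or.inl le_rfl),
        mem_cutSquare_left.2 (Or.inr le_rfl), fun c hc => mem_cutSquare_left.1 hc⟩
      rw [mem_cutSquare_both, Finset.mem_insert, Finset.mem_singleton]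

lemma two_le_card_cutSquare {h : i < j} (s : Square) : 2 ≤ (faceSet ((cutSquare i j h).obj s)).card := by
  have hsub : ({i, j} : Finset (Fin (n + 1))) ⊆ faceSet ((cutSquare i j h).obj s) := by
    intro k hk
    rcases Finset.mem_insert.1 hk with rfl | hk
    · exact mem_cutSquare.2 ⟨fun _ => Or.inl le_rfl, fun _ => ⟨le_rfl, h.le⟩⟩
    · rw [Finset.mem_singleton.1 hk]
      exact mem_cutSquare.2 ⟨fun _ => Or.inr le_rfl, fun _ => ⟨h.le, le_rfl⟩⟩
  exact (Finset.card_pair h.ne).ge.trans (Finset.card_le_card hsub)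

/-- The source of a relative Segal map with `2`-Segal target is `2`-Segal. -/
theorem IsTwoSegal.of_isRelativeSegal (hX : IsTwoSegal X) (hg : IsRelativeSegal g) : IsTwoSegal W := by
  intro n i j h
  -- For j = i + 1, and for i = 0 with j = n, the square has two parallel degenerate sides. In all
  -- other cases the faces {0,…,i,j,…,n} and {i,…,j} are incomparable; only then do the four corners
  -- form an embedded square.
  by_cases h₁ : i.val + 1 = j.val
  · refine isPullbackSquare_cutSquare_of_eq (Or.inl ⟨faceSet_inj.1 (Finset.ext fun k => ?_),
      faceSet_inj.1 (Finset.ext fun k => ?_)⟩)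
    · rw [cutSquare_bot, mem_cutSquare_left]
      refine iff_of_true (Finset.mem_univ k) ?_
      omega
    · rw [mem_cutSquare_right, mem_cutSquare_both]
      omega
  by_cases h₂ : i.val = 0 ∧ j.val = n
  · refine isPullbackSquare_cutSquare_of_eq (Or.inr ⟨faceSet_inj.1 (Finset.ext fun k => ?_),
      faceSet_inj.1 (Finset.ext fun k => ?_)⟩)
    · rw [cutSquare_bot, mem_cutSquare_right]
      refine iff_of_true (Finset.mem_univ k) ?_
      omega
    · rw [mem_cutSquare_left, mem_cutSquare_both]
      omega
  let A := (cutSquare i j h).obj (.mk 1 0)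
  let B := (cutSquare i j h).obj (.mk 0 1)
  let I := (cutSquare i j h).obj (.mk 1 1)
  have hAI : A ≤ I := faceSet_le.2 fun k hk => mem_cutSquare_left.2 (by
    rw [mem_cutSquare_both] at hk
    omega)
  have hBI : B ≤ I := faceSet_le.2 fun k hk => mem_cutSquare_right.2 (by
    rw [mem_cutSquare_both] at hk
    omega)
  have hAB : ¬ A ≤ B := fun hle => by
    have hm : (⟨i.val + 1, by omega⟩ : Fin (n + 1)) ∈ faceSet B := mem_cutSquare_right.2
      ⟨Fin.le_def.2 (by simp), Fin.le_def.2 (by simp; omega)⟩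
    have hm' := mem_cutSquare_left.1 (faceSet_le.1 hle hm)
    rw [Fin.le_def, Fin.le_def] at hm'
    simp only at hm'
    omega
  have hBA : ¬ B ≤ A := fun hle => by
    have h₀ := mem_cutSquare_right.1 (faceSet_le.1 hle (mem_cutSquare_left.2 (Or.inl (Fin.zero_le i))))
    have hn := mem_cutSquare_right.1 (faceSet_le.1 hle (mem_cutSquare_left.2 (Or.inr (Fin.le_last j))))
    have h₃ := Fin.le_def.1 h₀.1
    have h₄ := Fin.le_def.1 hn.2
    simp only [Fin.val_zero, Fin.val_last] at h₃ h₄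
    omega
  have hSI : ∀ T : (Face n)ᵒᵈ, IsSpine ⊥ T → ¬ T ≤ I := by
    rintro T ⟨a, b, hab, hT, -, -, hc⟩ hle
    have hi := faceSet_le.1 hle (mem_cutSquare_both.2 (Or.inl rfl))
    have hj := faceSet_le.1 hle (mem_cutSquare_both.2 (Or.inr rfl))
    rw [hT, Finset.mem_insert, Finset.mem_singleton] at hi hj
    have hc' := hc ⟨i.val + 1, by omega⟩ (Finset.mem_univ _)
    rw [Fin.le_def, Fin.le_def] at hc'
    simp only at hc'
    omega
  have hS : ∀ T : (Face n)ᵒᵈ, IsSpine ⊥ T → A ≤ T ∨ B ≤ T := by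
    rintro T ⟨a, b, hab, hT, -, -, hc⟩
    have hi := hc i (Finset.mem_univ _)
    have hj := hc j (Finset.mem_univ _)
    rw [faceSet_le, faceSet_le, hT]
    have : ((a ≤ i ∨ j ≤ a) ∧ (b ≤ i ∨ j ≤ b)) ∨ ((i ≤ a ∧ a ≤ j) ∧ (i ≤ b ∧ b ≤ j)) := by omega
    refine this.imp (fun h' k hk => mem_cutSquare_left.2 ?_) fun h' k hk => mem_cutSquare_right.2 ?_
    all_goals
      rw [Finset.mem_insert, Finset.mem_singleton] at hk
      rcases hk with rfl | rfl
    exacts [h'.1, h'.2, h'.1, h'.2]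
  have hS' : ∀ T : (Face n)ᵒᵈ, IsSpine ⊥ T → A ≤ T → B ≤ T → I ≤ T := by
    intro T _ hA hB
    refine faceSet_le.2 fun k hk => mem_cutSquare_both.2 ?_
    have hk₁ := mem_cutSquare_left.1 (faceSet_le.1 hA hk)
    have hk₂ := mem_cutSquare_right.1 (faceSet_le.1 hB hk)
    omega
  -- The order is reflected because a failure in one coordinate would force one of the incomparable
  -- faces `A` and `B` to contain the other.
  let c : Square ↪o (Face n)ᵒᵈ := OrderEmbedding.ofMapLEIff (cutSquare i j h).obj fun s t => by
    refine ⟨fun hst => ⟨?_, ?_⟩, fun hst => leOfHom ((cutSquare i j h).map (homOfLE hst))⟩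
    · by_contra hlt
      have hs : s.1 = 1 := by omega
      have ht : t.1 = 0 := by omega
      have hAs : A ≤ (cutSquare i j h).obj s := faceSet_le.2 fun k hk => mem_cutSquare_left.2
        ((mem_cutSquare.1 hk).1 hs)
      have htB : (cutSquare i j h).obj t ≤ B := faceSet_le.2 fun k hk => mem_cutSquare.2
        ⟨fun e => absurd (ht.symm.trans e) (by decide), fun _ => mem_cutSquare_right.1 hk⟩
      exact hAB (hAs.trans (hst.trans htB))
    · by_contra hlt
      have hs : s.2 = 1 := by omega
      have ht : t.2 = 0 := by omega
      have hBs : B ≤ (cutSquare i j h).obj s := faceSet_le.2 fun k hk => mem_cutSquare_right.2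
        ((mem_cutSquare.1 hk).2 hs)
      have htA : (cutSquare i j h).obj t ≤ A := faceSet_le.2 fun k hk => mem_cutSquare.2
        ⟨fun _ => mem_cutSquare_left.1 hk, fun e => absurd (ht.symm.trans e) (by decide)⟩
      exact hBA (hBs.trans (hst.trans htA))
  have hc (k : Fin 2) := exact_diag_square_iff (Φ := pairFunctor (faceFunctor n) (𝟭 (Fin 2))) (M := g.toMap)
    (c.trans (sectEmbL _ k)) (F := (cutSquare i j h ⋙ faceFunctor n) ⋙ Prod.sectL _ k) rfl
  have hbot : c (.mk 0 0) = ⊥ := cutSquare_bot h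
  have hX' : (diag (pairFunctor (faceFunctor n) (𝟭 (Fin 2))) g.toMap).Exact {(B, 1), (A, 1), (I, 1)}
      (insert (⊥, 1) {(B, 1), (A, 1), (I, 1)}) := by
    rw [← hbot]
    refine (hc 1).2 ?_
    have := hX n i j h
    rw [← g.target] at this
    exact this
  have hBs := hg.exact_face B (two_le_card_cutSquare _)
  have hAs := hg.exact_face A (two_le_card_cutSquare _)
  have hNs := hg.exact_face (⊥ : (Face n)ᵒᵈ) (hbot ▸ two_le_card_cutSquare (h := h) (.mk 0 0))
  simp only [B, isSpine_cut_right] at hBs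
  simp only [A, isSpine_cut_left] at hAs
  have hW := exact_cut (Sp := {T | IsSpine ⊥ T}) hAI hBI hAB hBA hSI hS hS' hX' hNs hBs hAs
  rw [← hbot] at hW
  rw [← g.source]
  exact (hc 0).1 hW

end TwoSegal

end InftyCat

/-- In the first assertion the Segal condition concerns Y alone, so only the pasting of naturality
squares remains. Finite limits are used in the second assertion, for the pointwise computation of
the fibre product. -/
theorem mainTheorem6 (C : SSet.{u}) [SSet.Quasicategory C] (hC : InftyCat.HasFiniteLimits C)
    (X Y Z W : InftyCat.SimplicialObj C)
    (p : InftyCat.SimplicialObj.Hom Y X) (hp : InftyCat.IsRelativeTwoSegal p)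
    (f : InftyCat.SimplicialObj.Hom X Z) (hf : InftyCat.IsActiveEquifibered f)
    (g : InftyCat.SimplicialObj.Hom W X) (hg : InftyCat.IsRelativeSegal g) :
    (∀ h : InftyCat.SimplicialObj.Hom Y Z, InftyCat.IsComposite p f h →
      InftyCat.IsRelativeTwoSegal h) ∧
    (∀ (T : InftyCat.SimplicialObj C) (q : InftyCat.SimplicialObj.Hom T Y)
      (π : InftyCat.SimplicialObj.Hom T W), InftyCat.IsFibreProduct q π p g →
      InftyCat.IsRelativeTwoSegal π) ∧
    (InftyCat.IsTwoSegal X → InftyCat.IsTwoSegal W) :=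
  ⟨fun _ hh => ⟨hp.isSegal, hp.isActiveEquifibered.of_isComposite hf hh⟩,
    fun _ _ _ hT => ⟨hp.isSegal.of_isFibreProduct hC hg hT,
      hp.isActiveEquifibered.of_isFibreProduct hC hT⟩, fun hX => hX.of_isRelativeSegal hg⟩
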